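/- **Setting.** Types are built from variables $X$, the unit $1$, $\sigma+\tau$, $\sigma\times\tau$, $\sigma\to\tau$, $\mu X\,\sigma$ and $\nu X\,\sigma$, where in $\mu X\,\sigma$ and $\nu X\,\sigma$ the body $\sigma$ is positive in $X$. Sequents $\Gamma\Rightarrow\tau$ consist of a list of types and a type. Let $\mu'\mathsf{LJ}$ be the sequent calculus given by the usual rules of intuitionistic logic $\mathsf{LJ}$ for $1,+,\times,\to$ (identity, exchange, weakening, contraction, cut, and left and right rules, context-splitting for cut, $\to$-left and $\times$-right) and the left and right unfolding rules for $\mu$ and $\nu$, which replace $\kappa X\,\sigma(X)$ in the conclusion by $\sigma(\kappa X\,\sigma(X))$ in the premiss ($\kappa\in\{\mu,\nu\}$). A *coderivation* is a possibly infinite tree (of height $\le\omega$) generated by these rules. It is *regular* if it has finitely many distinct sub-coderivations, and *progressing* if every infinite branch has a thread (a path in the graph of immediate ancestry) that is infinitely often principal and whose smallest infinitely often principal formula is a $\mu$-formula on the left or a $\nu$-formula on the right. $\mathsf{C}\mu\mathsf{LJ}$ is the class of regular progressing $\mu'\mathsf{LJ}$-coderivations. Let $N:=\mu X(1+X)$.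 The *native rules* for $N$ are: infer $\Rightarrow N$; from $\Gamma\Rightarrow N$ infer $\Gamma\Rightarrow N$ (successor); from $\Gamma\Rightarrow\sigma$ and $\Gamma,N\Rightarrow\sigma$ infer $\Gamma,N\Rightarrow\sigma$ (case distinction). The *negative fragment* $\mathsf{C}\mu\mathsf{LJ}^-$ is the class of regular progressing coderivations using only types built from variables and $N$ (regarded as primitive) by $\times,\to,\mu$, only the rules for these, and the native rules for $N$. Coderivations compute by *cut-reduction*: the reflexive transitive, context-closed closure of the usual principal, structural and commutative cut-reductions of $\mathsf{LJ}$ (modulo exchange), the reduction of a cut on $\kappa X\,\sigma(X)$ between a right and a left unfolding to a cut on $\sigma(\kappa X\,\sigma(X))$, and, in the negative fragment, the two principal reductions for the native rules of $N$. The numeral $\underline n$ is the cut-free derivation of $\Rightarrow N$ consisting of $n$ successors applied to zero; it is built with the right rules for $\mu$, $+$ and $1$ in $\mathsf{C}\mu\mathsf{LJ}$ and with the native rules in $\mathsf{C}\mu\mathsf{LJ}^-$. A coderivation $P$ of $N,\dots,N\Rightarrow N$ ($k$ copies of $N$ on the left) *represents* a possibly partial function $f:\mathbb N^k\rightharpoonup\mathbb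 N$ if, for all $n_1,\dots,n_k\in\mathbb N$, the coderivation of $\Rightarrow N$ obtained by cutting $P$ against $\underline{n_k},\dots,\underline{n_1}$ reduces to the numeral $\underline{f(n_1,\dots,n_k)}$ if $f(n_1,\dots,n_k)$ is defined, and reduces to no numeral otherwise. A function is *representable* in $\mathsf{C}\mu\mathsf{LJ}$ (or $\mathsf{C}\mu\mathsf{LJ}^-$) if a coderivation in that class represents it. **Theorem.** Every function on natural numbers (of any arity $k\ge 0$) that is representable in $\mathsf{C}\mu\mathsf{LJ}$ is also representable in $\mathsf{C}\mu\mathsf{LJ}^-$. More precisely, for every $k$ and every coderivation $P$ of $N,\dots,N\Rightarrow N$ (with $k$ copies of $N$ on the left) in $\mathsf{C}\mu\mathsf{LJ}$ there is a coderivation $P'$ of the same sequent in $\mathsf{C}\mu\mathsf{LJ}^-$ such that $P$ and $P'$ represent the same functions on natural numbers. -/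

import Mathlib

/-! Circular proofs with least and greatest fixed points: types, coderivations, regularity,
progress, cut-reduction, representability, and the negative fragment. -/

namespace CircMuLJ

/-! ### Types -/

/-- Pretypes, with de Bruijn indices: `mu σ` and `nu σ` bind index `0` of `σ`. -/
inductive Ty : Type
  | var (n : ℕ)
  | one
  | sum (σ τ : Ty)
  | prod (σ τ : Ty)
  | arr (σ τ : Ty)
  | mu (σ : Ty)
  | nu (σ : Ty)

namespace Ty

/-- Add one to every index that is at least `c`. -/
def lift : ℕ → Ty → Ty
  | c, var n => if n < c then var n else var (n + 1)
  | _, one => one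
  | c, sum σ τ => sum (lift c σ) (lift c τ)
  | c, prod σ τ => prod (lift c σ) (lift c τ)
  | c, arr σ τ => arr (lift c σ) (lift c τ)
  | c, mu σ => mu (lift (c + 1) σ)
  | c, nu σ => nu (lift (c + 1) σ)

/-- Capture-avoiding substitution of `ρ` for index `k`; larger indices drop by one. -/
def subst : ℕ → Ty → Ty → Ty
  | k, ρ, var n => if n = k then ρ else if k < n then var (n - 1) else var n
  | _, _, one => one
  | k, ρ, sum σ τ => sum (subst k ρ σ) (subst k ρ τ)
  | k, ρ, prod σ τ => prod (subst k ρ σ) (subst k ρ τ)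
  | k, ρ, arr σ τ => arr (subst k ρ σ) (subst k ρ τ)
  | k, ρ, mu σ => mu (subst (k + 1) (lift 0 ρ) σ)
  | k, ρ, nu σ => nu (subst (k + 1) (lift 0 ρ) σ)

/-- `σ.inst ρ` is `σ(ρ)`, where `σ` is the body of a binder. -/
def inst (σ ρ : Ty) : Ty := subst 0 ρ σ

/-- `Polar true i σ`: `σ` is positive in the variable `i`;
`Polar false i σ`: `σ` is negative in the variable `i`. -/
def Polar : Bool → ℕ → Ty → Prop
  | b, i, var n => n = i → b = true
  | _, _, one => True
  | b, i, sum σ τ => Polar b i σ ∧ Polar b i τ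
  | b, i, prod σ τ => Polar b i σ ∧ Polar b i τ
  | b, i, arr σ τ => Polar (!b) i σ ∧ Polar b i τ
  | b, i, mu σ => Polar b (i + 1) σ
  | b, i, nu σ => Polar b (i + 1) σ

/-- A pretype is a type if every fixed point binder binds a variable its body is positive in. -/
def IsType : Ty → Prop
  | var _ => True
  | one => True
  | sum σ τ => IsType σ ∧ IsType τ
  | prod σ τ => IsType σ ∧ IsType τ
  | arr σ τ => IsType σ ∧ IsType τ
  | mu σ => Polar true 0 σ ∧ IsType σ
  | nu σ => Polar true 0 σ ∧ IsType σ

/-- The type of natural numbers `N = μX(1 + X)`. -/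
def nat : Ty := mu (sum one (var 0))

/-- Pretypes generated from variables and `N` (as a primitive) by `×`, `→` and `μ`. -/
inductive IsNegative : Ty → Prop
  | var (n : ℕ) : IsNegative (var n)
  | nat : IsNegative nat
  | prod {σ τ : Ty} : IsNegative σ → IsNegative τ → IsNegative (prod σ τ)
  | arr {σ τ : Ty} : IsNegative σ → IsNegative τ → IsNegative (arr σ τ)
  | mu {σ : Ty} : IsNegative σ → IsNegative (mu σ)

/-- `Subformula φ ψ`: `φ` occurs in `ψ`. Under a binder `φ` is lifted, since the free variables
of `φ` are not the bound one. -/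
inductive Subformula : Ty → Ty → Prop
  | refl (φ : Ty) : Subformula φ φ
  | sum_left {φ σ τ : Ty} : Subformula φ σ → Subformula φ (sum σ τ)
  | sum_right {φ σ τ : Ty} : Subformula φ τ → Subformula φ (sum σ τ)
  | prod_left {φ σ τ : Ty} : Subformula φ σ → Subformula φ (prod σ τ)
  | prod_right {φ σ τ : Ty} : Subformula φ τ → Subformula φ (prod σ τ)
  | arr_left {φ σ τ : Ty} : Subformula φ σ → Subformula φ (arr σ τ)
  | arr_right {φ σ τ : Ty} : Subformula φ τ → Subformula φ (arr σ τ)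
  | mu {φ σ : Ty} : Subformula (lift 0 φ) σ → Subformula φ (mu σ)
  | nu {φ σ : Ty} : Subformula (lift 0 φ) σ → Subformula φ (nu σ)

end Ty

/-! ### Sequents and inference steps -/

/-- A sequent `ant ⇒ suc`. -/
@[ext] structure Sequent : Type where
  ant : List Ty
  suc : Ty

/-- Inference steps. The last three are the native rules for `N`; the others are the rules
of the system with unfolding (and no iteration) rules for the fixed points. -/
inductive Step : Type
  | id (σ : Ty)
  | exch (Γ : List Ty) (σ τ : Ty) (Δ : List Ty) (γ : Ty)
  | cut (Γ Δ : List Ty) (σ τ : Ty)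
  | wk (Γ : List Ty) (σ τ : Ty)
  | ctr (Γ : List Ty) (σ τ : Ty)
  | oneR
  | oneL (Γ : List Ty) (σ : Ty)
  | arrR (Γ : List Ty) (σ τ : Ty)
  | arrL (Γ Δ : List Ty) (σ τ γ : Ty)
  | prodR (Γ Δ : List Ty) (σ τ : Ty)
  | prodL (Γ : List Ty) (σ τ γ : Ty)
  | sumR₀ (Γ : List Ty) (σ τ : Ty)
  | sumR₁ (Γ : List Ty) (σ τ : Ty)
  | sumL (Γ : List Ty) (σ τ γ : Ty)
  | muR (Γ : List Ty) (σ : Ty)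
  | muL (Γ : List Ty) (σ τ : Ty)
  | nuR (Γ : List Ty) (σ : Ty)
  | nuL (Γ : List Ty) (σ τ : Ty)
  | natR₀
  | natR₁ (Γ : List Ty)
  | natL (Γ : List Ty) (σ : Ty)

namespace Step

/-- The conclusion of a step. -/
def concl : Step → Sequent
  | id σ => ⟨[σ], σ⟩
  | exch Γ σ τ Δ γ => ⟨Γ ++ τ :: σ :: Δ, γ⟩
  | cut Γ Δ _ τ => ⟨Γ ++ Δ, τ⟩
  | wk Γ σ τ => ⟨Γ ++ [σ], τ⟩
  | ctr Γ σ τ => ⟨Γ ++ [σ], τ⟩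
  | oneR => ⟨[], .one⟩
  | oneL Γ σ => ⟨Γ ++ [.one], σ⟩
  | arrR Γ σ τ => ⟨Γ, .arr σ τ⟩
  | arrL Γ Δ σ τ γ => ⟨Γ ++ Δ ++ [.arr σ τ], γ⟩
  | prodR Γ Δ σ τ => ⟨Γ ++ Δ, .prod σ τ⟩
  | prodL Γ σ τ γ => ⟨Γ ++ [.prod σ τ], γ⟩
  | sumR₀ Γ σ τ => ⟨Γ, .sum σ τ⟩
  | sumR₁ Γ σ τ => ⟨Γ, .sum σ τ⟩
  | sumL Γ σ τ γ => ⟨Γ ++ [.sum σ τ], γ⟩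
  | muR Γ σ => ⟨Γ, .mu σ⟩
  | muL Γ σ τ => ⟨Γ ++ [.mu σ], τ⟩
  | nuR Γ σ => ⟨Γ, .nu σ⟩
  | nuL Γ σ τ => ⟨Γ ++ [.nu σ], τ⟩
  | natR₀ => ⟨[], .nat⟩
  | natR₁ Γ => ⟨Γ, .nat⟩
  | natL Γ σ => ⟨Γ ++ [.nat], σ⟩

/-- The premisses of a step, from left to right. -/
def prems : Step → List Sequent
  | id _ => []
  | exch Γ σ τ Δ γ => [⟨Γ ++ σ :: τ :: Δ, γ⟩]
  | cut Γ Δ σ τ => [⟨Γ, σ⟩, ⟨Δ ++ [σ], τ⟩]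
  | wk Γ _ τ => [⟨Γ, τ⟩]
  | ctr Γ σ τ => [⟨Γ ++ [σ, σ], τ⟩]
  | oneR => []
  | oneL Γ σ => [⟨Γ, σ⟩]
  | arrR Γ σ τ => [⟨Γ ++ [σ], τ⟩]
  | arrL Γ Δ σ τ γ => [⟨Γ, σ⟩, ⟨Δ ++ [τ], γ⟩]
  | prodR Γ Δ σ τ => [⟨Γ, σ⟩, ⟨Δ, τ⟩]
  | prodL Γ σ τ γ => [⟨Γ ++ [σ, τ], γ⟩]
  | sumR₀ Γ σ _ => [⟨Γ, σ⟩]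
  | sumR₁ Γ _ τ => [⟨Γ, τ⟩]
  | sumL Γ σ τ γ => [⟨Γ ++ [σ], γ⟩, ⟨Γ ++ [τ], γ⟩]
  | muR Γ σ => [⟨Γ, σ.inst (.mu σ)⟩]
  | muL Γ σ τ => [⟨Γ ++ [σ.inst (.mu σ)], τ⟩]
  | nuR Γ σ => [⟨Γ, σ.inst (.nu σ)⟩]
  | nuL Γ σ τ => [⟨Γ ++ [σ.inst (.nu σ)], τ⟩]
  | natR₀ => []
  | natR₁ Γ => [⟨Γ, .nat⟩]
  | natL Γ σ => [⟨Γ, σ⟩, ⟨Γ ++ [.nat], σ⟩]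

/-- The left (`false`) or right (`true`) premiss, if there is one. -/
def prem (s : Step) (b : Bool) : Option Sequent := s.prems[b.toNat]?

/-- Being an instance of a native rule for `N`. -/
def IsNative : Step → Prop
  | natR₀ => True
  | natR₁ _ => True
  | natL _ _ => True
  | _ => False

end Step

/-- An occurrence of a type in a sequent. -/
inductive Occ : Type
  | lhs (i : ℕ)
  | rhs

/-- The type at an occurrence, if the occurrence exists. -/
def Sequent.type (S : Sequent) : Occ → Option Ty
  | .lhs i => S.ant[i]?
  | .rhs => some S.suc

namespace Step

/-- `s.descendant b o = some o'`: the occurrence `o` in premiss `b` of `s` is an immediate ancestor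
of the occurrence `o'` in the conclusion of `s`. -/
def descendant : Step → Bool → Occ → Option Occ
  | exch Γ _ _ _ _, _, .lhs i =>
      some (.lhs (if i = Γ.length then i + 1 else if i = Γ.length + 1 then Γ.length else i))
  | cut _ _ _ _, false, .lhs i => some (.lhs i)
  | cut _ _ _ _, false, .rhs => none
  | cut Γ Δ _ _, true, .lhs i => if i < Δ.length then some (.lhs (Γ.length + i)) else none
  | ctr Γ _ _, _, .lhs i => some (.lhs (min i Γ.length))
  | arrR Γ _ _, _, .lhs i => some (if i < Γ.length then .lhs i else .rhs)
  | arrL Γ Δ _ _ _, false, .rhs => some (.lhs (Γ.length + Δ.length))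
  | arrL Γ _ _ _ _, true, .lhs i => some (.lhs (Γ.length + i))
  | prodR Γ _ _ _, true, .lhs i => some (.lhs (Γ.length + i))
  | prodL Γ _ _ _, _, .lhs i => some (.lhs (min i Γ.length))
  | _, _, o => some o

/-- The principal occurrence (in the conclusion) of a logical step. Identity, cut and the
structural steps have none. -/
def principal : Step → Option Occ
  | id _ => none
  | exch _ _ _ _ _ => none
  | cut _ _ _ _ => none
  | wk _ _ _ => none
  | ctr _ _ _ => none
  | oneR => some .rhs
  | oneL Γ _ => some (.lhs Γ.length)
  | arrR _ _ _ => some .rhs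
  | arrL Γ Δ _ _ _ => some (.lhs (Γ.length + Δ.length))
  | prodR _ _ _ _ => some .rhs
  | prodL Γ _ _ _ => some (.lhs Γ.length)
  | sumR₀ _ _ _ => some .rhs
  | sumR₁ _ _ _ => some .rhs
  | sumL Γ _ _ _ => some (.lhs Γ.length)
  | muR _ _ => some .rhs
  | muL Γ _ _ => some (.lhs Γ.length)
  | nuR _ _ => some .rhs
  | nuL Γ _ _ => some (.lhs Γ.length)
  | natR₀ => some .rhs
  | natR₁ _ => some .rhs
  | natL Γ _ => some (.lhs Γ.length)

end Step

/-! ### Coderivations -/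

/-- Possibly infinite binary trees labelled by steps: partial functions on addresses. -/
abbrev PTree : Type := List Bool → Option Step

namespace PTree

/-- The subtree at an address. -/
def sub (t : PTree) (α : List Bool) : PTree := fun β => t (α ++ β)

/-- The conclusion of the step at the root. -/
def concl (t : PTree) : Option Sequent := (t []).map Step.concl

/-- `t` is a coderivation of `S`, all of whose steps are in the class `R`: its root is labelled by a
step with conclusion `S`, and each labelled node has exactly one child for every premiss of its
step, which is labelled by a step concluding that premiss. -/
structure IsCoderivation (R : Step → Prop) (t : PTree) (S : Sequent) : Prop where
  root : t.concl = some S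
  child : ∀ α s, t α = some s → ∀ b, (t (α ++ [b])).map Step.concl = s.prem b
  closed : ∀ α, t α = none → ∀ b, t (α ++ [b]) = none
  steps : ∀ α s, t α = some s → R s

/-- Finitely many distinct sub-coderivations. -/
def Regular (t : PTree) : Prop :=
  {u : PTree | ∃ α, t α ≠ none ∧ u = t.sub α}.Finite

/-- The node at height `n` of the branch `β`. -/
def node (β : ℕ → Bool) (n : ℕ) : List Bool := (List.range n).map β

/-- An infinite branch. -/
def IsBranch (t : PTree) (β : ℕ → Bool) : Prop := ∀ n, t (node β n) ≠ none

/-- An infinite path `o` in the graph of immediate ancestry along the branch `β`, starting at height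
`k`. Any such path extends (downwards, uniquely, by finitely many occurrences) to a maximal one, and
whether it is progressing depends only on its tails. -/
def IsThread (t : PTree) (β : ℕ → Bool) (k : ℕ) (o : ℕ → Occ) : Prop :=
  ∀ n, ∃ s, t (node β (k + n)) = some s ∧ s.concl.type (o n) ≠ none ∧
    s.descendant (β (k + n)) (o (n + 1)) = some (o n)

/-- The `n`-th element of the thread is principal, and is an occurrence of `φ`. -/
def PrincipalAt (t : PTree) (β : ℕ → Bool) (k : ℕ) (o : ℕ → Occ) (n : ℕ) (φ : Ty) : Prop :=
  ∃ s, t (node β (k + n)) = some s ∧ s.principal = some (o n) ∧ s.concl.type (o n) = some φ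

/-- `φ` is a `μ`-formula occurring on the left or a `ν`-formula occurring on the right. -/
def IsGood (φ : Ty) (o : Occ) : Prop :=
  (∃ σ i, φ = .mu σ ∧ o = .lhs i) ∨ (∃ σ, φ = .nu σ ∧ o = .rhs)

/-- The thread has a smallest infinitely often principal formula, and that one is a `μ`-formula on
the left or a `ν`-formula on the right. -/
def IsProgressingThread (t : PTree) (β : ℕ → Bool) (k : ℕ) (o : ℕ → Occ) : Prop :=
  ∃ φ, (∃ᶠ n in Filter.atTop, t.PrincipalAt β k o n φ ∧ IsGood φ (o n)) ∧
    ∀ ψ, (∃ᶠ n in Filter.atTop, t.PrincipalAt β k o n ψ) → φ.Subformula ψ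

/-- Every infinite branch has a progressing thread. -/
def Progressing (t : PTree) : Prop :=
  ∀ β, t.IsBranch β → ∃ k o, t.IsThread β k o ∧ t.IsProgressingThread β k o

/-- A step without premisses. -/
def leaf (s : Step) : PTree
  | [] => some s
  | _ :: _ => none

/-- A step `s` with one premiss, concluded by `t`. -/
def un (s : Step) (t : PTree) : PTree
  | [] => some s
  | false :: α => t α
  | true :: _ => none

/-- A step `s` with two premisses, concluded by `t` and `u`. -/
def bin (s : Step) (t u : PTree) : PTree
  | [] => some s
  | false :: α => t α
  | true :: α => u α

end PTree

open PTree

/-- Steps of the full system: non-native, over arbitrary types. -/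
def FullStep (s : Step) : Prop :=
  ¬ s.IsNative ∧ (∀ σ ∈ s.concl.ant, σ.IsType) ∧ s.concl.suc.IsType

/-- Steps of the negative fragment: over types built from `N`, `×`, `→`, `μ`, including the
native rules. (In a coderivation this rules out all steps for `1`, `+`, `ν` and the unfolding
of `N` into `1 + N`, as each of these has a conclusion or a premiss outside of the fragment.) -/
def NegativeStep (s : Step) : Prop :=
  (∀ σ ∈ s.concl.ant, σ.IsType ∧ σ.IsNegative) ∧ s.concl.suc.IsType ∧ s.concl.suc.IsNegative

/-- The circular system: regular progressing coderivations. -/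
def Circular (t : PTree) (S : Sequent) : Prop :=
  t.IsCoderivation FullStep S ∧ t.Regular ∧ t.Progressing

/-- The negative fragment of the circular system. -/
def CircularNegative (t : PTree) (S : Sequent) : Prop :=
  t.IsCoderivation NegativeStep S ∧ t.Regular ∧ t.Progressing

/-! ### Cut-reduction -/

/-- `Exs p t u`: `u` is obtained from `t` by finitely many exchange steps below its root. The list
`p` gives, for each position of the antecedent of `u`, the position in the antecedent of
`t` it comes from. -/
inductive Exs : List ℕ → PTree → PTree → Prop
  | nil {t : PTree} {S : Sequent} : t.concl = some S → Exs (List.range S.ant.length) t t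
  | step {t u : PTree} {a b : List ℕ} {i j : ℕ} {Γ Δ : List Ty} {σ τ γ : Ty} :
      Exs (a ++ i :: j :: b) t u → u.concl = some ⟨Γ ++ σ :: τ :: Δ, γ⟩ →
      a.length = Γ.length →
      Exs (a ++ j :: i :: b) t (un (.exch Γ σ τ Δ γ) u)

/-- `InCut Γ Δ₁ Δ₂ σ τ A B Q`: from `A : Γ ⇒ σ` and `B : Δ₁, σ, Δ₂ ⇒ τ`, the tree
`Q : Δ₁, Γ, Δ₂ ⇒ τ` is a cut of `A` against the displayed occurrence of `σ`, up to exchanges: move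
`σ` to the end in `B`, cut, and move `Γ` between `Δ₁` and `Δ₂`. -/
inductive InCut (Γ Δ₁ Δ₂ : List Ty) (σ τ : Ty) (A B : PTree) : PTree → Prop
  | mk {B' Q : PTree} : A.concl = some ⟨Γ, σ⟩ → B.concl = some ⟨Δ₁ ++ σ :: Δ₂, τ⟩ →
      Exs (List.range Δ₁.length ++ List.range' (Δ₁.length + 1) Δ₂.length ++ [Δ₁.length]) B B' →
      Exs (List.range' Γ.length Δ₁.length ++ List.range Γ.length ++
          List.range' (Γ.length + Δ₁.length) Δ₂.length)
        (bin (.cut Γ (Δ₁ ++ Δ₂) σ τ) A B') Q →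
      InCut Γ Δ₁ Δ₂ σ τ A B Q

/-- `weaken τ Γ Δ B : Δ, Γ ⇒ τ` weakens `B : Δ ⇒ τ` by all of `Γ`. -/
def weaken (τ : Ty) : List Ty → List Ty → PTree → PTree
  | [], _, B => B
  | γ :: Γ, Δ, B => weaken τ Γ (Δ ++ [γ]) (un (.wk Δ γ τ) B)

/-- `Contract τ Γ Δ t u`: `u : Δ, Γ ⇒ τ` is obtained from `t : Δ, Γ, Γ ⇒ τ` by contracting each
type of the first copy of `Γ` with the corresponding one of the second. -/
inductive Contract (τ : Ty) : List Ty → List Ty → PTree → PTree → Prop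
  | nil {Δ : List Ty} {t : PTree} : Contract τ [] Δ t t
  | cons {γ : Ty} {Γ Δ : List Ty} {t t₁ t₂ u : PTree} :
      Exs (List.range Δ.length ++ List.range' (Δ.length + 1) Γ.length ++
          List.range' (Δ.length + Γ.length + 2) Γ.length ++
          [Δ.length, Δ.length + Γ.length + 1]) t t₁ →
      Exs (List.range Δ.length ++ [Δ.length + Γ.length + Γ.length] ++
          List.range' Δ.length (Γ.length + Γ.length)) (un (.ctr (Δ ++ Γ ++ Γ) γ τ) t₁) t₂ →
      Contract τ Γ (Δ ++ [γ]) t₂ u →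
      Contract τ (γ :: Γ) Δ t u

/-- Unary steps `R Θ γ` on the left: from `Θ, Φ' ⇒ γ` infer `Θ, Φ ⇒ γ`. -/
inductive UnaryLeft : (List Ty → Ty → Step) → (Φ Φ' : List Ty) → Prop
  | wk (σ : Ty) : UnaryLeft (fun Θ γ => .wk Θ σ γ) [σ] []
  | ctr (σ : Ty) : UnaryLeft (fun Θ γ => .ctr Θ σ γ) [σ] [σ, σ]
  | oneL : UnaryLeft (fun Θ γ => .oneL Θ γ) [.one] []
  | prodL (σ τ : Ty) : UnaryLeft (fun Θ γ => .prodL Θ σ τ γ) [.prod σ τ] [σ, τ]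
  | muL (σ : Ty) : UnaryLeft (fun Θ γ => .muL Θ σ γ) [.mu σ] [σ.inst (.mu σ)]
  | nuL (σ : Ty) : UnaryLeft (fun Θ γ => .nuL Θ σ γ) [.nu σ] [σ.inst (.nu σ)]

/-- Unary steps `R Θ` on the right: from `Θ, Φ' ⇒ γ'` infer `Θ ⇒ γ`. -/
inductive UnaryRight : (List Ty → Step) → (Φ' : List Ty) → (γ γ' : Ty) → Prop
  | arrR (σ τ : Ty) : UnaryRight (fun Θ => .arrR Θ σ τ) [σ] (.arr σ τ) τ
  | sumR₀ (σ τ : Ty) : UnaryRight (fun Θ => .sumR₀ Θ σ τ) [] (.sum σ τ) σ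
  | sumR₁ (σ τ : Ty) : UnaryRight (fun Θ => .sumR₁ Θ σ τ) [] (.sum σ τ) τ
  | muR (σ : Ty) : UnaryRight (fun Θ => .muR Θ σ) [] (.mu σ) (σ.inst (.mu σ))
  | nuR (σ : Ty) : UnaryRight (fun Θ => .nuR Θ σ) [] (.nu σ) (σ.inst (.nu σ))
  | natR₁ : UnaryRight (fun Θ => .natR₁ Θ) [] .nat .nat

/-- Context-sharing binary steps `R Θ γ`: from `Θ, Φ₀ ⇒ γ` and `Θ, Φ₁ ⇒ γ` infer `Θ, Φ ⇒ γ`. -/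
inductive BinaryLeft : (List Ty → Ty → Step) → (Φ Φ₀ Φ₁ : List Ty) → Prop
  | sumL (σ τ : Ty) : BinaryLeft (fun Θ γ => .sumL Θ σ τ γ) [.sum σ τ] [σ] [τ]
  | natL : BinaryLeft (fun Θ γ => .natL Θ γ) [.nat] [] [.nat]

/-- Context-splitting binary steps `R Θ Ξ γ`: from `Θ ⇒ δ` and `Ξ, Φ' ⇒ γ` infer
`Θ, Ξ, Φ ⇒ γ`. -/
inductive SplitLeft : (List Ty → List Ty → Ty → Step) → (Φ : List Ty) → (δ : Ty) →
    (Φ' : List Ty) → Prop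
  | cut (σ : Ty) : SplitLeft (fun Θ Ξ γ => .cut Θ Ξ σ γ) [] σ [σ]
  | arrL (σ τ : Ty) : SplitLeft (fun Θ Ξ γ => .arrL Θ Ξ σ τ γ) [.arr σ τ] σ [τ]

/-- One step of cut-reduction. -/
inductive Red : PTree → PTree → Prop
  -- reduction in sub-coderivations
  | un {s : Step} {t t' : PTree} : Red t t' → Red (un s t) (un s t')
  | bin_left {s : Step} {t t' u : PTree} : Red t t' → Red (bin s t u) (bin s t' u)
  | bin_right {s : Step} {t u u' : PTree} : Red u u' → Red (bin s t u) (bin s t u')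
  -- sequences of exchanges realising the same permutation are interchangeable
  | exs {p : List ℕ} {t u u' : PTree} : Exs p t u → Exs p t u' → Red u u'
  -- cut against an exchange not involving the cut formula
  | exch_left {Γ₁ Γ₂ Δ : List Ty} {ρ τ σ γ : Ty} {A B : PTree} :
      Red (bin (.cut (Γ₁ ++ τ :: ρ :: Γ₂) Δ σ γ) (un (.exch Γ₁ ρ τ Γ₂ σ) A) B)
        (un (.exch Γ₁ ρ τ (Γ₂ ++ Δ) γ) (bin (.cut (Γ₁ ++ ρ :: τ :: Γ₂) Δ σ γ) A B))
  | exch_right {Γ Δ₁ Δ₂ : List Ty} {ρ τ σ γ : Ty} {A B : PTree} :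
      Red (bin (.cut Γ (Δ₁ ++ τ :: ρ :: Δ₂) σ γ) A (un (.exch Δ₁ ρ τ (Δ₂ ++ [σ]) γ) B))
        (un (.exch (Γ ++ Δ₁) ρ τ Δ₂ γ) (bin (.cut Γ (Δ₁ ++ ρ :: τ :: Δ₂) σ γ) A B))
  -- commuting the cut above the last step of its left premiss
  | comm_left_unary {R : List Ty → Ty → Step} {Φ Φ' Γ Δ : List Ty} {σ τ : Ty} {A B Q Q' : PTree} :
      UnaryLeft R Φ Φ' →
      InCut (Γ ++ Φ) Δ [] σ τ (un (R Γ σ) A) B Q →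
      InCut (Γ ++ Φ') Δ [] σ τ A B Q' →
      Red Q (un (R (Δ ++ Γ) τ) Q')
  | comm_left_binary {R : List Ty → Ty → Step} {Φ Φ₀ Φ₁ Γ Δ : List Ty} {σ τ : Ty}
      {A₀ A₁ B Q Q₀ Q₁ : PTree} :
      BinaryLeft R Φ Φ₀ Φ₁ →
      InCut (Γ ++ Φ) Δ [] σ τ (bin (R Γ σ) A₀ A₁) B Q →
      InCut (Γ ++ Φ₀) Δ [] σ τ A₀ B Q₀ →
      InCut (Γ ++ Φ₁) Δ [] σ τ A₁ B Q₁ →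
      Red Q (bin (R (Δ ++ Γ) τ) Q₀ Q₁)
  | comm_left_split {R : List Ty → List Ty → Ty → Step} {Φ Φ' Θ Ξ Δ : List Ty} {δ σ τ : Ty}
      {A₀ A₁ B Q Q₁ Q' : PTree} :
      SplitLeft R Φ δ Φ' →
      InCut (Θ ++ Ξ ++ Φ) Δ [] σ τ (bin (R Θ Ξ σ) A₀ A₁) B Q →
      InCut (Ξ ++ Φ') Δ [] σ τ A₁ B Q₁ →
      Exs (List.range' Θ.length Δ.length ++ List.range Θ.length ++
          List.range' (Θ.length + Δ.length) (Ξ.length + Φ.length))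
        (bin (R Θ (Δ ++ Ξ) τ) A₀ Q₁) Q' →
      Red Q Q'
  -- commuting the cut above the last step of its right premiss
  | comm_right_unaryLeft {R : List Ty → Ty → Step} {Φ Φ' Γ Δ₁ Δ₂ : List Ty} {σ τ : Ty}
      {A B Q Q' : PTree} :
      UnaryLeft R Φ Φ' →
      InCut Γ Δ₁ (Δ₂ ++ Φ) σ τ A (un (R (Δ₁ ++ σ :: Δ₂) τ) B) Q →
      InCut Γ Δ₁ (Δ₂ ++ Φ') σ τ A B Q' →
      Red Q (un (R (Δ₁ ++ Γ ++ Δ₂) τ) Q')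
  | comm_right_unaryRight {R : List Ty → Step} {Φ' Γ Δ₁ Δ₂ : List Ty} {σ γ γ' : Ty}
      {A B Q Q' : PTree} :
      UnaryRight R Φ' γ γ' →
      InCut Γ Δ₁ Δ₂ σ γ A (un (R (Δ₁ ++ σ :: Δ₂)) B) Q →
      InCut Γ Δ₁ (Δ₂ ++ Φ') σ γ' A B Q' →
      Red Q (un (R (Δ₁ ++ Γ ++ Δ₂)) Q')
  | comm_right_binary {R : List Ty → Ty → Step} {Φ Φ₀ Φ₁ Γ Δ₁ Δ₂ : List Ty} {σ τ : Ty}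
      {A B₀ B₁ Q Q₀ Q₁ : PTree} :
      BinaryLeft R Φ Φ₀ Φ₁ →
      InCut Γ Δ₁ (Δ₂ ++ Φ) σ τ A (bin (R (Δ₁ ++ σ :: Δ₂) τ) B₀ B₁) Q →
      InCut Γ Δ₁ (Δ₂ ++ Φ₀) σ τ A B₀ Q₀ →
      InCut Γ Δ₁ (Δ₂ ++ Φ₁) σ τ A B₁ Q₁ →
      Red Q (bin (R (Δ₁ ++ Γ ++ Δ₂) τ) Q₀ Q₁)
  | comm_right_split₀ {R : List Ty → List Ty → Ty → Step} {Φ Φ' Γ Δ₁ Δ₂ Ξ : List Ty} {δ σ τ : Ty}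
      {A B₀ B₁ Q Q₀ : PTree} :
      SplitLeft R Φ δ Φ' →
      InCut Γ Δ₁ (Δ₂ ++ Ξ ++ Φ) σ τ A (bin (R (Δ₁ ++ σ :: Δ₂) Ξ τ) B₀ B₁) Q →
      InCut Γ Δ₁ Δ₂ σ δ A B₀ Q₀ →
      Red Q (bin (R (Δ₁ ++ Γ ++ Δ₂) Ξ τ) Q₀ B₁)
  | comm_right_split₁ {R : List Ty → List Ty → Ty → Step} {Φ Φ' Γ Δ₁ Δ₂ Θ : List Ty} {δ σ τ : Ty}
      {A B₀ B₁ Q Q₁ : PTree} :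
      SplitLeft R Φ δ Φ' →
      InCut Γ (Θ ++ Δ₁) (Δ₂ ++ Φ) σ τ A (bin (R Θ (Δ₁ ++ σ :: Δ₂) τ) B₀ B₁) Q →
      InCut Γ Δ₁ (Δ₂ ++ Φ') σ τ A B₁ Q₁ →
      Red Q (bin (R Θ (Δ₁ ++ Γ ++ Δ₂) τ) B₀ Q₁)
  | comm_right_prodR₀ {Γ Δ₁ Δ₂ Ξ : List Ty} {σ ρ τ : Ty} {A B₀ B₁ Q Q₀ : PTree} :
      InCut Γ Δ₁ (Δ₂ ++ Ξ) σ (.prod ρ τ) A (bin (.prodR (Δ₁ ++ σ :: Δ₂) Ξ ρ τ) B₀ B₁) Q →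
      InCut Γ Δ₁ Δ₂ σ ρ A B₀ Q₀ →
      Red Q (bin (.prodR (Δ₁ ++ Γ ++ Δ₂) Ξ ρ τ) Q₀ B₁)
  | comm_right_prodR₁ {Γ Δ₁ Δ₂ Θ : List Ty} {σ ρ τ : Ty} {A B₀ B₁ Q Q₁ : PTree} :
      InCut Γ (Θ ++ Δ₁) Δ₂ σ (.prod ρ τ) A (bin (.prodR Θ (Δ₁ ++ σ :: Δ₂) ρ τ) B₀ B₁) Q →
      InCut Γ Δ₁ Δ₂ σ τ A B₁ Q₁ →
      Red Q (bin (.prodR Θ (Δ₁ ++ Γ ++ Δ₂) ρ τ) B₀ Q₁)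
  -- identity, weakening and contraction on the cut formula
  | id_left {Δ : List Ty} {σ τ : Ty} {B Q : PTree} :
      InCut [σ] Δ [] σ τ (leaf (.id σ)) B Q → Red Q B
  | id_right {Γ : List Ty} {σ : Ty} {A : PTree} :
      Red (bin (.cut Γ [] σ σ) A (leaf (.id σ))) A
  | wk {Γ Δ : List Ty} {σ τ : Ty} {A B Q : PTree} :
      InCut Γ Δ [] σ τ A (un (.wk Δ σ τ) B) Q → Red Q (weaken τ Γ Δ B)
  | ctr {Γ Δ : List Ty} {σ τ : Ty} {A B Q Q₁ Q₂ Q' : PTree} :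
      InCut Γ Δ [] σ τ A (un (.ctr Δ σ τ) B) Q →
      InCut Γ Δ [σ] σ τ A B Q₁ →
      InCut Γ (Δ ++ Γ) [] σ τ A Q₁ Q₂ →
      Contract τ Γ Δ Q₂ Q' →
      Red Q Q'
  -- principal cases
  | one {Δ : List Ty} {τ : Ty} {B : PTree} :
      Red (bin (.cut [] Δ .one τ) (leaf .oneR) (un (.oneL Δ τ) B)) B
  | arr {Γ Θ Ξ : List Ty} {σ τ γ : Ty} {A B C Q : PTree} :
      InCut Θ Γ [] σ τ B A Q →
      Red (bin (.cut Γ (Θ ++ Ξ) (.arr σ τ) γ) (un (.arrR Γ σ τ) A) (bin (.arrL Θ Ξ σ τ γ) B C))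
        (bin (.cut (Γ ++ Θ) Ξ τ γ) Q C)
  | prod {Γ₀ Γ₁ Δ : List Ty} {σ τ γ : Ty} {A₀ A₁ B Q Q₁ Q₂ : PTree} :
      InCut (Γ₀ ++ Γ₁) Δ [] (.prod σ τ) γ (bin (.prodR Γ₀ Γ₁ σ τ) A₀ A₁)
        (un (.prodL Δ σ τ γ) B) Q →
      InCut Γ₀ Δ [τ] σ γ A₀ B Q₁ →
      InCut Γ₁ (Δ ++ Γ₀) [] τ γ A₁ Q₁ Q₂ →
      Red Q Q₂
  | sum₀ {Γ Δ : List Ty} {σ τ γ : Ty} {A B₀ B₁ : PTree} :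
      Red (bin (.cut Γ Δ (.sum σ τ) γ) (un (.sumR₀ Γ σ τ) A) (bin (.sumL Δ σ τ γ) B₀ B₁))
        (bin (.cut Γ Δ σ γ) A B₀)
  | sum₁ {Γ Δ : List Ty} {σ τ γ : Ty} {A B₀ B₁ : PTree} :
      Red (bin (.cut Γ Δ (.sum σ τ) γ) (un (.sumR₁ Γ σ τ) A) (bin (.sumL Δ σ τ γ) B₀ B₁))
        (bin (.cut Γ Δ τ γ) A B₁)
  | mu {Γ Δ : List Ty} {σ τ : Ty} {A B : PTree} :
      Red (bin (.cut Γ Δ (.mu σ) τ) (un (.muR Γ σ) A) (un (.muL Δ σ τ) B))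
        (bin (.cut Γ Δ (σ.inst (.mu σ)) τ) A B)
  | nu {Γ Δ : List Ty} {σ τ : Ty} {A B : PTree} :
      Red (bin (.cut Γ Δ (.nu σ) τ) (un (.nuR Γ σ) A) (un (.nuL Δ σ τ) B))
        (bin (.cut Γ Δ (σ.inst (.nu σ)) τ) A B)
  | nat₀ {Δ : List Ty} {τ : Ty} {B₀ B₁ : PTree} :
      Red (bin (.cut [] Δ .nat τ) (leaf .natR₀) (bin (.natL Δ τ) B₀ B₁)) B₀
  | nat₁ {Γ Δ : List Ty} {τ : Ty} {A B₀ B₁ : PTree} :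
      Red (bin (.cut Γ Δ .nat τ) (un (.natR₁ Γ) A) (bin (.natL Δ τ) B₀ B₁))
        (bin (.cut Γ Δ .nat τ) A B₁)

/-- The reflexive transitive closure of cut-reduction. -/
def Reduces : PTree → PTree → Prop := Relation.ReflTransGen Red

/-! ### Representability -/

/-- The sequent `N, …, N ⇒ N` with `k` copies of `N` on the left. -/
def natSequent (k : ℕ) : Sequent := ⟨List.replicate k .nat, .nat⟩

/-- The numerals of the full system. -/
def numeral : ℕ → PTree
  | 0 => un (.muR [] (.sum .one (.var 0))) (un (.sumR₀ [] .one .nat) (leaf .oneR))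
  | n + 1 => un (.muR [] (.sum .one (.var 0))) (un (.sumR₁ [] .one .nat) (numeral n))

/-- The numerals of the negative fragment, given by the native rules. -/
def nativeNumeral : ℕ → PTree
  | 0 => leaf .natR₀
  | n + 1 => un (.natR₁ []) (nativeNumeral n)

/-- Cut `P : N, …, N ⇒ N` against numerals: the `i`-th copy of `N` against the numeral for `v i`. -/
def apply (num : ℕ → PTree) : (k : ℕ) → (Fin k → ℕ) → PTree → PTree
  | 0, _, P => P
  | k + 1, v, P => apply num k (fun i => v i.castSucc)
      (bin (.cut [] (List.replicate k .nat) .nat .nat) (num (v (Fin.last k))) P)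

/-- `P` represents the (possibly partial) function `f`, with respect to the numerals `num`. -/
def Represents (num : ℕ → PTree) {k : ℕ} (P : PTree) (f : (Fin k → ℕ) →. ℕ) : Prop :=
  ∀ v, (∀ m ∈ f v, Reduces (apply num k v P) (num m)) ∧
    (¬ (f v).Dom → ∀ m, ¬ Reduces (apply num k v P) (num m))

/-- Representability in the circular system. -/
def Representable {k : ℕ} (f : (Fin k → ℕ) →. ℕ) : Prop :=
  ∃ P, Circular P (natSequent k) ∧ Represents numeral P f

/-- Representability in the negative fragment of the circular system. -/
def NegativelyRepresentable {k : ℕ} (f : (Fin k → ℕ) →. ℕ) : Prop :=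
  ∃ P, CircularNegative P (natSequent k) ∧ Represents nativeNumeral P f

end CircMuLJ

-- The translation is a continuation-passing (negative) translation with answer type `N`. Each type
-- `σ` receives a type `K σ` of continuations, built from `×`, `→`, `μ` and `N` only, and is
-- replaced by `C σ = K σ → N`. A sequent `Γ ⇒ τ` becomes `C Γ, K τ ⇒ N`, so the succedent moves to
-- the left. The two injections of a sum are told apart by a tag in `N`. A `ν` becomes a `μ` on the
-- side of continuations, and this is why a good `ν` on the right turns into a good `μ` on the left.
--
-- Every inference step is replaced by a finite fragment (`gadget`) whose holes stand for its
-- premisses, and the translation unfolds these fragments corecursively. There are finitely many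
-- sub-coderivations to put into the holes, so regularity survives. A thread of the original passes
-- through each gadget as a thread whose principal formulas all contain `core φ`, where `φ` is the
-- smallest formula principal infinitely often in the original thread. A good occurrence of `φ`
-- makes `core φ` principal as a `μ` on the left. Hence progress survives (`follows_gadget`,
-- `PTree.IsCoderivation.progressing_tr`).
--
-- That the translation computes the same numerals is shown without normalisation or confluence, and
-- without progress. A semantics by finite tokens, in the style of intersection types, assigns to a
-- coderivation `t` the tokens `b` it computes from token environments `e`, written `Sem t e b`. It
-- satisfies - subject expansion (`Red.sem`): a tree computes whatever its reducts compute; -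
-- adequacy (`SemN.real`): a closed coderivation that computes a token reduces to a tree of the
-- shape which the token describes. The token of a numeral determines the numeral, so reducing to a
-- numeral is the same as computing its token.
--
-- The translation is correct in both directions. If `P` computes `b`, then its translation answers
-- the continuation that asks for `b` (`SemN.tr`). Conversely, a logical relation `Resp` between
-- tokens of `C σ` and closed coderivations of `σ` shows that whatever the translation answers comes
-- from an actual reduction of `P` (`SemN.resp`).
--
-- It remains to pass between numerals and their translations. Two cyclic coderivations of the
-- negative fragment do so: `input` turns a native numeral into a computation of type `C N` by
-- recursion on the numeral, and `accept` is the continuation that counts such a computation down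
-- while counting an accumulator up. Composing them with the translation of `P` gives `negative k
-- P`, and `reduces_apply_negative` compares the two applications numeral by numeral. As this
-- comparison is an equivalence, partial functions need no separate treatment.

namespace CircMuLJ

open PTree

/-! ### Token semantics -/

/-- Finite pieces of information about the value of a coderivation. -/
inductive Tok : Type
  | one
  | fn (x y : List Tok)
  | pair (x y : List Tok)
  | inl (x : List Tok)
  | inr (x : List Tok)
  | mu (x : List Tok)
  | nu (x : List Tok)
  | zero
  | succ (x : List Tok)

/-- Environments, listed in the reverse order of antecedents. -/
abbrev Env : Type := List (List Tok)

/-- The meaning of a step, given the meanings of its premisses. -/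
def SemStep : Step → (Env → Tok → Prop) → (Env → Tok → Prop) → Env → Tok → Prop
  | .id _, _, _, e, b => ∃ a, e = [a] ∧ b ∈ a
  | .exch _ _ _ Δ _, L, _, e, b =>
      ∃ d x y g, e = d ++ x :: y :: g ∧ d.length = Δ.length ∧ L (d ++ y :: x :: g) b
  -- Only a finite list of tokens of the cut formula is passed on. Environments are reversed, so the
  -- tokens for `Δ` come before those for `Γ`, and the formula the rules act on is the head.
  | .cut _ Δ _ _, L, R, e, b =>
      ∃ d g a, e = d ++ g ∧ d.length = Δ.length ∧ (∀ x ∈ a, L g x) ∧ R (a :: d) b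
  | .wk _ _ _, L, _, e, b => ∃ a g, e = a :: g ∧ L g b
  | .ctr _ _ _, L, _, e, b => ∃ a g, e = a :: g ∧ L (a :: a :: g) b
  | .oneR, _, _, _, b => b = .one
  | .oneL _ _, L, _, e, b => ∃ a g, e = a :: g ∧ .one ∈ a ∧ L g b
  | .arrR _ _ _, L, _, e, b => ∃ x y, b = .fn x y ∧ ∀ z ∈ y, L (x :: e) z
  | .arrL _ Δ _ _ _, L, R, e, b =>
      ∃ f d g x y, e = f :: (d ++ g) ∧ d.length = Δ.length ∧ .fn x y ∈ f ∧
        (∀ z ∈ x, L g z) ∧ R (y :: d) b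
  | .prodR _ Δ _ _, L, R, e, b =>
      ∃ d g x y, e = d ++ g ∧ d.length = Δ.length ∧ b = .pair x y ∧
        (∀ z ∈ x, L g z) ∧ ∀ z ∈ y, R d z
  | .prodL _ _ _ _, L, _, e, b => ∃ a g x y, e = a :: g ∧ .pair x y ∈ a ∧ L (y :: x :: g) b
  | .sumR₀ _ _ _, L, _, e, b => ∃ x, b = .inl x ∧ ∀ z ∈ x, L e z
  | .sumR₁ _ _ _, L, _, e, b => ∃ x, b = .inr x ∧ ∀ z ∈ x, L e z
  | .sumL _ _ _ _, L, R, e, b =>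
      ∃ a g, e = a :: g ∧ ((∃ x, .inl x ∈ a ∧ L (x :: g) b) ∨ ∃ x, .inr x ∈ a ∧ R (x :: g) b)
  | .muR _ _, L, _, e, b => ∃ x, b = .mu x ∧ ∀ z ∈ x, L e z
  | .muL _ _ _, L, _, e, b => ∃ a g x, e = a :: g ∧ .mu x ∈ a ∧ L (x :: g) b
  | .nuR _ _, L, _, e, b => ∃ x, b = .nu x ∧ ∀ z ∈ x, L e z
  | .nuL _ _ _, L, _, e, b => ∃ a g x, e = a :: g ∧ .nu x ∈ a ∧ L (x :: g) b
  | .natR₀, _, _, _, b => b = .zero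
  | .natR₁ _, L, _, e, b => ∃ x, b = .succ x ∧ ∀ z ∈ x, L e z
  | .natL _ _, L, R, e, b =>
      ∃ a g, e = a :: g ∧ ((.zero ∈ a ∧ L g b) ∨ ∃ x, .succ x ∈ a ∧ R (x :: g) b)

/-- `SemN n t e b`: exploring `t` up to depth `n` shows that it computes `b` from `e`. -/
def SemN : ℕ → PTree → Env → Tok → Prop
  -- Nothing is computed at depth zero, so `Sem` is the least solution of its defining equations,
  -- and a computation that never answers yields no token.
  | 0, _, _, _ => False
  | n + 1, t, e, b => ∃ s, t [] = some s ∧ e.length = s.concl.ant.length ∧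
      SemStep s (SemN n (t.sub [false])) (SemN n (t.sub [true])) e b

/-- `Sem t e b`: the coderivation `t` computes `b` from `e`. -/
def Sem (t : PTree) (e : Env) (b : Tok) : Prop := ∃ n, SemN n t e b

theorem SemStep.mono {s : Step} {L L' R R' : Env → Tok → Prop} (hL : ∀ e b, L e b → L' e b)
    (hR : ∀ e b, R e b → R' e b) {e : Env} {b : Tok} (h : SemStep s L R e b) :
    SemStep s L' R' e b := by
  cases s <;> simp only [SemStep] at h ⊢ <;> grind

theorem SemN.succ_mono {n : ℕ} : ∀ {t : PTree} {e : Env} {b : Tok}, SemN n t e b →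
    SemN (n + 1) t e b := by
  induction n with
  | zero => intro t e b h; exact h.elim
  | succ n ih =>
    rintro t e b ⟨s, h₁, h₂, h₃⟩
    exact ⟨s, h₁, h₂, h₃.mono (fun _ _ => ih) (fun _ _ => ih)⟩

theorem SemN.mono {m n : ℕ} (hmn : m ≤ n) {t : PTree} {e : Env} {b : Tok} (h : SemN m t e b) :
    SemN n t e b := by
  induction hmn with
  | refl => exact h
  | step _ ih => exact ih.succ_mono

theorem exists_bound {P : ℕ → Tok → Prop} (hP : ∀ m n x, m ≤ n → P m x → P n x) (a : List Tok)
    (h : ∀ x ∈ a, ∃ n, P n x) : ∃ n, ∀ x ∈ a, P n x := by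
  induction a with
  | nil => exact ⟨0, by simp⟩
  | cons y a ih =>
    obtain ⟨n, hn⟩ := ih fun x hx => h x (List.mem_cons_of_mem _ hx)
    obtain ⟨m, hm⟩ := h y List.mem_cons_self
    refine ⟨max m n, fun x hx => ?_⟩
    rcases List.mem_cons.1 hx with rfl | hx
    · exact hP _ _ _ (le_max_left _ _) hm
    · exact hP _ _ _ (le_max_right _ _) (hn x hx)

/-- This is continuity: one step consults its premisses for finitely many tokens, so the depths
needed have a maximum. -/
theorem SemStep.exists_depth {s : Step} {t u : PTree} {e : Env} {b : Tok}
    (h : SemStep s (Sem t) (Sem u) e b) : ∃ n, SemStep s (SemN n t) (SemN n u) e b := by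
  have mn : ∀ {m n t e b}, m ≤ n → SemN m t e b → SemN n t e b := fun h => SemN.mono h
  have bd : ∀ {t : PTree} {e : Env} {a : List Tok}, (∀ x ∈ a, Sem t e x) →
      ∃ n, ∀ x ∈ a, SemN n t e x := fun {t e a} h =>
    exists_bound (P := fun n x => SemN n t e x) (fun _ _ _ h => mn h) a h
  cases s <;> simp only [SemStep] at h ⊢
  case id => exact ⟨0, h⟩
  case oneR => exact ⟨0, h⟩
  case natR₀ => exact ⟨0, h⟩
  case exch =>
    obtain ⟨d, x, y, g, h₁, h₂, n, h₃⟩ := h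
    exact ⟨n, d, x, y, g, h₁, h₂, h₃⟩
  case cut =>
    obtain ⟨d, g, a, h₁, h₂, h₃, n, h₄⟩ := h
    obtain ⟨m, h₃⟩ := bd h₃
    exact ⟨max m n, d, g, a, h₁, h₂, fun x hx => mn (le_max_left _ _) (h₃ x hx),
      mn (le_max_right _ _) h₄⟩
  case wk => obtain ⟨a, g, h₁, n, h₂⟩ := h; exact ⟨n, a, g, h₁, h₂⟩
  case ctr => obtain ⟨a, g, h₁, n, h₂⟩ := h; exact ⟨n, a, g, h₁, h₂⟩
  case oneL => obtain ⟨a, g, h₁, h₃, n, h₂⟩ := h; exact ⟨n, a, g, h₁, h₃, h₂⟩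
  case arrR => obtain ⟨x, y, h₁, h₂⟩ := h; obtain ⟨n, h₂⟩ := bd h₂; exact ⟨n, x, y, h₁, h₂⟩
  case arrL =>
    obtain ⟨f, d, g, x, y, h₁, h₂, h₅, h₃, n, h₄⟩ := h
    obtain ⟨m, h₃⟩ := bd h₃
    exact ⟨max m n, f, d, g, x, y, h₁, h₂, h₅, fun x hx => mn (le_max_left _ _) (h₃ x hx),
      mn (le_max_right _ _) h₄⟩
  case prodR =>
    obtain ⟨d, g, x, y, h₁, h₂, h₅, h₃, h₄⟩ := h
    obtain ⟨m, h₃⟩ := bd h₃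
    obtain ⟨n, h₄⟩ := bd h₄
    exact ⟨max m n, d, g, x, y, h₁, h₂, h₅, fun x hx => mn (le_max_left _ _) (h₃ x hx),
      fun x hx => mn (le_max_right _ _) (h₄ x hx)⟩
  case prodL => obtain ⟨a, g, x, y, h₁, h₃, n, h₂⟩ := h; exact ⟨n, a, g, x, y, h₁, h₃, h₂⟩
  case sumR₀ => obtain ⟨x, h₁, h₂⟩ := h; obtain ⟨n, h₂⟩ := bd h₂; exact ⟨n, x, h₁, h₂⟩
  case sumR₁ => obtain ⟨x, h₁, h₂⟩ := h; obtain ⟨n, h₂⟩ := bd h₂; exact ⟨n, x, h₁, h₂⟩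
  case muR => obtain ⟨x, h₁, h₂⟩ := h; obtain ⟨n, h₂⟩ := bd h₂; exact ⟨n, x, h₁, h₂⟩
  case nuR => obtain ⟨x, h₁, h₂⟩ := h; obtain ⟨n, h₂⟩ := bd h₂; exact ⟨n, x, h₁, h₂⟩
  case natR₁ => obtain ⟨x, h₁, h₂⟩ := h; obtain ⟨n, h₂⟩ := bd h₂; exact ⟨n, x, h₁, h₂⟩
  case muL => obtain ⟨a, g, x, h₁, h₃, n, h₂⟩ := h; exact ⟨n, a, g, x, h₁, h₃, h₂⟩
  case nuL => obtain ⟨a, g, x, h₁, h₃, n, h₂⟩ := h; exact ⟨n, a, g, x, h₁, h₃, h₂⟩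
  case sumL =>
    obtain ⟨a, g, h₁, ⟨x, h₂, n, h₃⟩ | ⟨x, h₂, n, h₃⟩⟩ := h
    · exact ⟨n, a, g, h₁, .inl ⟨x, h₂, h₃⟩⟩
    · exact ⟨n, a, g, h₁, .inr ⟨x, h₂, h₃⟩⟩
  case natL =>
    obtain ⟨a, g, h₁, ⟨h₂, n, h₃⟩ | ⟨x, h₂, n, h₃⟩⟩ := h
    · exact ⟨n, a, g, h₁, .inl ⟨h₂, h₃⟩⟩
    · exact ⟨n, a, g, h₁, .inr ⟨x, h₂, h₃⟩⟩

/-- The fixed point equation of the semantics. Continuity is what makes the union over all depths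
closed under steps. -/
theorem sem_iff {t : PTree} {e : Env} {b : Tok} :
    Sem t e b ↔ ∃ s, t [] = some s ∧ e.length = s.concl.ant.length ∧
      SemStep s (Sem (t.sub [false])) (Sem (t.sub [true])) e b := by
  constructor
  · rintro ⟨_ | n, h⟩
    · exact h.elim
    · obtain ⟨s, h₁, h₂, h₃⟩ := h
      exact ⟨s, h₁, h₂, h₃.mono (fun _ _ h => ⟨n, h⟩) (fun _ _ h => ⟨n, h⟩)⟩
  · rintro ⟨s, h₁, h₂, h₃⟩
    obtain ⟨n, h₃⟩ := h₃.exists_depth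
    exact ⟨n + 1, s, h₁, h₂, h₃⟩

theorem sem_un {s : Step} {t : PTree} {e : Env} {b : Tok} :
    Sem (un s t) e b ↔ e.length = s.concl.ant.length ∧
      SemStep s (Sem t) (Sem fun _ => none) e b := by
  rw [sem_iff]
  have h₀ : (un s t).sub [false] = t := rfl
  have h₁ : (un s t).sub [true] = fun _ => none := rfl
  have h₂ : un s t [] = some s := rfl
  simp [h₀, h₁, h₂]

theorem sem_bin {s : Step} {t u : PTree} {e : Env} {b : Tok} :
    Sem (bin s t u) e b ↔ e.length = s.concl.ant.length ∧ SemStep s (Sem t) (Sem u) e b := by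
  rw [sem_iff]
  have h₀ : (bin s t u).sub [false] = t := rfl
  have h₁ : (bin s t u).sub [true] = u := rfl
  have h₂ : bin s t u [] = some s := rfl
  simp [h₀, h₁, h₂]

theorem sem_leaf {s : Step} {e : Env} {b : Tok} :
    Sem (leaf s) e b ↔ e.length = s.concl.ant.length ∧
      SemStep s (Sem fun _ => none) (Sem fun _ => none) e b := by
  rw [sem_iff]
  have h₀ : (leaf s).sub [false] = fun _ => none := rfl
  have h₁ : (leaf s).sub [true] = fun _ => none := rfl
  have h₂ : leaf s [] = some s := rfl
  simp [h₀, h₁, h₂]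

theorem Sem.length {t : PTree} {S : Sequent} (hS : t.concl = some S) {e : Env} {b : Tok}
    (h : Sem t e b) : e.length = S.ant.length := by
  obtain ⟨s, h₁, h₂, -⟩ := sem_iff.1 h
  simp only [PTree.concl, h₁, Option.map_some, Option.some.injEq] at hS
  rw [h₂, hS]

/-- Pointwise inclusion of environments. -/
abbrev Env.Le : Env → Env → Prop := List.Forall₂ (· ⊆ ·)

theorem Env.Le.refl (e : Env) : Env.Le e e := List.forall₂_same.2 fun _ _ => List.Subset.refl _

theorem SemStep.mono_env {s : Step} {L R : Env → Tok → Prop}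
    (hL : ∀ e e' b, Env.Le e e' → L e b → L e' b)
    (hR : ∀ e e' b, Env.Le e e' → R e b → R e' b) {e e' : Env} {b : Tok} (he : Env.Le e e')
    (h : SemStep s L R e b) : SemStep s L R e' b := by
  -- An enlarged environment splits at the same place as the original one.
  have app : ∀ {d g e' : Env}, Env.Le (d ++ g) e' →
      ∃ d' g', e' = d' ++ g' ∧ Env.Le d d' ∧ Env.Le g g' := by
    intro d
    induction d with
    | nil => exact fun h => ⟨[], _, rfl, .nil, h⟩
    | cons a d ih =>
      intro g e' h
      obtain ⟨a', e', h₁, h₂, rfl⟩ := List.forall₂_cons_left_iff.1 h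
      obtain ⟨d', g', rfl, h₃, h₄⟩ := ih h₂
      exact ⟨a' :: d', g', rfl, .cons h₁ h₃, h₄⟩
  cases s <;> simp only [SemStep] at h ⊢
  case id =>
    obtain ⟨a, rfl, h⟩ := h
    obtain ⟨a', _, h₁, h₂, rfl⟩ := List.forall₂_cons_left_iff.1 he
    cases h₂
    exact ⟨a', rfl, h₁ h⟩
  case oneR => exact h
  case natR₀ => exact h
  case exch =>
    obtain ⟨d, x, y, g, rfl, h₂, h₃⟩ := h
    obtain ⟨d', _, rfl, h₄, h₅⟩ := app he
    obtain ⟨x', _, h₆, h₇, rfl⟩ := List.forall₂_cons_left_iff.1 h₅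
    obtain ⟨y', g', h₈, h₉, rfl⟩ := List.forall₂_cons_left_iff.1 h₇
    exact ⟨d', x', y', g', rfl, h₄.length_eq.symm.trans h₂,
      hL _ _ _ (List.rel_append h₄ (.cons h₈ (.cons h₆ h₉))) h₃⟩
  case cut =>
    obtain ⟨d, g, a, rfl, h₂, h₃, h₄⟩ := h
    obtain ⟨d', g', rfl, h₅, h₆⟩ := app he
    exact ⟨d', g', a, rfl, h₅.length_eq.symm.trans h₂, fun x hx => hL _ _ _ h₆ (h₃ x hx),
      hR _ _ _ (.cons (List.Subset.refl _) h₅) h₄⟩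
  case arrL =>
    obtain ⟨f, d, g, x, y, rfl, h₂, h₃, h₄, h₇⟩ := h
    obtain ⟨f', _, h₈, h₉, rfl⟩ := List.forall₂_cons_left_iff.1 he
    obtain ⟨d', g', rfl, h₅, h₆⟩ := app h₉
    exact ⟨f', d', g', x, y, rfl, h₅.length_eq.symm.trans h₂, h₈ h₃,
      fun x hx => hL _ _ _ h₆ (h₄ x hx), hR _ _ _ (.cons (List.Subset.refl _) h₅) h₇⟩
  case prodR =>
    obtain ⟨d, g, x, y, rfl, h₂, h₃, h₄, h₇⟩ := h
    obtain ⟨d', g', rfl, h₅, h₆⟩ := app he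
    exact ⟨d', g', x, y, rfl, h₅.length_eq.symm.trans h₂, h₃,
      fun x hx => hL _ _ _ h₆ (h₄ x hx), fun x hx => hR _ _ _ h₅ (h₇ x hx)⟩
  case arrR =>
    obtain ⟨x, y, h₁, h₂⟩ := h
    exact ⟨x, y, h₁, fun z hz => hL _ _ _ (.cons (List.Subset.refl _) he) (h₂ z hz)⟩
  case sumR₀ => obtain ⟨x, h₁, h₂⟩ := h; exact ⟨x, h₁, fun z hz => hL _ _ _ he (h₂ z hz)⟩
  case sumR₁ => obtain ⟨x, h₁, h₂⟩ := h; exact ⟨x, h₁, fun z hz => hL _ _ _ he (h₂ z hz)⟩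
  case muR => obtain ⟨x, h₁, h₂⟩ := h; exact ⟨x, h₁, fun z hz => hL _ _ _ he (h₂ z hz)⟩
  case nuR => obtain ⟨x, h₁, h₂⟩ := h; exact ⟨x, h₁, fun z hz => hL _ _ _ he (h₂ z hz)⟩
  case natR₁ => obtain ⟨x, h₁, h₂⟩ := h; exact ⟨x, h₁, fun z hz => hL _ _ _ he (h₂ z hz)⟩
  all_goals
    obtain ⟨a, g, h⟩ := h
    have he₀ := he
    obtain ⟨rfl⟩ : e = a :: g := by first | exact h.1 | (obtain ⟨x, h, -⟩ := h; exact h) |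
      (obtain ⟨x, y, h, -⟩ := h; exact h)
    obtain ⟨a', g', h₅, h₆, rfl⟩ := List.forall₂_cons_left_iff.1 he₀
  case wk => exact ⟨a', g', rfl, hL _ _ _ h₆ h.2⟩
  case ctr => exact ⟨a', g', rfl, hL _ _ _ (.cons h₅ (.cons h₅ h₆)) h.2⟩
  case oneL => exact ⟨a', g', rfl, h₅ h.2.1, hL _ _ _ h₆ h.2.2⟩
  case prodL =>
    obtain ⟨x, y, h₁, h₂, h₃⟩ := h
    exact ⟨a', g', x, y, rfl, h₅ h₂,
      hL _ _ _ (.cons (List.Subset.refl _) (.cons (List.Subset.refl _) h₆)) h₃⟩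
  case muL =>
    obtain ⟨x, h₁, h₂, h₃⟩ := h
    exact ⟨a', g', x, rfl, h₅ h₂, hL _ _ _ (.cons (List.Subset.refl _) h₆) h₃⟩
  case nuL =>
    obtain ⟨x, h₁, h₂, h₃⟩ := h
    exact ⟨a', g', x, rfl, h₅ h₂, hL _ _ _ (.cons (List.Subset.refl _) h₆) h₃⟩
  case sumL =>
    obtain ⟨-, ⟨x, h₂, h₃⟩ | ⟨x, h₂, h₃⟩⟩ := h
    · exact ⟨a', g', rfl, .inl ⟨x, h₅ h₂, hL _ _ _ (.cons (List.Subset.refl _) h₆) h₃⟩⟩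
    · exact ⟨a', g', rfl, .inr ⟨x, h₅ h₂, hR _ _ _ (.cons (List.Subset.refl _) h₆) h₃⟩⟩
  case natL =>
    obtain ⟨-, ⟨h₂, h₃⟩ | ⟨x, h₂, h₃⟩⟩ := h
    · exact ⟨a', g', rfl, .inl ⟨h₅ h₂, hL _ _ _ h₆ h₃⟩⟩
    · exact ⟨a', g', rfl, .inr ⟨x, h₅ h₂, hR _ _ _ (.cons (List.Subset.refl _) h₆) h₃⟩⟩

/-- Lists of tokens count as finite sets of information. This is what allows separately found lists
to be merged by concatenation. -/
theorem Sem.mono_env {t : PTree} {e e' : Env} {b : Tok} (he : Env.Le e e') (h : Sem t e b) :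
    Sem t e' b := by
  obtain ⟨n, h⟩ := h
  refine ⟨n, ?_⟩
  induction n generalizing t e e' b with
  | zero => exact h
  | succ n ih =>
    obtain ⟨s, h₁, h₂, h₃⟩ := h
    exact ⟨s, h₁, he.length_eq.symm.trans h₂,
      SemStep.mono_env (L := SemN n (t.sub [false])) (R := SemN n (t.sub [true]))
        (fun _ _ _ he h => ih he h) (fun _ _ _ he h => ih he h) he h₃⟩

/-! ### Subject expansion -/

theorem map_getD_range' {A B C : Env} {s n : ℕ} (hA : A.length = s) (hB : B.length = n) :
    (List.range' s n).map (fun i => (A ++ B ++ C).getD i []) = B := by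
  subst hA hB
  apply List.ext_getElem
  · simp
  · intro i h₁ h₂
    simp [List.getElem?_append, h₂]

theorem map_getD_range {A C : Env} {n : ℕ} (hA : A.length = n) :
    (List.range n).map (fun i => (A ++ C).getD i []) = A := by
  rw [List.range_eq_range']
  exact map_getD_range' (A := []) rfl hA

theorem exists_eq_append {l : Env} {m n : ℕ} (h : l.length = m + n) :
    ∃ a b, l = a ++ b ∧ a.length = m ∧ b.length = n :=
  ⟨l.take m, l.drop m, (List.take_append_drop m l).symm, by simp [h], by simp [h]⟩

/-- The reversals appear because `p` counts positions in antecedents, while environments list them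
backwards. Only `p` matters, so two sequences of exchanges for the same permutation have the same
meaning. -/
theorem Exs.sem {p : List ℕ} {t u : PTree} (h : Exs p t u) : ∀ {e : Env} {b : Tok},
    Sem u e b ↔ ∃ e' : Env, e'.length = p.length ∧
      e.reverse = p.map (fun i => e'.reverse.getD i []) ∧ Sem t e' b := by
  induction h with
  | @nil t S hS =>
    intro e b
    have key : ∀ {e' : Env}, e'.length = S.ant.length →
        (List.range S.ant.length).map (fun i => e'.reverse.getD i []) = e'.reverse := by
      intro e' he'
      simpa using map_getD_range (A := e'.reverse) (C := []) (n := S.ant.length) (by simpa using he')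
    constructor
    · intro h
      have := h.length hS
      exact ⟨e, by simpa using this, (key this).symm, h⟩
    · rintro ⟨e', h₁, h₂, h₃⟩
      rw [key (h₃.length hS)] at h₂
      rwa [List.reverse_injective h₂]
  | @step t u a c i j Γ Δ σ τ γ h hu ha ih =>
    intro e b
    rw [sem_un]
    constructor
    · rintro ⟨-, d, x, y, g, rfl, hd, h⟩
      have hl := h.length hu
      obtain ⟨e', h₁, h₂, h₃⟩ := ih.1 h
      refine ⟨e', by simpa using h₁, ?_, h₃⟩
      simp only [List.reverse_append, List.reverse_cons, List.append_assoc, List.map_append,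
        List.map_cons, List.cons_append, List.nil_append] at h₂ ⊢
      obtain ⟨h₄, h₅⟩ := List.append_inj h₂ (by simp at hl ⊢; omega)
      simp only [List.cons.injEq] at h₅
      rw [h₄, h₅.1, h₅.2.1, h₅.2.2]
    · rintro ⟨e', h₁, h₂, h₃⟩
      have hs : Sem u (c.reverse.map (fun i => e'.reverse.getD i []) ++ e'.reverse.getD j [] ::
          e'.reverse.getD i [] :: a.reverse.map (fun i => e'.reverse.getD i [])) b :=
        ih.2 ⟨e', by simpa using h₁, by simp, h₃⟩
      have hl := hs.length hu
      have he : e = c.reverse.map (fun i => e'.reverse.getD i []) ++ e'.reverse.getD i [] ::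
          e'.reverse.getD j [] :: a.reverse.map (fun i => e'.reverse.getD i []) := by
        apply List.reverse_injective
        rw [h₂]
        simp
      simp only [List.length_append, List.length_map, List.length_reverse, List.length_cons] at hl
      refine ⟨by simp [he, Step.concl]; omega, _, _, _, _, he, by simp; omega, hs⟩

/-- The exchanges around the cut only move blocks of the environment. With them absorbed here, each
cut reduction can be treated as if cuts were allowed at any position. -/
theorem InCut.sem {Γ Δ₁ Δ₂ : List Ty} {σ τ : Ty} {A B Q : PTree} (h : InCut Γ Δ₁ Δ₂ σ τ A B Q)
    {e : Env} {b : Tok} :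
    Sem Q e b ↔ ∃ d₂ g d₁ a, e = d₂ ++ (g ++ d₁) ∧ d₂.length = Δ₂.length ∧ g.length = Γ.length ∧
      d₁.length = Δ₁.length ∧ (∀ x ∈ a, Sem A g x) ∧ Sem B (d₂ ++ a :: d₁) b := by
  obtain ⟨hA, hB, h₁, h₂⟩ := h
  -- The exchanges above the cut move the cut formula to the end; `perm₂` treats those below it,
  -- which put `Γ` between `Δ₁` and `Δ₂`.
  have perm₁ : ∀ {D₁ D₂ : Env} {a : List Tok}, D₁.length = Δ₁.length → D₂.length = Δ₂.length →
      (List.range Δ₁.length ++ List.range' (Δ₁.length + 1) Δ₂.length ++ [Δ₁.length]).map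
        (fun i => (D₁ ++ a :: D₂).getD i []) = D₁ ++ D₂ ++ [a] := by
    intro D₁ D₂ a h h'
    have e₁ := map_getD_range (C := a :: D₂) h
    have e₂ := map_getD_range' (A := D₁ ++ [a]) (B := D₂) (C := []) (s := Δ₁.length + 1)
      (by simp [h]) h'
    have e₃ := map_getD_range' (A := D₁) (B := [a]) (C := D₂) h rfl
    simp only [List.append_assoc, List.append_nil, List.cons_append, List.nil_append,
      List.length_singleton, List.range'_one] at e₂ e₃
    rw [List.map_append, List.map_append, e₁, e₂, e₃]
  have perm₂ : ∀ {G D₁ D₂ : Env}, G.length = Γ.length → D₁.length = Δ₁.length →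
      D₂.length = Δ₂.length →
      (List.range' Γ.length Δ₁.length ++ List.range Γ.length ++
        List.range' (Γ.length + Δ₁.length) Δ₂.length).map
        (fun i => (G ++ D₁ ++ D₂).getD i []) = D₁ ++ G ++ D₂ := by
    intro G D₁ D₂ h h' h''
    have e₁ := map_getD_range (C := D₁ ++ D₂) h
    have e₂ := map_getD_range' (A := G) (B := D₁) (C := D₂) h h'
    have e₃ := map_getD_range' (A := G ++ D₁) (B := D₂) (C := []) (s := Γ.length + Δ₁.length)
      (by simp [h, h']) h''
    simp only [List.append_nil] at e₃
    rw [← List.append_assoc] at e₁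
    rw [List.map_append, List.map_append, e₁, e₂, e₃]
  constructor
  · intro h
    obtain ⟨e', hl, he, h⟩ := h₂.sem.1 h
    rw [sem_bin] at h
    obtain ⟨-, d, g, a, rfl, hd, ha, h⟩ := h
    obtain ⟨f, hf, hf', h⟩ := h₁.sem.1 h
    simp only [List.length_append, List.length_range', List.length_range, List.length_singleton]
      at hl hf hd
    obtain ⟨d₂, d₁, rfl, hd₂, hd₁⟩ := exists_eq_append (l := d) (m := Δ₂.length)
      (n := Δ₁.length) (by omega)
    simp only [List.length_append] at hl
    obtain ⟨f₂, f', rfl, hf₂, hf₁⟩ := exists_eq_append (l := f) (m := Δ₂.length)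
      (n := 1 + Δ₁.length) (by omega)
    obtain ⟨a', f₁, rfl⟩ := List.exists_cons_of_ne_nil (l := f') (by rintro rfl; simp at hf₁; omega)
    simp only [List.length_cons] at hf₁
    have e₁ := perm₁ (D₁ := f₁.reverse) (D₂ := f₂.reverse) (a := a') (by simp; omega) (by simp [hf₂])
    simp only [List.reverse_append, List.reverse_cons, List.append_assoc, List.cons_append,
      List.nil_append] at hf' e₁
    rw [e₁, ← List.append_assoc, ← List.append_assoc] at hf'
    obtain ⟨hf', h₀⟩ := List.append_inj' hf' rfl
    obtain ⟨h₄, h₅⟩ := List.append_inj hf' (by simp; omega)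
    obtain rfl := List.reverse_injective h₄
    obtain rfl := List.reverse_injective h₅
    simp only [List.cons.injEq, and_true] at h₀
    subst h₀
    have e₂ := perm₂ (G := g.reverse) (D₁ := d₁.reverse) (D₂ := d₂.reverse) (by simp; omega)
      (by simp [hd₁]) (by simp [hd₂])
    simp only [List.reverse_append, ← List.append_assoc] at he
    rw [e₂] at he
    refine ⟨d₂, g, d₁, a, List.reverse_injective (by simp [he]), hd₂, by omega, hd₁, ha, h⟩
  · rintro ⟨d₂, g, d₁, a, rfl, hd₂, hg, hd₁, ha, h⟩
    refine h₂.sem.2 ⟨(d₂ ++ d₁) ++ g, by simp; omega, ?_, ?_⟩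
    · have e₂ := perm₂ (G := g.reverse) (D₁ := d₁.reverse) (D₂ := d₂.reverse) (by simp; omega)
        (by simp [hd₁]) (by simp [hd₂])
      simp only [List.reverse_append, ← List.append_assoc]
      rw [e₂]
    · rw [sem_bin]
      refine ⟨by simp [Step.concl]; omega, _, _, a, rfl, by simp; omega, ha, ?_⟩
      refine h₁.sem.2 ⟨_, ?_, ?_, h⟩
      · simp; omega
      · have e₁ := perm₁ (D₁ := d₁.reverse) (D₂ := d₂.reverse) (a := a) (by simp; omega)
          (by simp [hd₂])
        simp only [List.reverse_append, List.reverse_cons, List.append_assoc, List.cons_append,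
          List.nil_append] at e₁ ⊢
        rw [e₁]

/-- Each of finitely many tokens may need its own information about the cut formula; the
concatenation serves all of them at once. -/
theorem exists_common {P : List Tok → Tok → Prop} {G : Tok → Prop}
    (hP : ∀ a a' z, a ⊆ a' → P a z → P a' z) {y : List Tok}
    (h : ∀ z ∈ y, ∃ a, (∀ x ∈ a, G x) ∧ P a z) : ∃ a, (∀ x ∈ a, G x) ∧ ∀ z ∈ y, P a z := by
  induction y with
  | nil => exact ⟨[], by simp⟩
  | cons w y ih =>
    obtain ⟨a, h₁, h₂⟩ := ih fun z hz => h z (List.mem_cons_of_mem _ hz)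
    obtain ⟨a', h₃, h₄⟩ := h w List.mem_cons_self
    refine ⟨a ++ a', fun x hx => (List.mem_append.1 hx).elim (h₁ x) (h₃ x), fun z hz => ?_⟩
    rcases List.mem_cons.1 hz with rfl | hz
    · exact hP _ _ _ (List.subset_append_right _ _) h₄
    · exact hP _ _ _ (List.subset_append_left _ _) (h₂ z hz)

/-- Needed when a cut is pulled below a rule that demands a whole list of tokens from its premiss:
many uses of the commuted cut must come from one use of the original cut. -/
theorem InCut.sem_list {Γ Δ₁ Δ₂ : List Ty} {σ τ : Ty} {A B Q : PTree}
    (h : InCut Γ Δ₁ Δ₂ σ τ A B Q) {d₁ g d₂ : Env} (h₂ : d₂.length = Δ₂.length)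
    (hg : g.length = Γ.length) {y : List Tok} (hy : ∀ z ∈ y, Sem Q (d₂ ++ (g ++ d₁)) z) :
    ∃ a, (∀ x ∈ a, Sem A g x) ∧ ∀ z ∈ y, Sem B (d₂ ++ a :: d₁) z := by
  refine exists_common (P := fun a z => Sem B (d₂ ++ a :: d₁) z) ?_ fun z hz => ?_
  · exact fun a a' z ha h => h.mono_env (List.rel_append (Env.Le.refl _) (.cons ha (Env.Le.refl _)))
  · obtain ⟨d₂', g', d₁', a, h₁, h₃, h₄, h₅, h₆, h₇⟩ := h.sem.1 (hy z hz)
    obtain ⟨rfl, h₈⟩ := List.append_inj h₁ (h₂.trans h₃.symm)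
    obtain ⟨rfl, rfl⟩ := List.append_inj h₈ (hg.trans h₄.symm)
    exact ⟨a, h₆, h₇⟩

theorem sem_weaken {τ : Ty} {Γ : List Ty} : ∀ {Δ : List Ty} {B : PTree} {e : Env} {b : Tok},
    Sem (weaken τ Γ Δ B) e b → ∃ g d, e = g ++ d ∧ g.length = Γ.length ∧ Sem B d b := by
  induction Γ with
  | nil => intro Δ B e b h; exact ⟨[], e, rfl, rfl, h⟩
  | cons γ Γ ih =>
    intro Δ B e b h
    obtain ⟨g, d, rfl, hg, h⟩ := ih h
    rw [sem_un] at h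
    obtain ⟨-, a, d', rfl, h'⟩ := h
    exact ⟨g ++ [a], d', by simp, by simp [hg], h'⟩

theorem Contract.sem {τ : Ty} {Γ Δ : List Ty} {t u : PTree} (h : Contract τ Γ Δ t u) :
    ∀ {e : Env} {b : Tok}, Sem u e b →
      ∃ g d, e = g ++ d ∧ g.length = Γ.length ∧ Sem t (g ++ (g ++ d)) b := by
  induction h with
  | nil => intro e b h; exact ⟨[], e, rfl, rfl, h⟩
  | @cons γ Γ Δ t t₁ t₂ u h₁ h₂ h ih =>
    intro e b hu
    obtain ⟨g, d, rfl, hg, hs⟩ := ih hu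
    obtain ⟨f, hf, hf', hs⟩ := h₂.sem.1 hs
    rw [sem_un] at hs
    obtain ⟨-, a, f, rfl, hs⟩ := hs
    simp only [List.length_append, List.length_range', List.length_range,
      List.length_cons, List.length_nil] at hf
    obtain ⟨f₂, f₁, rfl, hf₂, hf₁⟩ := exists_eq_append (l := f) (m := Γ.length + Γ.length)
      (n := Δ.length) (by omega)
    obtain ⟨f₃, f₂, rfl, hf₃, hf₂'⟩ := exists_eq_append hf₂
    -- The blocks of the permutation are read off one at a time: here for the exchanges after the
    -- contraction, further down for those before it.
    have e₁ := map_getD_range (A := f₁.reverse) (C := f₂.reverse ++ f₃.reverse ++ [a])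
      (n := Δ.length) (by simp [hf₁])
    have e₂ := map_getD_range' (A := f₁.reverse ++ f₂.reverse ++ f₃.reverse) (B := [a]) (C := [])
      (s := Δ.length + Γ.length + Γ.length) (by simp; omega) rfl
    have e₃ := map_getD_range' (A := f₁.reverse) (B := f₂.reverse ++ f₃.reverse) (C := [a])
      (s := Δ.length) (n := Γ.length + Γ.length) (by simp [hf₁]) (by simp; omega)
    simp only [List.length_singleton, List.range'_one, List.append_nil, List.append_assoc]
      at e₁ e₂ e₃
    simp only [List.map_cons, List.map_nil, List.cons.injEq, and_true] at e₂
    simp only [List.reverse_append, List.reverse_cons, List.append_assoc, List.map_append,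
      e₁, e₂, e₃, List.map_cons, List.cons_append, List.nil_append] at hf'
    have hl := congrArg List.length hf'
    simp only [List.length_append, List.length_reverse, List.length_cons] at hl
    obtain ⟨d', d₁, rfl, hd', hd₁⟩ := exists_eq_append (l := d) (m := 1) (n := Δ.length) (by omega)
    obtain ⟨a', rfl⟩ := List.length_eq_one_iff.1 hd'
    simp only [List.cons_append, List.reverse_cons, List.append_assoc, List.nil_append] at hf'
    obtain ⟨h₃, h₄⟩ := List.append_inj hf' (by simp; omega)
    simp only [List.cons.injEq] at h₄
    obtain ⟨rfl, h₄⟩ := h₄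
    obtain ⟨h₅, h₆⟩ := List.append_inj h₄ (by simp; omega)
    obtain rfl := List.reverse_injective h₃
    obtain rfl := List.reverse_injective h₅
    obtain rfl := List.reverse_injective h₆
    obtain ⟨f, hf, hf', hs⟩ := h₁.sem.1 hs
    simp only [List.length_append, List.length_range', List.length_range, List.length_cons, List.length_nil] at hf
    obtain ⟨f₂, f, rfl, hf₂, hf₁⟩ := exists_eq_append (l := f) (m := Γ.length)
      (n := Δ.length + Γ.length + 2) (by omega)
    obtain ⟨f', f, rfl, hf'₁, hf₅⟩ := exists_eq_append (l := f) (m := 1)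
      (n := Γ.length + (Δ.length + 1)) (by omega)
    obtain ⟨b', rfl⟩ := List.length_eq_one_iff.1 hf'₁
    obtain ⟨f₃, f, rfl, hf₃', hf₆⟩ := exists_eq_append hf₅
    obtain ⟨f', f₄, rfl, hf'₁, hf₄⟩ := exists_eq_append (l := f) (m := 1) (n := Δ.length) (by omega)
    obtain ⟨c', rfl⟩ := List.length_eq_one_iff.1 hf'₁
    have e₁ := map_getD_range (A := f₄.reverse)
      (C := c' :: (f₃.reverse ++ b' :: f₂.reverse)) (n := Δ.length) (by simp [hf₄])
    have e₂ := map_getD_range' (A := f₄.reverse ++ [c']) (B := f₃.reverse)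
      (C := b' :: f₂.reverse) (s := Δ.length + 1) (n := Γ.length) (by simp; omega) (by simp; omega)
    have e₃ := map_getD_range' (A := f₄.reverse ++ [c'] ++ f₃.reverse ++ [b']) (B := f₂.reverse)
      (C := []) (s := Δ.length + Γ.length + 2) (n := Γ.length) (by simp; omega) (by simp; omega)
    have e₄ := map_getD_range' (A := f₄.reverse) (B := [c']) (C := f₃.reverse ++ b' :: f₂.reverse)
      (s := Δ.length) (by simp; omega) rfl
    have e₅ := map_getD_range' (A := f₄.reverse ++ [c'] ++ f₃.reverse) (B := [b'])
      (C := f₂.reverse) (s := Δ.length + Γ.length + 1) (by simp; omega) rfl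
    simp only [List.length_singleton, List.range'_one, List.append_nil, List.append_assoc,
      List.cons_append, List.nil_append, List.map_cons, List.map_nil] at e₁ e₂ e₃ e₄ e₅
    simp only [List.cons.injEq, and_true] at e₄ e₅
    simp only [List.reverse_append, List.reverse_cons, List.append_assoc, List.map_append,
      List.cons_append, List.nil_append, List.map_cons, List.map_nil,
      e₁, e₂, e₃, e₄, e₅] at hf'
    obtain ⟨h₃, h₄⟩ := List.append_inj hf' (by simp; omega)
    obtain ⟨h₅, h₆⟩ := List.append_inj h₄ (by simp; omega)
    obtain ⟨h₇, h₈⟩ := List.append_inj h₆ (by simp; omega)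
    obtain rfl := List.reverse_injective h₃
    obtain rfl := List.reverse_injective h₅
    obtain rfl := List.reverse_injective h₇
    simp only [List.cons.injEq, and_true] at h₈
    obtain ⟨rfl, rfl⟩ := h₈
    exact ⟨g ++ [a'], d₁, by simp, by simp [hg], by simpa using hs⟩

/-- A left rule rewrites only the block of the environment for its active formulas, by a relation
`T` independent of the context. Commuting cuts is then checked once per schema; the next three
lemmas do the same for the other schemata. -/
theorem UnaryLeft.sem {R : List Ty → Ty → Step} {Φ Φ' : List Ty} (h : UnaryLeft R Φ Φ') :
    (∀ Θ γ, (R Θ γ).concl = ⟨Θ ++ Φ, γ⟩) ∧ ∃ T : Env → Env → Prop,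
      (∀ f f', T f f' → f.length = Φ.length ∧ f'.length = Φ'.length) ∧
      ∀ Θ γ L M e b, SemStep (R Θ γ) L M e b ↔ ∃ f f' g, e = f ++ g ∧ T f f' ∧ L (f' ++ g) b := by
  refine ⟨by cases h <;> intros <;> rfl, ?_⟩
  cases h
  case wk =>
    refine ⟨fun f f' => ∃ a, f = [a] ∧ f' = [], by grind, fun Θ γ L M e b => ⟨?_, ?_⟩⟩
    · rintro ⟨a, g, rfl, h⟩
      exact ⟨[a], [], g, rfl, ⟨a, rfl, rfl⟩, h⟩
    · rintro ⟨_, _, g, rfl, ⟨a, rfl, rfl⟩, h⟩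
      exact ⟨a, g, rfl, h⟩
  case ctr =>
    refine ⟨fun f f' => ∃ a, f = [a] ∧ f' = [a, a], by grind, fun Θ γ L M e b => ⟨?_, ?_⟩⟩
    · rintro ⟨a, g, rfl, h⟩
      exact ⟨[a], [a, a], g, rfl, ⟨a, rfl, rfl⟩, h⟩
    · rintro ⟨_, _, g, rfl, ⟨a, rfl, rfl⟩, h⟩
      exact ⟨a, g, rfl, h⟩
  case oneL =>
    refine ⟨fun f f' => ∃ a, f = [a] ∧ .one ∈ a ∧ f' = [], by grind,
      fun Θ γ L M e b => ⟨?_, ?_⟩⟩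
    · rintro ⟨a, g, rfl, h₀, h⟩
      exact ⟨[a], [], g, rfl, ⟨a, rfl, h₀, rfl⟩, h⟩
    · rintro ⟨_, _, g, rfl, ⟨a, rfl, h₀, rfl⟩, h⟩
      exact ⟨a, g, rfl, h₀, h⟩
  case prodL =>
    refine ⟨fun f f' => ∃ a x y, f = [a] ∧ .pair x y ∈ a ∧ f' = [y, x], by grind,
      fun Θ γ L M e b => ⟨?_, ?_⟩⟩
    · rintro ⟨a, g, x, y, rfl, h₀, h⟩
      exact ⟨[a], [y, x], g, rfl, ⟨a, x, y, rfl, h₀, rfl⟩, h⟩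
    · rintro ⟨_, _, g, rfl, ⟨a, x, y, rfl, h₀, rfl⟩, h⟩
      exact ⟨a, g, x, y, rfl, h₀, h⟩
  case muL =>
    refine ⟨fun f f' => ∃ a x, f = [a] ∧ .mu x ∈ a ∧ f' = [x], by grind,
      fun Θ γ L M e b => ⟨?_, ?_⟩⟩
    · rintro ⟨a, g, x, rfl, h₀, h⟩
      exact ⟨[a], [x], g, rfl, ⟨a, x, rfl, h₀, rfl⟩, h⟩
    · rintro ⟨_, _, g, rfl, ⟨a, x, rfl, h₀, rfl⟩, h⟩
      exact ⟨a, g, x, rfl, h₀, h⟩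
  case nuL =>
    refine ⟨fun f f' => ∃ a x, f = [a] ∧ .nu x ∈ a ∧ f' = [x], by grind,
      fun Θ γ L M e b => ⟨?_, ?_⟩⟩
    · rintro ⟨a, g, x, rfl, h₀, h⟩
      exact ⟨[a], [x], g, rfl, ⟨a, x, rfl, h₀, rfl⟩, h⟩
    · rintro ⟨_, _, g, rfl, ⟨a, x, rfl, h₀, rfl⟩, h⟩
      exact ⟨a, g, x, rfl, h₀, h⟩

theorem UnaryRight.sem {R : List Ty → Step} {Φ' : List Ty} {γ γ' : Ty}
    (h : UnaryRight R Φ' γ γ') :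
    (∀ Θ, (R Θ).concl = ⟨Θ, γ⟩) ∧ ∃ T : Env → List Tok → Tok → Prop,
      (∀ f y b, T f y b → f.length = Φ'.length) ∧
      ∀ Θ L M e b, SemStep (R Θ) L M e b ↔ ∃ f y, T f y b ∧ ∀ z ∈ y, L (f ++ e) z := by
  refine ⟨by cases h <;> intros <;> rfl, ?_⟩
  cases h
  case arrR =>
    refine ⟨fun f y b => ∃ x, f = [x] ∧ b = .fn x y, by grind, fun Θ L M e b => ⟨?_, ?_⟩⟩
    · rintro ⟨x, y, rfl, h⟩
      exact ⟨[x], y, ⟨x, rfl, rfl⟩, h⟩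
    · rintro ⟨_, y, ⟨x, rfl, rfl⟩, h⟩
      exact ⟨x, y, rfl, h⟩
  case sumR₀ =>
    exact ⟨fun f y b => f = [] ∧ b = .inl y, by grind, fun Θ L M e b =>
      ⟨fun ⟨y, h, h'⟩ => ⟨[], y, ⟨rfl, h⟩, h'⟩, fun ⟨_, y, ⟨h, h'⟩, h''⟩ => ⟨y, h', by subst h; exact h''⟩⟩⟩
  case sumR₁ =>
    exact ⟨fun f y b => f = [] ∧ b = .inr y, by grind, fun Θ L M e b =>
      ⟨fun ⟨y, h, h'⟩ => ⟨[], y, ⟨rfl, h⟩, h'⟩, fun ⟨_, y, ⟨h, h'⟩, h''⟩ => ⟨y, h', by subst h; exact h''⟩⟩⟩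
  case muR =>
    exact ⟨fun f y b => f = [] ∧ b = .mu y, by grind, fun Θ L M e b =>
      ⟨fun ⟨y, h, h'⟩ => ⟨[], y, ⟨rfl, h⟩, h'⟩, fun ⟨_, y, ⟨h, h'⟩, h''⟩ => ⟨y, h', by subst h; exact h''⟩⟩⟩
  case nuR =>
    exact ⟨fun f y b => f = [] ∧ b = .nu y, by grind, fun Θ L M e b =>
      ⟨fun ⟨y, h, h'⟩ => ⟨[], y, ⟨rfl, h⟩, h'⟩, fun ⟨_, y, ⟨h, h'⟩, h''⟩ => ⟨y, h', by subst h; exact h''⟩⟩⟩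
  case natR₁ =>
    exact ⟨fun f y b => f = [] ∧ b = .succ y, by grind, fun Θ L M e b =>
      ⟨fun ⟨y, h, h'⟩ => ⟨[], y, ⟨rfl, h⟩, h'⟩, fun ⟨_, y, ⟨h, h'⟩, h''⟩ => ⟨y, h', by subst h; exact h''⟩⟩⟩

theorem BinaryLeft.sem {R : List Ty → Ty → Step} {Φ Φ₀ Φ₁ : List Ty} (h : BinaryLeft R Φ Φ₀ Φ₁) :
    (∀ Θ γ, (R Θ γ).concl = ⟨Θ ++ Φ, γ⟩) ∧ ∃ T₀ T₁ : Env → Env → Prop,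
      (∀ f f', T₀ f f' → f.length = Φ.length ∧ f'.length = Φ₀.length) ∧
      (∀ f f', T₁ f f' → f.length = Φ.length ∧ f'.length = Φ₁.length) ∧
      ∀ Θ γ L M e b, SemStep (R Θ γ) L M e b ↔ ∃ f f' g, e = f ++ g ∧
        ((T₀ f f' ∧ L (f' ++ g) b) ∨ (T₁ f f' ∧ M (f' ++ g) b)) := by
  refine ⟨by cases h <;> intros <;> rfl, ?_⟩
  cases h
  case sumL =>
    refine ⟨fun f f' => ∃ a x, f = [a] ∧ .inl x ∈ a ∧ f' = [x],
      fun f f' => ∃ a x, f = [a] ∧ .inr x ∈ a ∧ f' = [x], by grind, by grind, ?_⟩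
    simp only [SemStep]
    intro Θ γ L M e b
    constructor
    · rintro ⟨a, g, rfl, ⟨x, h₁, h₂⟩ | ⟨x, h₁, h₂⟩⟩
      · exact ⟨[a], [x], g, rfl, .inl ⟨⟨a, x, rfl, h₁, rfl⟩, h₂⟩⟩
      · exact ⟨[a], [x], g, rfl, .inr ⟨⟨a, x, rfl, h₁, rfl⟩, h₂⟩⟩
    · rintro ⟨_, _, g, rfl, ⟨⟨a, x, rfl, h₁, rfl⟩, h₂⟩ | ⟨⟨a, x, rfl, h₁, rfl⟩, h₂⟩⟩
      · exact ⟨a, g, rfl, .inl ⟨x, h₁, h₂⟩⟩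
      · exact ⟨a, g, rfl, .inr ⟨x, h₁, h₂⟩⟩
  case natL =>
    refine ⟨fun f f' => ∃ a, f = [a] ∧ .zero ∈ a ∧ f' = [],
      fun f f' => ∃ a x, f = [a] ∧ .succ x ∈ a ∧ f' = [x], by grind, by grind, ?_⟩
    simp only [SemStep]
    intro Θ γ L M e b
    constructor
    · rintro ⟨a, g, rfl, ⟨h₁, h₂⟩ | ⟨x, h₁, h₂⟩⟩
      · exact ⟨[a], [], g, rfl, .inl ⟨⟨a, rfl, h₁, rfl⟩, h₂⟩⟩
      · exact ⟨[a], [x], g, rfl, .inr ⟨⟨a, x, rfl, h₁, rfl⟩, h₂⟩⟩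
    · rintro ⟨_, _, g, rfl, ⟨⟨a, rfl, h₁, rfl⟩, h₂⟩ | ⟨⟨a, x, rfl, h₁, rfl⟩, h₂⟩⟩
      · exact ⟨a, g, rfl, .inl ⟨h₁, h₂⟩⟩
      · exact ⟨a, g, rfl, .inr ⟨x, h₁, h₂⟩⟩

theorem SplitLeft.sem {R : List Ty → List Ty → Ty → Step} {Φ Φ' : List Ty} {δ : Ty}
    (h : SplitLeft R Φ δ Φ') :
    (∀ Θ Ξ γ, (R Θ Ξ γ).concl = ⟨Θ ++ Ξ ++ Φ, γ⟩) ∧ ∃ T : Env → List Tok → Env → Prop,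
      (∀ f x f', T f x f' → f.length = Φ.length ∧ f'.length = Φ'.length) ∧
      ∀ Θ Ξ γ L M e b, SemStep (R Θ Ξ γ) L M e b ↔ ∃ f d g x f', e = f ++ (d ++ g) ∧
        d.length = Ξ.length ∧ T f x f' ∧ (∀ z ∈ x, L g z) ∧ M (f' ++ d) b := by
  refine ⟨by cases h <;> intros <;> simp [Step.concl], ?_⟩
  cases h
  case cut =>
    refine ⟨fun f x f' => f = [] ∧ f' = [x], by grind, ?_⟩
    simp only [SemStep]
    intro Θ Ξ γ L M e b
    constructor
    · rintro ⟨d, g, a, rfl, h₁, h₂, h₃⟩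
      exact ⟨[], d, g, a, [a], rfl, h₁, ⟨rfl, rfl⟩, h₂, h₃⟩
    · rintro ⟨_, d, g, a, _, rfl, h₁, ⟨rfl, rfl⟩, h₂, h₃⟩
      exact ⟨d, g, a, rfl, h₁, h₂, h₃⟩
  case arrL =>
    refine ⟨fun f x f' => ∃ a y, f = [a] ∧ .fn x y ∈ a ∧ f' = [y], by grind, ?_⟩
    simp only [SemStep]
    intro Θ Ξ γ L M e b
    constructor
    · rintro ⟨f, d, g, x, y, rfl, h₁, h₀, h₂, h₃⟩
      exact ⟨[f], d, g, x, [y], rfl, h₁, ⟨f, y, rfl, h₀, rfl⟩, h₂, h₃⟩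
    · rintro ⟨_, d, g, x, _, rfl, h₁, ⟨f, y, rfl, h₀, rfl⟩, h₂, h₃⟩
      exact ⟨f, d, g, x, y, rfl, h₁, h₀, h₂, h₃⟩

-- Lengths of antecedents under cut-reduction.

/-- The length of the antecedent of the conclusion. -/
def len (t : PTree) : Option ℕ := t.concl.map (·.ant.length)

/-- Premisses have the expected lengths. -/
def LengthTyped (t : PTree) : Prop :=
  ∀ α s, t α = some s → ∀ b, len (t.sub (α ++ [b])) = (s.prem b).map (·.ant.length)

theorem lengthTyped_un {s : Step} {t : PTree} : LengthTyped (un s t) ↔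
    LengthTyped t ∧ len t = (s.prem false).map (·.ant.length) ∧ s.prem true = none := by
  constructor
  · intro h
    refine ⟨fun α s' h' b => h (false :: α) s' h' b, h [] s rfl false, ?_⟩
    have : none = (s.prem true).map (·.ant.length) := h [] s rfl true
    simpa using this.symm
  · rintro ⟨h₁, h₂, h₃⟩ (_ | ⟨_ | _, α⟩) s' h b
    · cases h
      cases b
      · exact h₂
      · show none = _
        simp [h₃]
    · exact h₁ α s' h b
    · cases h

theorem lengthTyped_bin {s : Step} {t u : PTree} : LengthTyped (bin s t u) ↔
    LengthTyped t ∧ LengthTyped u ∧ len t = (s.prem false).map (·.ant.length) ∧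
      len u = (s.prem true).map (·.ant.length) := by
  constructor
  · intro h
    exact ⟨fun α s' h' b => h (false :: α) s' h' b, fun α s' h' b => h (true :: α) s' h' b,
      h [] s rfl false, h [] s rfl true⟩
  · rintro ⟨h₁, h₂, h₃, h₄⟩ (_ | ⟨_ | _, α⟩) s' h b
    · cases h
      cases b
      · exact h₃
      · exact h₄
    · exact h₁ α s' h b
    · exact h₂ α s' h b

theorem len_un {s : Step} {t : PTree} : len (un s t) = some s.concl.ant.length := rfl

theorem len_bin {s : Step} {t u : PTree} : len (bin s t u) = some s.concl.ant.length := rfl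

theorem Exs.len_eq {p : List ℕ} {t u : PTree} (h : Exs p t u) :
    len t = some p.length ∧ len u = some p.length := by
  induction h with
  | nil h => simp [len, h]
  | step h hu ha ih =>
    rw [len_un]
    refine ⟨by simpa using ih.1, ?_⟩
    have := ih.2
    simp only [len, hu] at this
    simpa [Step.concl] using this

theorem Exs.lengthTyped {p : List ℕ} {t u : PTree} (h : Exs p t u) :
    LengthTyped u ↔ LengthTyped t := by
  induction h with
  | nil h => rfl
  | step h hu ha ih =>
    rw [lengthTyped_un, ih]
    simp [len, hu, Step.prem, Step.prems]

theorem InCut.len_eq {Γ Δ₁ Δ₂ : List Ty} {σ τ : Ty} {A B Q : PTree} (h : InCut Γ Δ₁ Δ₂ σ τ A B Q) :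
    len Q = some (Γ.length + Δ₁.length + Δ₂.length) := by
  obtain ⟨-, -, -, h⟩ := h
  rw [h.len_eq.2]
  simp; omega

theorem InCut.lengthTyped {Γ Δ₁ Δ₂ : List Ty} {σ τ : Ty} {A B Q : PTree}
    (h : InCut Γ Δ₁ Δ₂ σ τ A B Q) : LengthTyped Q ↔ LengthTyped A ∧ LengthTyped B := by
  obtain ⟨hA, hB, h₁, h₂⟩ := h
  rw [h₂.lengthTyped, lengthTyped_bin, h₁.lengthTyped, h₁.len_eq.2]
  simp [len, hA, Step.prem, Step.prems]

theorem LengthTyped.weaken {τ : Ty} {Γ : List Ty} : ∀ {Δ : List Ty} {B : PTree},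
    LengthTyped B → len B = some Δ.length →
    LengthTyped (weaken τ Γ Δ B) ∧ len (weaken τ Γ Δ B) = some (Γ.length + Δ.length) := by
  induction Γ with
  | nil => intro Δ B h h'; exact ⟨h, by simpa [CircMuLJ.weaken] using h'⟩
  | cons γ Γ ih =>
    intro Δ B h h'
    have := ih (Δ := Δ ++ [γ]) (B := un (.wk Δ γ τ) B)
      (lengthTyped_un.2 ⟨h, h', rfl⟩) (by simp [len_un, Step.concl])
    refine ⟨this.1, this.2.trans ?_⟩
    simp; omega

theorem Contract.lengthTyped {τ : Ty} {Γ Δ : List Ty} {t u : PTree} (h : Contract τ Γ Δ t u) :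
    LengthTyped t → len t = some (Δ.length + Γ.length + Γ.length) →
    LengthTyped u ∧ len u = some (Δ.length + Γ.length) := by
  induction h with
  | nil => intro h h'; exact ⟨h, h'⟩
  | cons h₁ h₂ h ih =>
    intro ht hl
    have := ih ?_ ?_
    · refine ⟨this.1, this.2.trans ?_⟩
      simp; omega
    · rw [h₂.lengthTyped, lengthTyped_un, h₁.lengthTyped, h₁.len_eq.2]
      refine ⟨ht, ?_, rfl⟩
      simp [Step.prem, Step.prems]
    · rw [h₂.len_eq.2]
      simp; omega

theorem UnaryLeft.prems {R : List Ty → Ty → Step} {Φ Φ' : List Ty} (h : UnaryLeft R Φ Φ')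
    (Θ : List Ty) (γ : Ty) : (R Θ γ).prems = [⟨Θ ++ Φ', γ⟩] := by
  cases h <;> simp [Step.prems]

theorem UnaryRight.prems {R : List Ty → Step} {Φ' : List Ty} {γ γ' : Ty}
    (h : UnaryRight R Φ' γ γ') (Θ : List Ty) : (R Θ).prems = [⟨Θ ++ Φ', γ'⟩] := by
  cases h <;> simp [Step.prems]

theorem BinaryLeft.prems {R : List Ty → Ty → Step} {Φ Φ₀ Φ₁ : List Ty} (h : BinaryLeft R Φ Φ₀ Φ₁)
    (Θ : List Ty) (γ : Ty) : (R Θ γ).prems = [⟨Θ ++ Φ₀, γ⟩, ⟨Θ ++ Φ₁, γ⟩] := by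
  cases h <;> simp [Step.prems]

theorem SplitLeft.prems {R : List Ty → List Ty → Ty → Step} {Φ Φ' : List Ty} {δ : Ty}
    (h : SplitLeft R Φ δ Φ') (Θ Ξ : List Ty) (γ : Ty) :
    (R Θ Ξ γ).prems = [⟨Θ, δ⟩, ⟨Ξ ++ Φ', γ⟩] := by
  cases h <;> simp [Step.prems]

/-- Reduction is defined on arbitrary labelled trees. Preservation of lengths is the only part of
well-formedness that subject expansion needs, and it has to be carried along reduction sequences. -/
theorem Red.lengthTyped {t t' : PTree} (h : Red t t') :
    LengthTyped t → LengthTyped t' ∧ len t' = len t := by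
  induction h with
  | un _ ih =>
    intro h
    rw [lengthTyped_un] at h ⊢
    have := ih h.1
    exact ⟨⟨this.1, this.2.trans h.2.1, h.2.2⟩, rfl⟩
  | bin_left _ ih =>
    intro h
    rw [lengthTyped_bin] at h ⊢
    have := ih h.1
    exact ⟨⟨this.1, h.2.1, this.2.trans h.2.2.1, h.2.2.2⟩, rfl⟩
  | bin_right _ ih =>
    intro h
    rw [lengthTyped_bin] at h ⊢
    have := ih h.2.1
    exact ⟨⟨h.1, this.1, h.2.2.1, this.2.trans h.2.2.2⟩, rfl⟩
  | exs h₁ h₂ =>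
    intro h
    rw [h₂.lengthTyped, ← h₁.lengthTyped, h₁.len_eq.2, h₂.len_eq.2]
    exact ⟨h, rfl⟩
  | comm_left_unary hR h₁ h₂ =>
    intro h
    rw [h₁.lengthTyped, lengthTyped_un] at h
    rw [lengthTyped_un, h₂.lengthTyped, h₂.len_eq, len_un, h₁.len_eq, hR.sem.1]
    simp [Step.prem, hR.prems] at h ⊢
    refine ⟨⟨⟨h.1.1, h.2⟩, ?_⟩, ?_⟩ <;> omega
  | comm_left_binary hR h₁ h₂ h₃ =>
    intro h
    rw [h₁.lengthTyped, lengthTyped_bin] at h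
    rw [lengthTyped_bin, h₂.lengthTyped, h₂.len_eq, h₃.lengthTyped, h₃.len_eq, len_bin, h₁.len_eq,
      hR.sem.1]
    simp [Step.prem, hR.prems] at h ⊢
    refine ⟨⟨⟨h.1.1, h.2⟩, ⟨h.1.2.1, h.2⟩, ?_, ?_⟩, ?_⟩ <;> omega
  | comm_left_split hR h₁ h₂ h₃ =>
    intro h
    rw [h₁.lengthTyped, lengthTyped_bin] at h
    rw [h₃.lengthTyped, lengthTyped_bin, h₂.lengthTyped, h₂.len_eq, h₁.len_eq, h₃.len_eq.2]
    simp [Step.prem, hR.prems] at h ⊢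
    refine ⟨⟨h.1.1, ⟨h.1.2.1, h.2⟩, h.1.2.2.1, ?_⟩, ?_⟩ <;> omega
  | comm_right_unaryLeft hR h₁ h₂ =>
    intro h
    rw [h₁.lengthTyped, lengthTyped_un] at h
    rw [lengthTyped_un, h₂.lengthTyped, h₂.len_eq, len_un, h₁.len_eq, hR.sem.1]
    simp [Step.prem, hR.prems] at h ⊢
    refine ⟨⟨⟨h.1, h.2.1⟩, ?_⟩, ?_⟩ <;> omega
  | comm_right_unaryRight hR h₁ h₂ =>
    intro h
    rw [h₁.lengthTyped, lengthTyped_un] at h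
    rw [lengthTyped_un, h₂.lengthTyped, h₂.len_eq, len_un, h₁.len_eq, hR.sem.1]
    simp [Step.prem, hR.prems] at h ⊢
    refine ⟨⟨⟨h.1, h.2.1⟩, ?_⟩, ?_⟩ <;> omega
  | comm_right_binary hR h₁ h₂ h₃ =>
    intro h
    rw [h₁.lengthTyped, lengthTyped_bin] at h
    rw [lengthTyped_bin, h₂.lengthTyped, h₂.len_eq, h₃.lengthTyped, h₃.len_eq, len_bin, h₁.len_eq,
      hR.sem.1]
    simp [Step.prem, hR.prems] at h ⊢
    refine ⟨⟨⟨h.1, h.2.1⟩, ⟨h.1, h.2.2.1⟩, ?_, ?_⟩, ?_⟩ <;> omega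
  | comm_right_split₀ hR h₁ h₂ =>
    intro h
    rw [h₁.lengthTyped, lengthTyped_bin] at h
    rw [lengthTyped_bin, h₂.lengthTyped, h₂.len_eq, len_bin, h₁.len_eq, hR.sem.1]
    simp [Step.prem, hR.prems] at h ⊢
    refine ⟨⟨⟨h.1, h.2.1⟩, h.2.2.1, ?_, ?_⟩, ?_⟩ <;> first | omega | exact h.2.2.2.2
  | comm_right_split₁ hR h₁ h₂ =>
    intro h
    rw [h₁.lengthTyped, lengthTyped_bin] at h
    rw [lengthTyped_bin, h₂.lengthTyped, h₂.len_eq, len_bin, h₁.len_eq, hR.sem.1]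
    simp [Step.prem, hR.prems] at h ⊢
    refine ⟨⟨h.2.1, ⟨h.1, h.2.2.1⟩, h.2.2.2.1, ?_⟩, ?_⟩ <;> omega
  | comm_right_prodR₀ h₁ h₂ =>
    intro h
    rw [h₁.lengthTyped, lengthTyped_bin] at h
    rw [lengthTyped_bin, h₂.lengthTyped, h₂.len_eq, len_bin, h₁.len_eq]
    simp [Step.prem, Step.prems, Step.concl] at h ⊢
    refine ⟨⟨⟨h.1, h.2.1⟩, h.2.2.1, ?_, ?_⟩, ?_⟩ <;> first | omega | exact h.2.2.2.2
  | comm_right_prodR₁ h₁ h₂ =>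
    intro h
    rw [h₁.lengthTyped, lengthTyped_bin] at h
    rw [lengthTyped_bin, h₂.lengthTyped, h₂.len_eq, len_bin, h₁.len_eq]
    simp [Step.prem, Step.prems, Step.concl] at h ⊢
    refine ⟨⟨h.2.1, ⟨h.1, h.2.2.1⟩, h.2.2.2.1, ?_⟩, ?_⟩ <;> omega
  | id_left h₁ =>
    intro h
    rw [h₁.lengthTyped] at h
    refine ⟨h.2, ?_⟩
    rw [h₁.len_eq]
    obtain ⟨-, hB, -, -⟩ := h₁
    simp [len, hB]; omega
  | @wk Γ Δ σ τ A B Q h₁ =>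
    intro h
    rw [h₁.lengthTyped, lengthTyped_un] at h
    have := LengthTyped.weaken (τ := τ) (Γ := Γ) h.2.1 (by simpa [Step.prem, Step.prems] using h.2.2.1)
    rw [h₁.len_eq]
    exact ⟨this.1, this.2⟩
  | ctr h₁ h₂ h₃ h₄ =>
    intro h
    rw [h₁.lengthTyped, lengthTyped_un] at h
    have := h₄.lengthTyped (h₃.lengthTyped.2 ⟨h.1, h₂.lengthTyped.2 ⟨h.1, h.2.1⟩⟩)
      (by rw [h₃.len_eq]; simp; omega)
    refine ⟨this.1, ?_⟩
    rw [h₁.len_eq, this.2]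
    simp; omega
  | arr h₁ =>
    intro h
    rw [lengthTyped_bin, lengthTyped_un, lengthTyped_bin] at h
    rw [lengthTyped_bin, h₁.lengthTyped, h₁.len_eq, len_bin, len_bin]
    simp [Step.prem, Step.prems, Step.concl] at h ⊢
    refine ⟨⟨h.2.1.1, h.1.1⟩, h.2.1.2.1, ?_, h.2.1.2.2.2⟩
    omega
  | prod h₁ h₂ h₃ =>
    intro h
    rw [h₁.lengthTyped, lengthTyped_un, lengthTyped_bin] at h
    rw [h₃.lengthTyped, h₂.lengthTyped, h₃.len_eq, h₁.len_eq]
    refine ⟨⟨h.1.2.1, h.1.1, h.2.1⟩, ?_⟩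
    simp; omega
  | id_right | one =>
    intro h
    simp only [lengthTyped_bin, lengthTyped_un] at h
    simp [Step.prem, Step.prems, Step.concl, len_bin, len_un] at h ⊢
    simp [h]
  | nat₀ =>
    intro h
    simp only [lengthTyped_bin] at h
    simp [Step.prem, Step.prems, Step.concl, len_bin] at h ⊢
    simp [h]
  | exch_left | exch_right | mu | nu | sum₀ | sum₁ | nat₁ =>
    intro h
    simp only [lengthTyped_bin, lengthTyped_un] at h ⊢
    simp [Step.prem, Step.prems, Step.concl, len_bin, len_un] at h ⊢
    simp [h, ← Nat.add_assoc]

theorem Sem.length_eq {t : PTree} {e : Env} {b : Tok} (h : Sem t e b) : len t = some e.length := by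
  obtain ⟨s, h₁, h₂, -⟩ := sem_iff.1 h
  simp [len, PTree.concl, h₁, h₂]

/-- For each reduction, a token list for the cut formula is recovered from what the reduct uses.
Lengths enter where the reduct is a bare subtree, whose environment must fit the conclusion of the
redex. -/
theorem Red.sem {t t' : PTree} (h : Red t t') :
    LengthTyped t → ∀ {e : Env} {b : Tok}, Sem t' e b → Sem t e b := by
  induction h with
  | un _ ih =>
    intro ht e b h
    rw [sem_un] at h ⊢
    exact ⟨h.1, h.2.mono (fun _ _ h => ih (lengthTyped_un.1 ht).1 h) (fun _ _ h => h)⟩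
  | bin_left _ ih =>
    intro ht e b h
    rw [sem_bin] at h ⊢
    exact ⟨h.1, h.2.mono (fun _ _ h => ih (lengthTyped_bin.1 ht).1 h) (fun _ _ h => h)⟩
  | bin_right _ ih =>
    intro ht e b h
    rw [sem_bin] at h ⊢
    exact ⟨h.1, h.2.mono (fun _ _ h => h) (fun _ _ h => ih (lengthTyped_bin.1 ht).2.1 h)⟩
  | exs h₁ h₂ => intro _ e b h; exact h₁.sem.2 (h₂.sem.1 h)
  | @exch_left Γ₁ Γ₂ Δ =>
    intro ht e b h
    simp only [sem_un, sem_bin, SemStep, Step.concl] at h ⊢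
    obtain ⟨h₀, d, x, y, g, rfl, hd, h₁, d', g', a, he, hd', ha, hb⟩ := h
    obtain ⟨d₁, d₂, rfl, hd₁, hd₂⟩ := exists_eq_append (l := d) (m := Δ.length)
      (n := Γ₂.length) (hd.trans (by simp [Nat.add_comm]))
    rw [List.append_assoc] at he
    obtain ⟨rfl, rfl⟩ := List.append_inj he (hd₁.trans hd'.symm)
    simp only [List.length_append, List.length_cons] at h₀ ⊢
    refine ⟨by omega, d₁, d₂ ++ x :: y :: g, a, by simp, hd₁, fun z hz => ?_, hb⟩
    exact ⟨by simp; omega, d₂, x, y, g, rfl, hd₂, ha z hz⟩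
  | @exch_right Γ Δ₁ Δ₂ =>
    intro ht e b h
    simp only [sem_un, sem_bin, SemStep, Step.concl] at h ⊢
    obtain ⟨h₀, d, x, y, g, rfl, hd, h₁, d', g', a, he, hd', ha, hb⟩ := h
    simp only [List.length_append, List.length_cons] at h₀ h₁ hd'
    obtain ⟨g₁, g₂, rfl, hg₁, hg₂⟩ := exists_eq_append (l := g) (m := Δ₁.length) (n := Γ.length)
      (by omega)
    rw [← List.cons_append, ← List.cons_append, ← List.append_assoc] at he
    obtain ⟨rfl, rfl⟩ := List.append_inj he (by simp; omega)
    refine ⟨by simp; omega, d ++ x :: y :: g₁, g₂, a, by simp, by simp; omega, ha, ?_⟩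
    exact ⟨by simp; omega, a :: d, x, y, g₁, by simp, by simp; omega, by simpa using hb⟩
  | @comm_left_unary R Φ Φ' Γ Δ σ τ A B Q Q' hR h₁ h₂ =>
    intro ht e b h
    obtain ⟨hc, T, hT, hS⟩ := hR.sem
    rw [sem_un, hS, hc] at h
    obtain ⟨h₀, f, f', g, rfl, hf, h'⟩ := h
    obtain ⟨_, g', d, a, he, hd₂, hg', hd, ha, hb⟩ := h₂.sem.1 h'
    obtain rfl := List.eq_nil_of_length_eq_zero hd₂
    have := hT _ _ hf
    rw [List.length_append] at hg'
    obtain ⟨f'', g', rfl, hf'', hg''⟩ := exists_eq_append (l := g') (m := f'.length)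
      (n := Γ.length) (by omega)
    rw [List.nil_append, List.append_assoc] at he
    obtain ⟨rfl, rfl⟩ := List.append_inj he hf''.symm
    simp only [List.length_append] at h₀
    refine h₁.sem.2 ⟨[], f ++ g', d, a, by simp, rfl, by simp; omega, hd, fun x hx => ?_, hb⟩
    rw [sem_un, hS, hc]
    exact ⟨by simp; omega, f, f', g', rfl, hf, ha x hx⟩
  | @comm_left_binary R Φ Φ₀ Φ₁ Γ Δ σ τ A₀ A₁ B Q Q₀ Q₁ hR h₁ h₂ h₃ =>
    intro ht e b h
    obtain ⟨hc, T₀, T₁, hT₀, hT₁, hS⟩ := hR.sem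
    rw [sem_bin, hS, hc] at h
    obtain ⟨h₀, f, f', g, rfl, h⟩ := h
    simp only [List.length_append] at h₀
    have hf : f.length = Φ.length := by rcases h with h | h <;> grind
    obtain ⟨g, d, rfl, hg, hd⟩ := exists_eq_append (l := g) (m := Γ.length) (n := Δ.length)
      (by omega)
    have key : ∀ {Φ' A Q}, InCut (Γ ++ Φ') Δ [] σ τ A B Q → f'.length = Φ'.length →
        Sem Q (f' ++ (g ++ d)) b → ∃ a, (∀ x ∈ a, Sem A (f' ++ g) x) ∧ Sem B (a :: d) b := by
      intro Φ' A Q hQ hf' h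
      have := hQ.sem_list (d₁ := d) (g := f' ++ g) (d₂ := []) rfl (by simp; omega) (y := [b])
        (by simpa using h)
      simpa using this
    rcases h with ⟨hT, h⟩ | ⟨hT, h⟩
    · obtain ⟨a, ha, hb⟩ := key h₂ (hT₀ _ _ hT).2 h
      refine h₁.sem.2 ⟨[], f ++ g, d, a, by simp, rfl, by simp; omega, hd, fun x hx => ?_, hb⟩
      rw [sem_bin, hS, hc]
      exact ⟨by simp; omega, f, f', g, rfl, .inl ⟨hT, ha x hx⟩⟩
    · obtain ⟨a, ha, hb⟩ := key h₃ (hT₁ _ _ hT).2 h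
      refine h₁.sem.2 ⟨[], f ++ g, d, a, by simp, rfl, by simp; omega, hd, fun x hx => ?_, hb⟩
      rw [sem_bin, hS, hc]
      exact ⟨by simp; omega, f, f', g, rfl, .inr ⟨hT, ha x hx⟩⟩
  | @comm_left_split R Φ Φ' Θ Ξ Δ δ σ τ A₀ A₁ B Q Q₁ Q' hR h₁ h₂ h₃ =>
    intro ht e b h
    obtain ⟨hc, T, hT, hS⟩ := hR.sem
    obtain ⟨e', hl, he, h⟩ := h₃.sem.1 h
    rw [sem_bin, hS, hc] at h
    obtain ⟨h₀, f, d, g, x, f', rfl, hd, hf, hx, h'⟩ := h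
    have := hT _ _ _ hf
    simp only [List.length_append] at h₀ hd
    obtain ⟨d, d', rfl, hd', hd''⟩ := exists_eq_append (l := d) (m := Ξ.length) (n := Δ.length)
      (by omega)
    simp only [List.length_append] at h₀
    -- The final exchanges move `Δ` in front of `Θ`, so in the reversed environment the block `d'`
    -- goes to the very end.
    have e₁ := map_getD_range (A := g.reverse) (C := d'.reverse ++ (d.reverse ++ f.reverse))
      (n := Θ.length) (by simp; omega)
    have e₂ := map_getD_range' (A := g.reverse) (B := d'.reverse) (C := d.reverse ++ f.reverse)
      (s := Θ.length) (n := Δ.length) (by simp; omega) (by simp; omega)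
    have e₃ := map_getD_range' (A := g.reverse ++ d'.reverse) (B := d.reverse ++ f.reverse)
      (C := []) (s := Θ.length + Δ.length) (n := Ξ.length + Φ.length) (by simp; omega)
      (by simp; omega)
    simp only [List.append_assoc, List.append_nil] at e₁ e₂ e₃
    simp only [List.reverse_append, List.append_assoc, List.map_append, e₁, e₂, e₃] at he
    obtain rfl : e = f ++ (d ++ g) ++ d' := List.reverse_injective (by simp [he])
    have h₄ := h₂.sem_list (d₁ := d') (g := f' ++ d) (d₂ := []) rfl (by simp; omega) (y := [b])
      (by simpa using h')
    obtain ⟨a, ha, hb⟩ := h₄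
    refine h₁.sem.2 ⟨[], f ++ (d ++ g), d', a, rfl, rfl, by simp; omega, hd'',
      fun z hz => ?_, hb b (by simp)⟩
    rw [sem_bin, hS, hc]
    exact ⟨by simp; omega, f, d, g, x, f', rfl, hd', hf, hx, ha z hz⟩
  | @comm_right_unaryLeft R Φ Φ' Γ Δ₁ Δ₂ σ τ A B Q Q' hR h₁ h₂ =>
    intro ht e b h
    obtain ⟨hc, T, hT, hS⟩ := hR.sem
    rw [sem_un, hS, hc] at h
    obtain ⟨h₀, f, f', g, rfl, hf, h⟩ := h
    have := hT _ _ hf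
    simp only [List.length_append] at h₀
    obtain ⟨d₂, g, rfl, hd₂, hg⟩ := exists_eq_append (l := g) (m := Δ₂.length)
      (n := Γ.length + Δ₁.length) (by omega)
    obtain ⟨g, d₁, rfl, hg, hd₁⟩ := exists_eq_append hg
    obtain ⟨a, ha, hb⟩ := h₂.sem_list (d₁ := d₁) (g := g) (d₂ := f' ++ d₂) (by simp; omega) hg
      (y := [b]) (by simpa using h)
    refine h₁.sem.2 ⟨f ++ d₂, g, d₁, a, by simp, by simp; omega, hg, hd₁, ha, ?_⟩
    rw [sem_un, hS, hc]
    exact ⟨by simp; omega, f, f', d₂ ++ a :: d₁, by simp, hf, by simpa using hb b (by simp)⟩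
  | @comm_right_unaryRight R Φ' Γ Δ₁ Δ₂ σ γ γ' A B Q Q' hR h₁ h₂ =>
    intro ht e b h
    obtain ⟨hc, T, hT, hS⟩ := hR.sem
    rw [sem_un, hS, hc] at h
    obtain ⟨h₀, f', y, hf, h⟩ := h
    have := hT _ _ _ hf
    simp only [List.length_append] at h₀
    obtain ⟨d₂, g, rfl, hd₂, hg⟩ := exists_eq_append (l := e) (m := Δ₂.length)
      (n := Γ.length + Δ₁.length) (by omega)
    obtain ⟨g, d₁, rfl, hg, hd₁⟩ := exists_eq_append hg
    obtain ⟨a, ha, hb⟩ := h₂.sem_list (d₁ := d₁) (g := g) (d₂ := f' ++ d₂) (by simp; omega) hg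
      (y := y) (by simpa using h)
    refine h₁.sem.2 ⟨d₂, g, d₁, a, by simp, hd₂, hg, hd₁, ha, ?_⟩
    rw [sem_un, hS, hc]
    exact ⟨by simp; omega, f', y, hf, by simpa using hb⟩
  | @comm_right_binary R Φ Φ₀ Φ₁ Γ Δ₁ Δ₂ σ τ A B₀ B₁ Q Q₀ Q₁ hR h₁ h₂ h₃ =>
    intro ht e b h
    obtain ⟨hc, T₀, T₁, hT₀, hT₁, hS⟩ := hR.sem
    rw [sem_bin, hS, hc] at h
    obtain ⟨h₀, f, f', g, rfl, h⟩ := h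
    simp only [List.length_append] at h₀
    have hf : f.length = Φ.length := by rcases h with h | h <;> grind
    obtain ⟨d₂, g, rfl, hd₂, hg⟩ := exists_eq_append (l := g) (m := Δ₂.length)
      (n := Γ.length + Δ₁.length) (by omega)
    obtain ⟨g, d₁, rfl, hg, hd₁⟩ := exists_eq_append hg
    rcases h with ⟨hT, h⟩ | ⟨hT, h⟩
    · have := hT₀ _ _ hT
      obtain ⟨a, ha, hb⟩ := h₂.sem_list (d₁ := d₁) (g := g) (d₂ := f' ++ d₂) (by simp; omega) hg
        (y := [b]) (by simpa using h)
      refine h₁.sem.2 ⟨f ++ d₂, g, d₁, a, by simp, by simp; omega, hg, hd₁, ha, ?_⟩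
      rw [sem_bin, hS, hc]
      exact ⟨by simp; omega, f, f', d₂ ++ a :: d₁, by simp,
        .inl ⟨hT, by simpa using hb b (by simp)⟩⟩
    · have := hT₁ _ _ hT
      obtain ⟨a, ha, hb⟩ := h₃.sem_list (d₁ := d₁) (g := g) (d₂ := f' ++ d₂) (by simp; omega) hg
        (y := [b]) (by simpa using h)
      refine h₁.sem.2 ⟨f ++ d₂, g, d₁, a, by simp, by simp; omega, hg, hd₁, ha, ?_⟩
      rw [sem_bin, hS, hc]
      exact ⟨by simp; omega, f, f', d₂ ++ a :: d₁, by simp,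
        .inr ⟨hT, by simpa using hb b (by simp)⟩⟩
  | @comm_right_split₀ R Φ Φ' Γ Δ₁ Δ₂ Ξ δ σ τ A B₀ B₁ Q Q₀ hR h₁ h₂ =>
    intro ht e b h
    obtain ⟨hc, T, hT, hS⟩ := hR.sem
    rw [sem_bin, hS, hc] at h
    obtain ⟨h₀, f, d, g, x, f', rfl, hd, hf, hx, h⟩ := h
    have := hT _ _ _ hf
    simp only [List.length_append] at h₀
    obtain ⟨d₂, g, rfl, hd₂, hg⟩ := exists_eq_append (l := g) (m := Δ₂.length)
      (n := Γ.length + Δ₁.length) (by omega)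
    obtain ⟨g, d₁, rfl, hg, hd₁⟩ := exists_eq_append hg
    obtain ⟨a, ha, hb⟩ := h₂.sem_list (d₁ := d₁) (g := g) (d₂ := d₂) hd₂ hg hx
    refine h₁.sem.2 ⟨f ++ (d ++ d₂), g, d₁, a, by simp, by simp; omega, hg, hd₁, ha, ?_⟩
    rw [sem_bin, hS, hc]
    exact ⟨by simp; omega, f, d, d₂ ++ a :: d₁, x, f', by simp, hd, hf, hb, h⟩
  | @comm_right_split₁ R Φ Φ' Γ Δ₁ Δ₂ Θ δ σ τ A B₀ B₁ Q Q₁ hR h₁ h₂ =>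
    intro ht e b h
    obtain ⟨hc, T, hT, hS⟩ := hR.sem
    rw [sem_bin, hS, hc] at h
    obtain ⟨h₀, f, d, t, x, f', rfl, hd, hf, hx, h⟩ := h
    have := hT _ _ _ hf
    simp only [List.length_append] at h₀ hd
    obtain ⟨d₂, g, rfl, hd₂, hg⟩ := exists_eq_append (l := d) (m := Δ₂.length)
      (n := Γ.length + Δ₁.length) (by omega)
    obtain ⟨g, d₁, rfl, hg, hd₁⟩ := exists_eq_append hg
    obtain ⟨a, ha, hb⟩ := h₂.sem_list (d₁ := d₁) (g := g) (d₂ := f' ++ d₂) (by simp; omega) hg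
      (y := [b]) (by simpa using h)
    simp only [List.length_append] at h₀
    refine h₁.sem.2 ⟨f ++ d₂, g, d₁ ++ t, a, by simp, by simp; omega, hg, by simp; omega, ha, ?_⟩
    rw [sem_bin, hS, hc]
    exact ⟨by simp; omega, f, d₂ ++ a :: d₁, t, x, f', by simp, by simp; omega, hf, hx,
      by simpa using hb b (by simp)⟩
  | @comm_right_prodR₀ Γ Δ₁ Δ₂ Ξ σ ρ τ A B₀ B₁ Q Q₀ h₁ h₂ =>
    intro ht e b h
    simp only [sem_bin, SemStep, Step.concl] at h
    obtain ⟨h₀, d, g, x, y, rfl, hd, rfl, hx, hy⟩ := h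
    simp only [List.length_append] at h₀
    obtain ⟨d₂, g, rfl, hd₂, hg⟩ := exists_eq_append (l := g) (m := Δ₂.length)
      (n := Γ.length + Δ₁.length) (by omega)
    obtain ⟨g, d₁, rfl, hg, hd₁⟩ := exists_eq_append hg
    obtain ⟨a, ha, hb⟩ := h₂.sem_list (d₁ := d₁) (g := g) (d₂ := d₂) hd₂ hg hx
    refine h₁.sem.2 ⟨d ++ d₂, g, d₁, a, by simp, by simp; omega, hg, hd₁, ha, ?_⟩
    simp only [sem_bin, SemStep, Step.concl]
    exact ⟨by simp; omega, d, d₂ ++ a :: d₁, x, y, by simp, hd, rfl, hb, hy⟩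
  | @comm_right_prodR₁ Γ Δ₁ Δ₂ Θ σ ρ τ A B₀ B₁ Q Q₁ h₁ h₂ =>
    intro ht e b h
    simp only [sem_bin, SemStep, Step.concl] at h
    obtain ⟨h₀, d, t, x, y, rfl, hd, rfl, hx, hy⟩ := h
    simp only [List.length_append] at h₀ hd
    obtain ⟨d₂, g, rfl, hd₂, hg⟩ := exists_eq_append (l := d) (m := Δ₂.length)
      (n := Γ.length + Δ₁.length) (by omega)
    obtain ⟨g, d₁, rfl, hg, hd₁⟩ := exists_eq_append hg
    obtain ⟨a, ha, hb⟩ := h₂.sem_list (d₁ := d₁) (g := g) (d₂ := d₂) hd₂ hg hy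
    simp only [List.length_append] at h₀
    refine h₁.sem.2 ⟨d₂, g, d₁ ++ t, a, by simp, hd₂, hg, by simp; omega, ha, ?_⟩
    simp only [sem_bin, SemStep, Step.concl]
    exact ⟨by simp; omega, d₂ ++ a :: d₁, t, x, y, by simp, by simp; omega, rfl, hx, hb⟩
  | @id_left Δ σ τ B Q hQ =>
    intro ht e b h
    have hQ' := hQ
    obtain ⟨-, hB, -, -⟩ := hQ'
    have hl := h.length hB
    obtain ⟨a, d, rfl⟩ := List.exists_cons_of_ne_nil (l := e) (by rintro rfl; simp at hl)
    refine hQ.sem.2 ⟨[], [a], d, a, rfl, rfl, rfl, by simpa using hl, fun x hx => ?_, h⟩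
    simp only [sem_leaf, SemStep, Step.concl]
    exact ⟨rfl, a, rfl, hx⟩
  | @id_right Γ σ A =>
    intro ht e b h
    have hl := h.length_eq
    rw [(lengthTyped_bin.1 ht).2.2.1] at hl
    simp only [sem_bin, sem_leaf, SemStep, Step.concl]
    -- An identity needs to receive exactly the token it returns.
    refine ⟨by simpa [Step.prem, Step.prems] using hl.symm, [], e, [b], rfl, rfl, ?_, rfl, [b], rfl,
      by simp⟩
    simpa using h
  | @wk Γ Δ σ τ A B Q hQ =>
    intro ht e b h
    obtain ⟨g, d, rfl, hg, h⟩ := sem_weaken h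
    have hl := h.length_eq
    rw [(lengthTyped_un.1 (hQ.lengthTyped.1 ht).2).2.1] at hl
    have hd : d.length = Δ.length := by simpa [Step.prem, Step.prems] using hl.symm
    -- A weakened cut formula is never consulted, so the empty list of its tokens suffices.
    refine hQ.sem.2 ⟨[], g, d, [], rfl, rfl, hg, hd, by simp, ?_⟩
    simp only [sem_un, SemStep, Step.concl]
    exact ⟨by simp [hd], _, _, rfl, h⟩
  | @ctr Γ Δ σ τ A B Q Q₁ Q₂ Q' h₁ h₂ h₃ h₄ =>
    intro ht e b h
    obtain ⟨g, d, rfl, hg, hs⟩ := h₄.sem h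
    obtain ⟨d₂, g', d', a, he, hd₂, hg', -, ha, hs'⟩ := h₃.sem.1 hs
    obtain rfl := List.eq_nil_of_length_eq_zero hd₂
    rw [List.nil_append] at he
    obtain ⟨rfl, rfl⟩ := List.append_inj he (hg.trans hg'.symm)
    obtain ⟨d₂, g', d', a', he', hd₃, hg'', hd', ha', hs''⟩ := h₂.sem.1 hs'
    obtain ⟨a'', rfl⟩ := List.length_eq_one_iff.1 hd₃
    simp only [List.nil_append, List.cons_append, List.cons.injEq] at he'
    obtain ⟨rfl, he'⟩ := he'
    obtain ⟨rfl, rfl⟩ := List.append_inj he' (hg.trans hg''.symm)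
    -- The two copies of the cut formula use different lists; the single cut before the reduction
    -- supplies both, and monotonicity absorbs the excess.
    refine h₁.sem.2 ⟨[], g, d, a' ++ a, rfl, rfl, hg, hd',
      fun x hx => (List.mem_append.1 hx).elim (ha' x) (ha x), ?_⟩
    simp only [sem_un, SemStep, Step.concl]
    refine ⟨by simp; omega, _, _, rfl, hs''.mono_env ?_⟩
    exact .cons (List.subset_append_right _ _) (.cons (List.subset_append_left _ _) (Env.Le.refl _))
  | @one Δ τ B =>
    intro ht e b h
    have hl := h.length_eq
    rw [(lengthTyped_un.1 (lengthTyped_bin.1 ht).2.1).2.1] at hl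
    have hd : e.length = Δ.length := by simpa [Step.prem, Step.prems] using hl.symm
    simp only [sem_bin, sem_un, sem_leaf, SemStep, Step.concl]
    exact ⟨by simpa using hd, e, [], [.one], by simp, hd, by simp, by simp [hd], _, e, rfl,
      by simp, h⟩
  | @arr Γ Θ Ξ σ τ γ A B C Q hQ =>
    intro ht e b h
    simp only [sem_bin, SemStep, Step.concl] at h ⊢
    obtain ⟨h₀, d, t, a, rfl, hd, ha, h⟩ := h
    simp only [List.length_append] at h₀
    obtain ⟨t, g, rfl, ht, hg⟩ := exists_eq_append (l := t) (m := Θ.length)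
      (n := Γ.length) (by omega)
    obtain ⟨x, hx, ha⟩ := hQ.sem_list (d₂ := []) (g := t) (d₁ := g) rfl ht ha
    -- The one token needed of the function records what the reduct uses: `x` from the argument and
    -- `a` as the result. The other principal cases build a singleton in the same way.
    refine ⟨by simp; omega, d ++ t, g, [.fn x a], by simp, by simp; omega, ?_, ?_⟩
    · simp only [sem_un, SemStep, Step.concl, List.mem_singleton]
      rintro _ rfl
      exact ⟨hg, x, a, rfl, ha⟩
    · exact ⟨by simp; omega, _, d, t, x, a, rfl, hd, by simp, hx, h⟩
  | @prod Γ₀ Γ₁ Δ σ τ γ A₀ A₁ B Q Q₁ Q₂ h₁ h₂ h₃ =>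
    intro ht e b h
    obtain ⟨d₂, g, d, a, rfl, hd₂, hg, -, ha, hs⟩ := h₃.sem.1 h
    obtain rfl := List.eq_nil_of_length_eq_zero hd₂
    obtain ⟨d₂, g', d', a', he, hd₃, hg', hd', ha', hs'⟩ := h₂.sem.1 hs
    obtain ⟨a'', rfl⟩ := List.length_eq_one_iff.1 hd₃
    simp only [List.nil_append, List.cons_append, List.cons.injEq] at he
    obtain ⟨rfl, rfl⟩ := he
    refine h₁.sem.2 ⟨[], g ++ g', d', [.pair a' a], by simp, rfl, by simp; omega, hd', ?_, ?_⟩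
    · simp only [sem_bin, SemStep, Step.concl, List.mem_singleton]
      rintro _ rfl
      exact ⟨by simp; omega, g, g', a', a, rfl, hg, rfl, ha', ha⟩
    · simp only [sem_un, SemStep, Step.concl]
      exact ⟨by simp; omega, _, _, a', a, rfl, by simp, by simpa using hs'⟩
  | @sum₀ Γ Δ =>
    intro ht e b h
    simp only [sem_bin, sem_un, SemStep, Step.concl] at h ⊢
    obtain ⟨h₀, d, g, a, rfl, hd, ha, h⟩ := h
    simp only [List.length_append] at h₀
    refine ⟨by simpa using h₀, d, g, [.inl a], rfl, hd, ?_, by simp [hd], _, d, rfl,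
      .inl ⟨a, by simp, h⟩⟩
    simp only [List.mem_singleton]
    rintro _ rfl
    exact ⟨by omega, a, rfl, ha⟩
  | sum₁ =>
    intro ht e b h
    simp only [sem_bin, sem_un, SemStep, Step.concl] at h ⊢
    obtain ⟨h₀, d, g, a, rfl, hd, ha, h⟩ := h
    simp only [List.length_append] at h₀
    refine ⟨by simpa using h₀, d, g, [.inr a], rfl, hd, ?_, by simp [hd], _, d, rfl,
      .inr ⟨a, by simp, h⟩⟩
    simp only [List.mem_singleton]
    rintro _ rfl
    exact ⟨by omega, a, rfl, ha⟩
  | mu =>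
    intro ht e b h
    simp only [sem_bin, sem_un, SemStep, Step.concl] at h ⊢
    obtain ⟨h₀, d, g, a, rfl, hd, ha, h⟩ := h
    simp only [List.length_append] at h₀
    refine ⟨by simpa using h₀, d, g, [.mu a], rfl, hd, ?_, by simp [hd], _, d, a, rfl,
      by simp, h⟩
    simp only [List.mem_singleton]
    rintro _ rfl
    exact ⟨by omega, a, rfl, ha⟩
  | nu =>
    intro ht e b h
    simp only [sem_bin, sem_un, SemStep, Step.concl] at h ⊢
    obtain ⟨h₀, d, g, a, rfl, hd, ha, h⟩ := h
    simp only [List.length_append] at h₀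
    refine ⟨by simpa using h₀, d, g, [.nu a], rfl, hd, ?_, by simp [hd], _, d, a, rfl,
      by simp, h⟩
    simp only [List.mem_singleton]
    rintro _ rfl
    exact ⟨by omega, a, rfl, ha⟩
  | @nat₀ Δ τ B₀ B₁ =>
    intro ht e b h
    have hl := h.length_eq
    rw [(lengthTyped_bin.1 (lengthTyped_bin.1 ht).2.1).2.2.1] at hl
    have hd : e.length = Δ.length := by simpa [Step.prem, Step.prems] using hl.symm
    simp only [sem_bin, sem_leaf, SemStep, Step.concl]
    exact ⟨by simpa using hd, e, [], [.zero], by simp, hd, by simp, by simp [hd], _, e, rfl,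
      .inl ⟨by simp, h⟩⟩
  | nat₁ =>
    intro ht e b h
    simp only [sem_bin, sem_un, SemStep, Step.concl] at h ⊢
    obtain ⟨h₀, d, g, a, rfl, hd, ha, h⟩ := h
    simp only [List.length_append] at h₀
    refine ⟨by simpa using h₀, d, g, [.succ a], rfl, hd, ?_, by simp [hd], _, d, rfl,
      .inr ⟨a, by simp, h⟩⟩
    simp only [List.mem_singleton]
    rintro _ rfl
    exact ⟨by omega, a, rfl, ha⟩

/-! ### Closing coderivations by cuts -/

theorem PTree.IsCoderivation.cases {R : Step → Prop} {t : PTree} {S : Sequent}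
    (h : t.IsCoderivation R S) : ∃ s, t [] = some s ∧ R s ∧ s.concl = S ∧
      ((s.prems = [] ∧ t = leaf s) ∨
        (∃ S₀ t₀, s.prems = [S₀] ∧ t = un s t₀ ∧ t₀.IsCoderivation R S₀) ∨
        ∃ S₀ S₁ t₀ t₁, s.prems = [S₀, S₁] ∧ t = bin s t₀ t₁ ∧
          t₀.IsCoderivation R S₀ ∧ t₁.IsCoderivation R S₁) := by
  obtain ⟨hroot, hchild, hclosed, hsteps⟩ := h
  obtain ⟨s, hs, rfl⟩ := Option.map_eq_some_iff.1 hroot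
  have sub : ∀ {b S₀}, s.prem b = some S₀ → (t.sub [b]).IsCoderivation R S₀ := fun {b S₀} hb =>
    ⟨(hchild [] s hs b).trans hb, fun α => hchild (b :: α), fun α => hclosed (b :: α),
      fun α => hsteps (b :: α)⟩
  have none : ∀ {b}, s.prem b = none → ∀ α, t (b :: α) = none := by
    intro b hb α
    induction α using List.reverseRecOn with
    | nil => simpa [hb] using hchild [] s hs b
    | append_singleton α c ih => exact hclosed (b :: α) ih c
  have hp : s.prems = [] ∨ (∃ S₀, s.prems = [S₀]) ∨ ∃ S₀ S₁, s.prems = [S₀, S₁] := by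
    cases s <;> simp [Step.prems]
  refine ⟨s, hs, hsteps [] s hs, rfl, ?_⟩
  rcases hp with hp | ⟨S₀, hp⟩ | ⟨S₀, S₁, hp⟩
  · refine .inl ⟨hp, ?_⟩
    funext α
    rcases α with _ | ⟨b, α⟩
    · exact hs
    · exact none (by simp [Step.prem, hp]) α
  · refine .inr (.inl ⟨S₀, t.sub [false], hp, ?_, sub (by simp [Step.prem, hp])⟩)
    funext α
    rcases α with _ | ⟨_ | _, α⟩
    · exact hs
    · rfl
    · exact none (by simp [Step.prem, hp]) α
  · refine .inr (.inr ⟨S₀, S₁, t.sub [false], t.sub [true], hp, ?_,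
      sub (by simp [Step.prem, hp]), sub (by simp [Step.prem, hp])⟩)
    funext α
    rcases α with _ | ⟨_ | _, α⟩
    · exact hs
    · rfl
    · rfl

theorem PTree.IsCoderivation.lengthTyped {R : Step → Prop} {t : PTree} {S : Sequent}
    (h : t.IsCoderivation R S) : LengthTyped t := by
  intro α s hs b
  rw [← h.child α s hs b, len, PTree.concl, PTree.sub, List.append_nil, Option.map_map]

theorem Reduces.un {s : Step} {t t' : PTree} (h : Reduces t t') : Reduces (un s t) (un s t') :=
  Relation.ReflTransGen.lift (PTree.un s) (fun _ _ => Red.un) _ _ h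

theorem Reduces.bin_left {s : Step} {t t' u : PTree} (h : Reduces t t') :
    Reduces (bin s t u) (bin s t' u) :=
  Relation.ReflTransGen.lift (fun t => PTree.bin s t u) (fun _ _ => Red.bin_left) _ _ h

theorem Reduces.bin_right {s : Step} {t u u' : PTree} (h : Reduces u u') :
    Reduces (bin s t u) (bin s t u') :=
  Relation.ReflTransGen.lift (PTree.bin s t) (fun _ _ => Red.bin_right) _ _ h

theorem Reduces.trans {t u v : PTree} (h : Reduces t u) (h' : Reduces u v) : Reduces t v :=
  Relation.ReflTransGen.trans h h'

theorem Red.reduces {t u : PTree} (h : Red t u) : Reduces t u := .single h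

/-- Closed coderivations with their types, in the reverse order of antecedents. -/
abbrev Closers : Type := List (PTree × Ty)

/-- The antecedent closed by `e`. -/
def ctx (e : Closers) : List Ty := (e.map Prod.snd).reverse

/-- The members of `e` are closed and have the displayed types. -/
def AllClosed (e : Closers) : Prop := ∀ p ∈ e, p.1.concl = some ⟨[], p.2⟩

/-- Cut `t : (ctx e) ⇒ τ` against all of `e`. -/
def close (τ : Ty) : Closers → PTree → PTree
  | [], t => t
  | (c, σ) :: e, t => close τ e (bin (.cut [] (ctx e) σ τ) c t)

@[simp] theorem ctx_nil : ctx [] = [] := rfl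

@[simp] theorem ctx_cons (p : PTree × Ty) (e : Closers) :
    ctx (p :: e) = (ctx e) ++ [p.2] := by simp [ctx]

@[simp] theorem ctx_append (d e : Closers) :
    ctx (d ++ e) = (ctx e) ++ (ctx d) := by simp [ctx]

theorem allClosed_cons {p : PTree × Ty} {e : Closers} :
    AllClosed (p :: e) ↔ p.1.concl = some ⟨[], p.2⟩ ∧ AllClosed e := List.forall_mem_cons

theorem allClosed_append {d e : Closers} : AllClosed (d ++ e) ↔ AllClosed d ∧ AllClosed e :=
  List.forall_mem_append

theorem Reduces.close {τ : Ty} {e : Closers} : ∀ {t t' : PTree}, Reduces t t' →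
    Reduces (close τ e t) (close τ e t') := by
  induction e with
  | nil => exact fun h => h
  | cons p e ih => exact fun h => ih h.bin_right

theorem concl_close {τ : Ty} {e : Closers} : ∀ {t : PTree}, t.concl = some ⟨(ctx e), τ⟩ →
    (close τ e t).concl = some ⟨[], τ⟩ := by
  induction e with
  | nil => exact fun h => h
  | cons p e ih => exact fun h => ih (by simp [PTree.concl, bin, Step.concl])

/-- If one of the two contexts is empty, the permutation that moves `Γ` behind `Δ` is the identity,
so no exchange is needed. -/
theorem inCut_last {Γ Δ : List Ty} {σ τ : Ty} {A B : PTree} (hA : A.concl = some ⟨Γ, σ⟩)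
    (hB : B.concl = some ⟨Δ ++ [σ], τ⟩) (h : Γ = [] ∨ Δ = []) :
    InCut Γ Δ [] σ τ A B (bin (.cut Γ Δ σ τ) A B) := by
  refine .mk (B' := B) hA hB ?_ ?_
  · have := Exs.nil hB
    simpa [List.range_succ] using this
  · have := Exs.nil (t := bin (.cut Γ Δ σ τ) A B) (S := ⟨Γ ++ Δ, τ⟩) rfl
    rcases h with rfl | rfl
    · simpa [List.range_eq_range'] using this
    · simpa using this

theorem exs_swap {Δ : List Ty} {σ ρ τ : Ty} {B : PTree} (hB : B.concl = some ⟨Δ ++ [σ, ρ], τ⟩) :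
    Exs (List.range Δ.length ++ [Δ.length + 1, Δ.length]) B (un (.exch Δ σ ρ [] τ) B) := by
  refine Exs.step (a := List.range Δ.length) ?_ hB (by simp)
  have := Exs.nil hB
  simpa [List.range_succ] using this

theorem inCut_snd {Δ : List Ty} {σ ρ τ : Ty} {A B : PTree} (hA : A.concl = some ⟨[], σ⟩)
    (hB : B.concl = some ⟨Δ ++ [σ, ρ], τ⟩) :
    InCut [] Δ [ρ] σ τ A B (bin (.cut [] (Δ ++ [ρ]) σ τ) A (un (.exch Δ σ ρ [] τ) B)) := by
  refine .mk (B' := un (.exch Δ σ ρ [] τ) B) hA (by simpa using hB) ?_ ?_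
  · simpa using exs_swap hB
  · have := Exs.nil (t := bin (.cut [] (Δ ++ [ρ]) σ τ) A (un (.exch Δ σ ρ [] τ) B))
      (S := ⟨[] ++ (Δ ++ [ρ]), τ⟩) rfl
    simpa [List.range_eq_range', List.range'_concat] using this

/-- Two opposite exchanges realise the identity permutation, as does the empty sequence of
exchanges. -/
theorem red_exch_exch {Δ : List Ty} {σ ρ τ : Ty} {B : PTree}
    (hB : B.concl = some ⟨Δ ++ [σ, ρ], τ⟩) :
    Red (un (.exch Δ ρ σ [] τ) (un (.exch Δ σ ρ [] τ) B)) B := by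
  have h₁ := Exs.nil hB
  refine Red.exs (p := List.range (Δ ++ [σ, ρ]).length) (t := B) ?_ h₁
  have := Exs.step (a := List.range Δ.length) (i := Δ.length + 1) (j := Δ.length) (b := [])
    (exs_swap hB) (Γ := Δ) (σ := ρ) (τ := σ) (Δ := []) (γ := τ) rfl (by simp)
  simpa [List.range_succ] using this

/-- Closing cuts have no context of their own, so they can be permuted, and an exchange below them
is undone by permuting the closers. -/
theorem reduces_close_exch {γ ρ σ : Ty} {a b : PTree} {g : Closers} (ha : a.concl = some ⟨[], ρ⟩)
    (_ : b.concl = some ⟨[], σ⟩) {d : Closers} : ∀ {t : PTree},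
    t.concl = some ⟨(ctx g) ++ σ :: ρ :: (ctx d), γ⟩ →
    Reduces (close γ (d ++ (b, σ) :: (a, ρ) :: g) (un (.exch (ctx g) σ ρ (ctx d) γ) t))
      (close γ (d ++ (a, ρ) :: (b, σ) :: g) t) := by
  induction d with
  | nil =>
    intro t ht
    simp only [List.nil_append, close, ctx_cons]
    -- Commuting the cut with `a` above the cut with `b` creates a second exchange, which cancels
    -- the given one.
    refine Reduces.close ((Red.comm_right_split₁ (R := fun Θ Ξ γ => .cut Θ Ξ σ γ) (Φ := [])
      (Γ := []) (Θ := []) (Δ₁ := (ctx g)) (Δ₂ := []) (.cut σ) (by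
        simpa using inCut_last (Γ := []) (Δ := (ctx g)) ha rfl (.inl rfl)) (by
        simpa using inCut_snd ha (B := un (.exch (ctx g) σ ρ [] γ) t) rfl)).reduces.trans ?_)
    simpa using (red_exch_exch ht).reduces.bin_right.bin_right
  | cons p d ih =>
    intro t ht
    obtain ⟨c, δ⟩ := p
    have h := Red.exch_right (Γ := []) (Δ₁ := (ctx g)) (Δ₂ := (ctx d)) (ρ := σ) (τ := ρ) (σ := δ)
      (γ := γ) (A := c) (B := t)
    simp only [List.cons_append, close, ctx_cons, ctx_append, List.append_assoc,
      List.nil_append] at h ⊢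
    exact (Reduces.close h.reduces).trans (ih (by simp [PTree.concl, bin, Step.concl]))

theorem reduces_close_cut_left {σ τ : Ty} {t₁ : PTree} (_ : t₁.concl = some ⟨[σ], τ⟩)
    {g : Closers} (hg : AllClosed g) : ∀ {t₀ : PTree}, t₀.concl = some ⟨(ctx g), σ⟩ →
    Reduces (close τ g (bin (.cut (ctx g) [] σ τ) t₀ t₁)) (bin (.cut [] [] σ τ) (close σ g t₀) t₁) := by
  induction g with
  | nil => intro t₀ _; exact .refl
  | cons p g ih =>
    intro t₀ h₀
    obtain ⟨c, δ⟩ := p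
    obtain ⟨hc, hg⟩ := allClosed_cons.1 hg
    rw [ctx_cons] at h₀
    have h := Red.comm_right_split₀ (R := fun Θ Ξ γ => .cut Θ Ξ σ γ) (Φ := []) (Φ' := [σ])
      (Γ := []) (Δ₁ := (ctx g)) (Δ₂ := []) (Ξ := []) (σ := δ) (τ := τ) (B₁ := t₁) (.cut σ) (by
        simpa using inCut_last (Γ := []) (Δ := (ctx g)) hc
          (B := bin (.cut ((ctx g) ++ [δ]) [] σ τ) t₀ t₁) (by simp [PTree.concl, bin, Step.concl])
          (.inl rfl))
      (by simpa using inCut_last (Γ := []) (Δ := (ctx g)) hc h₀ (.inl rfl))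
    simp only [close, ctx_cons, List.append_nil] at h ⊢
    exact (Reduces.close h.reduces).trans (ih hg (by simp [PTree.concl, bin, Step.concl]))

/-- The closers are pushed into the premiss that uses them: those of `Δ` first, then those of `Γ`.
The closed left premiss thereby becomes a closer itself. -/
theorem reduces_close_cut {σ τ : Ty} {g : Closers} (hg : AllClosed g) {t₀ : PTree}
    (h₀ : t₀.concl = some ⟨(ctx g), σ⟩) {d : Closers} (hd : AllClosed d) : ∀ {t₁ : PTree},
    t₁.concl = some ⟨(ctx d) ++ [σ], τ⟩ →
    Reduces (close τ (d ++ g) (bin (.cut (ctx g) (ctx d) σ τ) t₀ t₁))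
      (close τ ((close σ g t₀, σ) :: d) t₁) := by
  induction d with
  | nil => intro t₁ h₁; exact reduces_close_cut_left h₁ hg h₀
  | cons p d ih =>
    intro t₁ h₁
    obtain ⟨c, δ⟩ := p
    obtain ⟨hc, hd⟩ := allClosed_cons.1 hd
    have h₁' : t₁.concl = some ⟨(ctx d) ++ [δ, σ], τ⟩ := by simpa using h₁
    have h := Red.comm_right_split₁ (R := fun Θ Ξ γ => .cut Θ Ξ σ γ) (Φ := [])
      (Γ := []) (Θ := (ctx g)) (Δ₁ := (ctx d)) (Δ₂ := []) (B₀ := t₀) (.cut σ) (by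
        simpa using inCut_last (Γ := []) (Δ := (ctx g) ++ (ctx d)) hc
          (B := bin (.cut (ctx g) ((ctx d) ++ [δ]) σ τ) t₀ t₁) (by simp [PTree.concl, bin, Step.concl])
          (.inl rfl)) (by simpa using inCut_snd hc h₁')
    simp only [close, ctx_cons, List.append_nil, List.cons_append, ctx_append] at h ⊢
    -- The closer `c` ends up inside the cut on `σ`, with an exchange on top; one swap restores the
    -- order of the closers.
    refine (Reduces.close h.reduces).trans ((ih hd (by simp [PTree.concl, bin, Step.concl])).trans ?_)
    simpa [close] using reduces_close_exch (d := []) (concl_close h₀) hc h₁'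

theorem reduces_close_un {R : List Ty → Step} {γ γ' : Ty} (hR : UnaryRight R [] γ γ')
    {e : Closers} (he : AllClosed e) : ∀ {t : PTree}, t.concl = some ⟨(ctx e), γ'⟩ →
    Reduces (close γ e (un (R (ctx e)) t)) (un (R []) (close γ' e t)) := by
  induction e with
  | nil => intro t _; exact .refl
  | cons p e ih =>
    intro t ht
    obtain ⟨c, δ⟩ := p
    obtain ⟨hc, he⟩ := allClosed_cons.1 he
    rw [ctx_cons] at ht
    have h := Red.comm_right_unaryRight (Γ := []) (Δ₁ := (ctx e)) (Δ₂ := []) (A := c) (B := t) hR (by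
      simpa using inCut_last (Γ := []) (Δ := (ctx e)) hc (B := un (R ((ctx e) ++ [δ])) t)
        (by simp [PTree.concl, un, hR.sem.1]) (.inl rfl))
      (by simpa using inCut_last (Γ := []) (Δ := (ctx e)) hc ht (.inl rfl))
    simp only [close, ctx_cons, List.append_nil] at h ⊢
    exact (Reduces.close h.reduces).trans (ih he (by simp [PTree.concl, bin, Step.concl]))

/-- The body `u` under the abstraction is already closed except for its argument. Supplying the
argument commutes with the earlier closers, so it agrees with closing `t` outright. -/
theorem reduces_close_arrR {σ τ : Ty} {e : Closers} (he : AllClosed e) : ∀ {t : PTree},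
    t.concl = some ⟨(ctx e) ++ [σ], τ⟩ → ∃ u, u.concl = some ⟨[σ], τ⟩ ∧
      Reduces (close (.arr σ τ) e (un (.arrR (ctx e) σ τ) t)) (un (.arrR [] σ τ) u) ∧
      ∀ c, c.concl = some ⟨[], σ⟩ →
        Reduces (bin (.cut [] [] σ τ) c u) (close τ ((c, σ) :: e) t) := by
  induction e with
  | nil => intro t ht; exact ⟨t, ht, .refl, fun c _ => .refl⟩
  | cons p e ih =>
    intro t ht
    obtain ⟨c, δ⟩ := p
    obtain ⟨hc, he⟩ := allClosed_cons.1 he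
    have ht' : t.concl = some ⟨(ctx e) ++ [δ, σ], τ⟩ := by simpa using ht
    have h := Red.comm_right_unaryRight (Γ := []) (Δ₁ := (ctx e)) (Δ₂ := []) (A := c) (B := t)
      (.arrR σ τ) (by
        simpa using inCut_last (Γ := []) (Δ := (ctx e)) hc (B := un (.arrR ((ctx e) ++ [δ]) σ τ) t)
          (by simp [PTree.concl, un, Step.concl]) (.inl rfl))
      (by simpa using inCut_snd hc ht')
    simp only [close, ctx_cons, List.append_nil] at h ⊢
    obtain ⟨u, hu, h₁, h₂⟩ := ih he (t := bin (.cut [] ((ctx e) ++ [σ]) δ τ) c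
      (un (.exch (ctx e) δ σ [] τ) t)) (by simp [PTree.concl, bin, Step.concl])
    refine ⟨u, hu, (Reduces.close h.reduces).trans h₁, fun c' hc' => (h₂ c' hc').trans ?_⟩
    have := reduces_close_exch (d := []) (g := e) hc' hc ht'
    simpa [close] using this

theorem reduces_close_prodR_left {σ τ : Ty} {t₁ : PTree} {g : Closers} (hg : AllClosed g) :
    ∀ {t₀ : PTree}, t₀.concl = some ⟨(ctx g), σ⟩ →
    Reduces (close (.prod σ τ) g (bin (.prodR (ctx g) [] σ τ) t₀ t₁))
      (bin (.prodR [] [] σ τ) (close σ g t₀) t₁) := by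
  induction g with
  | nil => intro t₀ _; exact .refl
  | cons p g ih =>
    intro t₀ h₀
    obtain ⟨c, δ⟩ := p
    obtain ⟨hc, hg⟩ := allClosed_cons.1 hg
    rw [ctx_cons] at h₀
    have h := Red.comm_right_prodR₀
      (Γ := []) (Δ₁ := (ctx g)) (Δ₂ := []) (Ξ := []) (σ := δ) (ρ := σ) (τ := τ) (B₁ := t₁) (by
        simpa using inCut_last (Γ := []) (Δ := (ctx g)) hc
          (B := bin (.prodR ((ctx g) ++ [δ]) [] σ τ) t₀ t₁) (by simp [PTree.concl, bin, Step.concl])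
          (.inl rfl))
      (by simpa using inCut_last (Γ := []) (Δ := (ctx g)) hc h₀ (.inl rfl))
    simp only [close, ctx_cons, List.append_nil] at h ⊢
    exact (Reduces.close h.reduces).trans (ih hg (by simp [PTree.concl, bin, Step.concl]))

theorem reduces_close_prodR {σ τ : Ty} {g : Closers} (hg : AllClosed g) {t₀ : PTree}
    (h₀ : t₀.concl = some ⟨(ctx g), σ⟩) {d : Closers} (hd : AllClosed d) : ∀ {t₁ : PTree},
    t₁.concl = some ⟨(ctx d), τ⟩ →
    Reduces (close (.prod σ τ) (d ++ g) (bin (.prodR (ctx g) (ctx d) σ τ) t₀ t₁))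
      (bin (.prodR [] [] σ τ) (close σ g t₀) (close τ d t₁)) := by
  induction d with
  | nil => intro t₁ _; exact reduces_close_prodR_left hg h₀
  | cons p d ih =>
    intro t₁ h₁
    obtain ⟨c, δ⟩ := p
    obtain ⟨hc, hd⟩ := allClosed_cons.1 hd
    rw [ctx_cons] at h₁
    have h := Red.comm_right_prodR₁
      (Γ := []) (Θ := (ctx g)) (Δ₁ := (ctx d)) (Δ₂ := []) (ρ := σ) (τ := τ) (B₀ := t₀) (by
        simpa using inCut_last (Γ := []) (Δ := (ctx g) ++ (ctx d)) hc
          (B := bin (.prodR (ctx g) ((ctx d) ++ [δ]) σ τ) t₀ t₁) (by simp [PTree.concl, bin, Step.concl])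
          (.inl rfl)) (by simpa using inCut_last (Γ := []) (Δ := (ctx d)) hc h₁ (.inl rfl))
    simp only [close, ctx_cons, List.append_nil, List.cons_append,
      ctx_append] at h ⊢
    exact (Reduces.close h.reduces).trans (ih hd (by simp [PTree.concl, bin, Step.concl]))

-- Closing a left rule: bring the principal closer to head form, then contract.

section Left

variable {γ : Ty} {c : PTree} {g : Closers} {t t' : PTree}

theorem reduces_close_head {σ : Ty} {c' : PTree} (h : Reduces c c') :
    Reduces (close γ ((c, σ) :: g) t) (close γ ((c', σ) :: g) t) :=
  Reduces.close h.bin_left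

theorem reduces_close_id : c.concl = some ⟨[], γ⟩ → Reduces (close γ [(c, γ)] (leaf (.id γ))) c :=
  fun _ => Red.id_right.reduces

theorem reduces_close_wk {σ : Ty} (hc : c.concl = some ⟨[], σ⟩) :
    Reduces (close γ ((c, σ) :: g) (un (.wk (ctx g) σ γ) t)) (close γ g t) :=
  Reduces.close (Red.wk (inCut_last hc rfl (.inl rfl))).reduces

/-- A closer has an empty antecedent, so duplicating it leaves nothing to contract afterwards. -/
theorem reduces_close_ctr {σ : Ty} (hc : c.concl = some ⟨[], σ⟩)
    (ht : t.concl = some ⟨(ctx g) ++ [σ, σ], γ⟩) :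
    Reduces (close γ ((c, σ) :: g) (un (.ctr (ctx g) σ γ) t))
      (close γ ((c, σ) :: (c, σ) :: g) t) := by
  refine (Reduces.close (e := g) ?_).trans
    (by simpa [close] using reduces_close_exch (d := []) hc hc ht)
  exact (Red.ctr (inCut_last hc rfl (.inl rfl)) (inCut_snd hc ht)
    (by simpa using inCut_last hc (B := bin (.cut [] ((ctx g) ++ [σ]) σ γ) c
      (un (.exch (ctx g) σ σ [] γ) t)) rfl (.inl rfl)) .nil).reduces

theorem reduces_close_oneL (hc : Reduces c (leaf .oneR)) :
    Reduces (close γ ((c, .one) :: g) (un (.oneL (ctx g) γ) t)) (close γ g t) :=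
  (reduces_close_head hc).trans (Reduces.close Red.one.reduces)

theorem reduces_close_prodL {σ τ : Ty} {u v : PTree}
    (hc : Reduces c (bin (.prodR [] [] σ τ) u v)) (hu : u.concl = some ⟨[], σ⟩)
    (hv : v.concl = some ⟨[], τ⟩) (ht : t.concl = some ⟨(ctx g) ++ [σ, τ], γ⟩) :
    Reduces (close γ ((c, .prod σ τ) :: g) (un (.prodL (ctx g) σ τ γ) t))
      (close γ ((v, τ) :: (u, σ) :: g) t) := by
  refine (reduces_close_head hc).trans
    ((Reduces.close (e := g) ?_).trans
      (by simpa [close] using reduces_close_exch (d := []) hv hu ht))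
  exact (Red.prod (Γ₀ := []) (Γ₁ := []) (inCut_last rfl rfl (.inl rfl)) (inCut_snd hu ht)
    (by simpa using inCut_last hv (B := bin (.cut [] ((ctx g) ++ [τ]) σ γ) u
      (un (.exch (ctx g) σ τ [] γ) t)) rfl (.inl rfl))).reduces

theorem reduces_close_sumL₀ {σ τ : Ty} {u : PTree} (hc : Reduces c (un (.sumR₀ [] σ τ) u)) :
    Reduces (close γ ((c, .sum σ τ) :: g) (bin (.sumL (ctx g) σ τ γ) t t'))
      (close γ ((u, σ) :: g) t) :=
  (reduces_close_head hc).trans (Reduces.close Red.sum₀.reduces)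

theorem reduces_close_sumL₁ {σ τ : Ty} {u : PTree} (hc : Reduces c (un (.sumR₁ [] σ τ) u)) :
    Reduces (close γ ((c, .sum σ τ) :: g) (bin (.sumL (ctx g) σ τ γ) t t'))
      (close γ ((u, τ) :: g) t') :=
  (reduces_close_head hc).trans (Reduces.close Red.sum₁.reduces)

theorem reduces_close_muL {σ : Ty} {u : PTree} (hc : Reduces c (un (.muR [] σ) u)) :
    Reduces (close γ ((c, .mu σ) :: g) (un (.muL (ctx g) σ γ) t))
      (close γ ((u, σ.inst (.mu σ)) :: g) t) :=
  (reduces_close_head hc).trans (Reduces.close Red.mu.reduces)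

theorem reduces_close_nuL {σ : Ty} {u : PTree} (hc : Reduces c (un (.nuR [] σ) u)) :
    Reduces (close γ ((c, .nu σ) :: g) (un (.nuL (ctx g) σ γ) t))
      (close γ ((u, σ.inst (.nu σ)) :: g) t) :=
  (reduces_close_head hc).trans (Reduces.close Red.nu.reduces)

theorem reduces_close_natL₀ (hc : Reduces c (leaf .natR₀)) :
    Reduces (close γ ((c, .nat) :: g) (bin (.natL (ctx g) γ) t t')) (close γ g t) :=
  (reduces_close_head hc).trans (Reduces.close Red.nat₀.reduces)

theorem reduces_close_natL₁ {u : PTree} (hc : Reduces c (un (.natR₁ []) u)) :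
    Reduces (close γ ((c, .nat) :: g) (bin (.natL (ctx g) γ) t t'))
      (close γ ((u, .nat) :: g) t') :=
  (reduces_close_head hc).trans (Reduces.close Red.nat₁.reduces)

theorem reduces_close_arrL {σ τ : Ty} {u : PTree} {d : Closers} (hg : AllClosed g) (hd : AllClosed d)
    (hc : Reduces c (un (.arrR [] σ τ) u)) (hu : u.concl = some ⟨[σ], τ⟩)
    (ht : t.concl = some ⟨(ctx g), σ⟩) (ht' : t'.concl = some ⟨(ctx d) ++ [τ], γ⟩) :
    Reduces (close γ ((c, .arr σ τ) :: (d ++ g)) (bin (.arrL (ctx g) (ctx d) σ τ γ) t t'))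
      (close γ ((bin (.cut [] [] σ τ) (close σ g t) u, τ) :: d) t') := by
  refine (reduces_close_head hc).trans ?_
  have h := Red.arr (Γ := []) (Θ := (ctx g)) (Ξ := (ctx d)) (A := u) (B := t) (C := t') (γ := γ)
    (inCut_last (Δ := []) ht hu (.inr rfl))
  simp only [close, ctx_append, List.nil_append] at h ⊢
  refine (Reduces.close h.reduces).trans
    ((reduces_close_cut hg (by simp [PTree.concl, bin, Step.concl]) hd ht').trans ?_)
  exact Reduces.close (reduces_close_cut_left hu hg ht).bin_left

end Left

/-! ### Adequacy of the token semantics -/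

/-- The closed coderivation `c` of the given type computes a token. -/
def Real : Tok → Ty → PTree → Prop
  | .one, ρ, c => ρ = .one ∧ Reduces c (leaf .oneR)
  -- The recursion is on tokens and not on types, so unfolding `μ` and `ν` causes no circularity.
  -- The argument `s` is only asked to have the right conclusion.
  | .fn x y, ρ, c => ∃ σ τ d, ρ = .arr σ τ ∧ Reduces c (un (.arrR [] σ τ) d) ∧
      d.concl = some ⟨[σ], τ⟩ ∧ ∀ s, s.concl = some ⟨[], σ⟩ → (∀ z ∈ x, Real z σ s) →
        ∀ z ∈ y, Real z τ (bin (.cut [] [] σ τ) s d)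
  | .pair x y, ρ, c => ∃ σ τ u v, ρ = .prod σ τ ∧ Reduces c (bin (.prodR [] [] σ τ) u v) ∧
      u.concl = some ⟨[], σ⟩ ∧ v.concl = some ⟨[], τ⟩ ∧ (∀ z ∈ x, Real z σ u) ∧
        ∀ z ∈ y, Real z τ v
  | .inl x, ρ, c => ∃ σ τ u, ρ = .sum σ τ ∧ Reduces c (un (.sumR₀ [] σ τ) u) ∧
      u.concl = some ⟨[], σ⟩ ∧ ∀ z ∈ x, Real z σ u
  | .inr x, ρ, c => ∃ σ τ u, ρ = .sum σ τ ∧ Reduces c (un (.sumR₁ [] σ τ) u) ∧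
      u.concl = some ⟨[], τ⟩ ∧ ∀ z ∈ x, Real z τ u
  | .mu x, ρ, c => ∃ σ u, ρ = .mu σ ∧ Reduces c (un (.muR [] σ) u) ∧
      u.concl = some ⟨[], σ.inst (.mu σ)⟩ ∧ ∀ z ∈ x, Real z (σ.inst (.mu σ)) u
  | .nu x, ρ, c => ∃ σ u, ρ = .nu σ ∧ Reduces c (un (.nuR [] σ) u) ∧
      u.concl = some ⟨[], σ.inst (.nu σ)⟩ ∧ ∀ z ∈ x, Real z (σ.inst (.nu σ)) u
  | .zero, ρ, c => ρ = .nat ∧ Reduces c (leaf .natR₀)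
  | .succ x, ρ, c => ∃ u, ρ = .nat ∧ Reduces c (un (.natR₁ []) u) ∧
      u.concl = some ⟨[], .nat⟩ ∧ ∀ z ∈ x, Real z .nat u

/-- Each clause asks only for something that `c` reduces to. -/
theorem Real.expand {b : Tok} {ρ : Ty} {c c' : PTree} (h : Reduces c c') (hr : Real b ρ c') :
    Real b ρ c := by
  cases b <;> rw [Real] at hr ⊢
  case one => exact ⟨hr.1, h.trans hr.2⟩
  case zero => exact ⟨hr.1, h.trans hr.2⟩
  case fn => obtain ⟨σ, τ, d, h₁, h₂, h₃⟩ := hr; exact ⟨σ, τ, d, h₁, h.trans h₂, h₃⟩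
  case pair => obtain ⟨σ, τ, u, v, h₁, h₂, h₃⟩ := hr; exact ⟨σ, τ, u, v, h₁, h.trans h₂, h₃⟩
  case inl => obtain ⟨σ, τ, u, h₁, h₂, h₃⟩ := hr; exact ⟨σ, τ, u, h₁, h.trans h₂, h₃⟩
  case inr => obtain ⟨σ, τ, u, h₁, h₂, h₃⟩ := hr; exact ⟨σ, τ, u, h₁, h.trans h₂, h₃⟩
  case mu => obtain ⟨σ, u, h₁, h₂, h₃⟩ := hr; exact ⟨σ, u, h₁, h.trans h₂, h₃⟩
  case nu => obtain ⟨σ, u, h₁, h₂, h₃⟩ := hr; exact ⟨σ, u, h₁, h.trans h₂, h₃⟩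
  case succ => obtain ⟨u, h₁, h₂, h₃⟩ := hr; exact ⟨u, h₁, h.trans h₂, h₃⟩

@[simp] theorem un_sub (s : Step) (t : PTree) : (un s t).sub [false] = t := rfl

@[simp] theorem bin_sub_false (s : Step) (t u : PTree) : (bin s t u).sub [false] = t := rfl

@[simp] theorem bin_sub_true (s : Step) (t u : PTree) : (bin s t u).sub [true] = u := rfl

theorem ctx_eq_append {e : Closers} {Γ Δ : List Ty} (h : ctx e = Γ ++ Δ) :
    ∃ d g, e = d ++ g ∧ ctx d = Δ ∧ ctx g = Γ := by
  have h' : e.map Prod.snd = Δ.reverse ++ Γ.reverse := by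
    rw [← List.reverse_append, ← h, ctx, List.reverse_reverse]
  obtain ⟨d, g, rfl, h₁, h₂⟩ := List.map_eq_append_iff.1 h'
  exact ⟨d, g, rfl, by rw [ctx, h₁, List.reverse_reverse], by rw [ctx, h₂, List.reverse_reverse]⟩

theorem ctx_eq_nil {e : Closers} (h : ctx e = []) : e = [] := by
  simpa [ctx] using h

theorem ctx_eq_concat {e : Closers} {Γ : List Ty} {σ : Ty} (h : ctx e = Γ ++ [σ]) :
    ∃ c g, e = (c, σ) :: g ∧ ctx g = Γ := by
  obtain ⟨d, g, rfl, h₁, h₂⟩ := ctx_eq_append h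
  obtain ⟨⟨c, σ'⟩, rfl⟩ : ∃ p, d = [p] := by
    have := congrArg List.length h₁
    simp only [ctx, List.length_reverse, List.length_map, List.length_singleton] at this
    exact List.length_eq_one_iff.1 this
  obtain rfl : σ' = σ := by simpa [ctx] using h₁
  exact ⟨c, g, rfl, h₂⟩

theorem length_ctx (e : Closers) : (ctx e).length = e.length := by simp [ctx]

/-- Pointwise agreement of closed coderivations with an environment. -/
abbrev Models (V : Tok → Ty → PTree → Prop) : Closers → Env → Prop :=
  List.Forall₂ fun p a => ∀ z ∈ a, V z p.2 p.1

theorem Models.append {V : Tok → Ty → PTree → Prop} {d g : Closers} {E₀ E₁ : Env}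
    (h : Models V (d ++ g) (E₀ ++ E₁)) (hl : E₀.length = (ctx d).length) :
    Models V d E₀ ∧ Models V g E₁ := by
  rw [length_ctx] at hl
  have h₁ := List.forall₂_take E₀.length h
  have h₂ := List.forall₂_drop E₀.length h
  rw [List.take_left] at h₁
  rw [List.drop_left] at h₂
  rw [hl, List.take_left] at h₁
  rw [hl, List.drop_left] at h₂
  exact ⟨h₁, h₂⟩

/-- The fundamental lemma of the logical relation `Real`, by induction on the depth of the
computation. In each case the closing cuts reduce to closings of the premisses, and `Real.expand`
carries the conclusion back. The coderivation may be infinite and need not progress. -/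
theorem SemN.real {R : Step → Prop} {n : ℕ} : ∀ {t : PTree} {τ : Ty} {e : Closers} {E : Env}
    {b : Tok}, t.IsCoderivation R ⟨ctx e, τ⟩ → AllClosed e → Models Real e E → SemN n t E b →
    Real b τ (close τ e t) := by
  induction n with
  | zero => intro _ _ _ _ _ _ _ _ h; exact h.elim
  | succ n ih =>
    intro t τ e E b ht he hE ⟨s, hs, hlen, h⟩
    obtain ⟨s', hs', -, hconcl, ht'⟩ := ht.cases
    obtain rfl : s = s' := Option.some.inj (hs.symm.trans hs')
    clear hs hs' hlen ht
    rename' ht' => ht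
    cases s
    all_goals
      simp only [Step.prems, reduceCtorEq, false_and, List.cons.injEq, and_true, and_false,
        exists_false, true_and, or_false, false_or, exists_eq_left', exists_and_left,
        and_assoc] at ht
      simp only [Step.concl, Sequent.mk.injEq] at hconcl
      obtain ⟨hctx, hτ⟩ := hconcl
      replace hctx := hctx.symm
      subst hτ
    case id σ =>
      subst ht
      obtain ⟨a, rfl, hb⟩ := h
      obtain ⟨c, g, rfl, hg⟩ := ctx_eq_concat (Γ := []) hctx
      obtain rfl := ctx_eq_nil hg
      exact (((List.forall₂_cons.1 hE).1 b hb)).expand (reduces_close_id (allClosed_cons.1 he).1)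
    case oneR =>
      subst ht
      obtain rfl := ctx_eq_nil hctx
      obtain rfl := h
      rw [Real]; exact ⟨rfl, .refl⟩
    case natR₀ =>
      subst ht
      obtain rfl := ctx_eq_nil hctx
      obtain rfl := h
      rw [Real]; exact ⟨rfl, .refl⟩
    case exch Γ σ τ' Δ γ =>
      obtain ⟨t₀, rfl, ht₀⟩ := ht
      obtain ⟨d, x, y, g, rfl, hd, h⟩ := h
      obtain ⟨D, G, rfl, hD, hG⟩ := ctx_eq_append (Δ := Δ) (Γ := Γ ++ [τ'] ++ [σ]) (by simpa using hctx)
      obtain ⟨c, G', rfl, hG'⟩ := ctx_eq_concat hG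
      obtain ⟨c', G, rfl, rfl⟩ := ctx_eq_concat hG'
      subst hD
      obtain ⟨hE₁, hE₂⟩ := hE.append hd
      simp only [List.forall₂_cons] at hE₂
      have he' := allClosed_append.1 he
      simp only [allClosed_cons] at he'
      refine (ih (by simpa using ht₀) ?_ (List.rel_append hE₁ (.cons hE₂.2.1 (.cons hE₂.1 hE₂.2.2)))
        h).expand (reduces_close_exch he'.2.2.1 he'.2.1 ht₀.root)
      simp only [allClosed_append, allClosed_cons]
      exact ⟨he'.1, he'.2.2.1, he'.2.1, he'.2.2.2⟩
    case cut Γ Δ σ γ =>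
      obtain ⟨t₀, t₁, rfl, ht₀, ht₁⟩ := ht
      obtain ⟨d, g, a, rfl, hd, h₀, h₁⟩ := h
      obtain ⟨D, G, rfl, rfl, rfl⟩ := ctx_eq_append hctx
      obtain ⟨hE₁, hE₂⟩ := hE.append hd
      obtain ⟨heD, heG⟩ := allClosed_append.1 he
      refine (ih (e := (close σ G t₀, σ) :: D) (by simpa using ht₁) (allClosed_cons.2
        ⟨concl_close ht₀.root, heD⟩) (.cons (fun z hz => ih ht₀ heG hE₂ (h₀ z hz)) hE₁) h₁).expand
        (reduces_close_cut heG ht₀.root heD ht₁.root)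
    case wk Γ σ γ =>
      obtain ⟨t₀, rfl, ht₀⟩ := ht
      obtain ⟨a, g, rfl, h⟩ := h
      obtain ⟨c, G, rfl, rfl⟩ := ctx_eq_concat hctx
      simp only [List.forall₂_cons, allClosed_cons] at hE he
      exact (ih ht₀ he.2 hE.2 h).expand (reduces_close_wk he.1)
    case ctr Γ σ γ =>
      obtain ⟨t₀, rfl, ht₀⟩ := ht
      obtain ⟨a, g, rfl, h⟩ := h
      obtain ⟨c, G, rfl, rfl⟩ := ctx_eq_concat hctx
      simp only [List.forall₂_cons, allClosed_cons] at hE he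
      exact (ih (e := (c, σ) :: (c, σ) :: G) (by simpa using ht₀) (by simpa [allClosed_cons] using he)
        (.cons hE.1 (.cons hE.1 hE.2)) h).expand (reduces_close_ctr he.1 ht₀.root)
    case oneL Γ γ =>
      obtain ⟨t₀, rfl, ht₀⟩ := ht
      obtain ⟨a, g, rfl, ha, h⟩ := h
      obtain ⟨c, G, rfl, rfl⟩ := ctx_eq_concat hctx
      simp only [List.forall₂_cons, allClosed_cons] at hE he
      have hc := hE.1 _ ha
      rw [Real] at hc
      exact (ih ht₀ he.2 hE.2 h).expand (reduces_close_oneL hc.2)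
    case arrR Γ σ τ =>
      obtain ⟨t₀, rfl, ht₀⟩ := ht
      obtain ⟨x, y, rfl, h⟩ := h
      subst hctx
      obtain ⟨u, hu, h₁, h₂⟩ := reduces_close_arrR he ht₀.root
      rw [Real]
      exact ⟨σ, τ, u, rfl, h₁, hu, fun s hs hx z hz => (ih (by simpa using ht₀)
        (allClosed_cons.2 ⟨hs, he⟩) (.cons hx hE) (h z hz)).expand (h₂ s hs)⟩
    case arrL Γ Δ σ τ γ =>
      obtain ⟨t₀, t₁, rfl, ht₀, ht₁⟩ := ht
      obtain ⟨f, d, g, x, y, rfl, hd, hf, h₀, h₁⟩ := h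
      obtain ⟨c, G, rfl, hG⟩ := ctx_eq_concat hctx
      obtain ⟨D, G, rfl, rfl, rfl⟩ := ctx_eq_append hG
      simp only [List.forall₂_cons, allClosed_cons] at hE he
      have hc := hE.1 _ hf
      rw [Real] at hc
      obtain ⟨σ', τ', u, heq, hcu, hu, hc⟩ := hc
      obtain ⟨rfl, rfl⟩ := Ty.arr.inj heq
      obtain ⟨hE₁, hE₂⟩ := Models.append hE.2 hd
      obtain ⟨heD, heG⟩ := allClosed_append.1 he.2
      exact (ih (e := (bin (.cut [] [] σ τ) (close σ G t₀) u, τ) :: D) (by simpa using ht₁)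
        (allClosed_cons.2 ⟨rfl, heD⟩) (.cons (hc _ (concl_close ht₀.root)
          fun z hz => ih ht₀ heG hE₂ (h₀ z hz)) hE₁) h₁).expand
        (reduces_close_arrL heG heD hcu hu ht₀.root ht₁.root)
    case prodR Γ Δ σ τ =>
      obtain ⟨t₀, t₁, rfl, ht₀, ht₁⟩ := ht
      obtain ⟨d, g, x, y, rfl, hd, rfl, h₀, h₁⟩ := h
      obtain ⟨D, G, rfl, rfl, rfl⟩ := ctx_eq_append hctx
      obtain ⟨hE₁, hE₂⟩ := hE.append hd
      obtain ⟨heD, heG⟩ := allClosed_append.1 he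
      rw [Real]
      exact ⟨σ, τ, _, _, rfl, reduces_close_prodR heG ht₀.root heD ht₁.root,
        concl_close ht₀.root, concl_close ht₁.root, fun z hz => ih ht₀ heG hE₂ (h₀ z hz),
        fun z hz => ih ht₁ heD hE₁ (h₁ z hz)⟩
    case prodL Γ σ τ' γ =>
      obtain ⟨t₀, rfl, ht₀⟩ := ht
      obtain ⟨a, g, x, y, rfl, ha, h⟩ := h
      obtain ⟨c, G, rfl, rfl⟩ := ctx_eq_concat hctx
      simp only [List.forall₂_cons, allClosed_cons] at hE he
      have hc := hE.1 _ ha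
      rw [Real] at hc
      obtain ⟨σ', τ'', u, v, heq, hcu, hu, hv, hx, hy⟩ := hc
      obtain ⟨rfl, rfl⟩ := Ty.prod.inj heq
      exact (ih (e := (v, τ') :: (u, σ) :: G) (by simpa using ht₀)
        (allClosed_cons.2 ⟨hv, allClosed_cons.2 ⟨hu, he.2⟩⟩) (.cons hy (.cons hx hE.2)) h).expand
        (reduces_close_prodL hcu hu hv ht₀.root)
    case sumR₀ Γ σ τ =>
      obtain ⟨t₀, rfl, ht₀⟩ := ht
      obtain ⟨x, rfl, h⟩ := h
      subst hctx
      rw [Real]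
      exact ⟨σ, τ, _, rfl, reduces_close_un (.sumR₀ σ τ) he ht₀.root, concl_close ht₀.root,
        fun z hz => ih ht₀ he hE (h z hz)⟩
    case sumR₁ Γ σ τ =>
      obtain ⟨t₀, rfl, ht₀⟩ := ht
      obtain ⟨x, rfl, h⟩ := h
      subst hctx
      rw [Real]
      exact ⟨σ, τ, _, rfl, reduces_close_un (.sumR₁ σ τ) he ht₀.root, concl_close ht₀.root,
        fun z hz => ih ht₀ he hE (h z hz)⟩
    case muR Γ σ =>
      obtain ⟨t₀, rfl, ht₀⟩ := ht
      obtain ⟨x, rfl, h⟩ := h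
      subst hctx
      rw [Real]
      exact ⟨σ, _, rfl, reduces_close_un (.muR σ) he ht₀.root, concl_close ht₀.root,
        fun z hz => ih ht₀ he hE (h z hz)⟩
    case nuR Γ σ =>
      obtain ⟨t₀, rfl, ht₀⟩ := ht
      obtain ⟨x, rfl, h⟩ := h
      subst hctx
      rw [Real]
      exact ⟨σ, _, rfl, reduces_close_un (.nuR σ) he ht₀.root, concl_close ht₀.root,
        fun z hz => ih ht₀ he hE (h z hz)⟩
    case natR₁ Γ =>
      obtain ⟨t₀, rfl, ht₀⟩ := ht
      obtain ⟨x, rfl, h⟩ := h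
      subst hctx
      rw [Real]
      exact ⟨_, rfl, reduces_close_un .natR₁ he ht₀.root, concl_close ht₀.root,
        fun z hz => ih ht₀ he hE (h z hz)⟩
    case muL Γ σ γ =>
      obtain ⟨t₀, rfl, ht₀⟩ := ht
      obtain ⟨a, g, x, rfl, ha, h⟩ := h
      obtain ⟨c, G, rfl, rfl⟩ := ctx_eq_concat hctx
      simp only [List.forall₂_cons, allClosed_cons] at hE he
      have hc := hE.1 _ ha
      rw [Real] at hc
      obtain ⟨σ', u, heq, hcu, hu, hx⟩ := hc
      obtain rfl := Ty.mu.inj heq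
      exact (ih (e := (u, σ.inst (.mu σ)) :: G) (by simpa using ht₀)
        (allClosed_cons.2 ⟨hu, he.2⟩) (.cons hx hE.2) h).expand (reduces_close_muL hcu)
    case nuL Γ σ γ =>
      obtain ⟨t₀, rfl, ht₀⟩ := ht
      obtain ⟨a, g, x, rfl, ha, h⟩ := h
      obtain ⟨c, G, rfl, rfl⟩ := ctx_eq_concat hctx
      simp only [List.forall₂_cons, allClosed_cons] at hE he
      have hc := hE.1 _ ha
      rw [Real] at hc
      obtain ⟨σ', u, heq, hcu, hu, hx⟩ := hc
      obtain rfl := Ty.nu.inj heq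
      exact (ih (e := (u, σ.inst (.nu σ)) :: G) (by simpa using ht₀)
        (allClosed_cons.2 ⟨hu, he.2⟩) (.cons hx hE.2) h).expand (reduces_close_nuL hcu)
    case sumL Γ σ τ' γ =>
      obtain ⟨t₀, t₁, rfl, ht₀, ht₁⟩ := ht
      obtain ⟨a, g, rfl, h⟩ := h
      obtain ⟨c, G, rfl, rfl⟩ := ctx_eq_concat hctx
      simp only [List.forall₂_cons, allClosed_cons] at hE he
      obtain ⟨x, ha, h⟩ | ⟨x, ha, h⟩ := h
      · have hc := hE.1 _ ha
        rw [Real] at hc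
        obtain ⟨σ', τ'', u, heq, hcu, hu, hx⟩ := hc
        obtain ⟨rfl, rfl⟩ := Ty.sum.inj heq
        exact (ih (e := (u, _) :: G) (by simpa using ht₀) (allClosed_cons.2 ⟨hu, he.2⟩)
          (.cons hx hE.2) h).expand (reduces_close_sumL₀ hcu)
      · have hc := hE.1 _ ha
        rw [Real] at hc
        obtain ⟨σ', τ'', u, heq, hcu, hu, hx⟩ := hc
        obtain ⟨rfl, rfl⟩ := Ty.sum.inj heq
        exact (ih (e := (u, _) :: G) (by simpa using ht₁) (allClosed_cons.2 ⟨hu, he.2⟩)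
          (.cons hx hE.2) h).expand (reduces_close_sumL₁ hcu)
    case natL Γ γ =>
      obtain ⟨t₀, t₁, rfl, ht₀, ht₁⟩ := ht
      obtain ⟨a, g, rfl, h⟩ := h
      obtain ⟨c, G, rfl, rfl⟩ := ctx_eq_concat hctx
      simp only [List.forall₂_cons, allClosed_cons] at hE he
      obtain ⟨ha, h⟩ | ⟨x, ha, h⟩ := h
      · have hc := hE.1 _ ha
        rw [Real] at hc
        exact (ih ht₀ he.2 hE.2 h).expand (reduces_close_natL₀ hc.2)
      · have hc := hE.1 _ ha
        rw [Real] at hc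
        obtain ⟨u, heq, hcu, hu, hx⟩ := hc
        exact (ih (e := (u, Ty.nat) :: G) (by simpa using ht₁)
          (allClosed_cons.2 ⟨hu, he.2⟩) (.cons hx hE.2) h).expand (reduces_close_natL₁ hcu)

theorem Sem.real {R : Step → Prop} {t : PTree} {τ : Ty} {e : Closers} {E : Env} {b : Tok}
    (ht : t.IsCoderivation R ⟨ctx e, τ⟩) (he : AllClosed e) (hE : Models Real e E)
    (h : Sem t E b) : Real b τ (close τ e t) :=
  let ⟨_, h⟩ := h; h.real ht he hE

/-! ### Unfolding systems of tree fragments -/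

/-- Finite tree fragments, with holes labelled by `U`. -/
inductive Frag (U : Type) : Type
  | hole (u : U)
  | leaf (s : Step)
  | un (s : Step) (f : Frag U)
  | bin (s : Step) (f f' : Frag U)

namespace Frag

variable {U V : Type}

/-- Relabelling of holes. -/
def map (h : U → V) : Frag U → Frag V
  | hole u => hole (h u)
  | leaf s => leaf s
  | un s f => un s (f.map h)
  | bin s f f' => bin s (f.map h) (f'.map h)

/-- Being more than a hole. -/
def IsProper : Frag U → Prop
  | hole _ => False
  | _ => True

/-- Unfold a hole once. -/
def expand (g : U → Frag U) : Frag U → Frag U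
  | hole u => g u
  | f => f

/-- The label of the root. -/
def label : Frag U → Option Step
  | hole _ => none
  | leaf s => some s
  | un s _ => some s
  | bin s _ _ => some s

/-- The child in the given direction. -/
def child : Bool → Frag U → Option (Frag U)
  | false, un _ f => some f
  | false, bin _ f _ => some f
  | true, bin _ _ f => some f
  | _, _ => none

/-- The tree obtained by unfolding holes according to `g`. -/
def graft (g : U → Frag U) (f : Frag U) : PTree
  | [] => (f.expand g).label
  | b :: α => match (f.expand g).child b with
    | none => none
    | some f' => graft g f' α

variable {g : U → Frag U}

theorem graft_leaf (s : Step) : graft g (leaf s) = PTree.leaf s := by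
  funext α
  rcases α with _ | ⟨_ | _, α⟩ <;> rfl

theorem graft_un (s : Step) (f : Frag U) : graft g (un s f) = PTree.un s (graft g f) := by
  funext α
  rcases α with _ | ⟨_ | _, α⟩ <;> rfl

theorem graft_bin (s : Step) (f f' : Frag U) :
    graft g (bin s f f') = PTree.bin s (graft g f) (graft g f') := by
  funext α
  rcases α with _ | ⟨_ | _, α⟩ <;> rfl

/-- Unfolding happens once per node, so the equation relies on `g u` having a root label of its own;
properness is the guardedness condition. -/
theorem graft_hole (hg : ∀ u, (g u).IsProper) (u : U) : graft g (hole u) = graft g (g u) := by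
  have h : (g u).expand g = (hole u).expand g := by
    have := hg u
    show expand g (g u) = g u
    cases h : g u <;> simp_all [IsProper, expand]
  funext α
  rcases α with _ | ⟨b, α⟩ <;> rw [graft, graft, h]

/-- `f.Concludes R T S`: `f` is a fragment of a coderivation of `S`, where `T` says which sequents
the holes conclude. -/
def Concludes (R : Step → Prop) (T : U → Sequent → Prop) : Frag U → Sequent → Prop
  | hole u, S => T u S
  | leaf s, S => R s ∧ s.concl = S ∧ s.prems = []
  | un s f, S => R s ∧ s.concl = S ∧ ∃ S₀, s.prems = [S₀] ∧ f.Concludes R T S₀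
  | bin s f f', S => R s ∧ s.concl = S ∧ ∃ S₀ S₁, s.prems = [S₀, S₁] ∧ f.Concludes R T S₀ ∧
      f'.Concludes R T S₁

/-- The invariant `T` plays the part of a coinduction hypothesis: local correctness of every
fragment relative to `T` gives correctness at every address. -/
theorem Concludes.isCoderivation {R : Step → Prop} {T : U → Sequent → Prop}
    (hg : ∀ u, (g u).IsProper) (hT : ∀ u S, T u S → (g u).Concludes R T S) {f : Frag U}
    {S : Sequent} (hf : f.Concludes R T S) : (graft g f).IsCoderivation R S := by
  have root : ∀ {f : Frag U} {S}, f.Concludes R T S → ∃ s, graft g f [] = some s ∧ R s ∧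
      s.concl = S ∧ ∀ b, (s.prem b = none ∧ ∀ α, graft g f (b :: α) = none) ∨
        ∃ S' f', s.prem b = some S' ∧ f'.Concludes R T S' ∧
          ∀ α, graft g f (b :: α) = graft g f' α := by
    have proper : ∀ {f : Frag U} {S}, f.IsProper → f.Concludes R T S → ∃ s, graft g f [] = some s ∧
        R s ∧ s.concl = S ∧ ∀ b, (s.prem b = none ∧ ∀ α, graft g f (b :: α) = none) ∨
        ∃ S' f', s.prem b = some S' ∧ f'.Concludes R T S' ∧
          ∀ α, graft g f (b :: α) = graft g f' α := by
      intro f S hp hf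
      rcases f with u | s | ⟨s, f⟩ | ⟨s, f, f'⟩
      · exact hp.elim
      · obtain ⟨h₁, h₂, h₃⟩ := hf
        exact ⟨s, rfl, h₁, h₂, fun b => .inl ⟨by simp [Step.prem, h₃], fun α => by
          cases b <;> rfl⟩⟩
      · obtain ⟨h₁, h₂, S₀, h₃, h₄⟩ := hf
        refine ⟨s, rfl, h₁, h₂, fun b => ?_⟩
        cases b
        · exact .inr ⟨S₀, f, by simp [Step.prem, h₃], h₄, fun _ => rfl⟩
        · exact .inl ⟨by simp [Step.prem, h₃], fun _ => rfl⟩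
      · obtain ⟨h₁, h₂, S₀, S₁, h₃, h₄, h₅⟩ := hf
        refine ⟨s, rfl, h₁, h₂, fun b => ?_⟩
        cases b
        · exact .inr ⟨S₀, f, by simp [Step.prem, h₃], h₄, fun _ => rfl⟩
        · exact .inr ⟨S₁, f', by simp [Step.prem, h₃], h₅, fun _ => rfl⟩
    intro f S hf
    rcases f with u | s | ⟨s, f⟩ | ⟨s, f, f'⟩
    · rw [graft_hole hg]; exact proper (hg u) (hT u S hf)
    all_goals exact proper trivial hf
  have main : ∀ α {f : Frag U} {S}, f.Concludes R T S → (∀ s, graft g f α = some s → R s ∧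
      ∀ b, (graft g f (α ++ [b])).map Step.concl = s.prem b) ∧
      (graft g f α = none → ∀ b, graft g f (α ++ [b]) = none) := by
    intro α
    induction α with
    | nil =>
      intro f S hf
      obtain ⟨s, h₁, h₂, h₃, h₄⟩ := root hf
      refine ⟨fun s' hs' => ?_, fun h => by simp [h₁] at h⟩
      obtain rfl := Option.some.inj (h₁.symm.trans hs')
      refine ⟨h₂, fun b => ?_⟩
      rcases h₄ b with ⟨h, h'⟩ | ⟨S', f', h, h', h''⟩
      · rw [List.nil_append, h', h]; rfl
      · obtain ⟨s', h₅, -, h₆, -⟩ := root h'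
        rw [List.nil_append, h'', h₅, h, Option.map_some, h₆]
    | cons b α ih =>
      intro f S hf
      obtain ⟨s, h₁, h₂, h₃, h₄⟩ := root hf
      rcases h₄ b with ⟨h, h'⟩ | ⟨S', f', h, h', h''⟩
      · exact ⟨fun s hs => by simp [h'] at hs, fun _ b' => h' _⟩
      · simpa only [List.cons_append, h''] using ih h'
  obtain ⟨s, h₁, h₂, h₃, -⟩ := root hf
  exact ⟨by rw [PTree.concl, h₁, Option.map_some, h₃], fun α s hs => ((main α hf).1 s hs).2,
    fun α => (main α hf).2, fun α s hs => ((main α hf).1 s hs).1⟩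

/-- All fragments inside a fragment. -/
def subs : Frag U → Set (Frag U)
  | hole u => {hole u}
  | leaf s => {leaf s}
  | un s f => insert (un s f) f.subs
  | bin s f f' => insert (bin s f f') (f.subs ∪ f'.subs)

/-- The labels of holes. -/
def holes : Frag U → Set U
  | hole u => {u}
  | leaf _ => ∅
  | un _ f => f.holes
  | bin _ f f' => f.holes ∪ f'.holes

theorem finite_subs (f : Frag U) : f.subs.Finite := by
  induction f with
  | hole u => exact Set.finite_singleton _
  | leaf s => exact Set.finite_singleton _
  | un s f ih => exact ih.insert _
  | bin s f f' ih ih' => exact (ih.union ih').insert _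

theorem self_mem_subs (f : Frag U) : f ∈ f.subs := by
  cases f <;> simp [subs]

theorem child_mem_subs {f f' : Frag U} {b : Bool} (h : f.child b = some f') :
    ∀ {d : Frag U}, f ∈ d.subs → f' ∈ d.subs := by
  intro d
  induction d with
  | hole u => rintro rfl; cases b <;> simp [child] at h
  | leaf s => rintro rfl; cases b <;> simp [child] at h
  | un s d ih =>
    rintro (rfl | hd)
    · cases b
      · obtain rfl := Option.some.inj h
        exact .inr (self_mem_subs _)
      · simp [child] at h
    · exact .inr (ih hd)
  | bin s d d' ih ih' =>
    rintro (rfl | hd | hd)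
    · cases b
      · obtain rfl := Option.some.inj h
        exact .inr (.inl (self_mem_subs _))
      · obtain rfl := Option.some.inj h
        exact .inr (.inr (self_mem_subs _))
    · exact .inr (.inl (ih hd))
    · exact .inr (.inr (ih' hd))

theorem holes_of_mem_subs {u : U} : ∀ {d : Frag U}, hole u ∈ d.subs → u ∈ d.holes := by
  intro d
  induction d with
  | hole v => rintro h; simpa [subs, holes] using h
  | leaf s => rintro h; simp [subs] at h
  | un s d ih => rintro (h | h); · simp at h
                 · exact ih h
  | bin s d d' ih ih' => rintro (h | h | h); · simp at h
                         · exact .inl (ih h)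
                         · exact .inr (ih' h)

end Frag

-- Regularity of unfolded systems.

theorem PTree.Regular.of_finite {F : Set PTree} (hF : F.Finite)
    (h : ∀ t ∈ F, ∀ b, t [b] ≠ none → t.sub [b] ∈ F) {t : PTree}
    (hc : ∀ α, t α = none → ∀ b, t (α ++ [b]) = none) (ht : t ∈ F) : t.Regular := by
  have key : ∀ α, t α ≠ none → t.sub α ∈ F := by
    intro α
    induction α using List.reverseRecOn with
    | nil => exact fun _ => ht
    | append_singleton α b ih =>
      intro hα
      have h₁ := h _ (ih fun h' => hα (hc _ h' _)) b hα
      have h₂ : t.sub (α ++ [b]) = (t.sub α).sub [b] := by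
        funext β; simp [PTree.sub]
      rwa [h₂]
  refine hF.subset ?_
  rintro u ⟨α, hα, rfl⟩
  exact key α hα

/-- Every subtree is the unfolding of a piece of some `g u` with `u ∈ A`, or of the initial hole,
and there are finitely many such pieces. -/
theorem Frag.regular_graft {U : Type} {g : U → Frag U} {A : Set U} (hA : A.Finite)
    (h : ∀ u ∈ A, (g u).holes ⊆ A) {u : U} (hu : u ∈ A)
    (hc : ∀ α, graft g (hole u) α = none → ∀ b, graft g (hole u) (α ++ [b]) = none) :
    (graft g (hole u)).Regular := by
  refine .of_finite (F := graft g '' (hole '' A ∪ ⋃ u ∈ A, (g u).subs))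
    (((hA.image _).union (hA.biUnion fun u _ => finite_subs _)).image _) ?_ hc
    ⟨_, .inl ⟨u, hu, rfl⟩, rfl⟩
  rintro _ ⟨f, hf, rfl⟩ b hb
  obtain ⟨f', hf'⟩ : ∃ f', (f.expand g).child b = some f' := by
    cases h : (f.expand g).child b with
    | some f' => exact ⟨f', rfl⟩
    | none => simp [graft, h] at hb
  have h₁ : (graft g f).sub [b] = graft g f' := by
    funext α
    show graft g f (b :: α) = _
    rw [graft, hf']
  rw [h₁]
  refine Set.mem_image_of_mem _ (.inr ?_)
  -- A piece that is a hole is replaced by its own fragment, whose label is again in `A`.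
  have : ∃ u ∈ A, f.expand g ∈ (g u).subs := by
    rcases hf with ⟨u, hu, rfl⟩ | hf
    · exact ⟨u, hu, self_mem_subs _⟩
    · obtain ⟨u, hu, hf⟩ := Set.mem_iUnion₂.1 hf
      rcases f with v | s | ⟨s, f⟩ | ⟨s, f₀, f₁⟩
      · exact ⟨v, h u hu (holes_of_mem_subs hf), self_mem_subs _⟩
      all_goals exact ⟨u, hu, hf⟩
  obtain ⟨u, hu, hf⟩ := this
  exact Set.mem_iUnion₂.2 ⟨u, hu, child_mem_subs hf' hf⟩

/-! ### Tokens computed by fragments -/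

namespace Frag

variable {U : Type}

/-- The meaning of a fragment, given the meanings of its holes. -/
def Sem (H : U → Env → Tok → Prop) : Frag U → Env → Tok → Prop
  | hole u, e, b => H u e b
  | leaf s, e, b => e.length = s.concl.ant.length ∧
      SemStep s (fun _ _ => False) (fun _ _ => False) e b
  | un s f, e, b => e.length = s.concl.ant.length ∧ SemStep s (f.Sem H) (fun _ _ => False) e b
  | bin s f f', e, b => e.length = s.concl.ant.length ∧ SemStep s (f.Sem H) (f'.Sem H) e b

theorem Sem.mono {H H' : U → Env → Tok → Prop} (hH : ∀ u e b, H u e b → H' u e b) :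
    ∀ {f : Frag U} {e : Env} {b : Tok}, f.Sem H e b → f.Sem H' e b
  | hole u, _, _, h => hH u _ _ h
  | leaf _, _, _, h => h
  | un _ _, _, _, h => ⟨h.1, h.2.mono (fun _ _ => Sem.mono hH) fun _ _ h => h⟩
  | bin _ _ _, _, _, h => ⟨h.1, h.2.mono (fun _ _ => Sem.mono hH) fun _ _ => Sem.mono hH⟩

theorem Sem.graft {g : U → Frag U} : ∀ {f : Frag U} {e : Env} {b : Tok},
    f.Sem (fun u => CircMuLJ.Sem (graft g (hole u))) e b → CircMuLJ.Sem (graft g f) e b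
  | hole _, _, _, h => h
  | leaf _, _, _, h => by
    rw [graft_leaf, sem_leaf]
    exact ⟨h.1, h.2.mono (fun _ _ h => h.elim) fun _ _ h => h.elim⟩
  | un _ _, _, _, h => by
    rw [graft_un, sem_un]
    exact ⟨h.1, h.2.mono (fun _ _ => Sem.graft) fun _ _ h => h.elim⟩
  | bin _ _ _, _, _, h => by
    rw [graft_bin, sem_bin]
    exact ⟨h.1, h.2.mono (fun _ _ => Sem.graft) fun _ _ => Sem.graft⟩

theorem semN_none {n : ℕ} {e : Env} {b : Tok} : ¬ SemN n (fun _ => none) e b := by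
  rcases n with _ | n
  · exact id
  · rintro ⟨s, hs, -⟩; cases hs

/-- The depth bound is not lowered on the way to the holes; this loses information but also covers a
bare hole. -/
theorem sem_of_semN {g : U → Frag U} {n : ℕ} : ∀ {f : Frag U} {e : Env} {b : Tok},
    SemN n (graft g f) e b → f.Sem (fun u => SemN n (graft g (hole u))) e b
  | hole _, _, _, h => h
  | leaf s, _, _, h => by
    rcases n with _ | n
    · exact h.elim
    · rw [graft_leaf] at h
      obtain ⟨s', hs, h₁, h₂⟩ := h
      obtain rfl := Option.some.inj hs
      exact ⟨h₁, h₂.mono (fun _ _ => semN_none) fun _ _ => semN_none⟩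
  | un s f, e, b, h => by
    rcases n with _ | n
    · exact h.elim
    · rw [graft_un] at h
      obtain ⟨s', hs, h₁, h₂⟩ := h
      obtain rfl := Option.some.inj hs
      exact ⟨h₁, h₂.mono (fun _ _ h => sem_of_semN h.succ_mono) fun _ _ => semN_none⟩
  | bin s f f', e, b, h => by
    rcases n with _ | n
    · exact h.elim
    · rw [graft_bin] at h
      obtain ⟨s', hs, h₁, h₂⟩ := h
      obtain rfl := Option.some.inj hs
      exact ⟨h₁, h₂.mono (fun _ _ h => sem_of_semN h.succ_mono)
        fun _ _ h => sem_of_semN h.succ_mono⟩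

/-- A proper fragment has at least one step, so its holes are reached with strictly smaller depth.
Inductions over unfolded trees rest on this decrease. -/
theorem sem_of_semN_succ {g : U → Frag U} (hg : ∀ u, (g u).IsProper) {n : ℕ} {u : U} {e : Env}
    {b : Tok} (h : SemN (n + 1) (graft g (hole u)) e b) :
    (g u).Sem (fun u => SemN n (graft g (hole u))) e b := by
  rw [graft_hole hg] at h
  have hp := hg u
  revert h hp
  rcases g u with u | s | ⟨s, f⟩ | ⟨s, f, f'⟩
  · exact fun _ h => h.elim
  · intro h _
    rw [graft_leaf] at h
    obtain ⟨s', hs, h₁, h₂⟩ := h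
    obtain rfl := Option.some.inj hs
    exact ⟨h₁, h₂.mono (fun _ _ => semN_none) fun _ _ => semN_none⟩
  · intro h _
    rw [graft_un] at h
    obtain ⟨s', hs, h₁, h₂⟩ := h
    obtain rfl := Option.some.inj hs
    exact ⟨h₁, h₂.mono (fun _ _ => sem_of_semN) fun _ _ => semN_none⟩
  · intro h _
    rw [graft_bin] at h
    obtain ⟨s', hs, h₁, h₂⟩ := h
    obtain rfl := Option.some.inj hs
    exact ⟨h₁, h₂.mono (fun _ _ => sem_of_semN) fun _ _ => sem_of_semN⟩

theorem Sem.map {V : Type} {H : V → Env → Tok → Prop} {h : U → V} :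
    ∀ {f : Frag U} {e : Env} {b : Tok}, (f.map h).Sem H e b ↔ f.Sem (fun u => H (h u)) e b
  | hole _, _, _ => Iff.rfl
  | leaf _, _, _ => Iff.rfl
  | un s f, e, b => by
    have : (f.map h).Sem H = f.Sem fun u => H (h u) := by funext e b; exact propext Sem.map
    rw [Frag.map, Sem, Sem, this]
  | bin s f f', e, b => by
    have h₁ : (f.map h).Sem H = f.Sem fun u => H (h u) := by funext e b; exact propext Sem.map
    have h₂ : (f'.map h).Sem H = f'.Sem fun u => H (h u) := by funext e b; exact propext Sem.map
    rw [Frag.map, Sem, Sem, h₁, h₂]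

end Frag

/-! ### The negative translation of types -/

namespace Ty

/-- Negation relative to `N`. -/
abbrev neg (σ : Ty) : Ty := arr σ nat

/-- Extend an assignment of bits to variables by a bit for a new variable `0`. -/
def scons (b : Bool) (ε : ℕ → Bool) : ℕ → Bool
  | 0 => b
  | n + 1 => ε n

/-- The type of continuations for `σ`. The variables `n` with `ε n = true` stand for the types of
negated continuations, the others for types of continuations. -/
def cont (ε : ℕ → Bool) : Ty → Ty
  | var n => if ε n then neg (var n) else var n
  | one => neg nat
  -- A sum is represented by a pair of computations with a tag in `N`: zero selects the left one and
  -- a successor the right one.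
  | sum σ τ => neg (prod (prod (neg (cont ε σ)) (neg (cont ε τ))) nat)
  | prod σ τ => neg (prod (neg (cont ε σ)) (neg (cont ε τ)))
  -- The result continuation is doubly negated because left implication can supply a function on
  -- computations of `τ`, obtained by abstracting its right premiss, but not a continuation for `τ`.
  | arr σ τ => prod (neg (cont ε σ)) (neg (neg (cont ε τ)))
  -- The bound variable stands for the inner fixed point, hence it occurs negated inside, as the bit
  -- `true` records. The negations balance, so the new body is positive.
  | mu σ => neg (mu (neg (cont (scons true ε) σ)))
  -- Here the variable stands for the continuations themselves. The double negation has the same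
  -- reason as for `arr`.
  | nu σ => mu (neg (neg (cont (scons false ε) σ)))

theorem lift_nat (c : ℕ) : lift c nat = nat := by simp [nat, lift]

theorem subst_nat (k : ℕ) (ρ : Ty) : subst k ρ nat = nat := by simp [nat, subst]

theorem polar_nat (b : Bool) (i : ℕ) : Polar b i nat := by simp [nat, Polar]

theorem isType_nat : IsType nat := by simp [nat, IsType, Polar]

theorem cont_lift {σ : Ty} : ∀ {ε ε' : ℕ → Bool} {c : ℕ}, (∀ n < c, ε' n = ε n) →
    (∀ n ≥ c, ε' (n + 1) = ε n) → cont ε' (lift c σ) = lift c (cont ε σ) := by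
  have hc : ∀ {ε ε' : ℕ → Bool} {c : ℕ} (b : Bool), (∀ n < c, ε' n = ε n) →
      (∀ n ≥ c, ε' (n + 1) = ε n) → (∀ n < c + 1, scons b ε' n = scons b ε n) ∧
      (∀ n ≥ c + 1, scons b ε' (n + 1) = scons b ε n) := by
    intro ε ε' c b h₁ h₂
    constructor
    · rintro (_ | n) hn
      · rfl
      · exact h₁ n (by omega)
    · rintro (_ | n) hn
      · omega
      · exact h₂ n (by omega)
  induction σ with
  | var n =>
    intro ε ε' c h₁ h₂
    by_cases hn : n < c
    · simp only [lift, hn, if_true, cont, h₁ n hn]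
      split <;> simp [lift, hn, lift_nat]
    · simp only [lift, hn, if_false, cont, h₂ n (by omega)]
      split <;> simp [lift, hn, lift_nat]
  | one => intro ε ε' c _ _; simp [cont, lift, lift_nat]
  | sum σ τ ih ih' => intro ε ε' c h₁ h₂; simp [cont, lift, lift_nat, ih h₁ h₂, ih' h₁ h₂]
  | prod σ τ ih ih' => intro ε ε' c h₁ h₂; simp [cont, lift, lift_nat, ih h₁ h₂, ih' h₁ h₂]
  | arr σ τ ih ih' => intro ε ε' c h₁ h₂; simp [cont, lift, lift_nat, ih h₁ h₂, ih' h₁ h₂]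
  | mu σ ih =>
    intro ε ε' c h₁ h₂
    obtain ⟨h₃, h₄⟩ := hc true h₁ h₂
    simp [cont, lift, lift_nat, ih h₃ h₄]
  | nu σ ih =>
    intro ε ε' c h₁ h₂
    obtain ⟨h₃, h₄⟩ := hc false h₁ h₂
    simp [cont, lift, lift_nat, ih h₃ h₄]

theorem cont_lift_zero {ε : ℕ → Bool} {b : Bool} {σ : Ty} :
    cont (scons b ε) (lift 0 σ) = lift 0 (cont ε σ) :=
  cont_lift (fun _ h => absurd h (Nat.not_lt_zero _)) fun _ _ => rfl

/-- The bit `ε k` says whether variable `k` stands for `T` with `K ρ = T` or with `K ρ = ¬T`. The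
second option is what makes unfolding a `μ` commute with the translation. -/
theorem cont_subst {σ : Ty} : ∀ {ε ε' : ℕ → Bool} {k : ℕ} {ρ T : Ty},
    (∀ n < k, ε' n = ε n) → (∀ n ≥ k, ε' n = ε (n + 1)) →
    cont ε' ρ = (if ε k then neg T else T) → cont ε' (subst k ρ σ) = subst k T (cont ε σ) := by
  have hc : ∀ {ε ε' : ℕ → Bool} {k : ℕ} (b : Bool), (∀ n < k, ε' n = ε n) →
      (∀ n ≥ k, ε' n = ε (n + 1)) → (∀ n < k + 1, scons b ε' n = scons b ε n) ∧
      (∀ n ≥ k + 1, scons b ε' n = scons b ε (n + 1)) := by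
    intro ε ε' k b h₁ h₂
    constructor
    · rintro (_ | n) hn
      · rfl
      · exact h₁ n (by omega)
    · rintro (_ | n) hn
      · omega
      · exact h₂ n (by omega)
  induction σ with
  | var n =>
    intro ε ε' k ρ T h₁ h₂ hT
    rcases lt_trichotomy n k with hn | rfl | hn
    · have h₃ : ¬ n = k := by omega
      have h₄ : ¬ k < n := by omega
      simp only [subst, h₃, h₄, if_false, cont, h₁ n hn]
      split <;> simp [subst, h₃, h₄, subst_nat]
    · simp only [subst, if_true, cont, hT]
      split <;> simp [subst, subst_nat]
    · obtain ⟨m, rfl⟩ : ∃ m, n = m + 1 := ⟨n - 1, by omega⟩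
      have h₃ : ¬ m + 1 = k := by omega
      simp only [subst, h₃, hn, if_false, if_true, cont, Nat.add_sub_cancel, h₂ m (by omega)]
      split <;> simp [subst, h₃, hn, subst_nat]
  | one => intro ε ε' k ρ T _ _ _; simp [cont, subst, subst_nat]
  | sum σ τ ih ih' =>
    intro ε ε' k ρ T h₁ h₂ hT; simp [cont, subst, subst_nat, ih h₁ h₂ hT, ih' h₁ h₂ hT]
  | prod σ τ ih ih' =>
    intro ε ε' k ρ T h₁ h₂ hT; simp [cont, subst, subst_nat, ih h₁ h₂ hT, ih' h₁ h₂ hT]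
  | arr σ τ ih ih' =>
    intro ε ε' k ρ T h₁ h₂ hT; simp [cont, subst, subst_nat, ih h₁ h₂ hT, ih' h₁ h₂ hT]
  | mu σ ih =>
    intro ε ε' k ρ T h₁ h₂ hT
    obtain ⟨h₃, h₄⟩ := hc true h₁ h₂
    simp only [cont, subst, subst_nat]
    rw [ih h₃ h₄]
    rw [cont_lift_zero, hT]
    show lift 0 (if ε k = true then _ else _) = if ε k = true then _ else _
    split <;> simp [lift, lift_nat]
  | nu σ ih =>
    intro ε ε' k ρ T h₁ h₂ hT
    obtain ⟨h₃, h₄⟩ := hc false h₁ h₂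
    simp only [cont, subst, subst_nat]
    rw [ih h₃ h₄]
    rw [cont_lift_zero, hT]
    show lift 0 (if ε k = true then _ else _) = if ε k = true then _ else _
    split <;> simp [lift, lift_nat]

theorem cont_inst_mu {ε : ℕ → Bool} {σ : Ty} : cont ε (σ.inst (mu σ)) =
    (cont (scons true ε) σ).inst (mu (neg (cont (scons true ε) σ))) :=
  cont_subst (fun _ h => absurd h (Nat.not_lt_zero _)) (fun _ _ => rfl) (by simp [scons, cont])

theorem cont_inst_nu {ε : ℕ → Bool} {σ : Ty} : cont ε (σ.inst (nu σ)) =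
    (cont (scons false ε) σ).inst (mu (neg (neg (cont (scons false ε) σ)))) :=
  cont_subst (fun _ h => absurd h (Nat.not_lt_zero _)) (fun _ _ => rfl) (by simp [scons, cont])

/-- Types of continuations keep the polarity of a variable, except that the extra negation placed on
a variable with bit `true` reverses it. -/
theorem polar_cont {σ : Ty} : ∀ {ε : ℕ → Bool} {b : Bool} {i : ℕ}, Polar b i σ →
    Polar (xor b (ε i)) i (cont ε σ) := by
  induction σ with
  | var n =>
    intro ε b i h
    rw [cont]
    split_ifs with hε
    · refine ⟨fun hn => ?_, polar_nat _ _⟩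
      obtain rfl := hn
      simp [hε, h rfl]
    · intro hn
      obtain rfl := hn
      simpa [hε] using h rfl
  | one => intro ε b i _; exact ⟨polar_nat _ _, polar_nat _ _⟩
  | sum σ τ ih ih' =>
    intro ε b i h
    simpa [cont, Polar, polar_nat] using ⟨ih (ε := ε) h.1, ih' (ε := ε) h.2⟩
  | prod σ τ ih ih' =>
    intro ε b i h
    simpa [cont, Polar, polar_nat] using ⟨ih (ε := ε) h.1, ih' (ε := ε) h.2⟩
  | arr σ τ ih ih' =>
    intro ε b i h
    have h₁ := ih (ε := ε) h.1
    rw [Bool.not_xor] at h₁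
    simpa [cont, Polar, polar_nat] using ⟨h₁, ih' (ε := ε) h.2⟩
  | mu σ ih =>
    intro ε b i h
    simpa [cont, Polar, polar_nat, scons] using ih (ε := scons true ε) (i := i + 1) h
  | nu σ ih =>
    intro ε b i h
    simpa [cont, Polar, polar_nat, scons] using ih (ε := scons false ε) (i := i + 1) h

theorem isType_cont {σ : Ty} : ∀ {ε : ℕ → Bool}, IsType σ → IsType (cont ε σ) := by
  induction σ with
  | var n => intro ε _; rw [cont]; split_ifs <;> simp [IsType, isType_nat]
  | one => intro ε _; simp [cont, IsType, isType_nat]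
  | sum σ τ ih ih' => intro ε h; simpa [cont, IsType, isType_nat] using ⟨ih h.1, ih' h.2⟩
  | prod σ τ ih ih' => intro ε h; simpa [cont, IsType, isType_nat] using ⟨ih h.1, ih' h.2⟩
  | arr σ τ ih ih' => intro ε h; simpa [cont, IsType, isType_nat] using ⟨ih h.1, ih' h.2⟩
  | mu σ ih =>
    intro ε h
    simpa [cont, IsType, isType_nat, Polar, polar_nat, scons] using
      ⟨polar_cont (ε := scons true ε) h.1, ih h.2⟩
  | nu σ ih =>
    intro ε h
    simpa [cont, IsType, isType_nat, Polar, polar_nat, scons] using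
      ⟨polar_cont (ε := scons false ε) h.1, ih h.2⟩

theorem IsNegative.neg {σ : Ty} (h : IsNegative σ) : IsNegative (neg σ) := h.arr .nat

theorem isNegative_cont {σ : Ty} : ∀ {ε : ℕ → Bool}, IsNegative (cont ε σ) := by
  induction σ with
  | var n => intro ε; rw [cont]; split_ifs; exacts [(IsNegative.var n).neg, .var n]
  | one => exact IsNegative.nat.neg
  | sum σ τ ih ih' => exact ((ih.neg.prod ih'.neg).prod .nat).neg
  | prod σ τ ih ih' => exact (ih.neg.prod ih'.neg).neg
  | arr σ τ ih ih' => exact ih.neg.prod ih'.neg.neg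
  | mu σ ih => exact ih.neg.mu.neg
  | nu σ ih => exact ih.neg.neg.mu

-- The subformula order under the translation.

theorem lift_lift {σ : Ty} : ∀ {a c : ℕ}, a ≤ c →
    lift (c + 1) (lift a σ) = lift a (lift c σ) := by
  induction σ with
  | var n =>
    intro a c h
    simp only [lift]
    split_ifs <;> simp only [lift] <;> split_ifs <;> first | rfl | omega
  | one => intro a c h; rfl
  | sum σ τ ih ih' => intro a c h; simp [lift, ih h, ih' h]
  | prod σ τ ih ih' => intro a c h; simp [lift, ih h, ih' h]
  | arr σ τ ih ih' => intro a c h; simp [lift, ih h, ih' h]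
  | mu σ ih => intro a c h; simp [lift, ih (Nat.add_le_add_right h 1)]
  | nu σ ih => intro a c h; simp [lift, ih (Nat.add_le_add_right h 1)]

theorem Subformula.lift {φ ψ : Ty} (h : Subformula φ ψ) :
    ∀ c, Subformula (lift c φ) (lift c ψ) := by
  induction h with
  | refl φ => exact fun c => .refl _
  | sum_left _ ih => exact fun c => .sum_left (ih c)
  | sum_right _ ih => exact fun c => .sum_right (ih c)
  | prod_left _ ih => exact fun c => .prod_left (ih c)
  | prod_right _ ih => exact fun c => .prod_right (ih c)
  | arr_left _ ih => exact fun c => .arr_left (ih c)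
  | arr_right _ ih => exact fun c => .arr_right (ih c)
  | mu _ ih => exact fun c => .mu (by rw [← lift_lift (Nat.zero_le c)]; exact ih (c + 1))
  | nu _ ih => exact fun c => .nu (by rw [← lift_lift (Nat.zero_le c)]; exact ih (c + 1))

theorem Subformula.trans {φ ψ χ : Ty} (h : Subformula φ ψ) (h' : Subformula ψ χ) :
    Subformula φ χ := by
  induction h' generalizing φ with
  | refl => exact h
  | sum_left _ ih => exact .sum_left (ih h)
  | sum_right _ ih => exact .sum_right (ih h)
  | prod_left _ ih => exact .prod_left (ih h)
  | prod_right _ ih => exact .prod_right (ih h)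
  | arr_left _ ih => exact .arr_left (ih h)
  | arr_right _ ih => exact .arr_right (ih h)
  | mu _ ih => exact .mu (ih (h.lift 0))
  | nu _ ih => exact .nu (ih (h.lift 0))

/-- The fixed point in the type of continuations of a fixed point. -/
def core (ε : ℕ → Bool) : Ty → Ty
  -- In a translated thread this fixed point itself becomes principal, and `K (mu σ)`, its negation,
  -- is not one of its subformulas. The minimal formula must therefore be measured by the fixed
  -- point.
  | mu σ => mu (neg (cont (scons true ε) σ))
  | σ => cont ε σ

theorem core_lift {ε : ℕ → Bool} {b : Bool} {σ : Ty} :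
    core (scons b ε) (lift 0 σ) = lift 0 (core ε σ) := by
  cases σ with
  | mu σ =>
    have h := cont_lift_zero (ε := ε) (b := b) (σ := mu σ)
    simp only [lift, cont, neg, arr.injEq] at h
    exact h.1
  | var n => exact cont_lift_zero
  | one => exact cont_lift_zero
  | sum σ τ => exact cont_lift_zero
  | prod σ τ => exact cont_lift_zero
  | arr σ τ => exact cont_lift_zero
  | nu σ => exact cont_lift_zero

theorem core_sub_cont {ε : ℕ → Bool} {σ : Ty} : Subformula (core ε σ) (cont ε σ) := by
  cases σ with
  | mu σ => exact .arr_left (.refl _)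
  | _ => exact .refl _

/-- The translation is compositional, so it preserves subformulas. Consequently the minimal formula
of a thread is sent to a lower bound of the translated thread. -/
theorem Subformula.core {φ ψ : Ty} (h : Subformula φ ψ) :
    ∀ {ε : ℕ → Bool}, Subformula (core ε φ) (core ε ψ) := by
  induction h with
  | refl => exact .refl _
  | sum_left _ ih =>
    exact .arr_left (.prod_left (.prod_left (.arr_left (ih.trans core_sub_cont))))
  | sum_right _ ih =>
    exact .arr_left (.prod_left (.prod_right (.arr_left (ih.trans core_sub_cont))))
  | prod_left _ ih => exact .arr_left (.prod_left (.arr_left (ih.trans core_sub_cont)))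
  | prod_right _ ih => exact .arr_left (.prod_right (.arr_left (ih.trans core_sub_cont)))
  | arr_left _ ih => exact .prod_left (.arr_left (ih.trans core_sub_cont))
  | arr_right _ ih => exact .prod_right (.arr_left (.arr_left (ih.trans core_sub_cont)))
  | mu _ ih => exact .mu (.arr_left (by rw [← core_lift (b := true)]; exact ih.trans core_sub_cont))
  | nu _ ih =>
    exact .mu (.arr_left (.arr_left (by
      rw [← core_lift (b := false)]; exact ih.trans core_sub_cont)))

end Ty

/-! ### The negative translation of coderivations -/

namespace Ty

/-- The type of continuations for `σ`. -/
abbrev K (σ : Ty) : Ty := cont (fun _ => false) σ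

/-- The translation of `σ`. -/
abbrev C (σ : Ty) : Ty := neg (K σ)

/-- The body of the fixed point in `K (mu σ)`. -/
abbrev muBody (σ : Ty) : Ty := neg (cont (scons true fun _ => false) σ)

/-- The body of the fixed point in `K (nu σ)`. -/
abbrev nuBody (σ : Ty) : Ty := neg (neg (cont (scons false fun _ => false) σ))

/-- Unfolding the inner fixed point yields exactly a computation of the unfolded type, so one
translated step matches one original step. -/
theorem muBody_inst (σ : Ty) : (muBody σ).inst (mu (muBody σ)) = C (σ.inst (mu σ)) := by
  rw [C, K, cont_inst_mu]
  simp [inst, subst, subst_nat]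

theorem nuBody_inst (σ : Ty) : (nuBody σ).inst (mu (nuBody σ)) = neg (C (σ.inst (nu σ))) := by
  rw [C, K, cont_inst_nu]
  simp [inst, subst, subst_nat]

/-- Being a type of the negative fragment. -/
def Neg (σ : Ty) : Prop := σ.IsType ∧ σ.IsNegative

theorem neg_nat : Neg nat := ⟨isType_nat, .nat⟩

theorem neg_arr {σ τ : Ty} (h : Neg σ) (h' : Neg τ) : Neg (arr σ τ) := ⟨⟨h.1, h'.1⟩, h.2.arr h'.2⟩

theorem neg_prod {σ τ : Ty} (h : Neg σ) (h' : Neg τ) : Neg (prod σ τ) :=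
  ⟨⟨h.1, h'.1⟩, h.2.prod h'.2⟩

theorem neg_cont {ε : ℕ → Bool} {σ : Ty} (h : IsType σ) : Neg (cont ε σ) :=
  ⟨isType_cont h, isNegative_cont⟩

theorem neg_mu {σ : Ty} (h : IsType (mu σ)) : Neg (mu (muBody σ)) :=
  ⟨(isType_cont (ε := fun _ => false) h).1, isNegative_cont.neg.mu⟩

theorem neg_nu {σ : Ty} (h : IsType (nu σ)) : Neg (mu (nuBody σ)) := neg_cont h

end Ty

open Ty

/-- The translation of a sequent. -/
def Sequent.tr (S : Sequent) : Sequent := ⟨S.ant.map C ++ [K S.suc], .nat⟩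

namespace Frag

variable {U : Type}

/-- Apply the last formula, a negation, to the result of `f`. -/
def call (Θ : List Ty) (σ : Ty) (f : Frag U) : Frag U :=
  bin (.arrL Θ [] σ .nat .nat) f (leaf (.id .nat))

/-- Prove a negation. -/
def lam (Θ : List Ty) (σ : Ty) (f : Frag U) : Frag U := un (.arrR Θ σ .nat) f

/-- Swap the last two formulas of `Γ, σ, τ`. -/
def swap (Γ : List Ty) (σ τ : Ty) (f : Frag U) : Frag U := un (.exch Γ τ σ [] .nat) f

/-- Swap the first two formulas after `Γ` in `Γ, σ, τ, ρ`, and then the last two. -/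
def rotate (Γ : List Ty) (σ τ ρ : Ty) (f : Frag U) : Frag U :=
  un (.exch Γ τ σ [ρ] .nat) (swap (Γ ++ [τ]) σ ρ f)

/-- A constant function. -/
def const (σ : Ty) : Frag U := lam [] σ (un (.wk [] σ .nat) (leaf .natR₀))

end Frag

open Frag

/-- The fragment which translates a step. -/
def gadget : Step → Frag Bool
  | .id σ => swap [] (C σ) (K σ) (call [K σ] (K σ) (leaf (.id (K σ))))
  | .exch Γ σ τ Δ γ => un (.exch (Γ.map C) (C σ) (C τ) (Δ.map C ++ [K γ]) .nat) (hole false)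
  -- Abstracting the translated left premiss over its continuation gives a computation of `σ`, which
  -- is cut against the right premiss.
  | .cut Γ Δ σ τ => bin (.cut (Γ.map C) (Δ.map C ++ [K τ]) (C σ) .nat)
      (lam (Γ.map C) (K σ) (hole false)) (swap (Δ.map C) (K τ) (C σ) (hole true))
  | .wk Γ σ τ => swap (Γ.map C) (C σ) (K τ) (un (.wk (Γ.map C ++ [K τ]) (C σ) .nat) (hole false))
  | .ctr Γ σ τ => swap (Γ.map C) (C σ) (K τ) (un (.ctr (Γ.map C ++ [K τ]) (C σ) .nat)
      (rotate (Γ.map C) (K τ) (C σ) (C σ) (hole false)))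
  | .oneR => call [] .nat (leaf .natR₀)
  | .oneL Γ σ => swap (Γ.map C) (C one) (K σ) (call (Γ.map C ++ [K σ]) (K one)
      (lam (Γ.map C ++ [K σ]) nat (un (.wk (Γ.map C ++ [K σ]) .nat .nat) (hole false))))
  | .arrR Γ σ τ => un (.prodL (Γ.map C) (C σ) (neg (C τ)) .nat)
      (call (Γ.map C ++ [C σ]) (C τ) (lam (Γ.map C ++ [C σ]) (K τ) (hole false)))
  -- The function is called with a pair: a computation of the argument, and the right premiss as a
  -- function of the computation of `τ`.
  | .arrL Γ Δ σ τ γ => swap (Γ.map C ++ Δ.map C) (C (arr σ τ)) (K γ)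
      (call (Γ.map C ++ (Δ.map C ++ [K γ])) (K (arr σ τ))
        (bin (.prodR (Γ.map C) (Δ.map C ++ [K γ]) (C σ) (neg (C τ)))
          (lam (Γ.map C) (K σ) (hole false))
          (lam (Δ.map C ++ [K γ]) (C τ) (swap (Δ.map C) (K γ) (C τ) (hole true)))))
  | .prodR Γ Δ σ τ => call (Γ.map C ++ Δ.map C) (prod (C σ) (C τ))
      (bin (.prodR (Γ.map C) (Δ.map C) (C σ) (C τ)) (lam (Γ.map C) (K σ) (hole false))
        (lam (Δ.map C) (K τ) (hole true)))
  | .prodL Γ σ τ γ => swap (Γ.map C) (C (prod σ τ)) (K γ) (call (Γ.map C ++ [K γ]) (K (prod σ τ))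
      (lam (Γ.map C ++ [K γ]) (prod (C σ) (C τ)) (un (.prodL (Γ.map C ++ [K γ]) (C σ) (C τ) .nat)
        (rotate (Γ.map C) (K γ) (C σ) (C τ) (hole false)))))
  -- The unused component is filled by a constant function, which is harmless because the tag tells
  -- every consumer to ignore it.
  | .sumR₀ Γ σ τ => call (Γ.map C) (prod (prod (C σ) (C τ)) nat)
      (bin (.prodR (Γ.map C) [] (prod (C σ) (C τ)) nat)
        (bin (.prodR (Γ.map C) [] (C σ) (C τ)) (lam (Γ.map C) (K σ) (hole false)) (const (K τ)))
        (leaf .natR₀))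
  | .sumR₁ Γ σ τ => call (Γ.map C) (prod (prod (C σ) (C τ)) nat)
      (bin (.prodR (Γ.map C) [] (prod (C σ) (C τ)) nat)
        (bin (.prodR [] (Γ.map C) (C σ) (C τ)) (const (K σ)) (lam (Γ.map C) (K τ) (hole false)))
        (un (.natR₁ []) (leaf .natR₀)))
  | .sumL Γ σ τ γ => swap (Γ.map C) (C (sum σ τ)) (K γ) (call (Γ.map C ++ [K γ]) (K (sum σ τ))
      (lam (Γ.map C ++ [K γ]) (prod (prod (C σ) (C τ)) nat)
        (un (.prodL (Γ.map C ++ [K γ]) (prod (C σ) (C τ)) nat .nat)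
          (bin (.natL (Γ.map C ++ [K γ] ++ [prod (C σ) (C τ)]) .nat)
            (un (.prodL (Γ.map C ++ [K γ]) (C σ) (C τ) .nat)
              (un (.wk (Γ.map C ++ [K γ, C σ]) (C τ) .nat)
                (swap (Γ.map C) (K γ) (C σ) (hole false))))
            -- In the successor branch the predecessor of the tag carries no information and is
            -- dropped.
            (un (.wk (Γ.map C ++ [K γ] ++ [prod (C σ) (C τ)]) nat .nat)
              (un (.prodL (Γ.map C ++ [K γ]) (C σ) (C τ) .nat)
                (swap (Γ.map C ++ [K γ]) (C σ) (C τ)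
                  (un (.wk (Γ.map C ++ [K γ, C τ]) (C σ) .nat)
                    (swap (Γ.map C) (K γ) (C τ) (hole true))))))))))
  | .muR Γ σ => call (Γ.map C) (mu (muBody σ)) (un (.muR (Γ.map C) (muBody σ))
      (lam (Γ.map C) (K (σ.inst (mu σ))) (hole false)))
  | .muL Γ σ τ => swap (Γ.map C) (C (mu σ)) (K τ) (call (Γ.map C ++ [K τ]) (K (mu σ))
      (lam (Γ.map C ++ [K τ]) (mu (muBody σ)) (un (.muL (Γ.map C ++ [K τ]) (muBody σ) .nat)
        (swap (Γ.map C) (K τ) (C (σ.inst (mu σ))) (hole false)))))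
  -- The continuation for a `ν` is a `μ` on the left, so unfolding a `ν` on the right becomes a good
  -- step.
  | .nuR Γ σ => un (.muL (Γ.map C) (nuBody σ) .nat) (call (Γ.map C) (C (σ.inst (nu σ)))
      (lam (Γ.map C) (K (σ.inst (nu σ))) (hole false)))
  | .nuL Γ σ τ => swap (Γ.map C) (C (nu σ)) (K τ) (call (Γ.map C ++ [K τ]) (mu (nuBody σ))
      (un (.muR (Γ.map C ++ [K τ]) (nuBody σ)) (lam (Γ.map C ++ [K τ]) (C (σ.inst (nu σ)))
        (swap (Γ.map C) (K τ) (C (σ.inst (nu σ))) (hole false)))))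
  -- The native rules do not occur in the full system, so the last three values are arbitrary.
  | .natR₀ => leaf .natR₀
  | .natR₁ _ => leaf .natR₀
  | .natL _ _ => leaf .natR₀

theorem isProper_gadget (s : Step) : (gadget s).IsProper := by cases s <;> exact trivial

/-- All formulas are types. -/
def Sequent.IsTyped (S : Sequent) : Prop := (∀ σ ∈ S.ant, σ.IsType) ∧ S.suc.IsType

theorem Step.exists_prem {s : Step} {S : Sequent} (h : S ∈ s.prems) : ∃ b, s.prem b = some S := by
  rw [List.mem_iff_getElem?] at h
  obtain ⟨_ | _ | i, hi⟩ := h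
  · exact ⟨false, hi⟩
  · exact ⟨true, hi⟩
  · cases s <;> simp [Step.prems] at hi

set_option maxHeartbeats 1000000 in
set_option linter.unusedSimpArgs false in
theorem concludes_gadget {s : Step} (hn : ¬ s.IsNative) (h : s.concl.IsTyped)
    (h' : ∀ S ∈ s.prems, S.IsTyped) : (gadget s).Concludes NegativeStep
      (fun b S => ∃ P, s.prem b = some P ∧ S = P.tr) s.concl.tr := by
  have hC : ∀ {Γ : List Ty}, (∀ σ ∈ Γ, σ.IsType) → ∀ σ ∈ Γ, Neg (neg (cont (fun _ => false) σ)) :=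
    fun h σ hσ => neg_arr (neg_cont (h σ hσ)) neg_nat
  have hneg : ∀ s : Step, NegativeStep s ↔ (∀ σ ∈ s.concl.ant, Neg σ) ∧ Neg s.concl.suc :=
    fun s => Iff.rfl
  have hsum : ∀ σ τ, (sum σ τ).IsType ↔ σ.IsType ∧ τ.IsType := fun _ _ => Iff.rfl
  have hmu := @muBody_inst
  have hnu := @nuBody_inst
  simp only [muBody, nuBody, C] at hmu hnu
  cases s
  case natR₀ => exact (hn trivial).elim
  case natR₁ => exact (hn trivial).elim
  case natL => exact (hn trivial).elim
  all_goals
    simp only [Step.prems, Step.concl, Sequent.IsTyped, List.forall_mem_append,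
      List.forall_mem_cons, hsum] at h h'
    simp only [gadget, swap, call, lam, rotate, const, Concludes, Step.prems, Step.concl,
      Sequent.tr, List.cons.injEq, Sequent.mk.injEq, Step.prem, List.map_append, List.map_cons,
      List.map_nil, List.append_assoc, List.cons_append, List.nil_append, List.append_nil,
      Bool.toNat_false, Bool.toNat_true, List.getElem?_cons_zero, List.getElem?_cons_succ,
      Option.some.injEq, hmu, hnu, hneg, C, K, muBody, nuBody, and_true, exists_eq_left',
      exists_and_left, and_assoc, List.forall_mem_append, List.forall_mem_cons, List.forall_mem_map]
    try simp [neg_nat, cont]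
    try constructorm* _ ∧ _
    all_goals first
      | (intro j hj; refine hC ?_ j hj; tauto)
      | (repeat'
          first
          | with_reducible exact neg_nat
          | with_reducible refine neg_arr ?_ ?_
          | with_reducible refine neg_prod ?_ ?_
          | with_reducible refine neg_cont ?_
          | with_reducible refine neg_mu ?_
          | with_reducible refine neg_nu ?_
         all_goals tauto)

/-- Unfold the translation of a coderivation once. -/
def unfoldTr (t : PTree) : Frag PTree :=
  match t [] with
  | none => leaf .oneR
  | some s => (gadget s).map fun b => t.sub [b]

/-- The translation of a coderivation. -/
def tr (t : PTree) : PTree := graft unfoldTr (hole t)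

theorem Frag.IsProper.map {U V : Type} {h : U → V} {f : Frag U} (hf : f.IsProper) :
    (f.map h).IsProper := by
  cases f <;> exact hf

theorem isProper_unfoldTr (t : PTree) : (unfoldTr t).IsProper := by
  rw [unfoldTr]
  split
  · exact trivial
  · exact (isProper_gadget _).map

theorem Frag.Concludes.map {U V : Type} {h : U → V} {R : Step → Prop} {T : U → Sequent → Prop}
    {T' : V → Sequent → Prop} (hT : ∀ u S, T u S → T' (h u) S) {f : Frag U} : ∀ {S : Sequent},
    f.Concludes R T S → (f.map h).Concludes R T' S := by
  induction f with
  | hole u => exact hT _ _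
  | leaf s => exact fun h => h
  | un s f ih => exact fun ⟨h₁, h₂, S, h₃, h₄⟩ => ⟨h₁, h₂, S, h₃, ih h₄⟩
  | bin s f f' ih ih' => exact fun ⟨h₁, h₂, S, S', h₃, h₄, h₅⟩ => ⟨h₁, h₂, S, S', h₃, ih h₄, ih' h₅⟩

theorem PTree.IsCoderivation.sub {R : Step → Prop} {t : PTree} {S : Sequent} {s : Step}
    (ht : t.IsCoderivation R S) {α : List Bool} (hs : t α = some s) :
    (t.sub α).IsCoderivation R s.concl :=
  ⟨by simp [PTree.concl, PTree.sub, hs],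
    fun β s' hs' b => by simpa [PTree.sub] using ht.child (α ++ β) s' hs' b,
    fun β h b => by simpa [PTree.sub] using ht.closed (α ++ β) h b, fun β => ht.steps (α ++ β)⟩

theorem PTree.IsCoderivation.sub_prem {R : Step → Prop} {t : PTree} {S S' : Sequent} {s : Step}
    (ht : t.IsCoderivation R S) (hs : t [] = some s) {b : Bool} (hb : s.prem b = some S') :
    (t.sub [b]).IsCoderivation R S' := by
  have h := ht.child [] s hs b
  rw [hb] at h
  obtain ⟨s', hs', rfl⟩ := Option.map_eq_some_iff.1 h
  exact ht.sub hs'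

theorem PTree.IsCoderivation.isTyped {t : PTree} {S : Sequent} (ht : t.IsCoderivation FullStep S) :
    S.IsTyped := by
  obtain ⟨s, hs, rfl⟩ := Option.map_eq_some_iff.1 ht.root
  exact (ht.steps _ _ hs).2

theorem PTree.IsCoderivation.tr {t : PTree} {S : Sequent} (ht : t.IsCoderivation FullStep S) :
    (tr t).IsCoderivation NegativeStep S.tr := by
  refine Concludes.isCoderivation (f := hole t)
    (T := fun u S' => ∃ S, u.IsCoderivation FullStep S ∧ S' = S.tr) isProper_unfoldTr ?_ ⟨S, ht, rfl⟩
  rintro t _ ⟨S, ht, rfl⟩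
  obtain ⟨s, hs, rfl⟩ := Option.map_eq_some_iff.1 ht.root
  simp only [unfoldTr, hs]
  refine (concludes_gadget (ht.steps _ _ hs).1 ht.isTyped fun S hS => ?_).map ?_
  · obtain ⟨b, hb⟩ := Step.exists_prem hS
    exact (ht.sub_prem hs hb).isTyped
  · rintro b _ ⟨P, hP, rfl⟩
    exact ⟨P, ht.sub_prem hs hP, rfl⟩

theorem Frag.Concludes.holes {R : Step → Prop} {T : U → Sequent → Prop} {f : Frag U} :
    ∀ {S : Sequent}, f.Concludes R T S → ∀ u ∈ f.holes, ∃ S, T u S := by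
  induction f with
  | hole u => rintro S h _ rfl; exact ⟨S, h⟩
  | leaf s => rintro _ _ _ ⟨⟩
  | un s f ih => rintro _ ⟨-, -, _, -, h⟩; exact ih h
  | bin s f f' ih ih' =>
    rintro _ ⟨-, -, _, _, -, h, h'⟩ u (hu | hu)
    exacts [ih h u hu, ih' h' u hu]

theorem Frag.holes_map {U V : Type} {h : U → V} (f : Frag U) : (f.map h).holes = h '' f.holes := by
  induction f with
  | hole u => simp [Frag.map, Frag.holes]
  | leaf s => simp [Frag.map, Frag.holes]
  | un s f ih => simpa [Frag.map, Frag.holes]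
  | bin s f f' ih ih' => simp [Frag.map, Frag.holes, ih, ih', Set.image_union]

/-- The holes met during unfolding are labelled by sub-coderivations of `t`, and regularity of `t`
says that these are finitely many. -/
theorem PTree.IsCoderivation.regular_tr {t : PTree} {S : Sequent}
    (ht : t.IsCoderivation FullStep S) (hr : t.Regular) : (CircMuLJ.tr t).Regular := by
  have h₀ : t [] ≠ none := fun h => by have := ht.root; simp [PTree.concl, h] at this
  refine regular_graft hr ?_ ⟨[], h₀, rfl⟩ ht.tr.closed
  rintro _ ⟨α, hα, rfl⟩ v hv
  obtain ⟨s, hs⟩ := Option.ne_none_iff_exists'.1 hα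
  have hs' : t.sub α [] = some s := by simpa [PTree.sub] using hs
  simp only [unfoldTr, hs', holes_map] at hv
  obtain ⟨b, hb, rfl⟩ := hv
  have hs₂ := ht.sub hs
  have hc : (gadget s).Concludes NegativeStep (fun b S => ∃ P, s.prem b = some P ∧ S = P.tr)
      s.concl.tr := by
    refine concludes_gadget (ht.steps _ _ hs).1 hs₂.isTyped fun S hS => ?_
    obtain ⟨b, hb⟩ := Step.exists_prem hS
    exact (hs₂.sub_prem hs' hb).isTyped
  obtain ⟨S', P, hP, -⟩ := hc.holes b hb
  refine ⟨α ++ [b], ?_, by funext β; simp [PTree.sub]⟩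
  have := ht.child α s hs b
  rw [hP] at this
  intro h
  simp [h] at this

/-! ### Branches of unfolded fragments -/

/-- `Path f w u`: the address `w` leads to a hole `u` of `f`. -/
inductive Frag.Path {U : Type} : Frag U → List Bool → U → Prop
  | hole (u : U) : Path (hole u) [] u
  | un {s : Step} {f : Frag U} {w : List Bool} {u : U} : Path f w u → Path (un s f) (false :: w) u
  | left {s : Step} {f f' : Frag U} {w : List Bool} {u : U} : Path f w u →
      Path (bin s f f') (false :: w) u
  | right {s : Step} {f f' : Frag U} {w : List Bool} {u : U} : Path f' w u →
      Path (bin s f f') (true :: w) u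

theorem node_succ (β : ℕ → Bool) (n : ℕ) :
    node β (n + 1) = β 0 :: node (fun m => β (m + 1)) n := by
  simp [node, List.range_succ_eq_map, List.map_map, Function.comp_def]

theorem node_add (β : ℕ → Bool) (m n : ℕ) :
    node β (m + n) = node β m ++ node (fun i => β (m + i)) n := by
  simp [node, List.range_add, List.map_map, Function.comp_def]

theorem length_node (β : ℕ → Bool) (n : ℕ) : (node β n).length = n := by simp [node]

theorem node_concat (β : ℕ → Bool) (n : ℕ) : node β (n + 1) = node β n ++ [β n] := by
  simp [node, List.range_succ]

section Run

variable {U : Type} {g : U → Frag U}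

/-- Fragments are finite, so an infinite branch can leave one only through a hole. -/
theorem Frag.exists_path {f : Frag U} : ∀ {β : ℕ → Bool}, IsBranch (graft g f) β →
    ∃ w u, f.Path w u ∧ node β w.length = w ∧
      (graft g f).sub w = graft g (hole u) := by
  induction f with
  | hole u => exact fun _ => ⟨[], u, .hole u, rfl, rfl⟩
  | leaf s =>
    intro β h
    exfalso
    have := h 1
    rw [graft_leaf, node_succ] at this
    exact this rfl
  | un s f ih =>
    intro β h
    rw [graft_un] at h
    have hβ : β 0 = false := by
      have := h 1
      rw [node_succ] at this
      by_contra hβ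
      rw [Bool.not_eq_false] at hβ
      rw [hβ] at this
      exact this rfl
    have h' : IsBranch (graft g f) fun n => β (n + 1) := fun n => by
      have := h (n + 1)
      rwa [node_succ, hβ] at this
    obtain ⟨w, u, hp, hw, hs⟩ := ih h'
    exact ⟨false :: w, u, .un hp, by rw [List.length_cons, node_succ, hβ, hw], by
      rw [graft_un]; exact hs⟩
  | bin s f f' ih ih' =>
    intro β h
    rw [graft_bin] at h
    cases hβ : β 0
    · have h' : IsBranch (graft g f) fun n => β (n + 1) := fun n => by
        have := h (n + 1)
        rwa [node_succ, hβ] at this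
      obtain ⟨w, u, hp, hw, hs⟩ := ih h'
      exact ⟨false :: w, u, .left hp, by rw [List.length_cons, node_succ, hβ, hw], by
        rw [graft_bin]; exact hs⟩
    · have h' : IsBranch (graft g f') fun n => β (n + 1) := fun n => by
        have := h (n + 1)
        rwa [node_succ, hβ] at this
      obtain ⟨w, u, hp, hw, hs⟩ := ih' h'
      exact ⟨true :: w, u, .right hp, by rw [List.length_cons, node_succ, hβ, hw], by
        rw [graft_bin]; exact hs⟩

theorem PTree.IsBranch.sub {t : PTree} {β : ℕ → Bool} (h : t.IsBranch β) (m : ℕ) :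
    (t.sub (node β m)).IsBranch fun n => β (m + n) := fun n => by
  have := h (m + n)
  rwa [node_add] at this

/-- The part of a branch of an unfolded fragment between two holes. -/
structure Frag.Run (g : U → Frag U) (u : U) (β : ℕ → Bool) (us : ℕ → U) (ws : ℕ → List Bool)
    (pos : ℕ → ℕ) : Prop where
  zero : us 0 = u
  pos_zero : pos 0 = 0
  pos_succ : ∀ i, pos (i + 1) = pos i + (ws i).length
  path : ∀ i, (g (us i)).Path (ws i) (us (i + 1))
  proper : ∀ i, 0 < (ws i).length
  node_eq : ∀ i, node (fun n => β (pos i + n)) (ws i).length = ws i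
  sub_eq : ∀ i, (graft g (hole u)).sub (node β (pos i)) = graft g (hole (us i))

/-- Iterating `exists_path` cuts a branch into segments, each crossing one fragment; properness
makes all segments nonempty. -/
theorem Frag.exists_run (hg : ∀ u, (g u).IsProper) {u : U} {β : ℕ → Bool}
    (h : IsBranch (graft g (hole u)) β) : ∃ us ws pos, Run g u β us ws pos := by
  have next : ∀ u' m, (graft g (hole u)).sub (node β m) = graft g (hole u') →
      ∃ w u'', (g u').Path w u'' ∧ 0 < w.length ∧ node (fun n => β (m + n)) w.length = w ∧
        (graft g (hole u)).sub (node β (m + w.length)) = graft g (hole u'') := by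
    intro u' m hm
    have hb := h.sub m
    rw [hm, graft_hole hg] at hb
    obtain ⟨w, u'', hp, hw, hs⟩ := exists_path hb
    refine ⟨w, u'', hp, ?_, hw, ?_⟩
    · have := hg u'
      revert hp this
      rcases g u' with v | s | ⟨s, f⟩ | ⟨s, f, f'⟩
      · exact fun _ h => h.elim
      all_goals
        intro hp _
        cases hp
        all_goals exact Nat.succ_pos _
    · rw [node_add, hw, ← hs, ← graft_hole hg, ← hm]
      funext α
      simp [PTree.sub]
  choose! w v hp hl hw hs using next
  let st : ℕ → U × ℕ := fun n => n.rec (u, 0) fun _ p => (v p.1 p.2, p.2 + (w p.1 p.2).length)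
  have hst : ∀ i, (graft g (hole u)).sub (node β (st i).2) = graft g (hole (st i).1) := by
    intro i
    induction i with
    | zero => rfl
    | succ i ih => exact hs _ _ ih
  exact ⟨fun i => (st i).1, fun i => w (st i).1 (st i).2, fun i => (st i).2, rfl, rfl, fun i => rfl,
    fun i => hp _ _ (hst i), fun i => hl _ _ (hst i), fun i => hw _ _ (hst i), hst⟩

/-! ### Threads through fragments -/

/-- `o₁` in premiss `b` is an immediate ancestor of `o`, whose type satisfies `Φ` if it is
principal. -/
def StepAt (Φ : Ty → Prop) (s : Step) (b : Bool) (o o₁ : Occ) : Prop :=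
  s.descendant b o₁ = some o ∧ ∃ T, s.concl.type o = some T ∧ (s.principal = some o → Φ T)

/-- `o` is the principal occurrence, and is good of type `χ`. -/
def HitAt (χ : Ty) (s : Step) (o : Occ) : Prop :=
  s.principal = some o ∧ s.concl.type o = some χ ∧ IsGood χ o

/-- `Follows Φ χ f w u o o' h`: a thread from `o` in the conclusion of `f` to `o'` in the hole `u` at
address `w`. Its principal formulas satisfy `Φ`, and if `h` holds, one of them is good and is `χ`. -/
inductive Frag.Follows (Φ : Ty → Prop) (χ : Ty) :
    Frag U → List Bool → U → Occ → Occ → Prop → Prop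
  | hole (u : U) (o : Occ) : Follows Φ χ (hole u) [] u o o False
  | un {s : Step} {f : Frag U} {w : List Bool} {u : U} {o o₁ o' : Occ} {h h' : Prop} :
      StepAt Φ s false o o₁ → Follows Φ χ f w u o₁ o' h → (h' → h ∨ HitAt χ s o) →
      Follows Φ χ (un s f) (false :: w) u o o' h'
  | left {s : Step} {f f' : Frag U} {w : List Bool} {u : U} {o o₁ o' : Occ} {h h' : Prop} :
      StepAt Φ s false o o₁ → Follows Φ χ f w u o₁ o' h → (h' → h ∨ HitAt χ s o) →
      Follows Φ χ (bin s f f') (false :: w) u o o' h'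
  | right {s : Step} {f f' : Frag U} {w : List Bool} {u : U} {o o₁ o' : Occ} {h h' : Prop} :
      StepAt Φ s true o o₁ → Follows Φ χ f' w u o₁ o' h → (h' → h ∨ HitAt χ s o) →
      Follows Φ χ (bin s f f') (true :: w) u o o' h'

theorem Frag.Follows.path {Φ : Ty → Prop} {χ : Ty} {f : Frag U} {w : List Bool} {u : U}
    {o o' : Occ} {h : Prop} (hf : Follows Φ χ f w u o o' h) : f.Path w u := by
  induction hf with
  | hole u => exact .hole u
  | un _ _ _ ih => exact .un ih
  | left _ _ _ ih => exact .left ih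
  | right _ _ _ ih => exact .right ih

/-- A finite piece of a thread along the address `w`. -/
def IsSegment (Φ : Ty → Prop) (χ : Ty) (t : PTree) (w : List Bool) (s : ℕ → Occ) (h : Prop) :
    Prop :=
  (∀ j (hj : j < w.length), ∃ st, t (w.take j) = some st ∧ StepAt Φ st w[j] (s j) (s (j + 1))) ∧
    (h → ∃ j < w.length, ∃ st, t (w.take j) = some st ∧ HitAt χ st (s j))

theorem IsSegment.cons {Φ : Ty → Prop} {χ : Ty} {t : PTree} {w : List Bool} {s : ℕ → Occ}
    {h h' : Prop} {st : Step} {b : Bool} {o : Occ} (ht : t [] = some st)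
    (hs : StepAt Φ st b o (s 0)) (hw : IsSegment Φ χ (t.sub [b]) w s h)
    (hh : h' → h ∨ HitAt χ st o) :
    IsSegment Φ χ t (b :: w) (fun n => n.casesOn o s) h' := by
  constructor
  · rintro (_ | j) hj
    · exact ⟨st, ht, hs⟩
    · obtain ⟨st', h₁, h₂⟩ := hw.1 j (by simpa using hj)
      exact ⟨st', h₁, h₂⟩
  · intro hh'
    rcases hh hh' with h₀ | h₀
    · obtain ⟨j, hj, st', h₁, h₂⟩ := hw.2 h₀
      exact ⟨j + 1, by simpa using hj, st', h₁, h₂⟩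
    · exact ⟨0, by simp, st, ht, h₀⟩

theorem Frag.Follows.isSegment {Φ : Ty → Prop} {χ : Ty} {f : Frag U} {w : List Bool} {u : U}
    {o o' : Occ} {h : Prop} (hf : Follows Φ χ f w u o o' h) :
    ∃ s : ℕ → Occ, s 0 = o ∧ s w.length = o' ∧ IsSegment Φ χ (graft g f) w s h := by
  induction hf with
  | hole u o => exact ⟨fun _ => o, rfl, rfl, fun j hj => absurd hj (Nat.not_lt_zero _), False.elim⟩
  | un hs _ hh ih =>
    obtain ⟨s, rfl, h₂, h₃⟩ := ih
    refine ⟨_, rfl, ?_, IsSegment.cons (b := false) (by rw [graft_un]; rfl) hs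
      (by rw [graft_un]; exact h₃) hh⟩
    exact h₂
  | left hs _ hh ih =>
    obtain ⟨s, rfl, h₂, h₃⟩ := ih
    refine ⟨_, rfl, ?_, IsSegment.cons (b := false) (by rw [graft_bin]; rfl) hs
      (by rw [graft_bin]; exact h₃) hh⟩
    exact h₂
  | right hs _ hh ih =>
    obtain ⟨s, rfl, h₂, h₃⟩ := ih
    refine ⟨_, rfl, ?_, IsSegment.cons (b := true) (by rw [graft_bin]; rfl) hs
      (by rw [graft_bin]; exact h₃) hh⟩
    exact h₂

/-- Thread segments with matching ends are glued. Hits recurring over segments recur along the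
thread, and `χ` lies below every principal formula, so `χ` is the minimal one. -/
theorem exists_thread {t : PTree} {β : ℕ → Bool} {ws : ℕ → List Bool} {pos : ℕ → ℕ}
    (pos_succ : ∀ i, pos (i + 1) = pos i + (ws i).length) (proper : ∀ i, 0 < (ws i).length)
    (node_eq : ∀ i, node (fun n => β (pos i + n)) (ws i).length = ws i)
    {Φ : Ty → Prop} {χ : Ty} {s : ℕ → ℕ → Occ} {h : ℕ → Prop}
    (hs : ∀ i, s i (ws i).length = s (i + 1) 0)
    (hseg : ∀ i, IsSegment Φ χ (t.sub (node β (pos i))) (ws i) (s i) (h i))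
    (hh : ∃ᶠ i in Filter.atTop, h i) (hΦ : ∀ ψ, Φ ψ → χ.Subformula ψ) :
    ∃ k o, t.IsThread β k o ∧ t.IsProgressingThread β k o := by
  -- The state at time `n` is the current segment and the offset in it.
  let st : ℕ → ℕ × ℕ := fun n => n.rec (0, 0) fun _ p =>
    if p.2 + 1 < (ws p.1).length then (p.1, p.2 + 1) else (p.1 + 1, 0)
  have st_succ : ∀ n, st (n + 1) = if (st n).2 + 1 < (ws (st n).1).length
    then ((st n).1, (st n).2 + 1) else ((st n).1 + 1, 0) := fun n => rfl
  have hst : ∀ n, (st n).2 < (ws (st n).1).length ∧ pos (st n).1 + (st n).2 = pos 0 + n := by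
    intro n
    induction n with
    | zero => exact ⟨proper 0, rfl⟩
    | succ n ih =>
      rw [st_succ]
      split_ifs with hlt
      · exact ⟨hlt, by simp only; omega⟩
      · refine ⟨proper _, ?_⟩
        have := pos_succ (st n).1
        simp only
        omega
  have hnext : ∀ n, s (st (n + 1)).1 (st (n + 1)).2 = s (st n).1 ((st n).2 + 1) := by
    intro n
    rw [st_succ]
    split_ifs with hlt
    · rfl
    · have : (st n).2 + 1 = (ws (st n).1).length := by have := (hst n).1; omega
      rw [this, hs]
  have hmono : ∀ i j, i ≤ j → pos i ≤ pos j := fun i j hij => by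
    induction hij with
    | refl => exact le_rfl
    | step _ ih => rw [pos_succ]; omega
  -- Each position is visited, at a time no smaller than its segment number because segments are
  -- nonempty. Hence hits in late segments occur late.
  have hst' : ∀ i j, j < (ws i).length → ∃ n, st n = (i, j) ∧ i ≤ n := by
    intro i j hj
    have hle : ∀ i, pos 0 + i ≤ pos i := by
      intro i
      induction i with
      | zero => exact le_rfl
      | succ i ih => have := pos_succ i; have := proper i; omega
    refine ⟨pos i + j - pos 0, ?_, by have := hle i; omega⟩
    obtain ⟨h₁, h₂⟩ := hst (pos i + j - pos 0)
    have h₃ := hle i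
    generalize st (pos i + j - pos 0) = p at h₁ h₂
    obtain ⟨i', j'⟩ := p
    simp only at h₁ h₂
    have h₄ : i' = i := by
      rcases lt_trichotomy i' i with hlt | heq | hlt
      · have := hmono _ _ hlt
        have := pos_succ i'
        simp only [Nat.succ_eq_add_one] at *
        omega
      · exact heq
      · have := hmono _ _ hlt
        have := pos_succ i
        simp only [Nat.succ_eq_add_one] at *
        omega
    subst h₄
    have : j' = j := by omega
    rw [this]
  have hnode : ∀ i j, j < (ws i).length → ∀ x, (t.sub (node β (pos i))) ((ws i).take j) = x →
      t (node β (pos i + j)) = x := by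
    rintro i j hj x rfl
    rw [node_add, PTree.sub]
    congr 2
    conv_rhs => rw [← node_eq i]
    rw [node, node, ← List.map_take, List.take_range, min_eq_left hj.le]
  have hβ : ∀ i j (hj : j < (ws i).length), (ws i)[j] = β (pos i + j) := by
    intro i j hj
    have := node_eq i
    conv_lhs => rw [← List.getElem_of_eq this (by simpa [length_node] using hj)]
    simp [node]
  refine ⟨pos 0, fun n => s (st n).1 (st n).2, fun n => ?_, χ, ?_, ?_⟩
  · obtain ⟨h₁, h₂⟩ := hst n
    obtain ⟨x, hx, hd, T, hT, -⟩ := (hseg (st n).1).1 _ h₁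
    have := hnode _ _ h₁ _ hx
    rw [h₂] at this
    refine ⟨x, this, by simp [hT], ?_⟩
    simp only
    rw [hnext, ← h₂, ← hβ _ _ h₁, hd]
  · rw [Filter.frequently_atTop] at hh ⊢
    intro N
    obtain ⟨i, hi, hhi⟩ := hh N
    obtain ⟨j, hj, x, hx, hp, hT, hg⟩ := (hseg i).2 hhi
    obtain ⟨n, hn, hin⟩ := hst' i j hj
    have h₂ := (hst n).2
    rw [hn] at h₂
    refine ⟨n, by omega, ⟨x, ?_, by simpa only [hn] using hp, by simpa only [hn] using hT⟩,
      by simpa only [hn] using hg⟩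
    rw [← h₂]
    exact hnode _ _ hj _ hx
  · intro ψ hψ
    obtain ⟨n, x, hx, hp, hT⟩ := hψ.exists
    obtain ⟨h₁, h₂⟩ := hst n
    obtain ⟨x', hx', -, T, hT', hΦT⟩ := (hseg (st n).1).1 _ h₁
    have := hnode _ _ h₁ _ hx'
    rw [h₂, hx] at this
    obtain rfl := Option.some.inj this
    obtain rfl := Option.some.inj (hT.symm.trans hT')
    exact hΦ _ (hΦT hp)

theorem Frag.Run.progressing {u : U} {β : ℕ → Bool} {us : ℕ → U} {ws : ℕ → List Bool}
    {pos : ℕ → ℕ} (hr : Run g u β us ws pos) (hg : ∀ u, (g u).IsProper)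
    {Φ : Ty → Prop} {χ : Ty} {k : ℕ} {occ : ℕ → Occ} {h : ℕ → Prop}
    (hf : ∀ i, Follows Φ χ (g (us (k + i))) (ws (k + i)) (us (k + i + 1)) (occ i) (occ (i + 1)) (h i))
    (hh : ∃ᶠ i in Filter.atTop, h i) (hΦ : ∀ ψ, Φ ψ → χ.Subformula ψ) :
    ∃ k o, (graft g (hole u)).IsThread β k o ∧ (graft g (hole u)).IsProgressingThread β k o := by
  choose s h₁ h₂ h₃ using fun i => (hf i).isSegment (g := g)
  refine exists_thread (ws := fun i => ws (k + i)) (pos := fun i => pos (k + i)) (s := s) (h := h)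
    (fun i => hr.pos_succ (k + i)) (fun i => hr.proper _) (fun i => hr.node_eq _)
    (fun i => (h₂ i).trans (h₁ (i + 1)).symm) (fun i => ?_) hh hΦ
  rw [hr.sub_eq, graft_hole hg]
  exact h₃ i

end Run

/-! ### Threads through the translation -/

section Combinators

variable {U : Type} {Φ : Ty → Prop} {χ : Ty} {f f' : Frag U} {w : List Bool} {u : U} {o' : Occ}
  {h : Prop} {i j : ℕ} {Γ Δ : List Ty} {σ τ ρ : Ty}

theorem StepAt.of_lt {s : Step} {b : Bool} {o₁ : Occ} (hd : s.descendant b o₁ = some (.lhs i))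
    (hi : i < s.concl.ant.length) (hp : s.principal ≠ some (.lhs i)) : StepAt Φ s b (.lhs i) o₁ :=
  ⟨hd, _, List.getElem?_eq_getElem hi, fun h => absurd h hp⟩

/-- The last argument of `Follows` is a condition under which a hit is promised, so it may be
strengthened. This brings all gadgets to the common condition `IsHit`. -/
theorem Frag.Follows.weaken {o : Occ} {h' : Prop} (hf : Follows Φ χ f w u o o' h) (hh : h' → h) :
    Follows Φ χ f w u o o' h' := by
  induction hf generalizing h' with
  | hole u o =>
    obtain rfl : h' = False := propext ⟨hh, False.elim⟩
    exact .hole u o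
  | un hs hf h₁ _ => exact .un hs hf (h₁ ∘ hh)
  | left hs hf h₁ _ => exact .left hs hf (h₁ ∘ hh)
  | right hs hf h₁ _ => exact .right hs hf (h₁ ∘ hh)

theorem follows_swap_lt (hf : Follows Φ χ f w u (.lhs i) o' h)
    (hi : i < Γ.length := by first | omega | (simp at * <;> omega)) :
    Follows Φ χ (swap Γ σ τ f) (false :: w) u (.lhs i) o' h := by
  refine .un (.of_lt ?_ ?_ ?_) hf Or.inl
  · simp only [Step.descendant]
    rw [if_neg (by omega), if_neg (by omega)]
  · simp [Step.concl]; omega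
  · simp [Step.principal]

theorem follows_swap_fst (hf : Follows Φ χ f w u (.lhs j) o' h)
    (hi : i = Γ.length := by first | omega | (simp at * <;> omega))
    (hj : j = Γ.length + 1 := by first | omega | (simp at * <;> omega)) :
    Follows Φ χ (swap Γ σ τ f) (false :: w) u (.lhs i) o' h := by
  refine .un (.of_lt ?_ ?_ ?_) hf Or.inl
  · simp only [Step.descendant]
    rw [if_neg (by omega), if_pos hj, hi]
  · simp [Step.concl]; omega
  · simp [Step.principal]

theorem follows_swap_snd (hf : Follows Φ χ f w u (.lhs j) o' h)
    (hi : i = Γ.length + 1 := by first | omega | (simp at * <;> omega))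
    (hj : j = Γ.length := by first | omega | (simp at * <;> omega)) :
    Follows Φ χ (swap Γ σ τ f) (false :: w) u (.lhs i) o' h := by
  refine .un (.of_lt ?_ ?_ ?_) hf Or.inl
  · simp only [Step.descendant]
    rw [if_pos hj, hi, hj]
  · simp [Step.concl]; omega
  · simp [Step.principal]

theorem follows_rotate_lt (hf : Follows Φ χ f w u (.lhs i) o' h)
    (hi : i < Γ.length := by first | omega | (simp at * <;> omega)) :
    Follows Φ χ (rotate Γ σ τ ρ f) (false :: false :: w) u (.lhs i) o' h := by
  refine .un (.of_lt ?_ ?_ ?_) (follows_swap_lt hf) Or.inl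
  · simp only [Step.descendant]
    rw [if_neg (by omega), if_neg (by omega)]
  · simp [Step.concl]; omega
  · simp [Step.principal]

theorem follows_rotate_fst (hf : Follows Φ χ f w u (.lhs j) o' h)
    (hi : i = Γ.length := by first | omega | (simp at * <;> omega))
    (hj : j = Γ.length + 2 := by first | omega | (simp at * <;> omega)) :
    Follows Φ χ (rotate Γ σ τ ρ f) (false :: false :: w) u (.lhs i) o' h := by
  refine .un (.of_lt ?_ ?_ ?_) (follows_swap_fst (i := Γ.length + 1) hf) Or.inl
  · simp only [Step.descendant]
    rw [if_neg (by omega), hi]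
    simp
  · simp [Step.concl]; omega
  · simp [Step.principal]

theorem follows_rotate_snd (hf : Follows Φ χ f w u (.lhs j) o' h)
    (hi : i = Γ.length + 1 := by first | omega | (simp at * <;> omega))
    (hj : j = Γ.length := by first | omega | (simp at * <;> omega)) :
    Follows Φ χ (rotate Γ σ τ ρ f) (false :: false :: w) u (.lhs i) o' h := by
  refine .un (.of_lt ?_ ?_ ?_) (follows_swap_lt hf) Or.inl
  · simp only [Step.descendant]
    rw [if_pos hj, hi, hj]
  · simp [Step.concl]; omega
  · simp [Step.principal]

theorem follows_rotate_thd (hf : Follows Φ χ f w u (.lhs j) o' h)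
    (hi : i = Γ.length + 2 := by first | omega | (simp at * <;> omega))
    (hj : j = Γ.length + 1 := by first | omega | (simp at * <;> omega)) :
    Follows Φ χ (rotate Γ σ τ ρ f) (false :: false :: w) u (.lhs i) o' h := by
  refine .un (.of_lt ?_ ?_ ?_) (follows_swap_snd (i := Γ.length + 2) hf) Or.inl
  · simp only [Step.descendant]
    rw [if_neg (by omega), if_neg (by omega), hi]
  · simp [Step.concl]; omega
  · simp [Step.principal]

theorem follows_call_lt (hf : Follows Φ χ f w u (.lhs i) o' h)
    (hi : i < Γ.length := by first | omega | (simp at * <;> omega)) :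
    Follows Φ χ (call Γ σ f) (false :: w) u (.lhs i) o' h := by
  refine .left (.of_lt rfl ?_ ?_) hf Or.inl
  · simp [Step.concl]; omega
  · simp [Step.principal]; omega

theorem follows_call_last (hΦ : Φ (neg σ)) (hf : Follows Φ χ f w u .rhs o' h)
    (hi : i = Γ.length := by first | omega | (simp at * <;> omega)) :
    Follows Φ χ (call Γ σ f) (false :: w) u (.lhs i) o' h := by
  subst hi
  exact .left ⟨rfl, neg σ, by simp [Sequent.type, Step.concl], fun _ => hΦ⟩ hf Or.inl

theorem follows_lam_lt (hf : Follows Φ χ f w u (.lhs i) o' h)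
    (hi : i < Γ.length := by first | omega | (simp at * <;> omega)) :
    Follows Φ χ (lam Γ σ f) (false :: w) u (.lhs i) o' h := by
  refine .un (.of_lt ?_ hi (by simp [Step.principal])) hf Or.inl
  simp [Step.descendant, hi]

theorem follows_lam_rhs (hΦ : Φ (neg σ)) (hf : Follows Φ χ f w u (.lhs j) o' h)
    (hj : j = Γ.length := by first | omega | (simp at * <;> omega)) :
    Follows Φ χ (lam Γ σ f) (false :: w) u .rhs o' h :=
  .un ⟨by simp [Step.descendant, hj], neg σ, rfl, fun _ => hΦ⟩ hf Or.inl

theorem follows_wk (hf : Follows Φ χ f w u (.lhs i) o' h)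
    (hi : i < Γ.length := by first | omega | (simp at * <;> omega)) :
    Follows Φ χ (un (.wk Γ σ τ) f) (false :: w) u (.lhs i) o' h := by
  refine .un (.of_lt rfl ?_ (by simp [Step.principal])) hf Or.inl
  simp [Step.concl]; omega

theorem follows_ctr_lt (hf : Follows Φ χ f w u (.lhs i) o' h)
    (hi : i < Γ.length := by first | omega | (simp at * <;> omega)) :
    Follows Φ χ (un (.ctr Γ σ τ) f) (false :: w) u (.lhs i) o' h := by
  refine .un (.of_lt ?_ ?_ (by simp [Step.principal])) hf Or.inl
  · simp [Step.descendant]; omega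
  · simp [Step.concl]; omega

theorem follows_ctr_last (hf : Follows Φ χ f w u (.lhs j) o' h)
    (hi : i = Γ.length := by first | omega | (simp at * <;> omega))
    (hj : Γ.length ≤ j := by first | omega | (simp at * <;> omega)) :
    Follows Φ χ (un (.ctr Γ σ τ) f) (false :: w) u (.lhs i) o' h := by
  refine .un (.of_lt ?_ ?_ (by simp [Step.principal])) hf Or.inl
  · simp [Step.descendant]; omega
  · simp [Step.concl]; omega

theorem follows_prodL_lt (hf : Follows Φ χ f w u (.lhs i) o' h)
    (hi : i < Γ.length := by first | omega | (simp at * <;> omega)) :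
    Follows Φ χ (un (.prodL Γ σ τ ρ) f) (false :: w) u (.lhs i) o' h := by
  refine .un (.of_lt ?_ ?_ ?_) hf Or.inl
  · simp [Step.descendant]; omega
  · simp [Step.concl]; omega
  · simp [Step.principal]; omega

theorem follows_prodL_last (hΦ : Φ (prod σ τ)) (hf : Follows Φ χ f w u (.lhs j) o' h)
    (hi : i = Γ.length := by first | omega | (simp at * <;> omega))
    (hj : Γ.length ≤ j := by first | omega | (simp at * <;> omega)) :
    Follows Φ χ (un (.prodL Γ σ τ ρ) f) (false :: w) u (.lhs i) o' h := by
  subst hi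
  exact .un ⟨by simp [Step.descendant, hj], prod σ τ, by simp [Sequent.type, Step.concl],
    fun _ => hΦ⟩ hf Or.inl

theorem follows_prodR_left_lt (hf : Follows Φ χ f w u (.lhs i) o' h)
    (hi : i < Γ.length := by first | omega | (simp at * <;> omega)) :
    Follows Φ χ (bin (.prodR Γ Δ σ τ) f f') (false :: w) u (.lhs i) o' h := by
  refine .left (.of_lt rfl ?_ (by simp [Step.principal])) hf Or.inl
  simp [Step.concl]; omega

theorem follows_prodR_left_rhs (hΦ : Φ (prod σ τ)) (hf : Follows Φ χ f w u .rhs o' h) :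
    Follows Φ χ (bin (.prodR Γ Δ σ τ) f f') (false :: w) u .rhs o' h :=
  .left ⟨rfl, prod σ τ, rfl, fun _ => hΦ⟩ hf Or.inl

theorem follows_prodR_right_lt (hf : Follows Φ χ f' w u (.lhs j) o' h)
    (hi : i = Γ.length + j := by first | omega | (simp at * <;> omega))
    (hj : j < Δ.length := by first | omega | (simp at * <;> omega)) :
    Follows Φ χ (bin (.prodR Γ Δ σ τ) f f') (true :: w) u (.lhs i) o' h := by
  refine .right (.of_lt ?_ ?_ (by simp [Step.principal])) hf Or.inl
  · simp [Step.descendant, hi]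
  · simp [Step.concl]; omega

theorem follows_prodR_right_rhs (hΦ : Φ (prod σ τ)) (hf : Follows Φ χ f' w u .rhs o' h) :
    Follows Φ χ (bin (.prodR Γ Δ σ τ) f f') (true :: w) u .rhs o' h :=
  .right ⟨rfl, prod σ τ, rfl, fun _ => hΦ⟩ hf Or.inl

theorem follows_natL_left (hf : Follows Φ χ f w u (.lhs i) o' h)
    (hi : i < Γ.length := by first | omega | (simp at * <;> omega)) :
    Follows Φ χ (bin (.natL Γ σ) f f') (false :: w) u (.lhs i) o' h := by
  refine .left (.of_lt rfl ?_ ?_) hf Or.inl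
  · simp [Step.concl]; omega
  · simp [Step.principal]; omega

theorem follows_natL_right (hf : Follows Φ χ f' w u (.lhs i) o' h)
    (hi : i < Γ.length := by first | omega | (simp at * <;> omega)) :
    Follows Φ χ (bin (.natL Γ σ) f f') (true :: w) u (.lhs i) o' h := by
  refine .right (.of_lt rfl ?_ ?_) hf Or.inl
  · simp [Step.concl]; omega
  · simp [Step.principal]; omega

/-- The native case distinction is principal on `N`, which is literally a `μ`-formula; descending
along predecessors therefore makes progress. -/
theorem follows_natL_last (hΦ : Φ nat) (hf : Follows Φ χ f' w u (.lhs i) o' h)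
    (hi : i = Γ.length := by first | omega | (simp at * <;> omega)) :
    Follows Φ χ (bin (.natL Γ σ) f f') (true :: w) u (.lhs i) o' (h ∨ nat = χ) := by
  subst hi
  have hT : (Step.natL Γ σ).concl.type (.lhs Γ.length) = some nat := by
    simp [Sequent.type, Step.concl]
  refine .right ⟨rfl, nat, hT, fun _ => hΦ⟩ hf ?_
  rintro (h | rfl)
  · exact .inl h
  · exact .inr ⟨rfl, hT, .inl ⟨_, _, rfl, rfl⟩⟩

theorem follows_muR_lt (hf : Follows Φ χ f w u (.lhs i) o' h)
    (hi : i < Γ.length := by first | omega | (simp at * <;> omega)) :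
    Follows Φ χ (un (.muR Γ σ) f) (false :: w) u (.lhs i) o' h :=
  .un (.of_lt rfl hi (by simp [Step.principal])) hf Or.inl

theorem follows_muR_rhs (hΦ : Φ (mu σ)) (hf : Follows Φ χ f w u .rhs o' h) :
    Follows Φ χ (un (.muR Γ σ) f) (false :: w) u .rhs o' h :=
  .un ⟨rfl, mu σ, rfl, fun _ => hΦ⟩ hf Or.inl

theorem follows_muL_lt (hf : Follows Φ χ f w u (.lhs i) o' h)
    (hi : i < Γ.length := by first | omega | (simp at * <;> omega)) :
    Follows Φ χ (un (.muL Γ σ τ) f) (false :: w) u (.lhs i) o' h := by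
  refine .un (.of_lt rfl ?_ ?_) hf Or.inl
  · simp [Step.concl]; omega
  · simp [Step.principal]; omega

theorem follows_muL_last (hΦ : Φ (mu σ)) (hf : Follows Φ χ f w u (.lhs i) o' h)
    (hi : i = Γ.length := by first | omega | (simp at * <;> omega)) :
    Follows Φ χ (un (.muL Γ σ τ) f) (false :: w) u (.lhs i) o' (h ∨ mu σ = χ) := by
  subst hi
  have hT : (Step.muL Γ σ τ).concl.type (.lhs Γ.length) = some (mu σ) := by
    simp [Sequent.type, Step.concl]
  refine .un ⟨rfl, mu σ, hT, fun _ => hΦ⟩ hf ?_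
  rintro (h | rfl)
  · exact .inl h
  · exact .inr ⟨rfl, hT, .inl ⟨_, _, rfl, rfl⟩⟩

theorem follows_cut_left (hf : Follows Φ χ f w u (.lhs i) o' h)
    (hi : i < Γ.length := by first | omega | (simp at * <;> omega)) :
    Follows Φ χ (bin (.cut Γ Δ σ τ) f f') (false :: w) u (.lhs i) o' h := by
  refine .left (.of_lt rfl ?_ (by simp [Step.principal])) hf Or.inl
  simp [Step.concl]; omega

theorem follows_cut_right (hf : Follows Φ χ f' w u (.lhs j) o' h)
    (hi : i = Γ.length + j := by first | omega | (simp at * <;> omega))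
    (hj : j < Δ.length := by first | omega | (simp at * <;> omega)) :
    Follows Φ χ (bin (.cut Γ Δ σ τ) f f') (true :: w) u (.lhs i) o' h := by
  refine .right (.of_lt ?_ ?_ (by simp [Step.principal])) hf Or.inl
  · simp [Step.descendant, hi, hj]
  · simp [Step.concl]; omega

end Combinators

/-- The image of an occurrence under the translation. -/
def Sequent.img (S : Sequent) : Occ → Occ
  | .lhs i => .lhs i
  | .rhs => .lhs S.ant.length

/-- A progressing occurrence whose translation is a thread element with principal formula `χ`. -/
def IsHit (χ : Ty) (s : Step) (o : Occ) : Prop :=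
  (∃ Γ σ τ, s = .muL Γ σ τ ∧ o = .lhs Γ.length ∧ mu (muBody σ) = χ) ∨
    ∃ Γ σ, s = .nuR Γ σ ∧ o = .rhs ∧ mu (nuBody σ) = χ

-- A thread through a step is sent to a thread through its gadget, with the succedent sent to the
-- continuation on the left. The principal formulas passed on the way contain the core of the
-- conclusion's or of the premiss's formula. Assuming `Φ` for both cores and closing upwards thus
-- covers every case.
set_option linter.unusedSimpArgs false in
set_option maxHeartbeats 2000000 in
theorem follows_gadget {Φ : Ty → Prop} {χ : Ty} (hΦ : ∀ {σ τ : Ty}, Φ σ → Subformula σ τ → Φ τ)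
    {s : Step} (hn : ¬ s.IsNative) {b : Bool} {S : Sequent} (hb : s.prem b = some S) {o o₁ : Occ}
    {ψ ψ₁ : Ty} (h₁ : S.type o₁ = some ψ₁) (hd : s.descendant b o₁ = some o)
    (h : s.concl.type o = some ψ) (hψ : Φ (core (fun _ => false) ψ))
    (hψ₁ : Φ (core (fun _ => false) ψ₁)) : ∃ w,
      Follows Φ χ (gadget s) w b (s.concl.img o) (S.img o₁) (IsHit χ s o) := by
  -- The principal formulas inside the gadgets are mostly continuation types and their negations;
  -- those not listed here are obtained from these by enclosing them in a product.
  have hK : Φ (K ψ) := hΦ hψ core_sub_cont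
  have hK₁ : Φ (K ψ₁) := hΦ hψ₁ core_sub_cont
  have hC : Φ (C ψ) := hΦ hK (.arr_left (.refl _))
  have hC₁ : Φ (C ψ₁) := hΦ hK₁ (.arr_left (.refl _))
  have hNC₁ : Φ (neg (C ψ₁)) := hΦ hC₁ (.arr_left (.refl _))
  have no : (∀ Γ σ τ, s ≠ .muL Γ σ τ) → (∀ Γ σ, s ≠ .nuR Γ σ) → IsHit χ s o → False := by
    rintro h₁ h₂ (⟨_, _, _, h, _⟩ | ⟨_, _, h, _⟩)
    exacts [h₁ _ _ _ h, h₂ _ _ h]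
  have np : s.principal ≠ some o → IsHit χ s o → False := by
    rintro hp (⟨_, _, _, rfl, rfl, _⟩ | ⟨_, _, rfl, rfl, _⟩) <;> exact hp rfl
  -- Used for the two gadgets that unfold a `μ` on the left along the followed thread, those of
  -- `muL` and `nuR`.
  have hit : ∀ {σ : Ty}, (∀ Γ ρ τ, s = .muL Γ ρ τ → mu (muBody ρ) = mu σ) →
      (∀ Γ ρ, s = .nuR Γ ρ → mu (nuBody ρ) = mu σ) → IsHit χ s o → False ∨ mu σ = χ := by
    rintro σ h₁ h₂ (⟨_, _, _, h, -, rfl⟩ | ⟨_, _, h, -, rfl⟩)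
    exacts [.inr (h₁ _ _ _ h).symm, .inr (h₂ _ _ h).symm]
  have lt : ∀ {i : ℕ} {ψ : Ty} {S : Sequent}, S.type (.lhs i) = some ψ → i < S.ant.length :=
    fun h => (List.getElem?_eq_some_iff.1 h).1
  cases s
  case natR₀ => exact (hn trivial).elim
  case natR₁ => exact (hn trivial).elim
  case natL => exact (hn trivial).elim
  case id => cases b <;> simp [Step.prem, Step.prems] at hb
  case oneR => cases b <;> simp [Step.prem, Step.prems] at hb
  case exch Γ σ τ Δ γ =>
    cases b
    · simp only [Step.prem, Step.prems, Bool.toNat_false, List.getElem?_cons_zero,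
        Option.some.injEq] at hb
      subst hb
      simp only [gadget]
      refine ⟨[false], .weaken (h := False) (.un ?_ (.hole _ _) (by simp)) (no nofun nofun)⟩
      rcases o₁ with i | _
      · have hi := lt h₁
        simp only [List.length_append, List.length_cons] at hi
        simp only [Step.descendant, Option.some.injEq] at hd
        subst hd
        refine .of_lt ?_ ?_ (by simp [Step.principal])
        · simp [Step.descendant, Sequent.img]
        · simp only [Step.concl, List.length_append, List.length_cons, List.length_map]
          split_ifs <;> omega
      · simp only [Step.descendant, Option.some.injEq] at hd
        subst hd
        refine .of_lt ?_ ?_ (by simp [Step.principal])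
        · simp only [Step.descendant, Sequent.img, Step.concl, List.length_append, List.length_cons,
            List.length_map]
          rw [if_neg (by omega), if_neg (by omega)]
        · simp [Step.concl]
    · simp [Step.prem, Step.prems] at hb
  case cut Γ Δ σ τ =>
    cases b <;> simp only [Step.prem, Step.prems, Bool.toNat_false, Bool.toNat_true,
        List.getElem?_cons_zero, List.getElem?_cons_succ, Option.some.injEq] at hb <;> subst hb
    · rcases o₁ with i | _
      · have hi := lt h₁
        obtain rfl := Option.some.inj hd
        exact ⟨_, .weaken (follows_cut_left (follows_lam_lt (.hole _ _))) (no nofun nofun)⟩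
      · cases hd
    · rcases o₁ with i | _
      · simp only [Step.descendant] at hd
        split_ifs at hd with hi
        obtain rfl := Option.some.inj hd
        exact ⟨_, .weaken (follows_cut_right (follows_swap_lt (.hole _ _))) (no nofun nofun)⟩
      · obtain rfl := Option.some.inj hd
        simp only [Sequent.img, Step.concl, List.length_append, List.length_singleton]
        exact ⟨_, .weaken (follows_cut_right (j := Δ.length) (follows_swap_fst (.hole _ _)))
          (no nofun nofun)⟩
  case wk Γ σ τ =>
    cases b
    · simp only [Step.prem, Step.prems, Bool.toNat_false, List.getElem?_cons_zero,
        Option.some.injEq] at hb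
      subst hb
      rcases o₁ with i | _
      · have hi := lt h₁
        obtain rfl := Option.some.inj hd
        exact ⟨_, .weaken (follows_swap_lt (follows_wk (.hole _ _))) (no nofun nofun)⟩
      · obtain rfl := Option.some.inj hd
        simp only [Sequent.img, Step.concl, List.length_append, List.length_cons, List.length_nil]
        exact ⟨_, .weaken (follows_swap_snd (follows_wk (.hole _ _))) (no nofun nofun)⟩
    · simp [Step.prem, Step.prems] at hb
  case ctr Γ σ τ =>
    cases b
    · simp only [Step.prem, Step.prems, Bool.toNat_false, List.getElem?_cons_zero,
        Option.some.injEq] at hb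
      subst hb
      rcases o₁ with i | _
      · have hi := lt h₁
        simp only [List.length_append, List.length_cons, List.length_nil] at hi
        rcases Nat.lt_or_ge i Γ.length with hi' | hi'
        · obtain rfl : o = .lhs i := by
            simp only [Step.descendant, Option.some.injEq] at hd
            rw [← hd]; first | rfl | rw [if_pos hi'] | rw [min_eq_left hi'.le]
          exact ⟨_, .weaken (follows_swap_lt (follows_ctr_lt (follows_rotate_lt (.hole _ _)))) (no nofun nofun)⟩
        · obtain rfl : o = .lhs Γ.length := by
            simp only [Step.descendant, Option.some.injEq] at hd
            rw [← hd]; rw [min_eq_right hi']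
          obtain rfl | rfl : i = Γ.length ∨ i = Γ.length + 1 := by omega
          · simp only [Sequent.img, Step.concl]
            exact ⟨_, .weaken (follows_swap_fst (j := Γ.length + 1) (follows_ctr_last (j := Γ.length + 1) (follows_rotate_snd (.hole _ _)))) (no nofun nofun)⟩
          · simp only [Sequent.img, Step.concl]
            exact ⟨_, .weaken (follows_swap_fst (j := Γ.length + 1) (follows_ctr_last (j := Γ.length + 2) (follows_rotate_thd (.hole _ _)))) (no nofun nofun)⟩
      · obtain rfl := Option.some.inj hd
        simp only [Sequent.img, Step.concl, List.length_append, List.length_cons, List.length_nil]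
        exact ⟨_, .weaken (follows_swap_snd (j := Γ.length) (follows_ctr_lt (follows_rotate_fst (.hole _ _)))) (no nofun nofun)⟩
    · simp [Step.prem, Step.prems] at hb
  case oneL Γ σ =>
    cases b
    · simp only [Step.prem, Step.prems, Bool.toNat_false, List.getElem?_cons_zero,
        Option.some.injEq] at hb
      subst hb
      rcases o₁ with i | _
      · have hi := lt h₁
        obtain rfl := Option.some.inj hd
        exact ⟨_, .weaken (follows_swap_lt (follows_call_lt (follows_lam_lt (follows_wk (.hole _ _))))) (no nofun nofun)⟩
      · obtain rfl := Option.some.inj hd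
        simp only [Sequent.img, Step.concl, List.length_append, List.length_cons, List.length_nil]
        exact ⟨_, .weaken (follows_swap_snd (follows_call_lt (follows_lam_lt (follows_wk (.hole _ _))))) (no nofun nofun)⟩
    · simp [Step.prem, Step.prems] at hb
  case arrR Γ σ τ =>
    cases b
    · simp only [Step.prem, Step.prems, Bool.toNat_false, List.getElem?_cons_zero,
        Option.some.injEq] at hb
      subst hb
      rcases o₁ with i | _
      · have hi := lt h₁
        simp only [List.length_append, List.length_cons, List.length_nil] at hi
        rcases Nat.lt_or_ge i Γ.length with hi' | hi'
        · obtain rfl : o = .lhs i := by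
            simp only [Step.descendant, Option.some.injEq] at hd
            rw [← hd]; first | rfl | rw [if_pos hi']
          exact ⟨_, .weaken (follows_prodL_lt (follows_call_lt (follows_lam_lt (.hole _ _)))) (no nofun nofun)⟩
        · obtain rfl : o = .rhs := by
            simp only [Step.descendant, Option.some.injEq] at hd
            rw [← hd]; rw [if_neg (by omega)]
          obtain rfl : i = Γ.length := by omega
          have hψe : arr σ τ = ψ := by simpa [Sequent.type, Step.concl] using h
          subst hψe
          simp only [Sequent.img, Step.concl]
          exact ⟨_, .weaken (follows_prodL_last (j := Γ.length) hK (follows_call_lt (follows_lam_lt (.hole _ _)))) (no nofun nofun)⟩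
      · obtain rfl := Option.some.inj hd
        have hψe : arr σ τ = ψ := by simpa [Sequent.type, Step.concl] using h
        subst hψe
        have hψe₁ : τ = ψ₁ := by simpa [Sequent.type] using h₁
        subst hψe₁
        simp only [Sequent.img, Step.concl, List.length_append, List.length_cons, List.length_nil]
        exact ⟨_, .weaken (follows_prodL_last (j := Γ.length + 1) hK (follows_call_last hNC₁
          (follows_lam_rhs hC₁ (.hole _ _)))) (no nofun nofun)⟩
    · simp [Step.prem, Step.prems] at hb
  case arrL Γ Δ σ τ γ =>
    cases b <;> simp only [Step.prem, Step.prems, Bool.toNat_false, Bool.toNat_true,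
        List.getElem?_cons_zero, List.getElem?_cons_succ, Option.some.injEq] at hb <;> subst hb
    · rcases o₁ with i | _
      · have hi := lt h₁
        obtain rfl := Option.some.inj hd
        exact ⟨_, .weaken (follows_swap_lt (follows_call_lt (follows_prodR_left_lt (follows_lam_lt (.hole _ _))))) (no nofun nofun)⟩
      · obtain rfl := Option.some.inj hd
        have hψe : arr σ τ = ψ := by simpa [Sequent.type, Step.concl] using h
        subst hψe
        have hψe₁ : σ = ψ₁ := by simpa [Sequent.type] using h₁
        subst hψe₁
        simp only [Sequent.img, Step.concl, List.length_append, List.length_cons, List.length_nil]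
        exact ⟨_, .weaken (follows_swap_fst (j := Γ.length + Δ.length + 1) (follows_call_last hC (follows_prodR_left_rhs hK (follows_lam_rhs hC₁ (.hole _ _))))) (no nofun nofun)⟩
    · rcases o₁ with i | _
      · have hi := lt h₁
        simp only [List.length_append, List.length_cons, List.length_nil] at hi
        obtain rfl := Option.some.inj hd
        rcases Nat.lt_or_ge i Δ.length with hi' | hi'
        · exact ⟨_, .weaken (follows_swap_lt (follows_call_lt (follows_prodR_right_lt (j := i) (follows_lam_lt (follows_swap_lt (.hole _ _)))))) (no nofun nofun)⟩
        · obtain rfl : i = Δ.length := by omega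
          have hψe : arr σ τ = ψ := by simpa [Sequent.type, Step.concl] using h
          subst hψe
          have hψe₁ : τ = ψ₁ := by simpa [Sequent.type] using h₁
          subst hψe₁
          simp only [Sequent.img, Step.concl]
          exact ⟨_, .weaken (follows_swap_fst (j := Γ.length + Δ.length + 1) (follows_call_last hC (follows_prodR_right_rhs hK (follows_lam_rhs (j := Δ.length + 1) hNC₁ (follows_swap_snd (.hole _ _)))))) (no nofun nofun)⟩
      · obtain rfl := Option.some.inj hd
        simp only [Sequent.img, Step.concl, List.length_append, List.length_cons, List.length_nil]
        exact ⟨_, .weaken (follows_swap_snd (j := Γ.length + Δ.length) (follows_call_lt (follows_prodR_right_lt (j := Δ.length) (follows_lam_lt (follows_swap_fst (.hole _ _)))))) (no nofun nofun)⟩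
  case prodR Γ Δ σ τ =>
    cases b <;> simp only [Step.prem, Step.prems, Bool.toNat_false, Bool.toNat_true,
        List.getElem?_cons_zero, List.getElem?_cons_succ, Option.some.injEq] at hb <;> subst hb
    · rcases o₁ with i | _
      · have hi := lt h₁
        obtain rfl := Option.some.inj hd
        exact ⟨_, .weaken (follows_call_lt (follows_prodR_left_lt (follows_lam_lt (.hole _ _)))) (no nofun nofun)⟩
      · obtain rfl := Option.some.inj hd
        have hψe : prod σ τ = ψ := by simpa [Sequent.type, Step.concl] using h
        subst hψe
        have hψe₁ : σ = ψ₁ := by simpa [Sequent.type] using h₁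
        subst hψe₁
        have hP : Φ (prod (C σ) (C τ)) := hΦ hC₁ (.prod_left (.refl _))
        simp only [Sequent.img, Step.concl, List.length_append, List.length_cons, List.length_nil]
        exact ⟨_, .weaken (follows_call_last hK (follows_prodR_left_rhs hP (follows_lam_rhs hC₁ (.hole _ _)))) (no nofun nofun)⟩
    · rcases o₁ with i | _
      · have hi := lt h₁
        obtain rfl := Option.some.inj hd
        exact ⟨_, .weaken (follows_call_lt (follows_prodR_right_lt (j := i) (follows_lam_lt (.hole _ _)))) (no nofun nofun)⟩
      · obtain rfl := Option.some.inj hd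
        have hψe : prod σ τ = ψ := by simpa [Sequent.type, Step.concl] using h
        subst hψe
        have hψe₁ : τ = ψ₁ := by simpa [Sequent.type] using h₁
        subst hψe₁
        have hP : Φ (prod (C σ) (C τ)) := hΦ hC₁ (.prod_right (.refl _))
        simp only [Sequent.img, Step.concl, List.length_append, List.length_cons, List.length_nil]
        exact ⟨_, .weaken (follows_call_last hK (follows_prodR_right_rhs hP (follows_lam_rhs hC₁ (.hole _ _)))) (no nofun nofun)⟩
  case prodL Γ σ τ γ =>
    cases b
    · simp only [Step.prem, Step.prems, Bool.toNat_false, List.getElem?_cons_zero,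
        Option.some.injEq] at hb
      subst hb
      rcases o₁ with i | _
      · have hi := lt h₁
        simp only [List.length_append, List.length_cons, List.length_nil] at hi
        rcases Nat.lt_or_ge i Γ.length with hi' | hi'
        · obtain rfl : o = .lhs i := by
            simp only [Step.descendant, Option.some.injEq] at hd
            rw [← hd]; first | rfl | rw [if_pos hi'] | rw [min_eq_left hi'.le]
          exact ⟨_, .weaken (follows_swap_lt (follows_call_lt (follows_lam_lt (follows_prodL_lt (follows_rotate_lt (.hole _ _)))))) (no nofun nofun)⟩
        · obtain rfl : o = .lhs Γ.length := by
            simp only [Step.descendant, Option.some.injEq] at hd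
            rw [← hd]; rw [min_eq_right hi']
          obtain rfl | rfl : i = Γ.length ∨ i = Γ.length + 1 := by omega
          · have hψe : prod σ τ = ψ := by simpa [Sequent.type, Step.concl] using h
            subst hψe
            have hψe₁ : σ = ψ₁ := by simpa [Sequent.type] using h₁
            subst hψe₁
            have hP : Φ (prod (C σ) (C τ)) := hΦ hC₁ (.prod_left (.refl _))
            simp only [Sequent.img, Step.concl]
            exact ⟨_, .weaken (follows_swap_fst (j := Γ.length + 1) (follows_call_last hC (follows_lam_rhs (j := Γ.length + 1) hK (follows_prodL_last (j := Γ.length + 1) hP (follows_rotate_snd (.hole _ _)))))) (no nofun nofun)⟩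
          · have hψe : prod σ τ = ψ := by simpa [Sequent.type, Step.concl] using h
            subst hψe
            have hψe₁ : τ = ψ₁ := by simpa [Sequent.type] using h₁
            subst hψe₁
            have hP : Φ (prod (C σ) (C τ)) := hΦ hC₁ (.prod_right (.refl _))
            simp only [Sequent.img, Step.concl]
            exact ⟨_, .weaken (follows_swap_fst (j := Γ.length + 1) (follows_call_last hC (follows_lam_rhs (j := Γ.length + 1) hK (follows_prodL_last (j := Γ.length + 2) hP (follows_rotate_thd (.hole _ _)))))) (no nofun nofun)⟩
      · obtain rfl := Option.some.inj hd
        simp only [Sequent.img, Step.concl, List.length_append, List.length_cons, List.length_nil]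
        exact ⟨_, .weaken (follows_swap_snd (j := Γ.length) (follows_call_lt (follows_lam_lt (follows_prodL_lt (follows_rotate_fst (.hole _ _)))))) (no nofun nofun)⟩
    · simp [Step.prem, Step.prems] at hb
  case sumR₀ Γ σ τ =>
    cases b
    · simp only [Step.prem, Step.prems, Bool.toNat_false, List.getElem?_cons_zero,
        Option.some.injEq] at hb
      subst hb
      rcases o₁ with i | _
      · have hi := lt h₁
        obtain rfl := Option.some.inj hd
        exact ⟨_, .weaken (follows_call_lt (follows_prodR_left_lt (follows_prodR_left_lt (follows_lam_lt (.hole _ _))))) (no nofun nofun)⟩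
      · obtain rfl := Option.some.inj hd
        have hψe : sum σ τ = ψ := by simpa [Sequent.type, Step.concl] using h
        subst hψe
        have hψe₁ : σ = ψ₁ := by simpa [Sequent.type] using h₁
        subst hψe₁
        have hP : Φ (prod (C σ) (C τ)) := hΦ hC₁ (.prod_left (.refl _))
        have hPP : Φ (prod (prod (C σ) (C τ)) nat) := hΦ hP (.prod_left (.refl _))
        simp only [Sequent.img, Step.concl, List.length_append, List.length_cons, List.length_nil]
        exact ⟨_, .weaken (follows_call_last hK (follows_prodR_left_rhs hPP (follows_prodR_left_rhs hP (follows_lam_rhs hC₁ (.hole _ _))))) (no nofun nofun)⟩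
    · simp [Step.prem, Step.prems] at hb
  case sumR₁ Γ σ τ =>
    cases b
    · simp only [Step.prem, Step.prems, Bool.toNat_false, List.getElem?_cons_zero,
        Option.some.injEq] at hb
      subst hb
      rcases o₁ with i | _
      · have hi := lt h₁
        obtain rfl := Option.some.inj hd
        exact ⟨_, .weaken (follows_call_lt (follows_prodR_left_lt (follows_prodR_right_lt (j := i) (follows_lam_lt (.hole _ _))))) (no nofun nofun)⟩
      · obtain rfl := Option.some.inj hd
        have hψe : sum σ τ = ψ := by simpa [Sequent.type, Step.concl] using h
        subst hψe
        have hψe₁ : τ = ψ₁ := by simpa [Sequent.type] using h₁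
        subst hψe₁
        have hP : Φ (prod (C σ) (C τ)) := hΦ hC₁ (.prod_right (.refl _))
        have hPP : Φ (prod (prod (C σ) (C τ)) nat) := hΦ hP (.prod_left (.refl _))
        simp only [Sequent.img, Step.concl, List.length_append, List.length_cons, List.length_nil]
        exact ⟨_, .weaken (follows_call_last hK (follows_prodR_left_rhs hPP (follows_prodR_right_rhs hP (follows_lam_rhs hC₁ (.hole _ _))))) (no nofun nofun)⟩
    · simp [Step.prem, Step.prems] at hb
  case sumL Γ σ τ γ =>
    cases b <;> simp only [Step.prem, Step.prems, Bool.toNat_false, Bool.toNat_true,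
        List.getElem?_cons_zero, List.getElem?_cons_succ, Option.some.injEq] at hb <;> subst hb
    · rcases o₁ with i | _
      · have hi := lt h₁
        simp only [List.length_append, List.length_cons, List.length_nil] at hi
        rcases Nat.lt_or_ge i Γ.length with hi' | hi'
        · obtain rfl : o = .lhs i := by
            simp only [Step.descendant, Option.some.injEq] at hd
            rw [← hd]
          exact ⟨_, .weaken (follows_swap_lt (follows_call_lt (follows_lam_lt (follows_prodL_lt (follows_natL_left (follows_prodL_lt (follows_wk (follows_swap_lt (.hole _ _))))))))) (no nofun nofun)⟩
        · obtain rfl : i = Γ.length := by omega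
          obtain rfl := Option.some.inj hd
          have hψe : sum σ τ = ψ := by simpa [Sequent.type, Step.concl] using h
          subst hψe
          have hψe₁ : σ = ψ₁ := by simpa [Sequent.type] using h₁
          subst hψe₁
          have hP : Φ (prod (C σ) (C τ)) := hΦ hC₁ (.prod_left (.refl _))
          have hPP : Φ (prod (prod (C σ) (C τ)) nat) := hΦ hP (.prod_left (.refl _))
          simp only [Sequent.img, Step.concl]
          exact ⟨_, .weaken (follows_swap_fst (j := Γ.length + 1) (follows_call_last hC (follows_lam_rhs (j := Γ.length + 1) hK (follows_prodL_last (j := Γ.length + 1) hPP (follows_natL_left (follows_prodL_last (j := Γ.length + 1) hP (follows_wk (follows_swap_snd (.hole _ _))))))))) (no nofun nofun)⟩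
      · obtain rfl := Option.some.inj hd
        simp only [Sequent.img, Step.concl, List.length_append, List.length_cons, List.length_nil]
        exact ⟨_, .weaken (follows_swap_snd (j := Γ.length) (follows_call_lt (follows_lam_lt (follows_prodL_lt (follows_natL_left (follows_prodL_lt (follows_wk (follows_swap_fst (.hole _ _))))))))) (no nofun nofun)⟩
    · rcases o₁ with i | _
      · have hi := lt h₁
        simp only [List.length_append, List.length_cons, List.length_nil] at hi
        rcases Nat.lt_or_ge i Γ.length with hi' | hi'
        · obtain rfl : o = .lhs i := by
            simp only [Step.descendant, Option.some.injEq] at hd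
            rw [← hd]
          exact ⟨_, .weaken (follows_swap_lt (follows_call_lt (follows_lam_lt (follows_prodL_lt (follows_natL_right (follows_wk (follows_prodL_lt (follows_swap_lt (follows_wk (follows_swap_lt (.hole _ _))))))))))) (no nofun nofun)⟩
        · obtain rfl : i = Γ.length := by omega
          obtain rfl := Option.some.inj hd
          have hψe : sum σ τ = ψ := by simpa [Sequent.type, Step.concl] using h
          subst hψe
          have hψe₁ : τ = ψ₁ := by simpa [Sequent.type] using h₁
          subst hψe₁
          have hP : Φ (prod (C σ) (C τ)) := hΦ hC₁ (.prod_right (.refl _))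
          have hPP : Φ (prod (prod (C σ) (C τ)) nat) := hΦ hP (.prod_left (.refl _))
          simp only [Sequent.img, Step.concl]
          exact ⟨_, .weaken (follows_swap_fst (j := Γ.length + 1) (follows_call_last hC (follows_lam_rhs (j := Γ.length + 1) hK (follows_prodL_last (j := Γ.length + 1) hPP (follows_natL_right (follows_wk (follows_prodL_last (j := Γ.length + 2) hP (follows_swap_snd (j := Γ.length + 1) (follows_wk (follows_swap_snd (.hole _ _))))))))))) (no nofun nofun)⟩
      · obtain rfl := Option.some.inj hd
        simp only [Sequent.img, Step.concl, List.length_append, List.length_cons, List.length_nil]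
        exact ⟨_, .weaken (follows_swap_snd (j := Γ.length) (follows_call_lt (follows_lam_lt (follows_prodL_lt (follows_natL_right (follows_wk (follows_prodL_lt (follows_swap_lt (follows_wk (follows_swap_fst (.hole _ _))))))))))) (no nofun nofun)⟩
  case muR Γ σ =>
    cases b
    · simp only [Step.prem, Step.prems, Bool.toNat_false, List.getElem?_cons_zero,
        Option.some.injEq] at hb
      subst hb
      rcases o₁ with i | _
      · have hi := lt h₁
        obtain rfl := Option.some.inj hd
        exact ⟨_, .weaken (follows_call_lt (follows_muR_lt (follows_lam_lt (.hole _ _)))) (no nofun nofun)⟩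
      · obtain rfl := Option.some.inj hd
        have hψe : mu σ = ψ := by simpa [Sequent.type, Step.concl] using h
        subst hψe
        have hψe₁ : σ.inst (mu σ) = ψ₁ := by simpa [Sequent.type] using h₁
        subst hψe₁
        simp only [Sequent.img, Step.concl, List.length_append, List.length_cons, List.length_nil]
        exact ⟨_, .weaken (follows_call_last hK (follows_muR_rhs hψ (follows_lam_rhs hC₁ (.hole _ _)))) (no nofun nofun)⟩
    · simp [Step.prem, Step.prems] at hb
  case muL Γ σ τ =>
    cases b
    · simp only [Step.prem, Step.prems, Bool.toNat_false, List.getElem?_cons_zero,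
        Option.some.injEq] at hb
      subst hb
      rcases o₁ with i | _
      · have hi := lt h₁
        simp only [List.length_append, List.length_cons, List.length_nil] at hi
        rcases Nat.lt_or_ge i Γ.length with hi' | hi'
        · obtain rfl : o = .lhs i := by
            simp only [Step.descendant, Option.some.injEq] at hd
            rw [← hd]
          exact ⟨_, .weaken (follows_swap_lt (follows_call_lt (follows_lam_lt (follows_muL_lt (follows_swap_lt (.hole _ _)))))) (np (by simp [Step.principal]; try omega))⟩
        · obtain rfl : i = Γ.length := by omega
          obtain rfl := Option.some.inj hd
          have hψe : mu σ = ψ := by simpa [Sequent.type, Step.concl] using h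
          subst hψe
          simp only [Sequent.img, Step.concl]
          -- The thread passes from `C (mu σ)` to the right-hand side as `K (mu σ)` and back to the
          -- left as the inner fixed point, where it becomes good. Here `hψ` is used as it stands,
          -- since the core is that fixed point.
          exact ⟨_, .weaken (follows_swap_fst (j := Γ.length + 1) (follows_call_last hC (follows_lam_rhs (j := Γ.length + 1) hK (follows_muL_last hψ (follows_swap_snd (.hole _ _)))))) (hit (by rintro _ _ _ ⟨⟩; rfl) nofun)⟩
      · obtain rfl := Option.some.inj hd
        simp only [Sequent.img, Step.concl, List.length_append, List.length_cons, List.length_nil]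
        exact ⟨_, .weaken (follows_swap_snd (j := Γ.length) (follows_call_lt (follows_lam_lt (follows_muL_lt (follows_swap_fst (.hole _ _)))))) (np (by simp [Step.principal]; try omega))⟩
    · simp [Step.prem, Step.prems] at hb
  case nuR Γ σ =>
    cases b
    · simp only [Step.prem, Step.prems, Bool.toNat_false, List.getElem?_cons_zero,
        Option.some.injEq] at hb
      subst hb
      rcases o₁ with i | _
      · have hi := lt h₁
        obtain rfl := Option.some.inj hd
        exact ⟨_, .weaken (follows_muL_lt (follows_call_lt (follows_lam_lt (.hole _ _))))
          (np (by simp [Step.principal]))⟩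
      · obtain rfl := Option.some.inj hd
        have hψe : nu σ = ψ := by simpa [Sequent.type, Step.concl] using h
        subst hψe
        have hψe₁ : σ.inst (nu σ) = ψ₁ := by simpa [Sequent.type] using h₁
        subst hψe₁
        simp only [Sequent.img, Step.concl]
        exact ⟨_, .weaken (follows_muL_last hK (follows_call_last hNC₁
          (follows_lam_rhs hC₁ (.hole _ _)))) (hit nofun (by rintro _ _ ⟨⟩; rfl))⟩
    · simp [Step.prem, Step.prems] at hb
  case nuL Γ σ τ =>
    cases b
    · simp only [Step.prem, Step.prems, Bool.toNat_false, List.getElem?_cons_zero,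
        Option.some.injEq] at hb
      subst hb
      rcases o₁ with i | _
      · have hi := lt h₁
        simp only [List.length_append, List.length_cons, List.length_nil] at hi
        obtain rfl := Option.some.inj hd
        rcases Nat.lt_or_ge i Γ.length with hi' | hi'
        · exact ⟨_, .weaken (follows_swap_lt (follows_call_lt (follows_muR_lt (follows_lam_lt
            (follows_swap_lt (.hole _ _)))))) (no nofun nofun)⟩
        · obtain rfl : i = Γ.length := by omega
          have hψe : nu σ = ψ := by simpa [Sequent.type, Step.concl] using h
          subst hψe
          have hψe₁ : σ.inst (nu σ) = ψ₁ := by simpa [Sequent.type] using h₁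
          subst hψe₁
          simp only [Sequent.img, Step.concl]
          exact ⟨_, .weaken (follows_swap_fst (j := Γ.length + 1) (follows_call_last hC
            (follows_muR_rhs hK (follows_lam_rhs (j := Γ.length + 1) hNC₁
              (follows_swap_snd (.hole _ _)))))) (no nofun nofun)⟩
      · obtain rfl := Option.some.inj hd
        simp only [Sequent.img, Step.concl, List.length_append, List.length_cons, List.length_nil]
        exact ⟨_, .weaken (follows_swap_snd (j := Γ.length) (follows_call_lt (follows_muR_lt
          (follows_lam_lt (follows_swap_fst (.hole _ _)))))) (no nofun nofun)⟩
    · simp [Step.prem, Step.prems] at hb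

/-! ### The translation of a progressing coderivation is progressing -/

/-- Every label is on at most one hole. -/
def Frag.Linear {U : Type} : Frag U → Prop
  | hole _ => True
  | leaf _ => True
  | un _ f => f.Linear
  | bin _ f f' => f.Linear ∧ f'.Linear ∧ Disjoint f.holes f'.holes

theorem Frag.Path.mem_holes {U : Type} {f : Frag U} {w : List Bool} {u : U} (h : f.Path w u) :
    u ∈ f.holes := by
  induction h with
  | hole u => exact rfl
  | un _ ih => exact ih
  | left _ ih => exact .inl ih
  | right _ ih => exact .inr ih

/-- This ensures that the address along which a gadget's thread was constructed is the one which the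
given branch takes. -/
theorem Frag.Linear.path_unique {U : Type} {f : Frag U} {w w' : List Bool} {u : U} (hf : f.Linear)
    (h : f.Path w u) (h' : f.Path w' u) : w = w' := by
  induction h generalizing w' with
  | hole u => cases h'; rfl
  | un _ ih => cases h' with | un h' => rw [ih hf h']
  | left h ih =>
    cases h' with
    | left h' => rw [ih hf.1 h']
    | right h' => exact (Set.disjoint_left.1 hf.2.2 h.mem_holes h'.mem_holes).elim
  | right h ih =>
    cases h' with
    | left h' => exact (Set.disjoint_left.1 hf.2.2 h'.mem_holes h.mem_holes).elim
    | right h' => rw [ih hf.2.1 h']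

theorem linear_gadget (s : Step) : (gadget s).Linear := by
  cases s <;> simp [gadget, Frag.Linear, Frag.holes, swap, call, lam, rotate, const]

theorem Frag.Path.of_map {U V : Type} {h : U → V} {f : Frag U} {w : List Bool} {v : V}
    (hp : (f.map h).Path w v) : ∃ u, h u = v ∧ f.Path w u := by
  induction f generalizing w with
  | hole u => cases hp; exact ⟨u, rfl, .hole u⟩
  | leaf s => cases hp
  | un s f ih =>
    cases hp with
    | un hp => obtain ⟨u, rfl, h⟩ := ih hp; exact ⟨u, rfl, .un h⟩
  | bin s f f' ih ih' =>
    cases hp with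
    | left hp => obtain ⟨u, rfl, h⟩ := ih hp; exact ⟨u, rfl, .left h⟩
    | right hp => obtain ⟨u, rfl, h⟩ := ih' hp; exact ⟨u, rfl, .right h⟩

theorem Frag.Follows.map {U V : Type} {h : U → V} {Φ : Ty → Prop} {χ : Ty} {f : Frag U}
    {w : List Bool} {u : U} {o o' : Occ} {p : Prop} (hf : Follows Φ χ f w u o o' p) :
    Follows Φ χ (f.map h) w (h u) o o' p := by
  induction hf with
  | hole u => exact .hole _ _
  | un h₁ _ h₂ ih => exact .un h₁ ih h₂
  | left h₁ _ h₂ ih => exact .left h₁ ih h₂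
  | right h₁ _ h₂ ih => exact .right h₁ ih h₂

/-- Only principal occurrences differ from their immediate ancestors. -/
theorem Step.type_of_descendant {s : Step} {b : Bool} {S : Sequent} {o o₁ : Occ} {ψ : Ty}
    (hd : s.descendant b o₁ = some o) (hp : s.principal ≠ some o) (hb : s.prem b = some S)
    (h : S.type o₁ = some ψ) : s.concl.type o = some ψ := by
  cases s <;> cases b <;> simp only [Step.prem, Step.prems, Bool.toNat_false, Bool.toNat_true,
      List.getElem?_cons_zero, List.getElem?_cons_succ, List.getElem?_nil, Option.some.injEq,
      reduceCtorEq] at hb <;> subst hb <;> rcases o₁ with i | _ <;>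
    simp only [Step.descendant, Option.some.injEq, reduceCtorEq] at hd
  all_goals first
    | (subst hd; first | exact h | exact (hp rfl).elim)
    | skip
  all_goals
    simp only [Sequent.type, Step.concl, Step.principal, ne_eq, Option.some.injEq] at *
  all_goals grind

theorem PTree.Regular.finite_steps {t : PTree} (h : t.Regular) :
    {s : Step | ∃ α, t α = some s}.Finite := by
  refine ((h.image fun u => u []).preimage (f := some) (Option.some_injective _).injOn).subset ?_
  rintro s ⟨α, hα⟩
  exact ⟨t.sub α, ⟨α, by simp [hα], rfl⟩, by simp [PTree.sub, hα]⟩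

/-- The formulas of a thread are eventually bounded below by the smallest formula that is infinitely
often principal. -/
theorem PTree.IsCoderivation.eventually_subformula {R : Step → Prop} {t : PTree} {S : Sequent}
    (ht : t.IsCoderivation R S) (hr : t.Regular) {β : ℕ → Bool} {k : ℕ} {o : ℕ → Occ}
    {s : ℕ → Step} {T : ℕ → Ty} (hs : ∀ n, t (node β (k + n)) = some (s n))
    (hT : ∀ n, (s n).concl.type (o n) = some (T n))
    (hd : ∀ n, (s n).descendant (β (k + n)) (o (n + 1)) = some (o n)) {φ : Ty}
    (hf : ∃ᶠ n in Filter.atTop, t.PrincipalAt β k o n φ)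
    (hm : ∀ ψ, (∃ᶠ n in Filter.atTop, t.PrincipalAt β k o n ψ) → φ.Subformula ψ) :
    ∃ N, ∀ n ≥ N, φ.Subformula (T n) := by
  -- By regularity only finitely many formulas are ever principal, so those principal finitely often
  -- disappear after a common stage `N`.
  have hfin : {ψ : Ty | ∃ α s, t α = some s ∧ s.principal.bind s.concl.type = some ψ}.Finite := by
    refine ((hr.finite_steps.image fun s => s.principal.bind s.concl.type).preimage (f := some)
      (Option.some_injective _).injOn).subset ?_
    rintro ψ ⟨α, s, h, h'⟩
    exact ⟨s, ⟨α, h⟩, h'⟩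
  have hev : ∀ᶠ n in Filter.atTop, ∀ ψ ∈ {ψ : Ty | ∃ α s, t α = some s ∧
      s.principal.bind s.concl.type = some ψ}, t.PrincipalAt β k o n ψ → φ.Subformula ψ := by
    refine (Filter.eventually_all_finite hfin).2 fun ψ _ => ?_
    by_cases h : ∃ᶠ n in Filter.atTop, t.PrincipalAt β k o n ψ
    · exact .of_forall fun _ _ => hm ψ h
    · exact (Filter.not_frequently.1 h).mono fun n hn hn' => (hn hn').elim
  obtain ⟨N, hN⟩ := Filter.eventually_atTop.1 hev
  -- Descent from the next time `φ` is principal: after `N` a principal formula contains `φ`, and a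
  -- step that is not principal leaves the formula of the thread unchanged.
  have key : ∀ d n, N ≤ n → t.PrincipalAt β k o (n + d) φ → φ.Subformula (T n) := by
    intro d
    induction d with
    | zero =>
      rintro n - ⟨s', h₁, -, h₂⟩
      obtain rfl := Option.some.inj ((hs n).symm.trans h₁)
      obtain rfl := Option.some.inj ((hT n).symm.trans h₂)
      exact .refl _
    | succ d ih =>
      intro n hn h
      by_cases hp : (s n).principal = some (o n)
      · exact hN n hn (T n) ⟨_, _, hs n, by simp [hp, hT n]⟩ ⟨_, hs n, hp, hT n⟩
      · have h₁ := ih (n + 1) (by omega) (by rwa [Nat.add_right_comm])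
        have hc := ht.child _ _ (hs n) (β (k + n))
        rw [← node_concat, Nat.add_assoc, hs (n + 1)] at hc
        have := Step.type_of_descendant (hd n) hp hc.symm (hT (n + 1))
        rw [hT n] at this
        rwa [Option.some.inj this]
  refine ⟨N, fun n hn => ?_⟩
  obtain ⟨m, hm, hm'⟩ := Filter.frequently_atTop.1 hf n
  obtain ⟨d, rfl⟩ := Nat.exists_eq_add_of_le hm
  exact key d n hn hm'

theorem isHit_of_isGood {s : Step} {o : Occ} {φ : Ty} (hn : ¬ s.IsNative)
    (hp : s.principal = some o) (hT : s.concl.type o = some φ) (hg : IsGood φ o) :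
    IsHit (core (fun _ => false) φ) s o := by
  rcases hg with ⟨σ, i, rfl, rfl⟩ | ⟨σ, rfl, rfl⟩ <;> cases s <;>
    simp only [Step.principal, Option.some.injEq, reduceCtorEq, Occ.lhs.injEq] at hp <;>
    simp only [Sequent.type, Step.concl, Option.some.injEq, reduceCtorEq] at hT
  case inl.natL => exact (hn trivial).elim
  case inl.muL =>
    subst hp
    simp only [List.getElem?_concat_length, Option.some.injEq, Ty.mu.injEq] at hT
    subst hT
    exact .inl ⟨_, _, _, rfl, rfl, rfl⟩
  case inr.nuR =>
    obtain rfl := Ty.nu.inj hT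
    exact .inr ⟨_, _, rfl, rfl, rfl⟩
  all_goals first
    | exact (hn trivial).elim
    | skip
  all_goals
    subst hp
    first
      | (simp only [List.getElem?_concat_length, Option.some.injEq, reduceCtorEq] at hT)
      | (rw [← List.length_append, List.getElem?_concat_length] at hT; cases hT)

/-- A branch of the translation determines a branch `γ` of `P`, by recording which hole each gadget
is left through. The image of a progressing thread of `γ`, started late enough for all its formulas
to contain the minimal one, is progressing. -/
theorem PTree.IsCoderivation.progressing_tr {P : PTree} {S : Sequent}
    (ht : P.IsCoderivation FullStep S) (hr : P.Regular) (hp : P.Progressing) :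
    (CircMuLJ.tr P).Progressing := by
  intro β hβ
  obtain ⟨us, ws, pos, run⟩ := exists_run isProper_unfoldTr hβ
  have next : ∀ i, ∃ s b, us i [] = some s ∧ us (i + 1) = (us i).sub [b] ∧
      (gadget s).Path (ws i) b := by
    intro i
    have h := run.path i
    rcases hs : us i [] with _ | s
    · simp only [unfoldTr, hs] at h
      cases h
    · simp only [unfoldTr, hs] at h
      obtain ⟨b, hb, h⟩ := h.of_map
      exact ⟨s, b, rfl, hb.symm, h⟩
  choose s γ hs hu hpath using next
  have hus : ∀ i, us i = P.sub (node γ i) := by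
    intro i
    induction i with
    | zero => rw [run.zero]; rfl
    | succ i ih => rw [hu, ih, node_concat]; funext α; simp [PTree.sub]
  have hsP : ∀ i, P (node γ i) = some (s i) := fun i => by
    have := hs i
    rwa [hus, PTree.sub, List.append_nil] at this
  have hprem : ∀ i, (s i).prem (γ i) = some (s (i + 1)).concl := fun i => by
    rw [← ht.child _ _ (hsP i), ← node_concat, hsP]; rfl
  obtain ⟨k, o, hthr, φ, hgood, hmin⟩ := hp γ fun i => by rw [hsP]; exact Option.some_ne_none _
  have hthr' : ∀ n, ∃ T, (s (k + n)).concl.type (o n) = some T ∧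
      (s (k + n)).descendant (γ (k + n)) (o (n + 1)) = some (o n) := by
    intro n
    obtain ⟨s', h₁, h₂, h₃⟩ := hthr n
    obtain rfl := Option.some.inj ((hsP _).symm.trans h₁)
    obtain ⟨T, hT⟩ := Option.ne_none_iff_exists'.1 h₂
    exact ⟨T, hT, h₃⟩
  choose T hT hd using hthr'
  obtain ⟨N, hN⟩ := ht.eventually_subformula hr (fun n => hsP (k + n)) hT hd
    (hgood.mono fun _ h => h.1) hmin
  -- Dropping the first `N` elements removes the formulas that need not contain `φ`; the rest have
  -- `core φ` as a common lower bound.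
  refine run.progressing isProper_unfoldTr (k := k + N)
    (Φ := fun ψ => (core (fun _ => false) φ).Subformula ψ) (χ := core (fun _ => false) φ)
    (occ := fun i => (s (k + N + i)).concl.img (o (N + i)))
    (h := fun i => IsHit (core (fun _ => false) φ) (s (k + N + i)) (o (N + i)))
    (fun i => ?_) ?_ fun ψ h => h
  · have e : k + N + i = k + (N + i) := Nat.add_assoc _ _ _
    obtain ⟨w, hw⟩ := follows_gadget (χ := core (fun _ => false) φ)
      (Φ := fun ψ => (core (fun _ => false) φ).Subformula ψ) (fun h h' => h.trans h')
      (ht.steps _ _ (hsP (k + (N + i)))).1 (hprem _) (o := o (N + i)) (o₁ := o (N + i + 1))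
      (hT (N + i + 1)) (hd (N + i)) (hT (N + i)) ((hN _ (by omega)).core)
      ((hN _ (by omega)).core)
    obtain rfl := (linear_gadget _).path_unique hw.path (hpath _)
    have e' : k + N + (i + 1) = k + (N + i) + 1 := by omega
    rw [e, e', hu]
    simp only [unfoldTr, hs]
    exact hw.map (h := fun b => (us (k + (N + i))).sub [b])
  · rw [Filter.frequently_atTop] at hgood ⊢
    intro a
    obtain ⟨b, hb, ⟨s', h₁, h₂, h₃⟩, hg⟩ := hgood (N + a)
    obtain ⟨i, rfl⟩ := Nat.exists_eq_add_of_le (show N ≤ b by omega)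
    obtain rfl := Option.some.inj ((hsP _).symm.trans h₁)
    refine ⟨i, by omega, ?_⟩
    rw [Nat.add_assoc]
    exact isHit_of_isGood (ht.steps _ _ (hsP (k + (N + i)))).1 h₂ h₃ hg

/-! ### Meaning of fragments -/

section Combinators

variable {U : Type} {H : U → Env → Tok → Prop} {f f' : Frag U} {Γ Δ : List Ty} {σ τ ρ : Ty}
  {g d : Env} {a b c : List Tok} {r z : Tok}

namespace Frag

theorem sem_id : (leaf (.id σ) : Frag U).Sem H [a] z ↔ z ∈ a := by
  simp [Sem, SemStep, Step.concl]

theorem sem_natR₀ : (leaf .natR₀ : Frag U).Sem H [] z ↔ z = .zero := by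
  simp [Sem, SemStep, Step.concl]

theorem sem_natR₁ (hg : g.length = Γ.length) : (un (.natR₁ Γ) f).Sem H g z ↔
    ∃ x, z = .succ x ∧ ∀ y ∈ x, f.Sem H g y := by
  simp [Sem, SemStep, Step.concl, hg]

theorem sem_lam (hg : g.length = Γ.length) : (lam Γ σ f).Sem H g z ↔
    ∃ x y, z = .fn x y ∧ ∀ t ∈ y, f.Sem H (x :: g) t := by
  simp [lam, Sem, SemStep, Step.concl, hg]

theorem sem_call (hg : g.length = Γ.length) : (call Γ σ f).Sem H (a :: g) r ↔
    ∃ x y, .fn x y ∈ a ∧ r ∈ y ∧ ∀ z ∈ x, f.Sem H g z := by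
  simp only [call, Sem, SemStep, Step.concl, List.length_cons, List.length_append,
    List.length_nil, hg, Nat.add_zero, true_and]
  constructor
  · rintro ⟨f, d, g, x, y, h, hd, hx, h₁, -, a, h₂, h₃⟩
    obtain rfl := List.length_eq_zero_iff.1 hd
    cases h
    cases h₂
    exact ⟨x, y, hx, h₃, h₁⟩
  · rintro ⟨x, y, h, hr, hx⟩
    exact ⟨a, [], g, x, y, rfl, rfl, h, hx, rfl, y, rfl, hr⟩

theorem sem_swap (hg : g.length = Γ.length) : (swap Γ σ τ f).Sem H (b :: a :: g) r ↔
    f.Sem H (a :: b :: g) r := by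
  simp only [swap, Sem, SemStep, Step.concl, List.length_cons, List.length_append,
    List.length_nil, hg, true_and]
  constructor
  · rintro ⟨d, x, y, g, h, hd, h'⟩
    obtain rfl := List.length_eq_zero_iff.1 hd
    cases h
    exact h'
  · exact fun h => ⟨[], b, a, g, rfl, rfl, h⟩

theorem sem_rotate (hg : g.length = Γ.length) :
    (rotate Γ σ τ ρ f).Sem H (c :: b :: a :: g) r ↔ f.Sem H (a :: c :: b :: g) r := by
  have h₁ : (rotate Γ σ τ ρ f).Sem H (c :: b :: a :: g) r ↔
      (swap (Γ ++ [τ]) σ ρ f).Sem H (c :: a :: b :: g) r := by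
    simp only [rotate, Sem, SemStep, Step.concl, List.length_cons, List.length_append,
      List.length_nil, hg, true_and]
    constructor
    · rintro ⟨d, x, y, g, h, hd, h'⟩
      obtain ⟨x', rfl⟩ := List.length_eq_one_iff.1 hd
      cases h
      exact h'
    · exact fun h => ⟨[c], b, a, g, rfl, rfl, h⟩
  rw [h₁, sem_swap (by simp [hg])]

theorem sem_wk (hg : g.length = Γ.length) : (un (.wk Γ σ τ) f).Sem H (a :: g) r ↔ f.Sem H g r := by
  simp [Sem, SemStep, Step.concl, hg]

theorem sem_ctr (hg : g.length = Γ.length) : (un (.ctr Γ σ τ) f).Sem H (a :: g) r ↔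
    f.Sem H (a :: a :: g) r := by
  simp [Sem, SemStep, Step.concl, hg]

theorem sem_prodL (hg : g.length = Γ.length) : (un (.prodL Γ σ τ ρ) f).Sem H (a :: g) r ↔
    ∃ x y, .pair x y ∈ a ∧ f.Sem H (y :: x :: g) r := by
  simp [Sem, SemStep, Step.concl, hg]

theorem sem_muL (hg : g.length = Γ.length) : (un (.muL Γ σ τ) f).Sem H (a :: g) r ↔
    ∃ x, .mu x ∈ a ∧ f.Sem H (x :: g) r := by
  simp [Sem, SemStep, Step.concl, hg]

theorem sem_muR (hg : g.length = Γ.length) : (un (.muR Γ σ) f).Sem H g z ↔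
    ∃ x, z = .mu x ∧ ∀ y ∈ x, f.Sem H g y := by
  simp [Sem, SemStep, Step.concl, hg]

theorem sem_natL (hg : g.length = Γ.length) : (bin (.natL Γ σ) f f').Sem H (a :: g) r ↔
    (.zero ∈ a ∧ f.Sem H g r) ∨ ∃ x, .succ x ∈ a ∧ f'.Sem H (x :: g) r := by
  simp [Sem, SemStep, Step.concl, hg]

theorem sem_prodR (hg : g.length = Γ.length) (hd : d.length = Δ.length) :
    (bin (.prodR Γ Δ σ τ) f f').Sem H (d ++ g) z ↔
      ∃ x y, z = .pair x y ∧ (∀ t ∈ x, f.Sem H g t) ∧ ∀ t ∈ y, f'.Sem H d t := by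
  simp only [Sem, SemStep, Step.concl, List.length_append, hg, hd, Nat.add_comm, true_and]
  constructor
  · rintro ⟨d', g', x, y, h, hd', rfl, h₁, h₂⟩
    obtain ⟨rfl, rfl⟩ := List.append_inj h (hd.trans hd'.symm)
    exact ⟨x, y, rfl, h₁, h₂⟩
  · rintro ⟨x, y, rfl, h₁, h₂⟩
    exact ⟨d, g, x, y, rfl, hd, rfl, h₁, h₂⟩

theorem sem_cut (hg : g.length = Γ.length) (hd : d.length = Δ.length) :
    (bin (.cut Γ Δ σ τ) f f').Sem H (d ++ g) r ↔
      ∃ a, (∀ t ∈ a, f.Sem H g t) ∧ f'.Sem H (a :: d) r := by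
  simp only [Sem, SemStep, Step.concl, List.length_append, hg, hd, Nat.add_comm, true_and]
  constructor
  · rintro ⟨d', g', a, h, hd', h₁, h₂⟩
    obtain ⟨rfl, rfl⟩ := List.append_inj h (hd.trans hd'.symm)
    exact ⟨a, h₁, h₂⟩
  · rintro ⟨a, h₁, h₂⟩
    exact ⟨d, g, a, rfl, hd, h₁, h₂⟩

theorem sem_exch (hg : g.length = Γ.length) (hd : d.length = Δ.length) :
    (un (.exch Γ σ τ Δ ρ) f).Sem H (d ++ a :: b :: g) r ↔ f.Sem H (d ++ b :: a :: g) r := by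
  simp only [Sem, SemStep, Step.concl, List.length_append, List.length_cons, hg, hd]
  constructor
  · rintro ⟨-, d', x, y, g', h, hd', h'⟩
    obtain ⟨rfl, h₂⟩ := List.append_inj h (hd.trans hd'.symm)
    cases h₂
    exact h'
  · exact fun h => ⟨by omega, d, a, b, g, rfl, hd, h⟩

end Frag

end Combinators

/-! ### The translation computes what the original computes -/

mutual

/-- The continuation which asks for the given token, and then returns `r`. -/
def Tok.cont (r : Tok) : Tok → Tok
  | .one => .fn [] [r]
  -- Supply the argument tokens `x`, and to the resulting computation put the demand for all of `y`.
  | .fn x y => .pair (Tok.conts r x) [.fn (Tok.conts r y) [r]]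
  | .pair x y => .fn [.pair (Tok.conts r x) (Tok.conts r y)] [r]
  | .inl x => .fn [.pair [.pair (Tok.conts r x) []] [.zero]] [r]
  | .inr x => .fn [.pair [.pair [] (Tok.conts r x)] [.succ []]] [r]
  | .mu x => .fn [.mu (Tok.conts r x)] [r]
  | .nu x => .mu [.fn (Tok.conts r x) [r]]
  -- Native tokens are not computed in the full system; these values are placeholders.
  | .zero => .zero
  | .succ _ => .zero

/-- The computations which answer the continuations of the given tokens by `r`. -/
def Tok.conts (r : Tok) : List Tok → List Tok
  | [] => []
  | x :: xs => .fn [Tok.cont r x] [r] :: Tok.conts r xs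

end

theorem Tok.mem_conts {r z : Tok} {x : List Tok} :
    z ∈ Tok.conts r x ↔ ∃ y ∈ x, z = .fn [Tok.cont r y] [r] := by
  induction x with
  | nil => simp [Tok.conts]
  | cons y x ih => simp [Tok.conts, ih]

/-- The forward simulation of one step. The answer `r` is arbitrary, and every nested continuation
returns the same `r`, so an answer found deep inside is passed out unchanged. -/
theorem SemStep.gadget {s : Step} (hn : ¬ s.IsNative) {L R : Env → Tok → Prop}
    {H : Bool → Env → Tok → Prop} {r : Tok}
    (hL : ∀ {e b}, L e b → H false ([Tok.cont r b] :: e.map (Tok.conts r)) r)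
    (hR : ∀ {e b}, R e b → H true ([Tok.cont r b] :: e.map (Tok.conts r)) r) {e : Env} {b : Tok}
    (hl : e.length = s.concl.ant.length) (h : SemStep s L R e b) :
    (CircMuLJ.gadget s).Sem H ([Tok.cont r b] :: e.map (Tok.conts r)) r := by
  have lm : ∀ {g : Env} {Γ : List Ty}, g.length = Γ.length →
      (g.map (Tok.conts r)).length = (Γ.map C).length := by intro g Γ h; simpa
  have lams : ∀ {x : List Tok} {g : Env} {Γ : List Ty} {σ : Ty}, g.length = Γ.length →
      (∀ z ∈ x, L g z) → ∀ t ∈ Tok.conts r x,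
        (lam (Γ.map C) (K σ) (hole false)).Sem H (g.map (Tok.conts r)) t := by
    intro x g Γ σ hg h t ht
    obtain ⟨y, hy, rfl⟩ := Tok.mem_conts.1 ht
    refine (sem_lam (lm hg)).2 ⟨_, _, rfl, ?_⟩
    simpa [Frag.Sem] using hL (h y hy)
  have lams' : ∀ {x : List Tok} {g : Env} {Γ : List Ty} {σ : Ty}, g.length = Γ.length →
      (∀ z ∈ x, R g z) → ∀ t ∈ Tok.conts r x,
        (lam (Γ.map C) (K σ) (hole true)).Sem H (g.map (Tok.conts r)) t := by
    intro x g Γ σ hg h t ht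
    obtain ⟨y, hy, rfl⟩ := Tok.mem_conts.1 ht
    refine (sem_lam (lm hg)).2 ⟨_, _, rfl, ?_⟩
    simpa [Frag.Sem] using hR (h y hy)
  cases s
  case natR₀ => exact (hn trivial).elim
  case natR₁ => exact (hn trivial).elim
  case natL => exact (hn trivial).elim
  all_goals simp only [Step.concl, List.length_append, List.length_cons, List.length_nil] at hl
  case id σ =>
    obtain ⟨a, rfl, hb⟩ := h
    exact (sem_swap rfl).2 ((sem_call rfl).2
      ⟨_, _, Tok.mem_conts.2 ⟨b, hb, rfl⟩, List.mem_singleton_self _, fun z hz => sem_id.2 hz⟩)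
  case exch Γ σ τ Δ γ =>
    obtain ⟨d, x, y, g, rfl, hd, h⟩ := h
    have hg : g.length = Γ.length := by simp at hl; omega
    have := hL h
    rw [List.map_append, List.map_cons, List.map_cons, ← List.cons_append] at this ⊢
    exact (sem_exch (lm hg) (by simp [hd])).2 this
  case cut Γ Δ σ τ =>
    obtain ⟨d, g, a, rfl, hd, h₁, h₂⟩ := h
    have hg : g.length = Γ.length := by simp at hl; omega
    rw [List.map_append, ← List.cons_append]
    exact (sem_cut (lm hg) (by simp [hd])).2 ⟨Tok.conts r a, lams hg h₁,
      (sem_swap (lm hd)).2 (hR h₂)⟩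
  case wk Γ σ τ =>
    obtain ⟨a, g, rfl, h⟩ := h
    have hg : g.length = Γ.length := by simpa using hl
    exact (sem_swap (lm hg)).2 ((sem_wk (by simp [hg])).2 (hL h))
  case ctr Γ σ τ =>
    obtain ⟨a, g, rfl, h⟩ := h
    have hg : g.length = Γ.length := by simpa using hl
    exact (sem_swap (lm hg)).2 ((sem_ctr (by simp [hg])).2 ((sem_rotate (lm hg)).2 (hL h)))
  case oneR =>
    obtain rfl := List.length_eq_zero_iff.1 hl
    obtain rfl := h
    exact (sem_call rfl).2 ⟨_, _, List.mem_singleton_self _, List.mem_singleton_self _, nofun⟩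
  case oneL Γ σ =>
    obtain ⟨a, g, rfl, ha, h⟩ := h
    have hg : g.length = Γ.length := by simpa using hl
    refine (sem_swap (lm hg)).2 ((sem_call (by simp [hg])).2
      ⟨_, _, Tok.mem_conts.2 ⟨_, ha, rfl⟩, List.mem_singleton_self _, ?_⟩)
    simp only [List.mem_singleton, forall_eq]
    refine (sem_lam (by simp [hg])).2 ⟨_, _, Tok.cont.eq_1 r, ?_⟩
    simp only [List.mem_singleton, forall_eq]
    exact (sem_wk (by simp [hg])).2 (hL h)
  case arrR Γ σ τ =>
    obtain ⟨x, y, rfl, h⟩ := h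
    refine (sem_prodL (lm hl)).2 ⟨_, _, by rw [Tok.cont]; exact List.mem_singleton_self _, ?_⟩
    refine (sem_call (by simpa)).2 ⟨_, _, List.mem_singleton_self _, List.mem_singleton_self _, ?_⟩
    have := lams (x := y) (g := x :: e) (Γ := Γ ++ [σ]) (σ := τ) (by simpa) h
    simpa using this
  case arrL Γ Δ σ τ γ =>
    obtain ⟨f, d, g, x, y, rfl, hd, hf, h₁, h₂⟩ := h
    have hg : g.length = Γ.length := by simp at hl; omega
    refine (sem_swap (by simp; omega)).2 ((sem_call (by simp; omega)).2
      ⟨_, _, Tok.mem_conts.2 ⟨_, hf, rfl⟩, List.mem_singleton_self _, ?_⟩)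
    simp only [List.mem_singleton, forall_eq, List.map_append]
    rw [← List.cons_append, sem_prodR (lm hg) (by simp [hd])]
    refine ⟨_, _, Tok.cont.eq_2 r _ _, lams hg h₁, ?_⟩
    simp only [List.mem_singleton, forall_eq]
    refine (sem_lam (by simp [hd])).2 ⟨_, _, rfl, ?_⟩
    simp only [List.mem_singleton, forall_eq]
    exact (sem_swap (lm hd)).2 (hR h₂)
  case prodR Γ Δ σ τ =>
    obtain ⟨d, g, x, y, rfl, hd, rfl, h₁, h₂⟩ := h
    have hg : g.length = Γ.length := by simp at hl; omega
    refine (sem_call (by simp; omega)).2 ⟨_, _, by rw [Tok.cont]; exact List.mem_singleton_self _,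
      List.mem_singleton_self _, ?_⟩
    simp only [List.mem_singleton, forall_eq, List.map_append]
    exact (sem_prodR (lm hg) (lm hd)).2 ⟨_, _, rfl, lams hg h₁, lams' hd h₂⟩
  case prodL Γ σ τ γ =>
    obtain ⟨a, g, x, y, rfl, ha, h⟩ := h
    have hg : g.length = Γ.length := by simpa using hl
    refine (sem_swap (lm hg)).2 ((sem_call (by simp [hg])).2
      ⟨_, _, Tok.mem_conts.2 ⟨_, ha, rfl⟩, List.mem_singleton_self _, ?_⟩)
    simp only [List.mem_singleton, forall_eq]
    refine (sem_lam (by simp [hg])).2 ⟨_, _, Tok.cont.eq_3 r _ _, ?_⟩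
    simp only [List.mem_singleton, forall_eq]
    exact (sem_prodL (by simp [hg])).2 ⟨_, _, List.mem_singleton_self _,
      (sem_rotate (lm hg)).2 (hL h)⟩
  case sumR₀ Γ σ τ =>
    obtain ⟨x, rfl, h⟩ := h
    refine (sem_call (lm hl)).2 ⟨_, _, by rw [Tok.cont]; exact List.mem_singleton_self _,
      List.mem_singleton_self _, ?_⟩
    simp only [List.mem_singleton, forall_eq]
    refine (sem_prodR (d := []) (lm hl) rfl).2 ⟨_, _, rfl, ?_, ?_⟩
    · simp only [List.mem_singleton, forall_eq]
      exact (sem_prodR (d := []) (lm hl) rfl).2 ⟨_, _, rfl, lams hl h, nofun⟩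
    · simp only [List.mem_singleton, forall_eq]
      exact sem_natR₀.2 rfl
  case sumR₁ Γ σ τ =>
    obtain ⟨x, rfl, h⟩ := h
    refine (sem_call (lm hl)).2 ⟨_, _, by rw [Tok.cont]; exact List.mem_singleton_self _,
      List.mem_singleton_self _, ?_⟩
    simp only [List.mem_singleton, forall_eq]
    refine (sem_prodR (d := []) (lm hl) rfl).2 ⟨_, _, rfl, ?_, ?_⟩
    · simp only [List.mem_singleton, forall_eq]
      rw [← List.append_nil (e.map _)]
      exact (sem_prodR (g := []) rfl (lm hl)).2 ⟨_, _, rfl, nofun, lams hl h⟩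
    · simp only [List.mem_singleton, forall_eq]
      exact (sem_natR₁ rfl).2 ⟨_, rfl, nofun⟩
  case sumL Γ σ τ γ =>
    obtain ⟨a, g, rfl, h⟩ := h
    have hg : g.length = Γ.length := by simpa using hl
    obtain ⟨x, ha, h⟩ | ⟨x, ha, h⟩ := h
    · refine (sem_swap (lm hg)).2 ((sem_call (by simp [hg])).2
        ⟨_, _, Tok.mem_conts.2 ⟨_, ha, rfl⟩, List.mem_singleton_self _, ?_⟩)
      simp only [List.mem_singleton, forall_eq]
      refine (sem_lam (by simp [hg])).2 ⟨_, _, Tok.cont.eq_4 r _, ?_⟩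
      simp only [List.mem_singleton, forall_eq]
      refine (sem_prodL (by simp [hg])).2 ⟨_, _, List.mem_singleton_self _,
        (sem_natL (by simp [hg])).2 (.inl ⟨List.mem_singleton_self _, ?_⟩)⟩
      exact (sem_prodL (by simp [hg])).2 ⟨_, _, List.mem_singleton_self _,
        (sem_wk (by simp [hg])).2 ((sem_swap (lm hg)).2 (hL h))⟩
    · refine (sem_swap (lm hg)).2 ((sem_call (by simp [hg])).2
        ⟨_, _, Tok.mem_conts.2 ⟨_, ha, rfl⟩, List.mem_singleton_self _, ?_⟩)
      simp only [List.mem_singleton, forall_eq]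
      refine (sem_lam (by simp [hg])).2 ⟨_, _, Tok.cont.eq_5 r _, ?_⟩
      simp only [List.mem_singleton, forall_eq]
      refine (sem_prodL (by simp [hg])).2 ⟨_, _, List.mem_singleton_self _,
        (sem_natL (by simp [hg])).2 (.inr ⟨_, List.mem_singleton_self _, ?_⟩)⟩
      exact (sem_wk (by simp [hg])).2 ((sem_prodL (by simp [hg])).2 ⟨_, _, List.mem_singleton_self _,
        (sem_swap (by simp [hg])).2 ((sem_wk (by simp [hg])).2 ((sem_swap (lm hg)).2 (hR h)))⟩)
  case muR Γ σ =>
    obtain ⟨x, rfl, h⟩ := h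
    refine (sem_call (lm hl)).2 ⟨_, _, by rw [Tok.cont]; exact List.mem_singleton_self _,
      List.mem_singleton_self _, ?_⟩
    simp only [List.mem_singleton, forall_eq]
    exact (sem_muR (lm hl)).2 ⟨_, rfl, lams hl h⟩
  case muL Γ σ τ =>
    obtain ⟨a, g, x, rfl, ha, h⟩ := h
    have hg : g.length = Γ.length := by simpa using hl
    refine (sem_swap (lm hg)).2 ((sem_call (by simp [hg])).2
      ⟨_, _, Tok.mem_conts.2 ⟨_, ha, rfl⟩, List.mem_singleton_self _, ?_⟩)
    simp only [List.mem_singleton, forall_eq]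
    refine (sem_lam (by simp [hg])).2 ⟨_, _, Tok.cont.eq_6 r _, ?_⟩
    simp only [List.mem_singleton, forall_eq]
    exact (sem_muL (by simp [hg])).2 ⟨_, List.mem_singleton_self _, (sem_swap (lm hg)).2 (hL h)⟩
  case nuR Γ σ =>
    obtain ⟨x, rfl, h⟩ := h
    exact (sem_muL (lm hl)).2 ⟨_, by rw [Tok.cont]; exact List.mem_singleton_self _,
      (sem_call (lm hl)).2 ⟨_, _, List.mem_singleton_self _, List.mem_singleton_self _, lams hl h⟩⟩
  case nuL Γ σ τ =>
    obtain ⟨a, g, x, rfl, ha, h⟩ := h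
    have hg : g.length = Γ.length := by simpa using hl
    refine (sem_swap (lm hg)).2 ((sem_call (by simp [hg])).2
      ⟨_, _, Tok.mem_conts.2 ⟨_, ha, rfl⟩, List.mem_singleton_self _, ?_⟩)
    simp only [List.mem_singleton, forall_eq]
    refine (sem_muR (by simp [hg])).2 ⟨_, Tok.cont.eq_7 r _, ?_⟩
    simp only [List.mem_singleton, forall_eq]
    refine (sem_lam (by simp [hg])).2 ⟨_, _, rfl, ?_⟩
    simp only [List.mem_singleton, forall_eq]
    exact (sem_swap (lm hg)).2 (hL h)

theorem SemN.tr {n : ℕ} (r : Tok) : ∀ {P : PTree} {S : Sequent}, P.IsCoderivation FullStep S →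
    ∀ {e b}, SemN n P e b →
      CircMuLJ.Sem (CircMuLJ.tr P) ([Tok.cont r b] :: e.map (Tok.conts r)) r := by
  induction n with
  | zero => exact fun _ _ _ h => h.elim
  | succ n ih =>
    rintro P S hP e b ⟨s, hs, hl, h⟩
    rw [CircMuLJ.tr, graft_hole isProper_unfoldTr]
    refine Frag.Sem.graft ?_
    simp only [unfoldTr, hs]
    rw [Frag.Sem.map]
    have sub : ∀ {c e b}, SemN n (P.sub [c]) e b → ∃ S, (P.sub [c]).IsCoderivation FullStep S := by
      intro c e b h
      cases hc : s.prem c with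
      | none =>
        have := hP.child [] s hs c
        rw [hc, Option.map_eq_none_iff] at this
        rcases n with _ | n
        · exact h.elim
        · obtain ⟨s', h', -⟩ := h
          simp only [PTree.sub, List.append_nil] at h'
          rw [List.nil_append] at this
          rw [this] at h'
          cases h'
      | some S => exact ⟨S, hP.sub_prem hs hc⟩
    refine h.gadget (hP.steps _ _ hs).1 ?_ ?_ hl
    · intro e b h
      obtain ⟨S, hS⟩ := sub h
      exact ih hS h
    · intro e b h
      obtain ⟨S, hS⟩ := sub h
      exact ih hS h

theorem Sem.tr {P : PTree} {S : Sequent} (hP : P.IsCoderivation FullStep S) {e : Env} {b : Tok}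
    (h : Sem P e b) (r : Tok) :
    Sem (CircMuLJ.tr P) ([Tok.cont r b] :: e.map (Tok.conts r)) r :=
  let ⟨_, h⟩ := h
  h.tr r hP

/-! ### The original computes what the translation computes -/

/-- The closed coderivation `c` answers the continuations of its type as the token prescribes. -/
def Resp : Tok → Ty → PTree → Prop
  | .fn k rs, .one, c => ∀ r ∈ rs, Reduces c (leaf .oneR) ∧ ∃ x y, .fn x y ∈ k ∧ r ∈ y
  | .fn k rs, .arr σ τ, c => ∀ r ∈ rs, ∃ d, Reduces c (un (.arrR [] σ τ) d) ∧
      d.concl = some ⟨[σ], τ⟩ ∧ ∃ x f, ∃ _ : .pair x f ∈ k, ∃ y rs', ∃ _ : .fn y rs' ∈ f, r ∈ rs' ∧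
        ∀ s, s.concl = some ⟨[], σ⟩ → (∀ z ∈ x, Resp z σ s) →
          ∀ z ∈ y, Resp z τ (bin (.cut [] [] σ τ) s d)
  | .fn k rs, .prod σ τ, c => ∀ r ∈ rs, ∃ u v, Reduces c (bin (.prodR [] [] σ τ) u v) ∧
      u.concl = some ⟨[], σ⟩ ∧ v.concl = some ⟨[], τ⟩ ∧ ∃ p rs', ∃ _ : .fn p rs' ∈ k, r ∈ rs' ∧
        ∀ x y, .pair x y ∈ p → (∀ z ∈ x, Resp z σ u) ∧ ∀ z ∈ y, Resp z τ v
  | .fn k rs, .sum σ τ, c => ∀ r ∈ rs,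
      (∃ u, Reduces c (un (.sumR₀ [] σ τ) u) ∧ u.concl = some ⟨[], σ⟩ ∧
        -- What the continuation demands must be consistent with the injection that `c` really
        -- reduces to: the tag may only be seen as zero, and only the left component is constrained.
        ∃ p rs', ∃ _ : .fn p rs' ∈ k, r ∈ rs' ∧ ∀ q w, .pair q w ∈ p → (∀ t ∈ w, t = .zero) ∧
          ∀ x y, .pair x y ∈ q → ∀ z ∈ x, Resp z σ u) ∨
      ∃ u, Reduces c (un (.sumR₁ [] σ τ) u) ∧ u.concl = some ⟨[], τ⟩ ∧
        ∃ p rs', ∃ _ : .fn p rs' ∈ k, r ∈ rs' ∧ ∀ q w, .pair q w ∈ p → (∀ t ∈ w, ∃ x, t = .succ x) ∧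
          ∀ x y, .pair x y ∈ q → ∀ z ∈ y, Resp z τ u
  | .fn k rs, .mu σ, c => ∀ r ∈ rs, ∃ u, Reduces c (un (.muR [] σ) u) ∧
      u.concl = some ⟨[], σ.inst (.mu σ)⟩ ∧ ∃ p rs', ∃ _ : .fn p rs' ∈ k, r ∈ rs' ∧
        ∀ x, .mu x ∈ p → ∀ z ∈ x, Resp z (σ.inst (.mu σ)) u
  | .fn k rs, .nu σ, c => ∀ r ∈ rs, ∃ u, Reduces c (un (.nuR [] σ) u) ∧
      u.concl = some ⟨[], σ.inst (.nu σ)⟩ ∧ ∃ x, ∃ _ : .mu x ∈ k, ∃ y rs', ∃ _ : .fn y rs' ∈ x,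
        r ∈ rs' ∧ ∀ z ∈ y, Resp z (σ.inst (.nu σ)) u
  -- A closed coderivation of a variable has no head form, hence gives no answer.
  | .fn _ rs, .var _, _ => ∀ r ∈ rs, False
  | _, _, _ => True
termination_by t => sizeOf t
decreasing_by
  all_goals
    simp only [Tok.fn.sizeOf_spec]
    have h₁ := fun {a : Tok} {l : List Tok} (h : a ∈ l) => List.sizeOf_lt_of_mem h
    have h₂ : ∀ {a b l : List Tok}, Tok.fn a b ∈ l →
        sizeOf a < sizeOf l ∧ sizeOf b < sizeOf l := by
      intro a b l h; have := h₁ h; simp only [Tok.fn.sizeOf_spec] at this; omega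
    have h₃ : ∀ {a b l : List Tok}, Tok.pair a b ∈ l →
        sizeOf a < sizeOf l ∧ sizeOf b < sizeOf l := by
      intro a b l h; have := h₁ h; simp only [Tok.pair.sizeOf_spec] at this; omega
    have h₄ : ∀ {a : List Tok} {l : List Tok}, Tok.mu a ∈ l → sizeOf a < sizeOf l := by
      intro a l h; have := h₁ h; simp only [Tok.mu.sizeOf_spec] at this; omega
    grind

theorem resp_fn {k rs : List Tok} {σ : Ty} {c : PTree} :
    Resp (.fn k rs) σ c ↔ ∀ r ∈ rs, Resp (.fn k [r]) σ c := by
  cases σ <;> simp only [Resp, List.mem_singleton, forall_eq]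

theorem Resp.mono {k k' : List Tok} (hk : k ⊆ k') {r : Tok} {σ : Ty} {c : PTree}
    (h : Resp (.fn k [r]) σ c) : Resp (.fn k' [r]) σ c := by
  cases σ <;> simp only [Resp, List.mem_singleton, forall_eq, exists_prop] at h ⊢ <;> grind

theorem Resp.expand {z : Tok} {σ : Ty} {c c' : PTree} (h : Reduces c c') (hz : Resp z σ c') :
    Resp z σ c := by
  have ht : ∀ {d}, Reduces c' d → Reduces c d := fun h' => h.trans h'
  cases z with
  | fn k rs => cases σ <;> simp only [Resp] at hz ⊢ <;> grind
  | _ => simp only [Resp]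

theorem Models.of_append {V : Tok → Ty → PTree → Prop} {d g : Closers} {E : Env}
    (h : Models V (d ++ g) E) : ∃ E₀ E₁, E = E₀ ++ E₁ ∧ Models V d E₀ ∧ Models V g E₁ := by
  have hl := h.length_eq
  rw [List.length_append] at hl
  have h' := h
  rw [← List.take_append_drop d.length E] at h'
  exact ⟨_, _, (List.take_append_drop d.length E).symm, h'.append (by
    rw [length_ctx, List.length_take]; omega)⟩

theorem Models.length {V : PTree × Ty → List Tok → Prop} {g : Closers} {E : Env}
    (h : List.Forall₂ V g E) :
    E.length = (ctx g).length := by rw [length_ctx, h.length_eq]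

/-- The backward simulation, by induction on the depth at which the translation finds its answer.
The continuation `k` is arbitrary, not of the form `Tok.cont`, so the gadget's computation is
inverted step by step. Each answer is traced to a head reduction of a closer or of `P` itself. -/
theorem SemN.resp {n : ℕ} : ∀ {P : PTree} {τ : Ty} {e : Closers} {E : Env} {k : List Tok} {r : Tok},
    P.IsCoderivation FullStep ⟨ctx e, τ⟩ → AllClosed e → Models Resp e E →
    SemN n (CircMuLJ.tr P) (k :: E) r → Resp (.fn k [r]) τ (close τ e P) := by
  induction n with
  | zero => intro _ _ _ _ _ _ _ _ _ h; exact h.elim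
  | succ n ih =>
    intro P τ e E k r hP he hE h
    replace h := sem_of_semN_succ isProper_unfoldTr h
    obtain ⟨s, hs, hfull, hconcl, ht⟩ := hP.cases
    simp only [unfoldTr, hs] at h
    rw [Frag.Sem.map] at h
    -- The gadget contributes at least one step, so its holes are explored to depth `n` only and the
    -- induction hypothesis applies to them.
    generalize hH : (fun b => SemN n (graft unfoldTr (hole (P.sub [b])))) = H at h
    have ih₀ : ∀ {t τ e E k r}, P.sub [false] = t → t.IsCoderivation FullStep ⟨ctx e, τ⟩ →
        AllClosed e → Models Resp e E → H false (k :: E) r →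
        Resp (.fn k [r]) τ (close τ e t) := by
      rintro t τ e E k r rfl ht he hE h
      rw [← hH] at h
      exact ih ht he hE h
    have ih₁ : ∀ {t τ e E k r}, P.sub [true] = t → t.IsCoderivation FullStep ⟨ctx e, τ⟩ →
        AllClosed e → Models Resp e E → H true (k :: E) r →
        Resp (.fn k [r]) τ (close τ e t) := by
      rintro t τ e E k r rfl ht he hE h
      rw [← hH] at h
      exact ih ht he hE h
    clear hH ih
    have lams₀ : ∀ {t σ e E z}, P.sub [false] = t → t.IsCoderivation FullStep ⟨ctx e, σ⟩ →
        AllClosed e → Models Resp e E →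
        (lam ((ctx e).map C) (K σ) (hole false)).Sem H E z → Resp z σ (close σ e t) := by
      intro t σ e E z hs ht he hE h
      obtain ⟨x, y, rfl, h'⟩ := (sem_lam (by simp [Models.length hE])).1 h
      exact resp_fn.2 fun r hr => ih₀ hs ht he hE (h' r hr)
    have lams₁ : ∀ {t σ e E z}, P.sub [true] = t → t.IsCoderivation FullStep ⟨ctx e, σ⟩ →
        AllClosed e → Models Resp e E →
        (lam ((ctx e).map C) (K σ) (hole true)).Sem H E z → Resp z σ (close σ e t) := by
      intro t σ e E z hs ht he hE h
      obtain ⟨x, y, rfl, h'⟩ := (sem_lam (by simp [Models.length hE])).1 h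
      exact resp_fn.2 fun r hr => ih₁ hs ht he hE (h' r hr)
    have hn := hfull.1
    clear hs hP hfull
    cases s
    case natR₀ => exact (hn trivial).elim
    case natR₁ => exact (hn trivial).elim
    case natL => exact (hn trivial).elim
    all_goals
      simp only [Step.prems, reduceCtorEq, false_and, List.cons.injEq, and_true, and_false,
        exists_false, true_and, or_false, false_or, exists_eq_left', exists_and_left,
        and_assoc] at ht
      simp only [Step.concl, Sequent.mk.injEq] at hconcl
      obtain ⟨hctx, hτ⟩ := hconcl
      replace hctx := hctx.symm
      subst hτ
      simp only [gadget] at h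
      clear hn
    case id σ =>
      subst ht
      obtain ⟨c, g, rfl, hg⟩ := ctx_eq_concat (Γ := []) hctx
      obtain rfl := ctx_eq_nil hg
      obtain _ | ⟨hc, hE⟩ := hE
      obtain _ | _ := hE
      obtain ⟨x, y, hx, hr, h⟩ := (sem_call rfl).1 ((sem_swap rfl).1 h)
      exact ((resp_fn.1 (hc _ hx) r hr).mono fun z hz => sem_id.1 (h z hz)).expand
        (reduces_close_id (allClosed_cons.1 he).1)
    case exch Γ σ τ' Δ γ =>
      obtain ⟨t₀, rfl, ht₀⟩ := ht
      obtain ⟨D, G, rfl, hD, hG⟩ := ctx_eq_append (Δ := Δ) (Γ := Γ ++ [τ'] ++ [σ]) (by simpa using hctx)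
      obtain ⟨c, G', rfl, hG'⟩ := ctx_eq_concat hG
      obtain ⟨c', G, rfl, rfl⟩ := ctx_eq_concat hG'
      subst hD
      obtain ⟨E₀, E₁, rfl, hE₁, hE₂⟩ := Models.of_append hE
      obtain _ | ⟨hc, hE₂⟩ := hE₂
      obtain _ | ⟨hc', hE₂⟩ := hE₂
      have he' := allClosed_append.1 he
      simp only [allClosed_cons] at he'
      rw [← List.cons_append, sem_exch (by simp [Models.length hE₂]) (by simp [Models.length hE₁])] at h
      refine (ih₀ rfl (by simpa using ht₀) ?_ (List.rel_append hE₁ (.cons hc' (.cons hc hE₂)))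
        h).expand (reduces_close_exch he'.2.2.1 he'.2.1 ht₀.root)
      simp only [allClosed_append, allClosed_cons]
      exact ⟨he'.1, he'.2.2.1, he'.2.1, he'.2.2.2⟩
    case cut Γ Δ σ γ =>
      obtain ⟨t₀, t₁, rfl, ht₀, ht₁⟩ := ht
      obtain ⟨D, G, rfl, rfl, rfl⟩ := ctx_eq_append hctx
      obtain ⟨E₀, E₁, rfl, hE₁, hE₂⟩ := Models.of_append hE
      obtain ⟨heD, heG⟩ := allClosed_append.1 he
      rw [← List.cons_append, sem_cut (by simp [Models.length hE₂]) (by simp [Models.length hE₁])] at h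
      obtain ⟨a, ha, h⟩ := h
      rw [sem_swap (by simp [Models.length hE₁])] at h
      exact (ih₁ (e := (close σ G t₀, σ) :: D) rfl (by simpa using ht₁) (allClosed_cons.2
        ⟨concl_close ht₀.root, heD⟩) (.cons (fun z hz => lams₀ rfl ht₀ heG hE₂ (ha z hz)) hE₁)
        h).expand (reduces_close_cut heG ht₀.root heD ht₁.root)
    case wk Γ σ γ =>
      obtain ⟨t₀, rfl, ht₀⟩ := ht
      obtain ⟨c, G, rfl, rfl⟩ := ctx_eq_concat hctx
      obtain _ | ⟨hc, hE⟩ := hE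
      rw [sem_swap (by simp [Models.length hE]), sem_wk (by simp [Models.length hE])] at h
      obtain ⟨hcl, he⟩ := allClosed_cons.1 he
      exact (ih₀ rfl ht₀ he hE h).expand (reduces_close_wk hcl)
    case ctr Γ σ γ =>
      obtain ⟨t₀, rfl, ht₀⟩ := ht
      obtain ⟨c, G, rfl, rfl⟩ := ctx_eq_concat hctx
      obtain _ | ⟨hc, hE⟩ := hE
      rw [sem_swap (by simp [Models.length hE]), sem_ctr (by simp [Models.length hE]),
        sem_rotate (by simp [Models.length hE])] at h
      simp only [allClosed_cons] at he
      exact (ih₀ (e := (c, σ) :: (c, σ) :: G) rfl (by simpa using ht₀)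
        (by simpa [allClosed_cons] using he) (.cons hc (.cons hc hE)) h).expand
        (reduces_close_ctr he.1 ht₀.root)
    case oneR =>
      subst ht
      obtain rfl := ctx_eq_nil hctx
      obtain _ | _ := hE
      obtain ⟨x, y, hx, hr, -⟩ := (sem_call rfl).1 h
      simp only [Resp, List.mem_singleton, forall_eq]
      exact ⟨.refl, x, y, hx, hr⟩
    case oneL Γ γ =>
      obtain ⟨t₀, rfl, ht₀⟩ := ht
      obtain ⟨c, G, rfl, rfl⟩ := ctx_eq_concat hctx
      obtain _ | ⟨hc, hE⟩ := hE
      rw [sem_swap (by simp [Models.length hE]), sem_call (by simp [Models.length hE])] at h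
      obtain ⟨x, y, hx, hr, h⟩ := h
      have hc := hc _ hx
      rw [Resp] at hc
      obtain ⟨hcr, x', y', hx', hr'⟩ := hc r hr
      obtain ⟨p, q, heq, h⟩ := (sem_lam (by simp [Models.length hE])).1 (h _ hx')
      obtain ⟨rfl, rfl⟩ := Tok.fn.inj heq
      have h := (sem_wk (by simp [Models.length hE])).1 (h _ hr')
      exact (ih₀ rfl ht₀ (allClosed_cons.1 he).2 hE h).expand (reduces_close_oneL hcr)
    case arrR Γ σ τ =>
      obtain ⟨t₀, rfl, ht₀⟩ := ht
      subst hctx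
      rw [sem_prodL (by simp [Models.length hE])] at h
      obtain ⟨x, f, hxf, h⟩ := h
      rw [sem_call (by simp [Models.length hE])] at h
      obtain ⟨y, rs, hy, hr, h⟩ := h
      obtain ⟨u, hu, h₁, h₂⟩ := reduces_close_arrR he ht₀.root
      simp only [Resp, List.mem_singleton, forall_eq]
      refine ⟨u, h₁, hu, x, f, hxf, y, rs, hy, hr, fun s hs hx z hz => ?_⟩
      refine (lams₀ (e := (s, σ) :: e) rfl (by simpa using ht₀) (allClosed_cons.2 ⟨hs, he⟩)
        (.cons hx hE) (by simpa using h z hz)).expand (h₂ s hs)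
    case arrL Γ Δ σ τ γ =>
      obtain ⟨t₀, t₁, rfl, ht₀, ht₁⟩ := ht
      obtain ⟨c, G, rfl, hG⟩ := ctx_eq_concat hctx
      obtain ⟨D, G, rfl, rfl, rfl⟩ := ctx_eq_append hG
      obtain _ | ⟨hc, hE⟩ := hE
      obtain ⟨E₀, E₁, rfl, hE₁, hE₂⟩ := Models.of_append hE
      simp only [allClosed_cons, allClosed_append] at he
      obtain ⟨hcl, heD, heG⟩ := he
      rw [sem_swap (by simp [Models.length hE₁, Models.length hE₂]; omega),
        sem_call (by simp [Models.length hE₁, Models.length hE₂]; omega)] at h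
      obtain ⟨x, y, hx, hr, h⟩ := h
      have hc := hc _ hx
      rw [Resp] at hc
      obtain ⟨u, hcu, hu, p, f, hpf, q, rs, hq, hr, hc⟩ := hc r hr
      have h := h _ hpf
      rw [← List.cons_append, sem_prodR (by simp [Models.length hE₂]) (by simp [Models.length hE₁])] at h
      obtain ⟨p', f', heq, hp, hf⟩ := h
      obtain ⟨rfl, rfl⟩ := Tok.pair.inj heq
      obtain ⟨q', rs', heq, h⟩ := (sem_lam (by simp [Models.length hE₁])).1 (hf _ hq)
      obtain ⟨rfl, rfl⟩ := Tok.fn.inj heq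
      have h := (sem_swap (by simp [Models.length hE₁])).1 (h _ hr)
      exact (ih₁ (e := (bin (.cut [] [] σ τ) (close σ G t₀) u, τ) :: D) rfl (by simpa using ht₁)
        (allClosed_cons.2 ⟨rfl, heD⟩) (.cons (hc _ (concl_close ht₀.root)
          fun z hz => lams₀ rfl ht₀ heG hE₂ (hp z hz)) hE₁) h).expand
        (reduces_close_arrL heG heD hcu hu ht₀.root ht₁.root)
    case prodR Γ Δ σ τ =>
      obtain ⟨t₀, t₁, rfl, ht₀, ht₁⟩ := ht
      obtain ⟨D, G, rfl, rfl, rfl⟩ := ctx_eq_append hctx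
      obtain ⟨E₀, E₁, rfl, hE₁, hE₂⟩ := Models.of_append hE
      obtain ⟨heD, heG⟩ := allClosed_append.1 he
      rw [sem_call (by simp [Models.length hE₁, Models.length hE₂]; omega)] at h
      obtain ⟨p, rs, hp, hr, h⟩ := h
      simp only [Resp, List.mem_singleton, forall_eq]
      refine ⟨_, _, reduces_close_prodR heG ht₀.root heD ht₁.root, concl_close ht₀.root,
        concl_close ht₁.root, p, rs, hp, hr, fun x y hxy => ?_⟩
      have h := h _ hxy
      rw [sem_prodR (by simp [Models.length hE₂]) (by simp [Models.length hE₁])] at h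
      obtain ⟨x', y', heq, hx, hy⟩ := h
      obtain ⟨rfl, rfl⟩ := Tok.pair.inj heq
      exact ⟨fun z hz => lams₀ rfl ht₀ heG hE₂ (hx z hz),
        fun z hz => lams₁ rfl ht₁ heD hE₁ (hy z hz)⟩
    case prodL Γ σ τ' γ =>
      obtain ⟨t₀, rfl, ht₀⟩ := ht
      obtain ⟨c, G, rfl, rfl⟩ := ctx_eq_concat hctx
      obtain _ | ⟨hc, hE⟩ := hE
      rw [sem_swap (by simp [Models.length hE]), sem_call (by simp [Models.length hE])] at h
      obtain ⟨x, y, hx, hr, h⟩ := h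
      have hc := hc _ hx
      rw [Resp] at hc
      obtain ⟨u, v, hcu, hu, hv, p, rs, hp, hr, hc⟩ := hc r hr
      obtain ⟨p', rs', heq, h⟩ := (sem_lam (by simp [Models.length hE])).1 (h _ hp)
      obtain ⟨rfl, rfl⟩ := Tok.fn.inj heq
      obtain ⟨a, b, hab, h⟩ := (sem_prodL (by simp [Models.length hE])).1 (h _ hr)
      have h := (sem_rotate (by simp [Models.length hE])).1 h
      exact (ih₀ (e := (v, τ') :: (u, σ) :: G) rfl (by simpa using ht₀) (allClosed_cons.2
        ⟨hv, allClosed_cons.2 ⟨hu, (allClosed_cons.1 he).2⟩⟩)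
        (.cons (hc _ _ hab).2 (.cons (hc _ _ hab).1 hE)) h).expand
        (reduces_close_prodL hcu hu hv ht₀.root)
    case sumR₀ Γ σ τ =>
      obtain ⟨t₀, rfl, ht₀⟩ := ht
      subst hctx
      rw [sem_call (by simp [Models.length hE])] at h
      obtain ⟨p, rs, hp, hr, h⟩ := h
      simp only [Resp, List.mem_singleton, forall_eq]
      refine .inl ⟨_, reduces_close_un (.sumR₀ σ τ) he ht₀.root, concl_close ht₀.root, p, rs, hp,
        hr, fun q w hqw => ?_⟩
      have h := h _ hqw
      rw [← List.nil_append E, sem_prodR (by simp [Models.length hE]) rfl] at h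
      obtain ⟨q', w', heq, hq, hw⟩ := h
      obtain ⟨rfl, rfl⟩ := Tok.pair.inj heq
      refine ⟨fun t ht => sem_natR₀.1 (hw t ht), fun x y hxy z hz => ?_⟩
      have h := hq _ hxy
      rw [← List.nil_append E, sem_prodR (by simp [Models.length hE]) rfl] at h
      obtain ⟨x', y', heq, hx, -⟩ := h
      obtain ⟨rfl, rfl⟩ := Tok.pair.inj heq
      exact lams₀ rfl ht₀ he hE (hx z hz)
    case sumR₁ Γ σ τ =>
      obtain ⟨t₀, rfl, ht₀⟩ := ht
      subst hctx
      rw [sem_call (by simp [Models.length hE])] at h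
      obtain ⟨p, rs, hp, hr, h⟩ := h
      simp only [Resp, List.mem_singleton, forall_eq]
      refine .inr ⟨_, reduces_close_un (.sumR₁ σ τ) he ht₀.root, concl_close ht₀.root, p, rs, hp,
        hr, fun q w hqw => ?_⟩
      have h := h _ hqw
      rw [← List.nil_append E, sem_prodR (by simp [Models.length hE]) rfl] at h
      obtain ⟨q', w', heq, hq, hw⟩ := h
      obtain ⟨rfl, rfl⟩ := Tok.pair.inj heq
      refine ⟨fun t ht => ?_, fun x y hxy z hz => ?_⟩
      · obtain ⟨x, rfl, -⟩ := (sem_natR₁ rfl).1 (hw t ht)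
        exact ⟨x, rfl⟩
      have h := hq _ hxy
      rw [← List.append_nil E, sem_prodR rfl (by simp [Models.length hE])] at h
      obtain ⟨x', y', heq, -, hy⟩ := h
      obtain ⟨rfl, rfl⟩ := Tok.pair.inj heq
      exact lams₀ rfl ht₀ he hE (hy z hz)
    case sumL Γ σ τ' γ =>
      obtain ⟨t₀, t₁, rfl, ht₀, ht₁⟩ := ht
      obtain ⟨c, G, rfl, rfl⟩ := ctx_eq_concat hctx
      obtain _ | ⟨hc, hE⟩ := hE
      obtain ⟨hcl, he⟩ := allClosed_cons.1 he
      rw [sem_swap (by simp [Models.length hE]), sem_call (by simp [Models.length hE])] at h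
      obtain ⟨x, y, hx, hr, h⟩ := h
      have hc := hc _ hx
      rw [Resp] at hc
      obtain ⟨u, hcu, hu, p, rs, hp, hr, hc⟩ | ⟨u, hcu, hu, p, rs, hp, hr, hc⟩ := hc r hr <;>
        obtain ⟨p', rs', heq, h⟩ := (sem_lam (by simp [Models.length hE])).1 (h _ hp) <;>
        obtain ⟨rfl, rfl⟩ := Tok.fn.inj heq <;>
        obtain ⟨q, w, hqw, h⟩ := (sem_prodL (by simp [Models.length hE])).1 (h _ hr) <;>
        obtain ⟨hw, hc⟩ := hc q w hqw <;>
        obtain ⟨hz, h⟩ | ⟨z, hz, h⟩ := (sem_natL (by simp [Models.length hE])).1 h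
      · obtain ⟨a, b, hab, h⟩ := (sem_prodL (by simp [Models.length hE])).1 h
        have h := (sem_swap (by simp [Models.length hE])).1 ((sem_wk (by simp [Models.length hE])).1 h)
        exact (ih₀ (e := (u, _) :: G) rfl (by simpa using ht₀) (allClosed_cons.2 ⟨hu, he⟩)
          (.cons (hc _ _ hab) hE) h).expand (reduces_close_sumL₀ hcu)
      -- The closer reduces to a left injection, so its tag is zero and the successor branch cannot
      -- have been taken.
      · cases hw _ hz
      · obtain ⟨_, hw⟩ := hw _ hz
        cases hw
      · obtain ⟨a, b, hab, h⟩ := (sem_prodL (by simp [Models.length hE])).1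
          ((sem_wk (by simp [Models.length hE])).1 h)
        have h := (sem_swap (by simp [Models.length hE])).1 ((sem_wk (by simp [Models.length hE])).1
          ((sem_swap (by simp [Models.length hE])).1 h))
        exact (ih₁ (e := (u, _) :: G) rfl (by simpa using ht₁) (allClosed_cons.2 ⟨hu, he⟩)
          (.cons (hc _ _ hab) hE) h).expand (reduces_close_sumL₁ hcu)
    case muR Γ σ =>
      obtain ⟨t₀, rfl, ht₀⟩ := ht
      subst hctx
      rw [sem_call (by simp [Models.length hE])] at h
      obtain ⟨p, rs, hp, hr, h⟩ := h
      simp only [Resp, List.mem_singleton, forall_eq]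
      refine ⟨_, reduces_close_un (.muR σ) he ht₀.root, concl_close ht₀.root, p, rs, hp, hr,
        fun x hx z hz => ?_⟩
      obtain ⟨x', heq, h⟩ := (sem_muR (by simp [Models.length hE])).1 (h _ hx)
      obtain rfl := Tok.mu.inj heq
      exact lams₀ rfl ht₀ he hE (h z hz)
    case muL Γ σ γ =>
      obtain ⟨t₀, rfl, ht₀⟩ := ht
      obtain ⟨c, G, rfl, rfl⟩ := ctx_eq_concat hctx
      obtain _ | ⟨hc, hE⟩ := hE
      rw [sem_swap (by simp [Models.length hE]), sem_call (by simp [Models.length hE])] at h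
      obtain ⟨x, y, hx, hr, h⟩ := h
      have hc := hc _ hx
      rw [Resp] at hc
      obtain ⟨u, hcu, hu, p, rs, hp, hr, hc⟩ := hc r hr
      obtain ⟨p', rs', heq, h⟩ := (sem_lam (by simp [Models.length hE])).1 (h _ hp)
      obtain ⟨rfl, rfl⟩ := Tok.fn.inj heq
      obtain ⟨a, ha, h⟩ := (sem_muL (by simp [Models.length hE])).1 (h _ hr)
      have h := (sem_swap (by simp [Models.length hE])).1 h
      exact (ih₀ (e := (u, σ.inst (.mu σ)) :: G) rfl (by simpa using ht₀)
        (allClosed_cons.2 ⟨hu, (allClosed_cons.1 he).2⟩) (.cons (hc _ ha) hE) h).expand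
        (reduces_close_muL hcu)
    case nuR Γ σ =>
      obtain ⟨t₀, rfl, ht₀⟩ := ht
      subst hctx
      obtain ⟨x, hx, h⟩ := (sem_muL (by simp [Models.length hE])).1 h
      obtain ⟨y, rs, hy, hr, h⟩ := (sem_call (by simp [Models.length hE])).1 h
      simp only [Resp, List.mem_singleton, forall_eq]
      exact ⟨_, reduces_close_un (.nuR σ) he ht₀.root, concl_close ht₀.root, x, hx, y, rs, hy, hr,
        fun z hz => lams₀ rfl ht₀ he hE (h z hz)⟩
    case nuL Γ σ γ =>
      obtain ⟨t₀, rfl, ht₀⟩ := ht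
      obtain ⟨c, G, rfl, rfl⟩ := ctx_eq_concat hctx
      obtain _ | ⟨hc, hE⟩ := hE
      rw [sem_swap (by simp [Models.length hE]), sem_call (by simp [Models.length hE])] at h
      obtain ⟨x, y, hx, hr, h⟩ := h
      have hc := hc _ hx
      rw [Resp] at hc
      obtain ⟨u, hcu, hu, p, hp, q, rs, hq, hr, hc⟩ := hc r hr
      obtain ⟨p', heq, h⟩ := (sem_muR (by simp [Models.length hE])).1 (h _ hp)
      obtain rfl := Tok.mu.inj heq
      obtain ⟨q', rs', heq, h⟩ := (sem_lam (by simp [Models.length hE])).1 (h _ hq)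
      obtain ⟨rfl, rfl⟩ := Tok.fn.inj heq
      have h := (sem_swap (by simp [Models.length hE])).1 (h _ hr)
      exact (ih₀ (e := (u, σ.inst (.nu σ)) :: G) rfl (by simpa using ht₀)
        (allClosed_cons.2 ⟨hu, (allClosed_cons.1 he).2⟩) (.cons hc hE) h).expand
        (reduces_close_nuL hcu)

theorem Sem.resp {P : PTree} {τ : Ty} {e : Closers} {E : Env} {k : List Tok} {r : Tok}
    (hP : P.IsCoderivation FullStep ⟨ctx e, τ⟩) (he : AllClosed e) (hE : Models Resp e E)
    (h : Sem (CircMuLJ.tr P) (k :: E) r) : Resp (.fn k [r]) τ (close τ e P) :=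
  let ⟨_, h⟩ := h
  h.resp hP he hE

/-! ### Closure of the negative fragment under inference steps -/

theorem PTree.IsCoderivation.leaf {R : Step → Prop} {s : Step} (hs : R s) (hp : s.prems = []) :
    (leaf s).IsCoderivation R s.concl := by
  refine ⟨rfl, ?_, ?_, ?_⟩
  · rintro (_ | ⟨b, α⟩) s' h b'
    · obtain rfl := Option.some.inj h
      simp [PTree.leaf, Step.prem, hp]
    · cases h
  · rintro (_ | ⟨b, α⟩) h b'
    · cases h
    · rfl
  · rintro (_ | ⟨b, α⟩) s' h
    · rwa [← Option.some.inj h]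
    · cases h

theorem PTree.IsCoderivation.un {R : Step → Prop} {s : Step} {t : PTree} {S : Sequent} (hs : R s)
    (hp : s.prems = [S]) (h : t.IsCoderivation R S) : (un s t).IsCoderivation R s.concl := by
  refine ⟨rfl, ?_, ?_, ?_⟩
  · rintro (_ | ⟨_ | _, α⟩) s' h' b'
    · obtain rfl := Option.some.inj h'
      cases b'
      · exact h.root.trans (by simp [Step.prem, hp])
      · simp [PTree.un, Step.prem, hp]
    · exact h.child α s' h' b'
    · cases h'
  · rintro (_ | ⟨_ | _, α⟩) h' b'
    · cases h'
    · exact h.closed α h' b'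
    · rfl
  · rintro (_ | ⟨_ | _, α⟩) s' h'
    · rwa [← Option.some.inj h']
    · exact h.steps α s' h'
    · cases h'

theorem PTree.IsCoderivation.bin {R : Step → Prop} {s : Step} {t u : PTree} {S S' : Sequent}
    (hs : R s) (hp : s.prems = [S, S']) (h : t.IsCoderivation R S) (h' : u.IsCoderivation R S') :
    (bin s t u).IsCoderivation R s.concl := by
  refine ⟨rfl, ?_, ?_, ?_⟩
  · rintro (_ | ⟨_ | _, α⟩) s' hs' b'
    · obtain rfl := Option.some.inj hs'
      cases b'
      · exact h.root.trans (by simp [Step.prem, hp])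
      · exact h'.root.trans (by simp [Step.prem, hp])
    · exact h.child α s' hs' b'
    · exact h'.child α s' hs' b'
  · rintro (_ | ⟨_ | _, α⟩) hn b'
    · cases hn
    · exact h.closed α hn b'
    · exact h'.closed α hn b'
  · rintro (_ | ⟨_ | _, α⟩) s' hs'
    · rwa [← Option.some.inj hs']
    · exact h.steps α s' hs'
    · exact h'.steps α s' hs'

theorem PTree.Regular.of_sub {t : PTree} (h : ∀ b, (t.sub [b]).Regular) : t.Regular := by
  refine (((h false).union (h true)).insert t).subset ?_
  rintro _ ⟨_ | ⟨b, α⟩, hα, rfl⟩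
  · exact .inl rfl
  · cases b
    · exact .inr (.inl ⟨α, hα, rfl⟩)
    · exact .inr (.inr ⟨α, hα, rfl⟩)

/-- Progress depends only on tails of branches, so a step added at the root just shifts the start of
the thread by one. -/
theorem PTree.Progressing.of_sub {t : PTree} (h : ∀ b, (t.sub [b]).Progressing) :
    t.Progressing := by
  intro β hβ
  have hb : ((t.sub [β 0]).IsBranch fun n => β (n + 1)) := fun n => by
    have := hβ (n + 1)
    rwa [node_succ] at this
  obtain ⟨k, o, h₁, φ, h₂, h₃⟩ := h _ _ hb
  have hnode : ∀ n, t (node β (k + 1 + n)) = t.sub [β 0] (node (fun n => β (n + 1)) (k + n)) := by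
    intro n
    rw [Nat.add_right_comm, node_succ]
    rfl
  have hpr : ∀ n ψ, t.PrincipalAt β (k + 1) o n ψ ↔
      (t.sub [β 0]).PrincipalAt (fun n => β (n + 1)) k o n ψ := by
    intro n ψ
    simp only [PrincipalAt, hnode]
  refine ⟨k + 1, o, fun n => ?_, φ, ?_, fun ψ hψ => h₃ ψ ?_⟩
  · obtain ⟨s, hs, ho, hd⟩ := h₁ n
    exact ⟨s, by rw [hnode, hs], ho, by rwa [Nat.add_right_comm]⟩
  · simpa only [hpr] using h₂
  · simpa only [hpr] using hψ

theorem regular_none : Regular fun _ => none := by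
  refine Set.finite_empty.subset ?_
  rintro _ ⟨α, hα, -⟩
  exact hα rfl

theorem progressing_none : Progressing fun _ => none := fun _ h => (h 0 rfl).elim

theorem CircularNegative.leaf {s : Step} (hs : NegativeStep s) (hp : s.prems = []) :
    CircularNegative (leaf s) s.concl :=
  ⟨.leaf hs hp, .of_sub fun _ => regular_none, .of_sub fun _ => progressing_none⟩

theorem CircularNegative.un {s : Step} {t : PTree} {S : Sequent} (hs : NegativeStep s)
    (hp : s.prems = [S]) (h : CircularNegative t S) : CircularNegative (un s t) s.concl :=
  ⟨.un hs hp h.1, .of_sub fun b => by cases b; exacts [h.2.1, regular_none],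
    .of_sub fun b => by cases b; exacts [h.2.2, progressing_none]⟩

theorem CircularNegative.bin {s : Step} {t u : PTree} {S S' : Sequent} (hs : NegativeStep s)
    (hp : s.prems = [S, S']) (h : CircularNegative t S) (h' : CircularNegative u S') :
    CircularNegative (bin s t u) s.concl :=
  ⟨.bin hs hp h.1 h'.1, .of_sub fun b => by cases b; exacts [h.2.1, h'.2.1],
    .of_sub fun b => by cases b; exacts [h.2.2, h'.2.2]⟩

theorem Circular.tr {P : PTree} {S : Sequent} (h : Circular P S) :
    CircularNegative (CircMuLJ.tr P) S.tr :=
  ⟨h.1.tr, h.1.regular_tr h.2.1, h.1.progressing_tr h.2.1 h.2.2⟩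

/-! ### Fragments which repeat themselves -/

/-- Plug a fragment into itself. -/
def loop (f : Frag Unit) : PTree := graft (fun _ => f) (hole ())

/-- A thread that returns to its starting occurrence after one turn, with a hit and only formulas
above `χ` on the way, repeats for ever. By linearity every infinite branch makes the same turn. -/
theorem circularNegative_loop {f : Frag Unit} {S : Sequent} (hf : f.IsProper)
    (hc : f.Concludes NegativeStep (fun _ S' => S' = S) S) (hl : f.Linear) {χ : Ty} {o : Occ}
    {h : Prop} (hh : h) (hw : ∃ w, Follows (fun ψ => χ.Subformula ψ) χ f w () o o h) :
    CircularNegative (loop f) S := by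
  obtain ⟨w, hw⟩ := hw
  have hcd : (loop f).IsCoderivation NegativeStep S :=
    Concludes.isCoderivation (T := fun _ S' => S' = S) (fun _ => hf)
      (by rintro _ _ rfl; exact hc) (show S = S from rfl)
  refine ⟨hcd, regular_graft (A := Set.univ) Set.finite_univ (fun _ _ _ _ => trivial) trivial
    hcd.closed, fun β hβ => ?_⟩
  obtain ⟨us, ws, pos, run⟩ := exists_run (fun _ => hf) hβ
  refine run.progressing (fun _ => hf) (k := 0) (Φ := fun ψ => χ.Subformula ψ) (χ := χ)
    (occ := fun _ => o) (h := fun _ => h) (fun i => ?_) (.of_forall fun _ => hh) fun _ h => h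
  rw [hl.path_unique (run.path (0 + i)) hw.path]
  exact hw

theorem sem_loop {f : Frag Unit} (hf : f.IsProper) {e : Env} {b : Tok} :
    Sem (loop f) e b ↔ f.Sem (fun _ => Sem (loop f)) e b := by
  refine ⟨fun ⟨n, h⟩ => ?_, fun h => ?_⟩
  · have := sem_of_semN_succ (g := fun _ => f) (fun _ => hf) h.succ_mono
    exact this.mono fun _ _ _ h => ⟨n, h⟩
  · rw [loop, graft_hole fun _ => hf]
    exact Frag.Sem.graft h

/-! ### Conversions between numerals and computations of numerals -/

namespace Ty

/-- The least fixed point in the type of continuations for `N`. -/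
abbrev M : Ty := mu (muBody (sum one (var 0)))

/-- The argument of a continuation for `1 + N`. -/
abbrev natCase : Ty := prod (prod (C one) (C nat)) nat

theorem neg_M : Neg M := neg_mu isType_nat

end Ty

/-- Count down a computation of a numeral, and count up a numeral. -/
def accBody : Frag Unit :=
  un (.muL [nat] (muBody (sum one (var 0))) nat)
    (call [nat] (K (sum one nat)) (lam [nat] natCase
      (un (.prodL [nat] (prod (C one) (C nat)) nat nat)
        (bin (.natL [nat, prod (C one) (C nat)] nat)
          (un (.prodL [nat] (C one) (C nat) nat)
            (un (.wk [nat, C one] (C nat) nat)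
              -- Tag zero: the computation of type `1` is still run before the accumulator is
              -- returned. Otherwise an answer would not force it to reduce to the right rule for
              -- `1`.
              (call [nat] (neg nat) (lam [nat] nat (un (.wk [nat] nat nat) (leaf (.id nat)))))))
          (un (.wk [nat, prod (C one) (C nat)] nat nat)
            (un (.prodL [nat] (C one) (C nat) nat)
              (swap [nat] (C one) (C nat)
                (un (.wk [nat, C nat] (C one) nat)
                  (call [nat] (K nat) (lam [nat] M
                    -- Tag successor: the rest of the computation is counted with the accumulator
                    -- increased by one.
                    (bin (.cut [nat] [M] nat nat) (un (.natR₁ [nat]) (leaf (.id nat)))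
                      (swap [] M nat (hole ())))))))))))))

/-- Apply a continuation to a numeral. -/
def inpBody : Frag Unit :=
  call [nat] M (un (.muR [nat] (muBody (sum one (var 0))))
    (lam [nat] (K (sum one nat)) (call [nat] natCase
      -- The case distinction on the native numeral produces the tagged pair for `1 + N`; in the
      -- successor case the predecessor is fed back into the loop.
      (bin (.natL [] natCase)
        (bin (.prodR [] [] (prod (C one) (C nat)) nat)
          (bin (.prodR [] [] (C one) (C nat)) (lam [] (K one) (call [] nat (leaf .natR₀)))
            (const (K nat)))
          (leaf .natR₀))
        (bin (.prodR [nat] [] (prod (C one) (C nat)) nat)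
          (bin (.prodR [] [nat] (C one) (C nat)) (const (K one)) (lam [nat] (K nat) (hole ())))
          (un (.natR₁ []) (leaf .natR₀)))))))

/-- The continuation which returns the numeral it is given. -/
def accept : PTree :=
  un (.arrR [] M nat) (bin (.cut [] [M] nat nat) (leaf .natR₀)
    (un (.exch [] nat M [] nat) (loop accBody)))

/-- The computation of a numeral. -/
def input : PTree := un (.arrR [nat] (neg M) nat) (loop inpBody)

theorem neg_C_one : Neg (C one) := neg_arr (neg_arr neg_nat neg_nat) neg_nat

theorem neg_C_nat : Neg (C nat) := neg_arr (neg_arr neg_M neg_nat) neg_nat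

theorem inst_natBody : (muBody (sum one (var 0))).inst M = C (sum one nat) := muBody_inst _

/-- The thread follows the computation being counted down and not the accumulator: `M` is unfolded
on the left once per turn, and every principal formula passed contains it. -/
theorem circularNegative_acc : CircularNegative (loop accBody) ⟨[nat, M], nat⟩ := by
  have hM : Neg (mu (muBody (sum one (var 0)))) := neg_M
  have h1 : Neg (C one) := neg_C_one
  have hN : Neg (C nat) := neg_C_nat
  have hC : Neg (prod (C one) (C nat)) := neg_prod h1 hN
  have hKn : Neg (K nat) := neg_arr neg_M neg_nat
  have hK1 : Neg (K one) := neg_arr neg_nat neg_nat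
  have hA : Neg natCase := neg_prod hC neg_nat
  have hK : Neg (C (sum one nat)) := neg_arr (neg_arr hA neg_nat) neg_nat
  have hneg : ∀ s : Step, NegativeStep s ↔ (∀ σ ∈ s.concl.ant, Neg σ) ∧ Neg s.concl.suc :=
    fun s => Iff.rfl
  have hn := @neg_arr
  have hn' := neg_nat
  refine circularNegative_loop (χ := M) (o := .lhs 1) trivial ?_ ?_ (.inr rfl : False ∨ M = M) ?_
  · simp only [accBody, call, lam, swap, Concludes, hneg, Step.concl, Step.prems,
      List.forall_mem_cons, List.cons.injEq, Sequent.mk.injEq, List.cons_append, List.nil_append,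
      List.append_nil, inst_natBody, and_true, exists_eq_left', exists_and_left, and_assoc]
    repeat' first
      | exact trivial
      | exact rfl
      | exact List.forall_mem_nil _
      | assumption
      | with_reducible refine hn ?_ hn'
      | with_reducible refine And.intro ?_ ?_
  · simp [accBody, Linear, call, lam, swap, holes]
  · have s₁ : M.Subformula (C nat) := .arr_left (.arr_left (.refl _))
    have s₂ : M.Subformula (prod (C one) (C nat)) := .prod_right s₁
    have s₃ : M.Subformula natCase := .prod_left s₂
    have s₄ : M.Subformula (K (sum one nat)) := .arr_left s₃
    exact ⟨_, follows_muL_last (.refl _) (follows_call_last (.arr_left s₄) (follows_lam_rhs (j := 1) s₄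
      (follows_prodL_last (j := 1) s₃ (follows_natL_right (follows_wk (follows_prodL_last (j := 2) s₂
        (follows_swap_snd (j := 1) (follows_wk (follows_call_last s₁ (follows_lam_rhs (j := 1)
          (.arr_left (.refl _)) (follows_cut_right (j := 0) (follows_swap_fst (j := 1)
            (.hole _ _)))))))))))))⟩

/-- Here the native numeral is followed. It only passes through as context until the case
distinction makes it principal, so `N` is the sole principal formula of the thread. -/
theorem circularNegative_inp : CircularNegative (loop inpBody) ⟨[nat, neg M], nat⟩ := by
  have hM : Neg (mu (muBody (sum one (var 0)))) := neg_M
  have h1 : Neg (C one) := neg_C_one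
  have hN : Neg (C nat) := neg_C_nat
  have hC : Neg (prod (C one) (C nat)) := neg_prod h1 hN
  have hKn : Neg (K nat) := neg_arr neg_M neg_nat
  have hK1 : Neg (K one) := neg_arr neg_nat neg_nat
  have hA : Neg natCase := neg_prod hC neg_nat
  have hK : Neg (C (sum one nat)) := neg_arr (neg_arr hA neg_nat) neg_nat
  have hneg : ∀ s : Step, NegativeStep s ↔ (∀ σ ∈ s.concl.ant, Neg σ) ∧ Neg s.concl.suc :=
    fun s => Iff.rfl
  have hn := @neg_arr
  have hn' := neg_nat
  refine circularNegative_loop (χ := nat) (o := .lhs 0) trivial ?_ ?_ (.inr rfl : False ∨ nat = nat) ?_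
  · simp only [inpBody, call, lam, const, Concludes, hneg, Step.concl, Step.prems,
      List.forall_mem_cons, List.cons.injEq, Sequent.mk.injEq, List.cons_append, List.nil_append,
      List.append_nil, inst_natBody, and_true, exists_eq_left', exists_and_left, and_assoc]
    repeat' first
      | exact trivial
      | exact rfl
      | exact List.forall_mem_nil _
      | assumption
      | with_reducible refine hn ?_ hn'
      | with_reducible refine And.intro ?_ ?_
  · simp [inpBody, Linear, call, lam, const, holes]
  · exact ⟨_, follows_call_lt (follows_muR_lt (follows_lam_lt (follows_call_lt (follows_natL_last
      (.refl _) (follows_prodR_left_lt (follows_prodR_right_lt (j := 0) (follows_lam_lt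
        (.hole _ _))))))))⟩

theorem circularNegative_accept : CircularNegative accept ⟨[], K nat⟩ := by
  have hM := neg_M
  have h₁ := CircularNegative.un (s := .exch [] nat M [] nat) ⟨by simpa [Step.concl] using
    ⟨hM, neg_nat⟩, neg_nat⟩ rfl circularNegative_acc
  have h₂ := CircularNegative.bin (s := .cut [] [M] nat nat) ⟨by
    simpa [Step.concl] using And.intro hM.1 hM.2, neg_nat⟩ rfl (.leaf (s := .natR₀) ⟨List.forall_mem_nil _, neg_nat⟩ rfl) h₁
  exact .un (s := .arrR [] M nat) ⟨List.forall_mem_nil _, neg_arr hM neg_nat⟩ rfl h₂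

theorem circularNegative_input : CircularNegative input ⟨[nat], C nat⟩ :=
  .un (s := .arrR [nat] (neg M) nat) ⟨by
    simpa [Step.concl] using And.intro neg_nat.1 neg_nat.2, neg_C_nat⟩ rfl
    circularNegative_inp

/-! ### What the conversions compute -/

theorem sem_nativeNumeral_zero {z : Tok} : Sem (nativeNumeral 0) [] z ↔ z = .zero := by
  rw [nativeNumeral, sem_leaf]
  simp [SemStep, Step.concl]

theorem sem_nativeNumeral_succ {n : ℕ} {z : Tok} : Sem (nativeNumeral (n + 1)) [] z ↔
    ∃ x, z = .succ x ∧ ∀ y ∈ x, Sem (nativeNumeral n) [] y := by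
  rw [nativeNumeral, sem_un]
  simp [SemStep, Step.concl]

/-- The token of the native numeral for `n`. -/
def nativeTok : ℕ → Tok
  | 0 => .zero
  | n + 1 => .succ [nativeTok n]

theorem sem_nativeTok : ∀ n, Sem (nativeNumeral n) [] (nativeTok n)
  | 0 => sem_nativeNumeral_zero.2 rfl
  | n + 1 => sem_nativeNumeral_succ.2 ⟨_, rfl, by simpa using sem_nativeTok n⟩

/-- The token describes a numeral completely; this replaces any appeal to uniqueness of normal
forms. -/
theorem eq_of_sem_nativeTok : ∀ {m n : ℕ}, Sem (nativeNumeral m) [] (nativeTok n) → m = n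
  | 0, 0, _ => rfl
  | 0, n + 1, h => by cases sem_nativeNumeral_zero.1 h
  | m + 1, 0, h => by obtain ⟨_, h, -⟩ := sem_nativeNumeral_succ.1 h; cases h
  | m + 1, n + 1, h => by
    obtain ⟨x, hx, h⟩ := sem_nativeNumeral_succ.1 h
    obtain rfl := Tok.succ.inj hx
    rw [eq_of_sem_nativeTok (h _ (List.mem_singleton_self _))]

theorem concl_nativeNumeral : ∀ n, (nativeNumeral n).concl = some ⟨[], nat⟩
  | 0 => rfl
  | _ + 1 => rfl

theorem real_nativeTok : ∀ n, Real (nativeTok n) nat (nativeNumeral n)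
  | 0 => by rw [nativeTok, Real]; exact ⟨rfl, .refl⟩
  | n + 1 => by
    rw [nativeTok, Real]
    exact ⟨_, rfl, .refl, concl_nativeNumeral n, by simpa using real_nativeTok n⟩

theorem Real.reduces_nativeNumeral : ∀ {n : ℕ} {c : PTree}, Real (nativeTok n) nat c →
    Reduces c (nativeNumeral n)
  | 0, _, h => by rw [nativeTok, Real] at h; exact h.2
  | n + 1, _, h => by
    rw [nativeTok, Real] at h
    obtain ⟨u, -, h₁, -, h₂⟩ := h
    exact h₁.trans (Reduces.un (h₂ _ (List.mem_singleton_self _)).reduces_nativeNumeral)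

/-- The body of a token of a numeral. -/
def stepTok : ℕ → Tok
  | 0 => .inl [.one]
  | n + 1 => .inr [.mu [stepTok n]]

/-- The value of a numeral below its first unfolding. -/
def numeralStep : ℕ → PTree
  | 0 => un (.sumR₀ [] one nat) (leaf .oneR)
  | n + 1 => un (.sumR₁ [] one nat) (numeral n)

theorem numeral_eq : ∀ n, numeral n = un (.muR [] (sum one (var 0))) (numeralStep n)
  | 0 => rfl
  | _ + 1 => rfl

theorem concl_numeral (n : ℕ) : (numeral n).concl = some ⟨[], nat⟩ := by rw [numeral_eq]; rfl

theorem sem_numeral {n : ℕ} {z : Tok} : Sem (numeral n) [] z ↔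
    ∃ x, z = .mu x ∧ ∀ y ∈ x, Sem (numeralStep n) [] y := by
  rw [numeral_eq, sem_un]
  simp [SemStep, Step.concl]

theorem sem_numeralStep_zero {z : Tok} : Sem (numeralStep 0) [] z ↔
    ∃ x, z = .inl x ∧ ∀ y ∈ x, y = .one := by
  rw [numeralStep, sem_un]
  simp [SemStep, Step.concl, sem_leaf]

theorem sem_numeralStep_succ {n : ℕ} {z : Tok} : Sem (numeralStep (n + 1)) [] z ↔
    ∃ x, z = .inr x ∧ ∀ y ∈ x, Sem (numeral n) [] y := by
  rw [numeralStep, sem_un]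
  simp [SemStep, Step.concl]

theorem sem_stepTok : ∀ n, Sem (numeralStep n) [] (stepTok n)
  | 0 => sem_numeralStep_zero.2 ⟨_, rfl, by simp⟩
  | n + 1 => sem_numeralStep_succ.2 ⟨_, rfl, by
      simpa using sem_numeral.2 ⟨_, rfl, by simpa using sem_stepTok n⟩⟩

/-- All tokens `z` of the numeral are needed, including partial ones, as the coderivation under
translation decides how much of its argument it inspects. -/
theorem sem_inp {r : Tok} : ∀ {n : ℕ} {z : Tok}, Sem (numeral n) [] z →
    Sem (loop inpBody) [[Tok.cont r z], [nativeTok n]] r := by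
  intro n
  induction n with
  | zero =>
    intro z hz
    obtain ⟨x, rfl, hx⟩ := sem_numeral.1 hz
    refine (sem_loop (f := inpBody) trivial).2 ((sem_call rfl).2 ⟨_, _, by rw [Tok.cont]; exact List.mem_singleton_self _,
      List.mem_singleton_self _, ?_⟩)
    simp only [List.mem_singleton, forall_eq]
    refine (sem_muR rfl).2 ⟨_, rfl, fun t ht => ?_⟩
    obtain ⟨y, hy, rfl⟩ := Tok.mem_conts.1 ht
    refine (sem_lam rfl).2 ⟨_, _, rfl, ?_⟩
    obtain ⟨w, rfl, hw⟩ := sem_numeralStep_zero.1 (hx y hy)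
    simp only [List.mem_singleton, forall_eq]
    refine (sem_call rfl).2 ⟨_, _, by rw [Tok.cont]; exact List.mem_singleton_self _,
      List.mem_singleton_self _, ?_⟩
    simp only [List.mem_singleton, forall_eq]
    refine (sem_natL rfl).2 (.inl ⟨List.mem_singleton_self _, ?_⟩)
    refine (sem_prodR (g := []) (d := []) rfl rfl).2 ⟨_, _, rfl, ?_, by simp [sem_natR₀]⟩
    simp only [List.mem_singleton, forall_eq]
    refine (sem_prodR (g := []) (d := []) rfl rfl).2 ⟨_, _, rfl, fun t ht => ?_, nofun⟩
    obtain ⟨y, hy, rfl⟩ := Tok.mem_conts.1 ht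
    obtain rfl := hw y hy
    refine (sem_lam rfl).2 ⟨_, _, rfl, ?_⟩
    simp only [List.mem_singleton, forall_eq]
    exact (sem_call rfl).2 ⟨[], [r], by rw [Tok.cont]; exact List.mem_singleton_self _,
      List.mem_singleton_self _, fun _ h => (List.not_mem_nil h).elim⟩
  | succ n ih =>
    intro z hz
    obtain ⟨x, rfl, hx⟩ := sem_numeral.1 hz
    refine (sem_loop (f := inpBody) trivial).2 ((sem_call rfl).2 ⟨_, _, by rw [Tok.cont]; exact List.mem_singleton_self _,
      List.mem_singleton_self _, ?_⟩)
    simp only [List.mem_singleton, forall_eq]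
    refine (sem_muR rfl).2 ⟨_, rfl, fun t ht => ?_⟩
    obtain ⟨y, hy, rfl⟩ := Tok.mem_conts.1 ht
    refine (sem_lam rfl).2 ⟨_, _, rfl, ?_⟩
    obtain ⟨w, rfl, hw⟩ := sem_numeralStep_succ.1 (hx y hy)
    simp only [List.mem_singleton, forall_eq]
    refine (sem_call rfl).2 ⟨_, _, by rw [Tok.cont]; exact List.mem_singleton_self _,
      List.mem_singleton_self _, ?_⟩
    simp only [List.mem_singleton, forall_eq]
    refine (sem_natL rfl).2 (.inr ⟨_, List.mem_singleton_self _, ?_⟩)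
    refine (sem_prodR (g := [_]) (d := []) rfl rfl).2 ⟨_, _, rfl, ?_, ?_⟩
    · simp only [List.mem_singleton, forall_eq]
      refine (sem_prodR (g := []) (d := [_]) rfl rfl).2 ⟨_, _, rfl, nofun, fun t ht => ?_⟩
      obtain ⟨y, hy, rfl⟩ := Tok.mem_conts.1 ht
      refine (sem_lam rfl).2 ⟨_, _, rfl, ?_⟩
      simp only [List.mem_singleton, forall_eq]
      exact ih (hw y hy)
    · simp only [List.mem_singleton, forall_eq]
      exact (sem_natR₁ rfl).2 ⟨_, rfl, nofun⟩

theorem sem_input {b : Tok} {e : Env} : Sem input e b ↔ e.length = 1 ∧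
    ∃ x y, b = .fn x y ∧ ∀ r ∈ y, Sem (loop inpBody) (x :: e) r := by
  rw [input, sem_un]
  simp [SemStep, Step.concl]

theorem sem_accept {b : Tok} : Sem accept [] b ↔ ∃ x y, b = .fn x y ∧ ∀ r ∈ y,
    ∃ a, (∀ t ∈ a, t = .zero) ∧ Sem (loop accBody) [x, a] r := by
  rw [accept, sem_un]
  simp only [SemStep, Step.concl, List.length_nil, true_and]
  refine exists_congr fun x => exists_congr fun y => and_congr_right fun _ =>
    forall₂_congr fun r _ => ?_
  rw [sem_bin]
  simp only [SemStep, Step.concl, List.length_singleton, List.nil_append, true_and]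
  constructor
  · rintro ⟨d, g, a, h, hd, h₁, h₂⟩
    obtain ⟨d, rfl⟩ := List.length_eq_one_iff.1 hd
    obtain ⟨rfl, rfl⟩ := List.cons.inj h
    rw [sem_un] at h₂
    obtain ⟨-, d, u, v, g, h, hd, h₂⟩ := h₂
    obtain rfl := List.length_eq_zero_iff.1 hd
    cases h
    refine ⟨_, fun t ht => ?_, h₂⟩
    have := h₁ t ht
    rw [sem_leaf] at this
    exact this.2
  · rintro ⟨a, h₁, h₂⟩
    refine ⟨[x], [], a, rfl, rfl, fun t ht => ?_, ?_⟩
    · rw [sem_leaf]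
      exact ⟨rfl, h₁ t ht⟩
    · rw [sem_un]
      exact ⟨rfl, [], a, x, [], rfl, rfl, h₂⟩

/-- The answer asked for is the final value `a + n`, which stays fixed while `n` falls and the
accumulator `a` rises. -/
theorem sem_acc : ∀ {n a : ℕ}, Sem (loop accBody)
    [[.mu (Tok.conts (nativeTok (a + n)) [stepTok n])], [nativeTok a]] (nativeTok (a + n)) := by
  intro n
  induction n with
  | zero =>
    intro a
    refine (sem_loop (f := accBody) trivial).2 ((sem_muL rfl).2 ⟨_, List.mem_singleton_self _, (sem_call rfl).2
      ⟨_, _, Tok.mem_conts.2 ⟨_, List.mem_singleton_self _, rfl⟩, List.mem_singleton_self _, ?_⟩⟩)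
    simp only [List.mem_singleton, forall_eq]
    refine (sem_lam rfl).2 ⟨_, _, by rw [stepTok, Tok.cont], ?_⟩
    simp only [List.mem_singleton, forall_eq]
    refine (sem_prodL rfl).2 ⟨_, _, List.mem_singleton_self _, (sem_natL rfl).2
      (.inl ⟨List.mem_singleton_self _, (sem_prodL rfl).2 ⟨_, _, List.mem_singleton_self _,
        (sem_wk rfl).2 ((sem_call rfl).2 ⟨_, _, Tok.mem_conts.2 ⟨_, List.mem_singleton_self _, rfl⟩,
          List.mem_singleton_self _, ?_⟩)⟩⟩)⟩
    simp only [List.mem_singleton, forall_eq]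
    refine (sem_lam rfl).2 ⟨_, _, by rw [Tok.cont], ?_⟩
    simp only [List.mem_singleton, forall_eq]
    exact (sem_wk rfl).2 (sem_id.2 (List.mem_singleton_self _))
  | succ n ih =>
    intro a
    refine (sem_loop (f := accBody) trivial).2 ((sem_muL rfl).2 ⟨_, List.mem_singleton_self _, (sem_call rfl).2
      ⟨_, _, Tok.mem_conts.2 ⟨_, List.mem_singleton_self _, rfl⟩, List.mem_singleton_self _, ?_⟩⟩)
    simp only [List.mem_singleton, forall_eq]
    refine (sem_lam rfl).2 ⟨_, _, by rw [stepTok, Tok.cont], ?_⟩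
    simp only [List.mem_singleton, forall_eq]
    refine (sem_prodL rfl).2 ⟨_, _, List.mem_singleton_self _, (sem_natL rfl).2
      (.inr ⟨_, List.mem_singleton_self _, (sem_wk rfl).2 ((sem_prodL rfl).2
        ⟨_, _, List.mem_singleton_self _, (sem_swap rfl).2 ((sem_wk rfl).2 ((sem_call rfl).2
          ⟨_, _, Tok.mem_conts.2 ⟨_, List.mem_singleton_self _, rfl⟩,
            List.mem_singleton_self _, ?_⟩))⟩)⟩)⟩
    simp only [List.mem_singleton, forall_eq]
    refine (sem_lam rfl).2 ⟨_, _, by rw [Tok.cont], ?_⟩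
    simp only [List.mem_singleton, forall_eq]
    refine (sem_cut (g := [_]) (d := [_]) rfl rfl).2 ⟨[nativeTok (a + 1)], ?_,
      (sem_swap rfl).2 ?_⟩
    · simp only [List.mem_singleton, forall_eq]
      refine (sem_natR₁ rfl).2 ⟨_, rfl, ?_⟩
      simp only [List.mem_singleton, forall_eq]
      exact sem_id.2 (List.mem_singleton_self _)
    · have := @ih (a + 1)
      rwa [show a + 1 + n = a + (n + 1) by omega] at this

/-- The converse of `sem_inp`: whatever the loop answers on the native numeral, the numeral of the
full system answers as well. Tokens of the native numeral rule out the wrong branch of the case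
distinction. -/
theorem resp_of_sem_inp {r : Tok} : ∀ {j : ℕ} {k E : List Tok},
    (∀ e ∈ E, Sem (nativeNumeral j) [] e) → Sem (loop inpBody) [k, E] r →
    Resp (.fn k [r]) nat (numeral j) := by
  intro j
  induction j generalizing r with
  | zero =>
    intro k E hE h
    obtain ⟨p, rs, hp, hr, h⟩ := (sem_call rfl).1 ((sem_loop (f := inpBody) trivial).1 h)
    change Resp _ (mu (sum one (var 0))) _
    simp only [Resp, List.mem_singleton, forall_eq]
    refine ⟨numeralStep 0, .refl, rfl, p, rs, hp, hr, fun x hx z hz => ?_⟩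
    obtain ⟨_, hx', h⟩ := (sem_muR rfl).1 (h _ hx)
    obtain rfl := Tok.mu.inj hx'
    obtain ⟨k, rs, rfl, h⟩ := (sem_lam rfl).1 (h z hz)
    refine resp_fn.2 fun r hr => ?_
    obtain ⟨p, rs, hp, hr, h⟩ := (sem_call rfl).1 (h r hr)
    change Resp _ (sum one nat) _
    simp only [Resp, List.mem_singleton, forall_eq]
    refine .inl ⟨leaf .oneR, .refl, rfl, p, rs, hp, hr, fun q w hq => ?_⟩
    obtain ⟨-, h⟩ | ⟨e, he, -⟩ := (sem_natL rfl).1 (h _ hq)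
    · obtain ⟨_, _, hq', h, hw⟩ := (sem_prodR (g := []) (d := []) rfl rfl).1 h
      cases hq'
      refine ⟨fun t ht => sem_natR₀.1 (hw t ht), fun x y hx z hz => ?_⟩
      obtain ⟨_, _, hx', h, -⟩ := (sem_prodR (g := []) (d := []) rfl rfl).1 (h _ hx)
      cases hx'
      obtain ⟨k, rs, rfl, h⟩ := (sem_lam rfl).1 (h z hz)
      rw [Resp]
      intro r hr
      obtain ⟨x, y, hx, hr, -⟩ := (sem_call rfl).1 (h r hr)
      exact ⟨.refl, x, y, hx, hr⟩
    · cases sem_nativeNumeral_zero.1 (hE _ he)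
  | succ j ih =>
    intro k E hE h
    obtain ⟨p, rs, hp, hr, h⟩ := (sem_call rfl).1 ((sem_loop (f := inpBody) trivial).1 h)
    change Resp _ (mu (sum one (var 0))) _
    simp only [Resp, List.mem_singleton, forall_eq]
    refine ⟨numeralStep (j + 1), .refl, rfl, p, rs, hp, hr, fun x hx z hz => ?_⟩
    obtain ⟨_, hx', h⟩ := (sem_muR rfl).1 (h _ hx)
    obtain rfl := Tok.mu.inj hx'
    obtain ⟨k, rs, rfl, h⟩ := (sem_lam rfl).1 (h z hz)
    refine resp_fn.2 fun r hr => ?_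
    obtain ⟨p, rs, hp, hr, h⟩ := (sem_call rfl).1 (h r hr)
    change Resp _ (sum one nat) _
    simp only [Resp, List.mem_singleton, forall_eq]
    refine .inr ⟨numeral j, .refl, concl_numeral j, p, rs, hp, hr, fun q w hq => ?_⟩
    obtain ⟨he, -⟩ | ⟨e, he, h⟩ := (sem_natL rfl).1 (h _ hq)
    · obtain ⟨_, he, -⟩ := sem_nativeNumeral_succ.1 (hE _ he)
      cases he
    · obtain ⟨_, he, hE'⟩ := sem_nativeNumeral_succ.1 (hE _ he)
      obtain rfl := Tok.succ.inj he
      obtain ⟨_, _, hq', h, hw⟩ := (sem_prodR (g := [e]) (d := []) rfl rfl).1 h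
      cases hq'
      refine ⟨fun t ht => ?_, fun x y hx z hz => ?_⟩
      · obtain ⟨x, rfl, -⟩ := (sem_natR₁ rfl).1 (hw t ht)
        exact ⟨x, rfl⟩
      obtain ⟨_, _, hx', -, h⟩ := (sem_prodR (g := []) (d := [e]) rfl rfl).1 (h _ hx)
      cases hx'
      obtain ⟨k, rs, rfl, h⟩ := (sem_lam rfl).1 (h z hz)
      exact resp_fn.2 fun r hr => ih hE' (h r hr)

theorem resp_of_sem_input {j : ℕ} {E : List Tok} {z : Tok}
    (hE : ∀ e ∈ E, Sem (nativeNumeral j) [] e) (h : Sem input [E] z) : Resp z nat (numeral j) := by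
  obtain ⟨-, x, y, rfl, h'⟩ := sem_input.1 h
  exact resp_fn.2 fun r hr => resp_of_sem_inp hE (h' r hr)

/-- An answer of the accumulator loop is extracted only by evaluating the counted computation
completely, since each turn forces one more constructor. The answer is a token of the native numeral
for the accumulator plus the number of turns. Induction is on the depth, as `j` is not known
beforehand. -/
theorem reduces_of_semN_acc {n : ℕ} : ∀ {a : ℕ} {m e : List Tok} {r : Tok} {u : PTree},
    SemN n (loop accBody) [m, e] r → (∀ t ∈ e, Sem (nativeNumeral a) [] t) →
    (∀ x, .mu x ∈ m → ∀ z ∈ x, Resp z (sum one nat) u) →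
    ∃ j, Reduces (un (.muR [] (sum one (var 0))) u) (numeral j) ∧
      Sem (nativeNumeral (a + j)) [] r := by
  induction n with
  | zero => exact fun h => h.elim
  | succ n ih =>
    intro a m e r u h he hm
    replace h := sem_of_semN_succ (g := fun _ => accBody) (fun _ => trivial) h
    obtain ⟨x, hx, h⟩ := (sem_muL rfl).1 h
    obtain ⟨p, rs, hp, hr, h⟩ := (sem_call rfl).1 h
    have hu := resp_fn.1 (hm _ hx _ hp) r hr
    simp only [Resp, List.mem_singleton, forall_eq] at hu
    obtain ⟨u', hu, -, q, rs, hq, hr, hq'⟩ | ⟨u', hu, hc, q, rs, hq, hr, hq'⟩ := hu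
    · obtain ⟨_, _, hqr, h⟩ := (sem_lam rfl).1 (h _ hq)
      cases hqr
      obtain ⟨q, w, hqw, h⟩ := (sem_prodL rfl).1 (h r hr)
      obtain ⟨hw, hq'⟩ := hq' q w hqw
      obtain ⟨-, h⟩ | ⟨t, ht, -⟩ := (sem_natL rfl).1 h
      · obtain ⟨x, y, hxy, h⟩ := (sem_prodL rfl).1 h
        obtain ⟨p, rs, hp, hr, h⟩ := (sem_call rfl).1 ((sem_wk rfl).1 h)
        have hu' := resp_fn.1 (hq' x y hxy _ hp) r hr
        simp only [Resp, List.mem_singleton, forall_eq] at hu'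
        obtain ⟨hu', v, rs, hv, hr⟩ := hu'
        obtain ⟨_, _, hvr, h⟩ := (sem_lam rfl).1 (h _ hv)
        cases hvr
        exact ⟨0, Reduces.un (hu.trans (Reduces.un hu')),
          he r (sem_id.1 ((sem_wk rfl).1 (h r hr)))⟩
      · cases hw _ ht
    · obtain ⟨_, _, hqr, h⟩ := (sem_lam rfl).1 (h _ hq)
      cases hqr
      obtain ⟨q, w, hqw, h⟩ := (sem_prodL rfl).1 (h r hr)
      obtain ⟨hw, hq'⟩ := hq' q w hqw
      obtain ⟨ht, -⟩ | ⟨t, -, h⟩ := (sem_natL rfl).1 h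
      · obtain ⟨_, ht⟩ := hw _ ht
        cases ht
      · obtain ⟨x, y, hxy, h⟩ := (sem_prodL rfl).1 ((sem_wk rfl).1 h)
        obtain ⟨p, rs, hp, hr, h⟩ := (sem_call rfl).1 ((sem_wk rfl).1 ((sem_swap rfl).1 h))
        have hu' := resp_fn.1 (hq' x y hxy _ hp) r hr
        change Resp _ (mu (sum one (var 0))) _ at hu'
        simp only [Resp, List.mem_singleton, forall_eq] at hu'
        obtain ⟨u'', hu'', -, p, rs, hp, hr, hp'⟩ := hu'
        obtain ⟨_, _, hpr, h⟩ := (sem_lam rfl).1 (h _ hp)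
        cases hpr
        obtain ⟨e', he', h⟩ := (sem_cut (g := [e]) (d := [p]) rfl rfl).1 (h r hr)
        obtain ⟨j, hj, h⟩ := ih (a := a + 1) (u := u'') ((sem_swap rfl).1 h) (fun t ht => by
          obtain ⟨x, rfl, hx⟩ := (sem_natR₁ rfl).1 (he' t ht)
          exact sem_nativeNumeral_succ.2 ⟨x, rfl, fun y hy => he y (sem_id.1 (hx y hy))⟩) hp'
        exact ⟨j + 1, Reduces.un (hu.trans (Reduces.un (hu''.trans hj))),
          by rwa [show a + (j + 1) = a + 1 + j by omega]⟩

/-! ### Closing by numerals -/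

theorem Reduces.sem {t t' : PTree} (h : Reduces t t') (ht : LengthTyped t) {e : Env} {b : Tok}
    (hb : Sem t' e b) : Sem t e b := by
  induction h using Relation.ReflTransGen.head_induction_on with
  | refl => exact hb
  | head h _ ih => exact h.sem ht (ih (h.lengthTyped ht).1)

theorem lengthTyped_close {τ : Ty} {e : Closers} (he : AllClosed e)
    (hl : ∀ p ∈ e, LengthTyped p.1) : ∀ {t : PTree}, LengthTyped t → t.concl = some ⟨ctx e, τ⟩ →
    LengthTyped (close τ e t) := by
  induction e with
  | nil => exact fun h _ => h
  | cons p e ih =>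
    intro t ht hc
    obtain ⟨hp, he⟩ := allClosed_cons.1 he
    obtain ⟨hlp, hl⟩ := List.forall_mem_cons.1 hl
    refine ih he hl (lengthTyped_bin.2 ⟨hlp, ht, ?_, ?_⟩) rfl
    · simp [len, hp, Step.prem, Step.prems]
    · simp [len, hc, Step.prem, Step.prems]

/-- After subject expansion this splits an application into tokens of the numerals and a computation
of the open coderivation from them. -/
theorem sem_close {τ : Ty} {e : Closers} {b : Tok} : ∀ {t : PTree}, Sem (close τ e t) [] b ↔
    ∃ E, Models (fun z _ c => Sem c [] z) e E ∧ Sem t E b := by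
  induction e with
  | nil => simp [close]
  | cons p e ih =>
    intro t
    rw [close, ih]
    constructor
    · rintro ⟨E, hE, h⟩
      rw [sem_bin] at h
      obtain ⟨-, d, g, a, rfl, hd, h₁, h₂⟩ := h
      have hg : g = [] := by
        have := hE.length_eq
        rw [List.length_append, hd, length_ctx] at this
        exact List.length_eq_zero_iff.1 (by omega)
      subst hg
      rw [List.append_nil] at hE
      exact ⟨_, .cons h₁ hE, h₂⟩
    · rintro ⟨_, hE, h⟩
      obtain _ | ⟨ha, hE⟩ := hE
      rename_i a E
      refine ⟨E, hE, sem_bin.2 ⟨by simpa [Step.concl] using Models.length hE, E, [], a, by simp,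
        Models.length hE, ha, h⟩⟩

/-- The closing numerals of an application. -/
def numerals (num : ℕ → PTree) : (k : ℕ) → (Fin k → ℕ) → Closers
  | 0, _ => []
  | k + 1, v => (num (v (Fin.last k)), nat) :: numerals num k fun i => v i.castSucc

theorem ctx_numerals (num : ℕ → PTree) : ∀ {k : ℕ} (v : Fin k → ℕ),
    ctx (numerals num k v) = List.replicate k nat
  | 0, _ => rfl
  | k + 1, v => by rw [numerals, ctx_cons, ctx_numerals, ← List.replicate_succ']

theorem apply_eq_close (num : ℕ → PTree) : ∀ {k : ℕ} (v : Fin k → ℕ) (P : PTree),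
    apply num k v P = close nat (numerals num k v) P
  | 0, _, _ => rfl
  | k + 1, v, P => by
    rw [apply, apply_eq_close, numerals, close, ctx_numerals]

theorem forall_mem_numerals {num : ℕ → PTree} {p : PTree × Ty → Prop} (h : ∀ n, p (num n, nat)) :
    ∀ {k : ℕ} (v : Fin k → ℕ), ∀ q ∈ numerals num k v, p q
  | 0, _ => List.forall_mem_nil _
  | _ + 1, _ => List.forall_mem_cons.2 ⟨h _, forall_mem_numerals h _⟩

theorem allClosed_numerals {num : ℕ → PTree} (h : ∀ n, (num n).concl = some ⟨[], nat⟩) {k : ℕ}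
    (v : Fin k → ℕ) : AllClosed (numerals num k v) := forall_mem_numerals (p := fun _ => _) h v

theorem isCoderivation_numeral : ∀ n, (numeral n).IsCoderivation (fun _ => True) ⟨[], nat⟩
  | 0 => PTree.IsCoderivation.un (s := .muR [] (sum one (var 0))) trivial rfl
      (PTree.IsCoderivation.un (s := .sumR₀ [] one nat) trivial rfl
        (PTree.IsCoderivation.leaf (s := .oneR) trivial rfl))
  | n + 1 => PTree.IsCoderivation.un (s := .muR [] (sum one (var 0))) trivial rfl
      (PTree.IsCoderivation.un (s := .sumR₁ [] one nat) trivial rfl (isCoderivation_numeral n))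

theorem isCoderivation_nativeNumeral :
    ∀ n, (nativeNumeral n).IsCoderivation (fun _ => True) ⟨[], nat⟩
  | 0 => PTree.IsCoderivation.leaf (s := .natR₀) trivial rfl
  | n + 1 => PTree.IsCoderivation.un (s := .natR₁ []) trivial rfl (isCoderivation_nativeNumeral n)

/-- An application reduces to a numeral only if it computes what the numeral computes. -/
theorem Reduces.sem_apply {R : Step → Prop} {num : ℕ → PTree} {k : ℕ} {v : Fin k → ℕ} {P t : PTree}
    (hn : ∀ n, (num n).IsCoderivation (fun _ => True) ⟨[], nat⟩)
    (hP : P.IsCoderivation R (natSequent k)) (h : Reduces (apply num k v P) t) {b : Tok}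
    (hb : Sem t [] b) :
    ∃ E, Models (fun z _ c => Sem c [] z) (numerals num k v) E ∧ Sem P E b := by
  rw [apply_eq_close] at h
  refine sem_close.1 (h.sem (lengthTyped_close (allClosed_numerals (fun n => (hn n).root) v)
    (forall_mem_numerals (p := fun q => LengthTyped q.1) (fun n => (hn n).lengthTyped) v) hP.lengthTyped ?_) hb)
  rw [ctx_numerals]
  exact hP.root

/-! ### Feeding numerals -/

/-- Convert the last `j` of `i + j` assumptions from computations of numerals to numerals. -/
def feed : ℕ → ℕ → PTree → PTree
  | _, 0, Q => Q
  -- A cut consumes the last assumption and puts its own context first. Feeding the computations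
  -- from last to first thus leaves the numerals in their original order, without exchanges.
  | i, j + 1, Q => feed (i + 1) j
      (bin (.cut [nat] (List.replicate i nat ++ List.replicate j (C nat)) (C nat) nat) input Q)

theorem circularNegative_feed : ∀ {i j : ℕ} {Q : PTree},
    CircularNegative Q ⟨List.replicate i nat ++ List.replicate j (C nat), nat⟩ →
    CircularNegative (feed i j Q) (natSequent (i + j))
  | i, 0, Q, h => by simpa [natSequent, feed] using h
  | i, j + 1, Q, h => by
    rw [show i + (j + 1) = i + 1 + j by omega]
    refine circularNegative_feed (i := i + 1) (j := j) ?_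
    have hR : NegativeStep (.cut [nat] (List.replicate i nat ++ List.replicate j (C nat)) (C nat) nat) := by
      refine ⟨?_, neg_nat⟩
      simp only [Step.concl, List.forall_mem_append, List.forall_mem_singleton]
      exact ⟨neg_nat, fun σ h => List.eq_of_mem_replicate h ▸ neg_nat,
        fun σ h => List.eq_of_mem_replicate h ▸ neg_C_nat⟩
    refine .bin hR rfl circularNegative_input ?_
    rwa [List.append_assoc, ← List.replicate_succ']

theorem sem_feed {r : Tok} : ∀ {i j : ℕ} {Q : PTree} {m ns : Env}, m.length = i → ns.length = j →
    (Sem (feed i j Q) (m ++ ns) r ↔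
      ∃ as, List.Forall₂ (fun a n => ∀ x ∈ a, Sem input [n] x) as ns ∧ Sem Q (as ++ m) r)
  | i, 0, Q, m, ns, hm, hn => by
    obtain rfl := List.length_eq_zero_iff.1 hn
    simp [feed]
  | i, j + 1, Q, m, n :: ns, hm, hn => by
    have := sem_feed (r := r) (i := i + 1) (j := j) (m := m ++ [n]) (ns := ns)
      (Q := bin (.cut [nat] (List.replicate i nat ++ List.replicate j (C nat)) (C nat) nat) input Q)
      (by simp [hm]) (by simpa using hn)
    rw [feed]
    rw [List.append_assoc, List.singleton_append] at this
    rw [this]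
    constructor
    · rintro ⟨as, has, h⟩
      rw [sem_bin] at h
      obtain ⟨-, d, g, a, he, hd, h₁, h₂⟩ := h
      rw [← List.append_assoc] at he
      obtain ⟨rfl, rfl⟩ := List.append_inj he (by
        have := has.length_eq
        simp at hd hn ⊢
        omega)
      exact ⟨a :: as, .cons h₁ has, h₂⟩
    · rintro ⟨_, has, h⟩
      obtain _ | ⟨ha, has⟩ := has
      rename_i a as
      have := has.length_eq
      simp at hn
      exact ⟨as, has, sem_bin.2 ⟨by simp [Step.concl]; omega, as ++ m, [n], a, by simp, by simp; omega,
        ha, h⟩⟩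

/-- The translation of a coderivation of `N, …, N ⇒ N`, between numerals. -/
def negative (k : ℕ) (P : PTree) : PTree :=
  -- The continuation of the result is the last assumption of the translated sequent, so it can be
  -- cut against `accept` directly.
  feed 0 k (bin (.cut [] (List.replicate k (C nat)) (K nat) nat) accept (tr P))

theorem Circular.negative {k : ℕ} {P : PTree} (h : Circular P (natSequent k)) :
    CircularNegative (negative k P) (natSequent k) := by
  have hR : NegativeStep (.cut [] (List.replicate k (C nat)) (K nat) nat) :=
    ⟨fun σ h => List.eq_of_mem_replicate h ▸ neg_C_nat, neg_nat⟩
  have := circularNegative_feed (i := 0) (j := k) (.bin hR rfl circularNegative_accept (by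
    have := h.tr
    rwa [Sequent.tr, natSequent, List.map_replicate] at this))
  rwa [Nat.zero_add] at this

theorem sem_negative {k : ℕ} {P : PTree} {ns : Env} {r : Tok} (hn : ns.length = k) :
    Sem (negative k P) ns r ↔ ∃ as a, List.Forall₂ (fun a n => ∀ x ∈ a, Sem input [n] x) as ns ∧
      (∀ t ∈ a, Sem accept [] t) ∧ Sem (tr P) (a :: as) r := by
  have := sem_feed (r := r) (i := 0) (m := [])
    (Q := bin (.cut [] (List.replicate k (C nat)) (K nat) nat) accept (tr P)) rfl hn
  rw [List.nil_append] at this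
  rw [negative, this]
  constructor
  · rintro ⟨as, has, h⟩
    rw [sem_bin, List.append_nil] at h
    obtain ⟨-, d, g, a, rfl, hd, h₁, h₂⟩ := h
    have hg : g = [] := by
      have := has.length_eq
      simp at hd this
      exact List.length_eq_zero_iff.1 (by omega)
    subst hg
    rw [List.append_nil] at has
    exact ⟨d, a, has, h₁, h₂⟩
  · rintro ⟨as, a, has, h₁, h₂⟩
    have := has.length_eq
    exact ⟨as, has, by rw [List.append_nil]; exact sem_bin.2 ⟨by simp [Step.concl]; omega, as, [], a,
      by simp, by simp; omega, h₁, h₂⟩⟩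

/-! ### The main theorem -/

theorem models_resp {k : ℕ} : ∀ {v : Fin k → ℕ} {ns as : Env},
    Models (fun z _ c => Sem c [] z) (numerals nativeNumeral k v) ns →
    List.Forall₂ (fun a n => ∀ x ∈ a, Sem input [n] x) as ns →
    Models Resp (numerals numeral k v) as := by
  induction k with
  | zero =>
    rintro v _ _ ⟨⟩ ⟨⟩
    exact .nil
  | succ k ih =>
    intro v ns as hns has
    obtain _ | ⟨hn, hns⟩ := hns
    obtain _ | ⟨ha, has⟩ := has
    exact .cons (fun z hz => resp_of_sem_input hn (ha z hz)) (ih hns has)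

theorem exists_models_real (r : Tok) {k : ℕ} : ∀ {v : Fin k → ℕ} {E : Env},
    Models (fun z _ c => Sem c [] z) (numerals numeral k v) E →
    ∃ ns, Models Real (numerals nativeNumeral k v) ns ∧
      List.Forall₂ (fun a n => ∀ x ∈ a, Sem input [n] x) (E.map (Tok.conts r)) ns := by
  induction k with
  | zero =>
    rintro v _ ⟨⟩
    exact ⟨[], .nil, .nil⟩
  | succ k ih =>
    rintro v _ ⟨⟩
    rename_i a E h hE
    obtain ⟨ns, h₁, h₂⟩ := ih hE
    refine ⟨_ :: ns, .cons (List.forall_mem_singleton.2 (real_nativeTok _)) h₁, .cons (fun x hx => ?_) h₂⟩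
    obtain ⟨y, hy, rfl⟩ := Tok.mem_conts.1 hx
    refine sem_input.2 ⟨rfl, _, _, rfl, ?_⟩
    simpa using sem_inp (h y hy)

/-- Both directions go through tokens: subject expansion on the side assumed to reduce, then one of
the two simulations. The desired reduction comes from adequacy in one direction and from `Resp` with
the counting loop in the other. Neither argument uses progress. -/
theorem reduces_apply_negative {k : ℕ} {P : PTree} (hP : Circular P (natSequent k))
    {v : Fin k → ℕ} {n : ℕ} : Reduces (apply numeral k v P) (numeral n) ↔
      Reduces (apply nativeNumeral k v (negative k P)) (nativeNumeral n) := by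
  constructor
  · intro h
    -- This token describes the numeral completely, so nothing is lost by following it alone.
    obtain ⟨E, hE, hb⟩ := h.sem_apply isCoderivation_numeral hP.1 (b := .mu [stepTok n])
      (sem_numeral.2 ⟨_, rfl, by simpa using sem_stepTok n⟩)
    obtain ⟨ns, h₁, h₂⟩ := exists_models_real (nativeTok n) hE
    have := (sem_negative (k := k) (P := P) (by
      rw [Models.length h₁, ctx_numerals, List.length_replicate])).2
      ⟨_, _, h₂, by
        simp only [List.mem_singleton, forall_eq]
        refine sem_accept.2 ⟨_, _, by rw [Tok.cont], ?_⟩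
        simp only [List.mem_singleton, forall_eq]
        -- The continuation `accept` starts its accumulator at zero, hence `a := 0`.
        exact ⟨[nativeTok 0], by simp [nativeTok], by simpa using sem_acc (n := n) (a := 0)⟩,
        hb.tr hP.1 (nativeTok n)⟩
    rw [apply_eq_close]
    refine (this.real (R := NegativeStep) ?_ (allClosed_numerals concl_nativeNumeral v) h₁).reduces_nativeNumeral
    rw [ctx_numerals]
    exact hP.negative.1
  · intro h
    obtain ⟨ns, hns, hb⟩ := h.sem_apply isCoderivation_nativeNumeral hP.negative.1
      (sem_nativeTok n)
    obtain ⟨as, a, has, ha, hb⟩ := (sem_negative (by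
      rw [Models.length hns, ctx_numerals, List.length_replicate])).1 hb
    have := hb.resp (τ := nat) (by rw [ctx_numerals]; exact hP.1) (allClosed_numerals concl_numeral v)
      (models_resp hns has)
    rw [← apply_eq_close] at this
    change Resp _ (mu (sum one (var 0))) _ at this
    simp only [Resp, List.mem_singleton, forall_eq] at this
    obtain ⟨u, hu, -, p, rs, hp, hr, h⟩ := this
    obtain ⟨_, _, he, h'⟩ := sem_accept.1 (ha _ hp)
    cases he
    obtain ⟨e, he, N, h'⟩ := h' _ hr
    -- The loop shows that the application reduces to some numeral `j` and that the answer is a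
    -- token of `j`; as the answer is the full token of `n`, the two agree.
    obtain ⟨j, hj, hs⟩ := reduces_of_semN_acc (a := 0) h' (fun t ht => sem_nativeNumeral_zero.2
      (he t ht)) h
    rw [Nat.zero_add] at hs
    rw [← eq_of_sem_nativeTok hs]
    exact hu.trans hj

theorem Circular.represents_negative {k : ℕ} {P : PTree} (hP : Circular P (natSequent k))
    (f : (Fin k → ℕ) →. ℕ) :
    Represents numeral P f ↔ Represents nativeNumeral (CircMuLJ.negative k P) f := by
  simp only [Represents, reduces_apply_negative hP]

end CircMuLJ

theorem mainTheorem6 :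
    (∀ (k : ℕ) (f : (Fin k → ℕ) →. ℕ),
      CircMuLJ.Representable f → CircMuLJ.NegativelyRepresentable f) ∧
    (∀ (k : ℕ) (P : CircMuLJ.PTree), CircMuLJ.Circular P (CircMuLJ.natSequent k) →
      ∃ P' : CircMuLJ.PTree, CircMuLJ.CircularNegative P' (CircMuLJ.natSequent k) ∧
        ∀ f : (Fin k → ℕ) →. ℕ,
          CircMuLJ.Represents CircMuLJ.numeral P f ↔
            CircMuLJ.Represents CircMuLJ.nativeNumeral P' f) :=
  ⟨fun k _ ⟨P, hP, hf⟩ => ⟨CircMuLJ.negative k P, hP.negative, (hP.represents_negative _).1 hf⟩,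
    fun k P hP => ⟨CircMuLJ.negative k P, hP.negative, hP.represents_negative⟩⟩
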